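/- Let $(\Sigma,h)$ be a smooth closed (compact, boundaryless) Riemannian surface and let $S^n\subset\mathbb R^{n+1}$ be the unit sphere. For a surface $M$ with Riemannian metric (here $M=\Sigma$, or $M=\mathbb C$ with the Euclidean metric) and $p\ge 2$, a map $u\in W^{1,p}(M;S^n)$ (weakly differentiable, $|u|=1$, $\int_M|\nabla u|^p<\infty$) is called $p$-harmonic if it is a weak solution of $$-\operatorname{div}\big((1+|\nabla u|^2)^{\frac p2-1}\nabla u\big)=(1+|\nabla u|^2)^{\frac p2-1}|\nabla u|^2u ,$$ the Euler--Lagrange equation of $E_p(u)=\int(1+|\nabla u|^2)^{p/2}\,dvol$ (for $p=2$: of the Dirichlet energy $E$; then $u$ is called harmonic). Let $$V_u=\{w\in W^{1,2}(M;\mathbb R^{n+1}) : w(x)\cdot u(x)=0\text{ for a.e. }x\},$$ $$Q_u(w)=p(p-2)\int_M(1+|\nabla u|^2)^{\frac p2-2}(\nabla u\cdot\nabla w)^2\,dvol+p\int_M(1+|\nabla u|^2)^{\frac p2-1}\big(|\nabla w|^2-|\nabla u|^2|w|^2\big)\,dvol,$$ and let the Morse index $\operatorname{Ind}_{E_p}(u)$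 be the largest dimension of a linear subspace $W\subset V_u$ with $Q_u(w)<0$ for all $w\in W\setminus\{0\}$; write $\operatorname{Ind}_E$ for $p=2$. Let $p_k>2$ with $p_k\to2$, and let $u_k\in W^{1,p_k}(\Sigma;S^n)$ be $p_k$-harmonic maps with $\sup_kE_{p_k}(u_k)<\infty$. Suppose that $u_k$ bubble tree converges to a harmonic map $u_\infty\in W^{1,2}(\Sigma;S^n)$ and one single bubble, a harmonic map $v_\infty\in W^{1,2}(\mathbb C;S^n)$, in the following sense: there are a point $q\in\Sigma$, a conformal chart around $q$, points $x_k\to q$ in $\Sigma$ and radii $\delta_k>0$, $\delta_k\to0$, such that * $u_k\to u_\infty$ in $C^\infty_{loc}(\Sigma\setminus\{q\})$; * $v_k(z):=u_k(x_k+\delta_kz)\to v_\infty(z)$ in $C^\infty_{loc}(\mathbb C)$, where $u_k$ is read in the chart; * $\displaystyle\lim_{\eta\searrow0}\limsup_{k\to\infty}\sup_{\delta_k/\eta<\rho<2\rho<\eta}\int_{B_{2\rho}(x_k)\setminus B_\rho(x_k)}|\nabla u_k|^2\,dvol_\Sigma=0$, with balls taken in the chart. Then for all sufficiently large $k$ $$\operatorname{Ind}_E(u_\infty)+\operatorname{Ind}_E(v_\infty)\le\operatorname{Ind}_{E_{p_k}}(u_k).$$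 -/

import Mathlib

open Set Filter Topology MeasureTheory
open scoped Manifold ContDiff ENNReal

noncomputable section

namespace HarmonicIndex

/-! ### Riemannian surfaces

A surface is a smooth real two-dimensional manifold, with charts valued in the complex plane. -/

/-- Smooth Riemannian metrics on the surface `M`. -/
abbrev SurfaceMetric (M : Type*) [TopologicalSpace M] [ChartedSpace ℂ M]
    [IsManifold 𝓘(ℝ, ℂ) ∞ M] : Type _ :=
  Bundle.ContMDiffRiemannianMetric 𝓘(ℝ, ℂ) ∞ ℂ (fun x : M => TangentSpace 𝓘(ℝ, ℂ) x)

/-- The Euclidean metric of the plane. -/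
def flatMetric : SurfaceMetric ℂ where
  inner := (riemannianMetricVectorSpace ℂ).inner
  symm := (riemannianMetricVectorSpace ℂ).symm
  pos := (riemannianMetricVectorSpace ℂ).pos
  isVonNBounded := (riemannianMetricVectorSpace ℂ).isVonNBounded
  contMDiff := (riemannianMetricVectorSpace ℂ).contMDiff.of_le le_top

section Surface

variable {M : Type*} [TopologicalSpace M] [ChartedSpace ℂ M] [IsManifold 𝓘(ℝ, ℂ) ∞ M]
variable {F : Type*} [NormedAddCommGroup F] [InnerProductSpace ℝ F]

/-- The basis `1, i` of the model plane. -/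
def stdFrame : Fin 2 → ℂ := ![1, Complex.I]

/-- The differential at `y` of the inverse of a chart. -/
def chartDifferential (ψ : OpenPartialHomeomorph M ℂ) (y : ℂ) :
    ℂ →L[ℝ] TangentSpace 𝓘(ℝ, ℂ) (ψ.symm y) :=
  mfderiv 𝓘(ℝ, ℂ) 𝓘(ℝ, ℂ) ψ.symm y

/-- The coefficients `g_ij` of the metric in the chart `ψ`, at the point `y` of its target. -/
def chartGram (h : SurfaceMetric M) (ψ : OpenPartialHomeomorph M ℂ) (y : ℂ) :
    Matrix (Fin 2) (Fin 2) ℝ :=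
  Matrix.of fun i j => h.inner (ψ.symm y) (chartDifferential ψ y (stdFrame i))
    (chartDifferential ψ y (stdFrame j))

/-- The measure `√(det g_ij) dy` of the chart `ψ`, as a measure on `M` carried by the domain
of `ψ`. -/
def chartVolume [MeasurableSpace M] (h : SurfaceMetric M) (ψ : OpenPartialHomeomorph M ℂ) :
    Measure M :=
  ((volume.restrict ψ.target).withDensity
    fun y => ENNReal.ofReal (Real.sqrt (chartGram h ψ y).det)).map ψ.symm

/-- The Riemannian volume measure. By the change of variables formula the measures `chartVolume`
agree on overlaps of charts, so their supremum is the measure that restricts to `chartVolume h ψ`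
on the domain of each chart `ψ`. -/
def riemannianVolume [MeasurableSpace M] (h : SurfaceMetric M) : Measure M :=
  ⨆ ψ ∈ atlas ℂ M, chartVolume h ψ

/-- The Gram matrix of the metric at `x`, in the frame of the tangent space at `x` given by the
identification of that tangent space with the model plane. -/
def gram (h : SurfaceMetric M) (x : M) : Matrix (Fin 2) (Fin 2) ℝ :=
  Matrix.of fun i j => h.inner x (stdFrame i : ℂ) (stdFrame j : ℂ)

/-- The inner product `A · B = ∑ g^ij ⟨A e_i, B e_j⟩` of two linear maps from the tangent space
at `x` to `F`; it does not depend on the frame `e`. -/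
def pairing (h : SurfaceMetric M) (x : M) (A B : TangentSpace 𝓘(ℝ, ℂ) x →L[ℝ] F) : ℝ :=
  ∑ i, ∑ j, (gram h x)⁻¹ i j * inner ℝ (A (stdFrame i : ℂ)) (B (stdFrame j : ℂ))

/-! ### Weak derivatives -/

/-- `A` is the weak derivative of `f` in the open set `Ω` of the plane. -/
structure IsWeakDerivOn (Ω : Set ℂ) (f : ℂ → F) (A : ℂ → ℂ →L[ℝ] F) : Prop where
  locallyIntegrable : LocallyIntegrableOn f Ω
  locallyIntegrable_deriv : LocallyIntegrableOn A Ω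
  integral_eq : ∀ η : ℂ → ℝ, ContDiff ℝ ∞ η → HasCompactSupport η → tsupport η ⊆ Ω →
    ∀ v : ℂ, ∫ y, η y • A y v = - ∫ y, fderiv ℝ η y v • f y

/-- The section `G` of `Hom(TM, F)` is the weak differential of `w`: this holds in every chart. -/
def IsWeakDifferential (w : M → F) (G : (x : M) → TangentSpace 𝓘(ℝ, ℂ) x →L[ℝ] F) : Prop :=
  ∀ ψ ∈ atlas ℂ M, IsWeakDerivOn ψ.target (fun y => w (ψ.symm y))
    (fun y => (G (ψ.symm y)).comp (chartDifferential ψ y))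

open scoped Classical in
/-- The weak differential of `w` (unique almost everywhere), or `0` if there is none. -/
def weakDifferential (w : M → F) : (x : M) → TangentSpace 𝓘(ℝ, ℂ) x →L[ℝ] F :=
  if hw : ∃ G : (x : M) → TangentSpace 𝓘(ℝ, ℂ) x →L[ℝ] F, IsWeakDifferential w G
  then hw.choose else fun _ => 0

/-- `w` has a weak differential. -/
def WeaklyDifferentiable (w : M → F) : Prop :=
  ∃ G : (x : M) → TangentSpace 𝓘(ℝ, ℂ) x →L[ℝ] F, IsWeakDifferential w G

/-- The pointwise product `∇u · ∇w`. -/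
def gradInner (h : SurfaceMetric M) (u w : M → F) (x : M) : ℝ :=
  pairing h x (weakDifferential u x) (weakDifferential w x)

/-- `|∇u|²`. -/
def gradSq (h : SurfaceMetric M) (u : M → F) (x : M) : ℝ :=
  gradInner h u u x

section Measurable

variable [MeasurableSpace M]

/-- `w ∈ W^{1,2}(M; F)`. -/
structure MemW12 (h : SurfaceMetric M) (w : M → F) : Prop where
  weaklyDifferentiable : WeaklyDifferentiable w
  memLp : MemLp w 2 (riemannianVolume h)
  integrable_gradSq : Integrable (gradSq h w) (riemannianVolume h)

/-- `u ∈ W^{1,p}(M; S)` with `S` the unit sphere of `F`: a weakly differentiable map with values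
in `S` and `∫ |∇u|^p < ∞`. On a surface of finite volume `u` is in `L^p` because it is bounded;
on the plane this is the usual meaning of `W^{1,p}` for maps into a sphere. -/
structure MemSphereW1 (h : SurfaceMetric M) (p : ℝ) (u : M → F) : Prop where
  norm_eq_one : ∀ x, ‖u x‖ = 1
  weaklyDifferentiable : WeaklyDifferentiable u
  integrable_gradSq : Integrable (fun x => gradSq h u x ^ (p / 2)) (riemannianVolume h)

/-- The energy `E_p(u) = ∫ (1 + |∇u|²)^{p/2}`. -/
def energy (h : SurfaceMetric M) (p : ℝ) (u : M → F) : ℝ :=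
  ∫ x, (1 + gradSq h u x) ^ (p / 2) ∂riemannianVolume h

/-- `u ∈ W^{1,p}(M; S)` is `p`-harmonic: it is a weak solution of the Euler-Lagrange equation
`-div((1 + |∇u|²)^{p/2-1} ∇u) = (1 + |∇u|²)^{p/2-1} |∇u|² u`. For `p = 2` these are the harmonic
maps `-Δu = |∇u|² u`. -/
structure IsPHarmonic (h : SurfaceMetric M) (p : ℝ) (u : M → F) : Prop where
  memSphereW1 : MemSphereW1 h p u
  eulerLagrange : ∀ ξ : M → F, ContMDiff 𝓘(ℝ, ℂ) 𝓘(ℝ, F) ∞ ξ → HasCompactSupport ξ →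
    ∫ x, (1 + gradSq h u x) ^ (p / 2 - 1) *
        pairing h x (weakDifferential u x) (mfderiv 𝓘(ℝ, ℂ) 𝓘(ℝ, F) ξ x) ∂riemannianVolume h =
      ∫ x, (1 + gradSq h u x) ^ (p / 2 - 1) * gradSq h u x * inner ℝ (u x) (ξ x)
        ∂riemannianVolume h

/-! ### The Morse index -/

/-- `w ∈ V_u`: a `W^{1,2}` vector field along `u`, tangent to the sphere. -/
structure IsVariation (h : SurfaceMetric M) (u w : M → F) : Prop where
  memW12 : MemW12 h w
  tangent : ∀ᵐ x ∂riemannianVolume h, inner ℝ (u x) (w x) = 0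

/-- The second variation of `E_p` at `u`. -/
def secondVariation (h : SurfaceMetric M) (p : ℝ) (u w : M → F) : ℝ :=
  p * (p - 2) * ∫ x, (1 + gradSq h u x) ^ (p / 2 - 2) * gradInner h u w x ^ 2
      ∂riemannianVolume h +
    p * ∫ x, (1 + gradSq h u x) ^ (p / 2 - 1) * (gradSq h w x - gradSq h u x * ‖w x‖ ^ 2)
      ∂riemannianVolume h

/-- `W` is a linear subspace of `V_u` on which the second variation is negative definite. Its
elements are functions and not classes modulo equality almost everywhere; the condition forces
nonzero elements of `W` not to vanish almost everywhere, so dimensions are not affected. -/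
def IsNegativeSpace (h : SurfaceMetric M) (p : ℝ) (u : M → F) (W : Submodule ℝ (M → F)) : Prop :=
  ∀ w ∈ W, IsVariation h u w ∧ (w ≠ 0 → secondVariation h p u w < 0)

/-- The Morse index of `u` with respect to `E_p`: the largest dimension of a subspace of `V_u` on
which the second variation is negative definite (`⊤` if the dimensions were unbounded). For
`p = 2` it is the index with respect to the Dirichlet energy. -/
def morseIndex (h : SurfaceMetric M) (p : ℝ) (u : M → F) : ℕ∞ :=
  ⨆ W : {W : Submodule ℝ (M → F) // FiniteDimensional ℝ W ∧ IsNegativeSpace h p u W},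
    (Module.finrank ℝ W.1 : ℕ∞)

end Measurable

end Surface

/-! ### Bubble convergence -/

section Bubble

variable {M : Type*} [TopologicalSpace M] [ChartedSpace ℂ M] [IsManifold 𝓘(ℝ, ℂ) ∞ M]
variable {F : Type*} [NormedAddCommGroup F] [InnerProductSpace ℝ F]

/-- `f k → g` in `C^∞_loc(Ω)`, for an open set `Ω` of the plane: on a compact subset of `Ω` the
`f k` are eventually smooth, and all their derivatives converge uniformly there. -/
structure TendstoSmoothLoc (Ω : Set ℂ) (f : ℕ → ℂ → F) (g : ℂ → F) : Prop where
  contDiffOn : ContDiffOn ℝ ∞ g Ω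
  eventually_contDiffOn : ∀ K ⊆ Ω, IsCompact K →
    ∀ᶠ k in atTop, ∃ U, IsOpen U ∧ K ⊆ U ∧ ContDiffOn ℝ ∞ (f k) U
  tendsto : ∀ K ⊆ Ω, IsCompact K → ∀ j : ℕ,
    TendstoUniformlyOn (fun k => iteratedFDeriv ℝ j (f k)) (iteratedFDeriv ℝ j g) atTop K

/-- `f k → g` in `C^∞_loc(M ∖ {q})`: this holds in every chart. -/
def TendstoSmoothLocAway (q : M) (f : ℕ → M → F) (g : M → F) : Prop :=
  ∀ ψ ∈ atlas ℂ M, TendstoSmoothLoc (ψ.target ∩ ψ.symm ⁻¹' {q}ᶜ)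
    (fun k y => f k (ψ.symm y)) (fun y => g (ψ.symm y))

/-- `φ` is a smooth chart in which the metric is a positive multiple of the Euclidean one. -/
structure IsConformalChart (h : SurfaceMetric M) (φ : OpenPartialHomeomorph M ℂ) : Prop where
  mem_maximalAtlas : φ ∈ IsManifold.maximalAtlas 𝓘(ℝ, ℂ) ∞ M
  conformal : ∀ y ∈ φ.target, ∃ r : ℝ, 0 < r ∧ ∀ v v' : ℂ,
    h.inner (φ.symm y) (chartDifferential φ y v) (chartDifferential φ y v') = r * inner ℝ v v'

/-- The annulus `B_{2ρ}(a) ∖ B_ρ(a)`, in the chart `φ`. -/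
def chartAnnulus (φ : OpenPartialHomeomorph M ℂ) (a : M) (ρ : ℝ) : Set M :=
  {x | x ∈ φ.source ∧ ρ ≤ ‖φ x - φ a‖ ∧ ‖φ x - φ a‖ < 2 * ρ}

/-- The maps `u k : M → S` bubble tree converge to the harmonic map `uinf : M → S` and the single
bubble `vinf : ℂ → S`, with blow up point `q`, centres `a k` and radii `δ k`; the rescalings are
read in the conformal chart `φ` around `q`. -/
structure BubbleConvergence [MeasurableSpace M] (h : SurfaceMetric M) (u : ℕ → M → F)
    (uinf : M → F) (vinf : ℂ → F) (q : M) (φ : OpenPartialHomeomorph M ℂ) (a : ℕ → M)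
    (δ : ℕ → ℝ) : Prop where
  harmonic : IsPHarmonic h 2 uinf
  harmonic_bubble : IsPHarmonic flatMetric 2 vinf
  isConformalChart : IsConformalChart h φ
  mem_source : q ∈ φ.source
  tendsto_center : Tendsto a atTop (𝓝 q)
  radius_pos : ∀ k, 0 < δ k
  tendsto_radius : Tendsto δ atTop (𝓝 0)
  tendsto_away : TendstoSmoothLocAway q u uinf
  tendsto_bubble : TendstoSmoothLoc univ (fun k z => u k (φ.symm (φ (a k) + δ k • z))) vinf
  tendsto_neck : Tendsto (fun η : ℝ => limsup (fun k : ℕ =>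
      ⨆ ρ : ℝ, ⨆ _ : δ k / η < ρ ∧ 2 * ρ < η,
        ∫⁻ x in chartAnnulus φ (a k) ρ, ENNReal.ofReal (gradSq h (u k) x)
          ∂riemannianVolume h) atTop) (𝓝[>] 0) (𝓝 0)

end Bubble

end HarmonicIndex

end

open HarmonicIndex

noncomputable section

namespace HarmonicIndex

set_option linter.unusedSectionVars false

open Complex (I)
open ENNReal (ofReal)
open scoped Real

local notation "𝓘₂" => 𝓘(ℝ, ℂ)
local notation "T[" x "]" => TangentSpace 𝓘₂ x
local notation "T*[" x ", " F "]" => TangentSpace 𝓘₂ x →L[ℝ] F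
local notation "SmoothOn[" F "]" => ContMDiffOn 𝓘₂ 𝓘(ℝ, F) ∞
local notation "Smooth[" F "]" => ContMDiff 𝓘₂ 𝓘(ℝ, F) ∞
local notation "DiffAt[" F "]" => MDifferentiableAt 𝓘₂ 𝓘(ℝ, F)
local notation "vol[" h "]" => riemannianVolume h
local notation "Chart[" X "]" => OpenPartialHomeomorph X ℂ
local notation "cexp" => Complex.exp

variable {M : Type*} [TopologicalSpace M] [ChartedSpace ℂ M] [IsManifold 𝓘(ℝ, ℂ) ∞ M]
variable {F : Type*} [NormedAddCommGroup F] [InnerProductSpace ℝ F]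

/-! Negativity of the second variation is realised by finitely many smooth tangent fields with
compact support, where the convergence is smooth. Such fields can be carried over to `u k`, and the
fields coming from the bubble concentrate at `q`, away from the others, so the two negative spaces
add up.

Realising the index. Write D(w) = ∫ |dw|² and P(w) = ∫ |du|² |w|², so that the second variation of
the Dirichlet energy is 2 (D - P). A negative space consists of `W^{1,2}` fields. Smooth fields with
compact support are dense in `W^{1,2}`, also after removing the point `q`, because points have
capacity zero in dimension two (`IsW12.isApproximable_puncture`, `IsW12.isApproximable_plane`).
Density is useful only if P is continuous in `W^{1,2}`, and a single family can attain the index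
only if the index is finite. Both follow from P ≤ D / 4 + C ∫_K |w|² with K compact
(`IsHarmonicOn.exists_potential_le`). Indeed, where |u - c| ≤ ε, testing the harmonic map equation
with |w|² (u - c) gives (1 - 2ε) P ≤ ε D. On K the Poincaré inequality in small cells makes ∫_K |w|²
small against D on a subspace of finite codimension, which bounds the dimension
(`IsHarmonicOn.exists_finrank_le`).

That u is almost constant near a puncture and near infinity takes the place of the removable
singularity theorem. The end is conformal to a half cylinder, where the Hopf differential argument
equates radial and angular energy of circles. The angular energy f then satisfies f'' ≥ α f - β f³;
being integrable, it has no tall spikes and decays exponentially (`exists_exponential_decay`,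
`IsCylinderMap.exists_norm_sub_le`).

Transplantation. With s = p / 2 - 1, Cauchy–Schwarz bounds the second variation of `E_p` by p ∫ (1 +
|du|²)^s ((1 + 2s) |dw|² - |du|² |w|²). Projecting the fields to the tangent spaces along `u k`
changes them by a small amount, since `u k` is C¹-close to the limit on the supports. For `uinf` the
weight tends to 1. For the bubble, conformal invariance in the rescaled chart, with conformal factor
δ² r, produces the weight (1 + (δ² r)⁻¹ |dv|²)^s = δ^{-2s} (δ² + r⁻¹ |dv|²)^s. The positive constant
δ^{-2s} is irrelevant for signs and needs no estimate. The remaining weight need not tend to 1 where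
dv vanishes, but the gradient term needs only the upper bound 1 + η, and the potential term only
that weight times |dv|² is at least |dv|² - η (`rpow_weight_bounds`,
`IsHarmonicOn.perturbed_form_neg`). -/

theorem integral_congr_fun {α E : Type*} [MeasurableSpace α] [NormedAddCommGroup E]
    [NormedSpace ℝ E] {μ : Measure α} {f g : α → E} (hfg : ∀ x, f x = g x) :
    ∫ x, f x ∂μ = ∫ x, g x ∂μ :=
  congrArg (integral μ) (funext hfg)

/-! ### Linear algebra of the metric on one tangent space -/

section Pairing

/-- A frame of the tangent space at `x` that is orthonormal for `h`. -/
structure IsOrthoFrame (h : SurfaceMetric M) (x : M) (f₁ f₂ : T[x]) : Prop where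
  inner₁₁ : h.inner x f₁ f₁ = 1
  inner₂₂ : h.inner x f₂ f₂ = 1
  inner₁₂ : h.inner x f₁ f₂ = 0
  spans : ∀ v : T[x], ∃ a b : ℝ, v = a • f₁ + b • f₂

variable (h : SurfaceMetric M) (x : M)

theorem inner_comb (v w : T[x]) (a b c d : ℝ) :
    h.inner x (a • v + b • w) (c • v + d • w) =
      a * c * h.inner x v v + (a * d + b * c) * h.inner x v w + b * d * h.inner x w w := by
  simp only [map_add, map_smul, _root_.add_apply, _root_.smul_apply, smul_eq_mul, h.symm x w v]
  ring

theorem exists_comb_std (v : ℂ) : v = v.re • (1 : ℂ) + v.im • I := by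
  apply Complex.ext <;> simp

theorem exists_orthoFrame :
    ∃ f₁ f₂ : T[x], IsOrthoFrame h x f₁ f₂ := by
  let e₁ : T[x] := (1 : ℂ)
  let e₂ : T[x] := I
  have he : ∀ a b : ℝ, a • e₁ + b • e₂ = (⟨a, b⟩ : ℂ) := fun a b =>
    (exists_comb_std ⟨a, b⟩).symm
  set g₁ := h.inner x e₁ e₁ with hg₁
  set g₁₂ := h.inner x e₁ e₂ with hg₁₂
  have hpos₁ : 0 < g₁ := h.pos x e₁ (one_ne_zero (α := ℂ))
  -- Gram–Schmidt: the part of `e₂` orthogonal to `e₁`, which is nonzero because its second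
  -- coordinate is `1`.
  set w : T[x] := (-(g₁₂ / g₁)) • e₁ + (1 : ℝ) • e₂ with hw
  have hw0 : w ≠ 0 := by
    rw [hw, he]
    exact fun h0 => one_ne_zero (congrArg Complex.im (show (⟨-(g₁₂ / g₁), 1⟩ : ℂ) = 0 from h0))
  set g₂ := h.inner x w w with hg₂
  have hpos₂ : 0 < g₂ := h.pos x w hw0
  have hew : h.inner x e₁ w = 0 := by
    have := inner_comb h x e₁ e₂ 1 0 (-(g₁₂ / g₁)) 1
    rw [one_smul, zero_smul, add_zero, ← hw] at this
    rw [this, ← hg₁, ← hg₁₂]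
    field_simp
    ring
  have hs₁ : √g₁ * √g₁ = g₁ := Real.mul_self_sqrt hpos₁.le
  have hs₂ : √g₂ * √g₂ = g₂ := Real.mul_self_sqrt hpos₂.le
  have hp₁ : 0 < √g₁ := Real.sqrt_pos.2 hpos₁
  have hp₂ : 0 < √g₂ := Real.sqrt_pos.2 hpos₂
  refine ⟨(√g₁)⁻¹ • e₁, (√g₂)⁻¹ • w, ?_, ?_, ?_, ?_⟩
  · simp only [map_smul, _root_.smul_apply, smul_eq_mul, ← hg₁]
    field_simp
    nlinarith
  · simp only [map_smul, _root_.smul_apply, smul_eq_mul, ← hg₂]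
    field_simp
    nlinarith
  · simp only [map_smul, _root_.smul_apply, smul_eq_mul, hew, mul_zero]
  · intro v
    obtain ⟨a, b, hv⟩ : ∃ a b : ℝ, v = a • e₁ + b • e₂ := ⟨_, _, exists_comb_std v⟩
    refine ⟨√g₁ * (a + b * (g₁₂ / g₁)), √g₂ * b, ?_⟩
    rw [hv, smul_smul, smul_smul, hw, smul_add, smul_smul, smul_smul, ← add_assoc, ← add_smul]
    congr 2 <;> field_simp
    ring

/-- The Gram matrix of the metric in the frame `b₁, b₂`. -/
def frameGram (b : Fin 2 → T[x]) : Matrix (Fin 2) (Fin 2) ℝ :=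
  Matrix.of fun i j => h.inner x (b i) (b j)

theorem IsOrthoFrame.inner_comb {h : SurfaceMetric M} {x : M} {f₁ f₂ : T[x]}
    (hf : IsOrthoFrame h x f₁ f₂) (a b c d : ℝ) :
    h.inner x (a • f₁ + b • f₂) (c • f₁ + d • f₂) = a * c + b * d := by
  rw [HarmonicIndex.inner_comb, hf.inner₁₁, hf.inner₂₂, hf.inner₁₂]
  ring

theorem IsOrthoFrame.frameGram_det {h : SurfaceMetric M} {x : M} {f₁ f₂ : T[x]}
    (hf : IsOrthoFrame h x f₁ f₂) {b : Fin 2 → T[x]} {a₁ a₂ b₁ b₂ : ℝ}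
    (h0 : b 0 = a₁ • f₁ + a₂ • f₂) (h1 : b 1 = b₁ • f₁ + b₂ • f₂) :
    (frameGram h x b).det = (a₁ * b₂ - a₂ * b₁) ^ 2 := by
  simp only [Matrix.det_fin_two, frameGram, Matrix.of_apply, h0, h1, hf.inner_comb]
  ring

/-- In an orthonormal frame the Gram determinant is the square of the coefficient determinant, and
that one vanishes only if the two vectors are dependent. -/
theorem frameGram_det_pos (b : Fin 2 → T[x])
    (hb : ∀ c d : ℝ, c • b 0 + d • b 1 = 0 → c = 0 ∧ d = 0) : 0 < (frameGram h x b).det := by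
  obtain ⟨f₁, f₂, hf⟩ := exists_orthoFrame h x
  obtain ⟨a₁, a₂, h0⟩ := hf.spans (b 0)
  obtain ⟨b₁, b₂, h1⟩ := hf.spans (b 1)
  rw [hf.frameGram_det h0 h1]
  refine lt_of_le_of_ne (sq_nonneg _) fun h2 => ?_
  have h3 : a₁ * b₂ - a₂ * b₁ = 0 := by simpa using h2.symm
  have k1 := hb b₂ (-a₂) (by rw [h0, h1]; match_scalars <;> linarith)
  have k2 := hb b₁ (-a₁) (by rw [h0, h1]; match_scalars <;> linarith)
  exact one_ne_zero (hb 1 0 (by simp [h0, neg_eq_zero.1 k1.2, neg_eq_zero.1 k2.2])).1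

/-- The inner product of linear maps, computed in an arbitrary frame, agrees with its expression
in an orthonormal frame. -/
theorem IsOrthoFrame.sum_frameGram_inv {h : SurfaceMetric M} {x : M} {f₁ f₂ : T[x]}
    (hf : IsOrthoFrame h x f₁ f₂) (b : Fin 2 → T[x])
    (hb : (frameGram h x b).det ≠ 0) (A B : T*[x, F]) :
    ∑ i, ∑ j, (frameGram h x b)⁻¹ i j * inner ℝ (A (b i)) (B (b j)) =
      inner ℝ (A f₁) (B f₁) + inner ℝ (A f₂) (B f₂) := by
  obtain ⟨a₁, a₂, h0⟩ := hf.spans (b 0)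
  obtain ⟨b₁, b₂, h1⟩ := hf.spans (b 1)
  have hdet := hf.frameGram_det h0 h1
  have hd : a₁ * b₂ - a₂ * b₁ ≠ 0 := fun h3 => hb (by rw [hdet, h3]; norm_num)
  rw [Matrix.inv_def, Ring.inverse_eq_inv', hdet, Matrix.adjugate_fin_two]
  simp only [Fin.sum_univ_two, Matrix.smul_apply, smul_eq_mul, frameGram, Matrix.of_apply,
    Matrix.cons_val_zero, Matrix.cons_val_one, Matrix.cons_val', Matrix.cons_val_fin_one]
  rw [h0, h1, hf.inner_comb, hf.inner_comb, hf.inner_comb, hf.inner_comb]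
  simp only [map_add, map_smul, inner_add_left, inner_add_right, inner_smul_left, inner_smul_right,
    RCLike.conj_to_real]
  field_simp
  ring

theorem std_independent (x : M) (c d : ℝ) (h0 : c • ((1 : ℂ) : T[x]) + d • (I : T[x]) = 0) :
    c = 0 ∧ d = 0 := by
  have h1 : (⟨c, d⟩ : ℂ) = 0 := (exists_comb_std ⟨c, d⟩).trans h0
  exact ⟨congrArg Complex.re h1, congrArg Complex.im h1⟩

theorem IsOrthoFrame.pairing_eq {h : SurfaceMetric M} {x : M} {f₁ f₂ : T[x]}
    (hf : IsOrthoFrame h x f₁ f₂) (A B : T*[x, F]) :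
    pairing h x A B = inner ℝ (A f₁) (B f₁) + inner ℝ (A f₂) (B f₂) :=
  hf.sum_frameGram_inv (fun i => (stdFrame i : ℂ))
    (frameGram_det_pos h x _ (std_independent x)).ne' A B

theorem pairing_frame (b : Fin 2 → T[x])
    (hb : (frameGram h x b).det ≠ 0) (A B : T*[x, F]) :
    pairing h x A B = ∑ i, ∑ j, (frameGram h x b)⁻¹ i j * inner ℝ (A (b i)) (B (b j)) := by
  obtain ⟨f₁, f₂, hf⟩ := exists_orthoFrame h x
  rw [hf.pairing_eq, hf.sum_frameGram_inv b hb]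

/-- The linear map sending `A` to `(A f₁, A f₂)`, for some orthonormal frame `f₁, f₂`, turns
`pairing` into the inner product of `F × F`. -/
theorem exists_pairing_isometry :
    ∃ L : (T*[x, F]) →ₗ[ℝ] WithLp 2 (F × F), ∀ A B, pairing h x A B = inner ℝ (L A) (L B) := by
  obtain ⟨f₁, f₂, hf⟩ := exists_orthoFrame h x
  refine ⟨{ toFun := fun A => WithLp.toLp 2 (A f₁, A f₂), map_add' := ?_, map_smul' := ?_ }, ?_⟩
  · exact fun A B => rfl
  · exact fun c A => rfl
  · exact fun A B => by rw [hf.pairing_eq, WithLp.prod_inner_apply]; rfl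

theorem pairing_self_nonneg (A : T*[x, F]) : 0 ≤ pairing h x A A := by
  obtain ⟨L, hL⟩ := exists_pairing_isometry (F := F) h x
  rw [hL]; exact real_inner_self_nonneg

theorem pairing_comm (A B : T*[x, F]) :
    pairing h x A B = pairing h x B A := by
  obtain ⟨L, hL⟩ := exists_pairing_isometry (F := F) h x
  rw [hL, hL, real_inner_comm]

theorem pairing_add_left (A B C : T*[x, F]) :
    pairing h x (A + B) C = pairing h x A C + pairing h x B C := by
  obtain ⟨L, hL⟩ := exists_pairing_isometry (F := F) h x
  simp only [hL, map_add, inner_add_left]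

theorem pairing_add_right (A B C : T*[x, F]) :
    pairing h x A (B + C) = pairing h x A B + pairing h x A C := by
  obtain ⟨L, hL⟩ := exists_pairing_isometry (F := F) h x
  simp only [hL, map_add, inner_add_right]

theorem pairing_smul_left (c : ℝ)
    (A B : T*[x, F]) : pairing h x (c • A) B = c * pairing h x A B := by
  obtain ⟨L, hL⟩ := exists_pairing_isometry (F := F) h x
  simp only [hL, map_smul, real_inner_smul_left]

theorem pairing_smul_right (c : ℝ)
    (A B : T*[x, F]) : pairing h x A (c • B) = c * pairing h x A B := by
  rw [pairing_comm, pairing_smul_left, pairing_comm]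

theorem pairing_zero_left (A : T*[x, F]) : pairing h x 0 A = 0 := by
  simpa using pairing_smul_left h x 0 A A

theorem pairing_zero_right (A : T*[x, F]) : pairing h x A 0 = 0 := by
  rw [pairing_comm, pairing_zero_left]

theorem pairing_sq_le (A B : T*[x, F]) :
    pairing h x A B ^ 2 ≤ pairing h x A A * pairing h x B B := by
  obtain ⟨L, hL⟩ := exists_pairing_isometry (F := F) h x
  simp only [hL]
  nlinarith [real_inner_mul_inner_self_le (L A) (L B)]

/-- The norm `|A|` of a linear map from the tangent space at `x`. -/
def pnorm (A : T*[x, F]) : ℝ :=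
  √(pairing h x A A)

theorem pnorm_nonneg (A : T*[x, F]) :
    0 ≤ pnorm h x A := Real.sqrt_nonneg _

theorem pnorm_sq (A : T*[x, F]) :
    pnorm h x A ^ 2 = pairing h x A A := Real.sq_sqrt (pairing_self_nonneg h x A)

theorem pnorm_eq_norm {h : SurfaceMetric M} {x : M} {L : (T*[x, F]) →ₗ[ℝ] WithLp 2 (F × F)}
    (hL : ∀ A B, pairing h x A B = inner ℝ (L A) (L B)) (A : T*[x, F]) : pnorm h x A = ‖L A‖ := by
  rw [pnorm, hL, real_inner_self_eq_norm_sq, Real.sqrt_sq (norm_nonneg _)]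

theorem abs_pairing_le (A B : T*[x, F]) :
    |pairing h x A B| ≤ pnorm h x A * pnorm h x B := by
  obtain ⟨L, hL⟩ := exists_pairing_isometry (F := F) h x
  simp only [pnorm_eq_norm hL, hL]
  exact abs_real_inner_le_norm _ _

/-- `pairing` gives the Hilbert–Schmidt norm, which dominates the operator norm. -/
theorem norm_apply_sq_le (A : T*[x, F])
    (v : T[x]) : ‖A v‖ ^ 2 ≤ pairing h x A A * h.inner x v v := by
  obtain ⟨f₁, f₂, hf⟩ := exists_orthoFrame h x
  obtain ⟨a, b, rfl⟩ := hf.spans v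
  rw [hf.inner_comb, hf.pairing_eq, map_add, map_smul, map_smul]
  simp only [real_inner_self_eq_norm_sq]
  have h1 := pow_le_pow_left₀ (norm_nonneg _) (norm_add_le (a • A f₁) (b • A f₂)) 2
  rw [norm_smul, norm_smul, Real.norm_eq_abs, Real.norm_eq_abs] at h1
  nlinarith [sq_nonneg (|a| * ‖A f₂‖ - |b| * ‖A f₁‖), sq_abs a, sq_abs b]

end Pairing

/-! ### Smooth charts and the coefficients of the metric -/

section Charts

/-- A chart that is smooth in both directions. -/
structure IsSmoothChart (φ : Chart[M]) : Prop where
  contMDiffOn : SmoothOn[ℂ] φ φ.source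
  contMDiffOn_symm : SmoothOn[ℂ] φ.symm φ.target

theorem isSmoothChart_of_mem_maximalAtlas {φ : Chart[M]}
    (hφ : φ ∈ IsManifold.maximalAtlas 𝓘₂ ∞ M) : IsSmoothChart φ :=
  ⟨contMDiffOn_of_mem_maximalAtlas hφ, contMDiffOn_symm_of_mem_maximalAtlas hφ⟩

theorem isSmoothChart_of_mem_atlas {φ : Chart[M]} (hφ : φ ∈ atlas ℂ M) :
    IsSmoothChart φ :=
  isSmoothChart_of_mem_maximalAtlas (IsManifold.subset_maximalAtlas hφ)

theorem isSmoothChart_chartAt (x : M) : IsSmoothChart (chartAt ℂ x) :=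
  isSmoothChart_of_mem_atlas (chart_mem_atlas ℂ x)

/-- The density of the Riemannian volume in a chart. -/
def chartDensity (h : SurfaceMetric M) (φ : Chart[M]) (y : ℂ) : ℝ :=
  √(chartGram h φ y).det

theorem norm_stdFrame (i : Fin 2) : ‖stdFrame i‖ = 1 := by
  fin_cases i <;> simp [stdFrame]

theorem norm_le_sum_stdFrame (A : ℂ →L[ℝ] F) : ‖A‖ ≤ ‖A 1‖ + ‖A I‖ := by
  refine A.opNorm_le_bound (by positivity) fun v => ?_
  conv_lhs => rw [exists_comb_std v]
  rw [map_add, map_smul, map_smul]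
  refine (norm_add_le _ _).trans ?_
  rw [norm_smul, norm_smul, add_mul, Real.norm_eq_abs, Real.norm_eq_abs]
  have h1 := Complex.abs_re_le_norm v
  have h2 := Complex.abs_im_le_norm v
  nlinarith [norm_nonneg (A 1), norm_nonneg (A I)]

variable {φ : Chart[M]} (hφ : IsSmoothChart φ) (h : SurfaceMetric M)
include hφ

theorem IsSmoothChart.mdifferentiableAt {x : M} (hx : x ∈ φ.source) :
    DiffAt[ℂ] φ x :=
  (hφ.contMDiffOn.contMDiffAt (φ.open_source.mem_nhds hx)).mdifferentiableAt (by simp)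

section

variable {y : ℂ} (hy : y ∈ φ.target)
include hy

theorem IsSmoothChart.mdifferentiableAt_symm :
    DiffAt[ℂ] φ.symm y :=
  (hφ.contMDiffOn_symm.contMDiffAt (φ.open_target.mem_nhds hy)).mdifferentiableAt (by simp)

/-- The differential of the inverse of a chart is invertible, with inverse the differential of the
chart. -/
theorem IsSmoothChart.mfderiv_comp_chartDifferential (v : ℂ) : mfderiv 𝓘₂ 𝓘₂ φ (φ.symm y) (chartDifferential φ y v) = v := by
  have h1 := mfderiv_comp y (hφ.mdifferentiableAt (φ.map_target hy)) (hφ.mdifferentiableAt_symm hy)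
  have h2 : (φ ∘ φ.symm) =ᶠ[𝓝 y] id := by
    filter_upwards [φ.open_target.mem_nhds hy] with z hz using φ.right_inv hz
  rw [h2.mfderiv_eq, mfderiv_id] at h1
  exact (congrArg (fun A => A v) h1).symm

theorem IsSmoothChart.chartDifferential_comp_mfderiv (v : T[φ.symm y]) :
    chartDifferential φ y (mfderiv 𝓘₂ 𝓘₂ φ (φ.symm y) v) = v := by
  have hx := φ.map_target hy
  have h0 : DiffAt[ℂ] φ.symm (φ (φ.symm y)) := by
    rw [φ.right_inv hy]; exact hφ.mdifferentiableAt_symm hy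
  have h1 := mfderiv_comp (φ.symm y) h0 (hφ.mdifferentiableAt hx)
  have h2 : (φ.symm ∘ φ) =ᶠ[𝓝 (φ.symm y)] id := by
    filter_upwards [φ.open_source.mem_nhds hx] with z hz using φ.left_inv hz
  rw [h2.mfderiv_eq, mfderiv_id] at h1
  -- The differentials at `φ (φ.symm y)` and at `y` have different types; both are read as maps of
  -- `ℂ` before the points are identified.
  have h4 : ∀ z, z = y → (mfderiv 𝓘₂ 𝓘₂ φ.symm z : ℂ →L[ℝ] ℂ) = mfderiv 𝓘₂ 𝓘₂ φ.symm y := by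
    rintro z rfl; rfl
  exact ((congrArg (fun A => A v) h1).trans (congrArg (fun A : ℂ →L[ℝ] ℂ =>
    A (mfderiv 𝓘₂ 𝓘₂ φ (φ.symm y) v)) (h4 _ (φ.right_inv hy)))).symm

/-- The differential of the inverse of a chart as an equivalence. -/
def IsSmoothChart.equiv : ℂ ≃L[ℝ] T[φ.symm y] :=
  ContinuousLinearEquiv.equivOfInverse (chartDifferential φ y) (mfderiv 𝓘₂ 𝓘₂ φ (φ.symm y))
    (hφ.mfderiv_comp_chartDifferential hy) (hφ.chartDifferential_comp_mfderiv hy)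

theorem IsSmoothChart.comp_chartDifferential_injective {A B : T*[(φ.symm y), F]}
    (hAB : A.comp (chartDifferential φ y) = B.comp (chartDifferential φ y)) : A = B := by
  ext v
  have e := hφ.chartDifferential_comp_mfderiv hy v
  exact (congrArg A e).symm.trans ((DFunLike.congr_fun hAB _).trans (congrArg B e))

theorem IsSmoothChart.det_chartGram_pos : 0 < (chartGram h φ y).det := by
  refine frameGram_det_pos h (φ.symm y) (fun i => chartDifferential φ y (stdFrame i)) ?_
  intro c d h0
  have h1 : chartDifferential φ y (c • 1 + d • I) = 0 := by
    rw [map_add, map_smul, map_smul]; exact h0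
  have h2 := hφ.mfderiv_comp_chartDifferential hy (c • 1 + d • I)
  rw [h1, map_zero] at h2
  have h3 : (⟨c, d⟩ : ℂ) = 0 := (exists_comb_std ⟨c, d⟩).trans h2.symm
  exact ⟨congrArg Complex.re h3, congrArg Complex.im h3⟩

theorem IsSmoothChart.pairing_chart (A B : T*[(φ.symm y), F]) :
    pairing h (φ.symm y) A B = ∑ i, ∑ j, (chartGram h φ y)⁻¹ i j *
      inner ℝ (A (chartDifferential φ y (stdFrame i))) (B (chartDifferential φ y (stdFrame j))) :=
  pairing_frame h (φ.symm y) (fun i => chartDifferential φ y (stdFrame i))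
    (hφ.det_chartGram_pos h hy).ne' A B

theorem IsSmoothChart.chartDensity_pos : 0 < chartDensity h φ y :=
  Real.sqrt_pos.2 (hφ.det_chartGram_pos h hy)

end

/-- The metric is a smooth section of a bundle of bilinear forms, and `chartDifferential φ y v` is
the image of a constant field under the tangent map of `φ.symm`, hence a continuous section along
`φ.symm`. Evaluating the former on the latter is continuous. -/
theorem IsSmoothChart.continuousOn_inner (v w : ℂ) :
    ContinuousOn (fun y => h.inner (φ.symm y) (chartDifferential φ y v) (chartDifferential φ y w))
      φ.target := by
  have hsec : ∀ v : ℂ, ContMDiffOn 𝓘₂ (𝓘(ℝ, ℂ).prod 𝓘₂) 0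
      (fun y => Bundle.TotalSpace.mk' ℂ (E := fun x : M => T[x]) (φ.symm y)
        (chartDifferential φ y v)) φ.target := by
    intro v
    have h1 := (hφ.contMDiffOn_symm.of_le (m := 1) (by exact_mod_cast le_top)).contMDiffOn_tangentMapWithin
      (m := 0) (by simp) φ.open_target.uniqueMDiffOn
    have h2 : ContMDiffOn 𝓘₂ (𝓘(ℝ, ℂ).prod 𝓘₂) 0
        (fun y : ℂ => (⟨y, v⟩ : TangentBundle 𝓘₂ ℂ)) φ.target :=
      contMDiffOn_vectorSpace_iff_contDiffOn.2 contDiffOn_const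
    have h3 := h1.comp h2 (fun y hy => hy)
    refine h3.congr fun y hy => ?_
    simp only [Function.comp, tangentMapWithin, chartDifferential]
    rw [mfderivWithin_of_isOpen φ.open_target hy]
    rfl
  have hg := (h.contMDiff.of_le (m := 0) (by simp)).comp_contMDiffOn
    (hφ.contMDiffOn_symm.of_le (by simp))
  have h4 := ContMDiffOn.clm_bundle_apply₂ (F₁ := ℂ) (F₂ := ℂ) (F₃ := ℝ)
    (E₁ := fun x : M => T[x]) (E₂ := fun x : M => T[x])
    (E₃ := Bundle.Trivial M ℝ) hg (hsec v) (hsec w)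
  exact fun y hy => (Bundle.contMDiffWithinAt_totalSpace.1 (h4 y hy)).2.continuousWithinAt

theorem IsSmoothChart.continuousOn_det_chartGram :
    ContinuousOn (fun y => (chartGram h φ y).det) φ.target := by
  have hent := fun i j => hφ.continuousOn_inner h (stdFrame i) (stdFrame j)
  simp only [Matrix.det_fin_two]
  exact ((hent 0 0).mul (hent 1 1)).sub ((hent 0 1).mul (hent 1 0))

theorem IsSmoothChart.continuousOn_chartGram_inv
    (i j : Fin 2) : ContinuousOn (fun y => (chartGram h φ y)⁻¹ i j) φ.target := by
  have hent := fun i j => hφ.continuousOn_inner h (stdFrame i) (stdFrame j)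
  simp only [Matrix.inv_def, Ring.inverse_eq_inv', Matrix.adjugate_fin_two, Matrix.smul_apply,
    smul_eq_mul]
  refine ((hφ.continuousOn_det_chartGram h).inv₀ fun y hy => (hφ.det_chartGram_pos h hy).ne').mul ?_
  fin_cases i <;> fin_cases j
  · exact hent 1 1
  · exact (hent 0 1).neg
  · exact (hent 1 0).neg
  · exact hent 0 0

theorem IsSmoothChart.continuousOn_chartDensity :
    ContinuousOn (chartDensity h φ) φ.target :=
  (hφ.continuousOn_det_chartGram h).sqrt

/-- On compact subsets of a chart the norm `|A|` and the volume density are comparable to the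
Euclidean ones. -/
theorem IsSmoothChart.exists_comparison {K : Set ℂ}
    (hK : IsCompact K) (hKt : K ⊆ φ.target) :
    ∃ C : ℝ, 0 < C ∧ ∀ y ∈ K, chartDensity h φ y ≤ C ∧ 1 ≤ C * chartDensity h φ y ∧
      ∀ A : T*[(φ.symm y), F], pairing h (φ.symm y) A A ≤ C * ‖A.comp (chartDifferential φ y)‖ ^ 2 ∧
        ‖A.comp (chartDifferential φ y)‖ ^ 2 ≤ C * pairing h (φ.symm y) A A := by
  have hd := (hφ.continuousOn_chartDensity h).mono hKt
  obtain ⟨C₁, hC₁⟩ := hK.exists_bound_of_continuousOn hd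
  obtain ⟨C₂, hC₂⟩ := hK.exists_bound_of_continuousOn
    (hd.inv₀ fun y hy => (hφ.chartDensity_pos h (hKt hy)).ne')
  have hinv := fun i j => hK.exists_bound_of_continuousOn
    ((hφ.continuousOn_chartGram_inv h i j).mono hKt)
  choose D hD using hinv
  have hin := fun i j => hK.exists_bound_of_continuousOn
    ((hφ.continuousOn_inner h (stdFrame i) (stdFrame j)).mono hKt)
  choose E hE using hin
  set S := ∑ i, ∑ j, |D i j| with hS
  set T := 2 * (|E 0 0| + |E 1 1|) with hT
  have hS0 : 0 ≤ S := Finset.sum_nonneg fun i _ => Finset.sum_nonneg fun j _ => abs_nonneg _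
  have hT0 : 0 ≤ T := by positivity
  -- One constant serves all bounds: `C₁` and `C₂` control the density and its inverse, `S` the
  -- inverse Gram matrix and `T` twice the trace of the Gram matrix.
  refine ⟨|C₁| + |C₂| + S + T + 1, by positivity, fun y hy => ⟨?_, ?_, fun A => ⟨?_, ?_⟩⟩⟩
  · have := (le_abs_self _).trans ((hC₁ y hy).trans (le_abs_self _))
    linarith [abs_nonneg C₂]
  · have hp := hφ.chartDensity_pos h (hKt hy)
    have h1 := (le_abs_self _).trans ((hC₂ y hy).trans (le_abs_self _))
    have h2 : 1 ≤ |C₂| * chartDensity h φ y := by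
      have := mul_le_mul_of_nonneg_right h1 hp.le
      rwa [Pi.inv_apply, inv_mul_cancel₀ hp.ne'] at this
    nlinarith [abs_nonneg C₁]
  · rw [hφ.pairing_chart h (hKt hy)]
    set N := ‖A.comp (chartDifferential φ y)‖ with hN
    have hb : ∀ i, ‖A (chartDifferential φ y (stdFrame i))‖ ≤ N := fun i => by
      have := (A.comp (chartDifferential φ y)).le_opNorm (stdFrame i)
      rw [norm_stdFrame, mul_one] at this
      exact this
    have hN0 : 0 ≤ N := norm_nonneg _
    have h1 : ∑ i, ∑ j, (chartGram h φ y)⁻¹ i j *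
        inner ℝ (A (chartDifferential φ y (stdFrame i))) (A (chartDifferential φ y (stdFrame j)))
        ≤ ∑ i, ∑ j, |D i j| * N ^ 2 := by
      refine Finset.sum_le_sum fun i _ => Finset.sum_le_sum fun j _ => ?_
      refine (le_abs_self _).trans ?_
      rw [abs_mul]
      refine mul_le_mul ((hD i j y hy).trans (le_abs_self _)) ?_ (abs_nonneg _) (abs_nonneg _)
      refine (abs_real_inner_le_norm _ _).trans ?_
      rw [pow_two]
      exact mul_le_mul (hb i) (hb j) (norm_nonneg _) hN0
    refine h1.trans ?_
    simp only [← Finset.sum_mul, ← hS]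
    refine mul_le_mul_of_nonneg_right ?_ (by positivity)
    linarith [abs_nonneg C₁, abs_nonneg C₂]
  · have hp := pairing_self_nonneg h (φ.symm y) A
    have h1 := norm_apply_sq_le h (φ.symm y) A (chartDifferential φ y (stdFrame 0))
    have h2 := norm_apply_sq_le h (φ.symm y) A (chartDifferential φ y (stdFrame 1))
    have e1 := (le_abs_self _).trans ((hE 0 0 y hy).trans (le_abs_self _))
    have e2 := (le_abs_self _).trans ((hE 1 1 y hy).trans (le_abs_self _))
    have h3 : ‖A.comp (chartDifferential φ y)‖ ≤ ‖A (chartDifferential φ y (stdFrame 0))‖ +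
        ‖A (chartDifferential φ y (stdFrame 1))‖ := norm_le_sum_stdFrame _
    have h4 := pow_le_pow_left₀ (norm_nonneg _) h3 2
    have h5 : ‖A.comp (chartDifferential φ y)‖ ^ 2 ≤ T * pairing h (φ.symm y) A A := by
      have := mul_le_mul_of_nonneg_left e1 hp
      have := mul_le_mul_of_nonneg_left e2 hp
      nlinarith [sq_nonneg (‖A (chartDifferential φ y (stdFrame 0))‖ -
        ‖A (chartDifferential φ y (stdFrame 1))‖)]
    refine h5.trans (mul_le_mul_of_nonneg_right ?_ hp)
    linarith [abs_nonneg C₁, abs_nonneg C₂]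

end Charts

/-! ### The Riemannian volume in charts -/

section Volume

variable {φ ψ : Chart[M]}

theorem det_eq_re_im (T : ℂ →L[ℝ] ℂ) : T.det = (T 1).re * (T I).im - (T I).re * (T 1).im := by
  have h1 : T.det = LinearMap.det (T : ℂ →ₗ[ℝ] ℂ) := rfl
  rw [h1, ← LinearMap.det_toMatrix Complex.basisOneI, Matrix.det_fin_two]
  simp [LinearMap.toMatrix_apply, Complex.basisOneI]

theorem IsSmoothChart.chartDifferential_trans (hφ : IsSmoothChart φ) (hψ : IsSmoothChart ψ) {y : ℂ}
    (hy : y ∈ φ.target) (hy' : φ.symm y ∈ ψ.source) (v : ℂ) : (chartDifferential φ y v : ℂ) =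
      (chartDifferential ψ (ψ (φ.symm y)) (fderiv ℝ (fun z => ψ (φ.symm z)) y v) : ℂ) := by
  have hτ : DiffAt[ℂ] (fun z => ψ (φ.symm z)) y :=
    (hψ.mdifferentiableAt hy').comp y (hφ.mdifferentiableAt_symm hy)
  have h1 := mfderiv_comp y (hψ.mdifferentiableAt_symm (ψ.map_source hy')) hτ
  have h2 : (ψ.symm ∘ fun z => ψ (φ.symm z)) =ᶠ[𝓝 y] φ.symm := by
    filter_upwards [(φ.symm.isOpen_inter_preimage ψ.open_source).mem_nhds ⟨hy, hy'⟩] with z hz using ψ.left_inv hz.2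
  rw [h2.mfderiv_eq, mfderiv_eq_fderiv] at h1
  exact congrArg (fun A : ℂ →L[ℝ] ℂ => A v) h1

theorem inner_congr_point (h : SurfaceMetric M) {x x' : M} (hx : x = x') (a b : ℂ) :
    h.inner x a b = h.inner x' a b := by
  subst hx; rfl

/-- The Gram matrix transforms as `Jᵀ g J`, with `J` the Jacobian matrix of the transition map. -/
theorem IsSmoothChart.det_chartGram_trans (hφ : IsSmoothChart φ) (hψ : IsSmoothChart ψ)
    (h : SurfaceMetric M) {y : ℂ} (hy : y ∈ φ.target) (hy' : φ.symm y ∈ ψ.source) :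
    (chartGram h φ y).det =
      (fderiv ℝ (fun z => ψ (φ.symm z)) y).det ^ 2 * (chartGram h ψ (ψ (φ.symm y))).det := by
  set T := fderiv ℝ (fun z => ψ (φ.symm z)) y with hT
  set y' := ψ (φ.symm y) with hy'def
  have hx : φ.symm y = ψ.symm y' := (ψ.left_inv hy').symm
  have hD : ∀ v : ℂ, (chartDifferential φ y v : ℂ) =
      ((T v).re • (chartDifferential ψ y' 1) + (T v).im • (chartDifferential ψ y' I) :
        T[ψ.symm y']) := by
    intro v
    rw [hφ.chartDifferential_trans hψ hy hy', ← hy'def, ← hT]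
    conv_lhs => rw [exists_comb_std (T v)]
    rw [map_add, map_smul, map_smul]
  have hg : ∀ i j, chartGram h φ y i j = h.inner (ψ.symm y')
      ((T (stdFrame i)).re • (chartDifferential ψ y' 1) +
        (T (stdFrame i)).im • (chartDifferential ψ y' I))
      ((T (stdFrame j)).re • (chartDifferential ψ y' 1) +
        (T (stdFrame j)).im • (chartDifferential ψ y' I)) := fun i j => by
    rw [← hD, ← hD]; exact inner_congr_point h hx _ _
  rw [Matrix.det_fin_two, Matrix.det_fin_two, hg, hg, hg, hg, det_eq_re_im]
  simp only [inner_comb, chartGram, Matrix.of_apply]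
  have s0 : stdFrame 0 = 1 := rfl
  have s1 : stdFrame 1 = I := rfl
  rw [s0, s1, h.symm _ (chartDifferential ψ y' I) (chartDifferential ψ y' 1)]
  ring

theorem IsSmoothChart.chartDensity_trans (hφ : IsSmoothChart φ) (hψ : IsSmoothChart ψ)
    (h : SurfaceMetric M) {y : ℂ} (hy : y ∈ φ.target) (hy' : φ.symm y ∈ ψ.source) :
    chartDensity h φ y =
      |(fderiv ℝ (fun z => ψ (φ.symm z)) y).det| * chartDensity h ψ (ψ (φ.symm y)) := by
  rw [chartDensity, chartDensity, hφ.det_chartGram_trans hψ h hy hy', Real.sqrt_mul (sq_nonneg _),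
    Real.sqrt_sq_eq_abs]

variable [MeasurableSpace M] [BorelSpace M]

theorem measurableSet_target_inter_preimage (φ : Chart[M]) {S : Set M} (hS : MeasurableSet S) :
    MeasurableSet (φ.target ∩ φ.symm ⁻¹' S) := by
  have h1 : Measurable (φ.target.domRestrict φ.symm) := φ.continuousOn_symm.domRestrict.measurable
  convert φ.open_target.measurableSet.subtype_image (h1 hS) using 1
  ext y
  exact ⟨fun ⟨h1, h2⟩ => ⟨⟨y, h1⟩, h2, rfl⟩, by rintro ⟨⟨y, h1⟩, h2, rfl⟩; exact ⟨h1, h2⟩⟩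

theorem measurableSet_source_inter_preimage (φ : Chart[M]) {S : Set ℂ} (hS : MeasurableSet S) :
    MeasurableSet (φ.source ∩ φ ⁻¹' S) := by
  have h1 : Measurable (φ.source.domRestrict φ) := φ.continuousOn.domRestrict.measurable
  convert φ.open_source.measurableSet.subtype_image (h1 hS) using 1
  ext y
  exact ⟨fun ⟨h1, h2⟩ => ⟨⟨y, h1⟩, h2, rfl⟩, by rintro ⟨⟨y, h1⟩, h2, rfl⟩; exact ⟨h1, h2⟩⟩

theorem aemeasurable_symm_withDensity (φ : Chart[M]) (ρ : ℂ → ℝ≥0∞) :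
    AEMeasurable φ.symm ((volume.restrict φ.target).withDensity ρ) :=
  (φ.continuousOn_symm.aemeasurable φ.open_target.measurableSet).mono_ac
    (withDensity_absolutelyContinuous _ _)

theorem chartVolume_apply (h : SurfaceMetric M) (φ : Chart[M]) {S : Set M}
    (hS : MeasurableSet S) :
    chartVolume h φ S = ∫⁻ y in φ.target ∩ φ.symm ⁻¹' S, ofReal (chartDensity h φ y) := by
  rw [chartVolume, Measure.map_apply_of_aemeasurable (aemeasurable_symm_withDensity φ _) hS,
    withDensity_apply', Measure.restrict_restrict₀' φ.open_target.measurableSet.nullMeasurableSet, inter_comm]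
  rfl

/-- Change of variables: the ratio of the two densities is exactly the Jacobian of the transition
map. -/
theorem IsSmoothChart.chartVolume_restrict (hφ : IsSmoothChart φ) (hψ : IsSmoothChart ψ)
    (h : SurfaceMetric M) :
    (chartVolume h φ).restrict ψ.source = (chartVolume h ψ).restrict φ.source := by
  ext S hS
  rw [Measure.restrict_apply hS, Measure.restrict_apply hS,
    chartVolume_apply h φ (hS.inter ψ.open_source.measurableSet),
    chartVolume_apply h ψ (hS.inter φ.open_source.measurableSet)]
  set T := φ.target ∩ φ.symm ⁻¹' (S ∩ ψ.source) with hT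
  have hTm : MeasurableSet T :=
    measurableSet_target_inter_preimage φ (hS.inter ψ.open_source.measurableSet)
  have himg : ψ.target ∩ ψ.symm ⁻¹' (S ∩ φ.source) = (fun z => ψ (φ.symm z)) '' T := by
    ext z
    constructor
    · rintro ⟨hz, hzS, hzφ⟩
      refine ⟨φ (ψ.symm z), ⟨φ.map_source hzφ, ?_⟩, ?_⟩
      · rw [mem_preimage, φ.left_inv hzφ]; exact ⟨hzS, ψ.map_target hz⟩
      · simp only [φ.left_inv hzφ, ψ.right_inv hz]
    · rintro ⟨y, ⟨hy, hyS, hyψ⟩, rfl⟩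
      refine ⟨ψ.map_source hyψ, ?_⟩
      rw [mem_preimage, ψ.left_inv hyψ]
      exact ⟨hyS, φ.map_target hy⟩
  rw [himg, lintegral_image_eq_lintegral_abs_det_fderiv_mul volume hTm
    (f := fun z => ψ (φ.symm z)) (fun y hy => ((hψ.mdifferentiableAt hy.2.2).comp y
      (hφ.mdifferentiableAt_symm hy.1)).differentiableAt.hasFDerivAt.hasFDerivWithinAt)
    fun a ha b hb hab => φ.symm.injOn ha.1 hb.1 (ψ.injOn ha.2.2 hb.2.2 hab)]
  refine setLIntegral_congr_fun hTm fun y hy => ?_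
  rw [hφ.chartDensity_trans hψ h hy.1 hy.2.2, ENNReal.ofReal_mul (abs_nonneg _)]
  rfl

theorem chartVolume_restrict_source (h : SurfaceMetric M) (φ : Chart[M]) :
    (chartVolume h φ).restrict φ.source = chartVolume h φ := by
  ext S hS
  rw [Measure.restrict_apply hS, chartVolume_apply h φ (hS.inter φ.open_source.measurableSet),
    chartVolume_apply h φ hS]
  congr 2
  ext y
  simp only [mem_inter_iff, mem_preimage]
  exact ⟨fun hy => ⟨hy.1, hy.2.1⟩, fun hy => ⟨hy.1, hy.2, φ.map_target hy.1⟩⟩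

theorem riemannianVolume_restrict_of_mem_atlas (h : SurfaceMetric M) (hφ : φ ∈ atlas ℂ M) :
    vol[h].restrict φ.source = chartVolume h φ := by
  have hsup : vol[h] = sSup ((fun ψ => chartVolume h ψ) '' atlas ℂ M) := by
    rw [sSup_image]; rfl
  apply le_antisymm
  -- Off `φ.source` nothing is known about the other chart measures. The measure `⊤` bounds them
  -- there and disappears after restriction to `φ.source`.
  · have hle : vol[h] ≤ chartVolume h φ + (⊤ : Measure M).restrict φ.sourceᶜ := by
      rw [hsup]
      refine sSup_le ?_
      rintro _ ⟨ψ, hψ, rfl⟩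
      change chartVolume h ψ ≤ _
      rw [← Measure.restrict_add_restrict_compl (μ := chartVolume h ψ) φ.open_source.measurableSet,
        (isSmoothChart_of_mem_atlas hψ).chartVolume_restrict (isSmoothChart_of_mem_atlas hφ)]
      exact add_le_add Measure.restrict_le_self (Measure.restrict_mono subset_rfl le_top)
    refine (Measure.restrict_mono subset_rfl hle).trans ?_
    rw [Measure.restrict_add, Measure.restrict_restrict φ.open_source.measurableSet,
      inter_compl_self, Measure.restrict_empty, add_zero]
    exact Measure.restrict_le_self
  · rw [← chartVolume_restrict_source h φ]
    refine Measure.restrict_mono subset_rfl ?_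
    rw [hsup]
    exact le_sSup ⟨φ, hφ, rfl⟩

variable [SecondCountableTopology M]

theorem exists_countable_atlas_cover :
    ∃ s : Set M, s.Countable ∧ ⋃ x ∈ s, (chartAt ℂ x).source = univ :=
  countable_cover_nhds fun x => (chartAt ℂ x).open_source.mem_nhds (mem_chart_source ℂ x)

/-- The chart need not belong to the atlas that defines the volume: countably many atlas charts
cover, and the chart measures agree on overlaps. This makes the conformal chart around `q` and its
rescalings available for computing integrals. -/
theorem IsSmoothChart.riemannianVolume_restrict (hφ : IsSmoothChart φ) (h : SurfaceMetric M) :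
    vol[h].restrict φ.source = chartVolume h φ := by
  obtain ⟨s, hs, hcov⟩ := exists_countable_atlas_cover (M := M)
  rw [← Measure.restrict_univ (μ := chartVolume h φ), ← hcov,
    ← Measure.restrict_univ (μ := vol[h].restrict φ.source), ← hcov,
    Measure.restrict_biUnion_congr hs]
  intro x _
  rw [Measure.restrict_restrict (chartAt ℂ x).open_source.measurableSet, inter_comm,
    ← Measure.restrict_restrict φ.open_source.measurableSet,
    riemannianVolume_restrict_of_mem_atlas h (chart_mem_atlas ℂ x),
    (isSmoothChart_chartAt x).chartVolume_restrict hφ h]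

/-- A property that holds almost everywhere in all charts holds almost everywhere. -/
theorem ae_riemannianVolume_of_charts (h : SurfaceMetric M) {P : M → Prop}
    (hP : ∀ ψ ∈ atlas ℂ M, ∀ᵐ y, y ∈ ψ.target → P (ψ.symm y)) : ∀ᵐ x ∂vol[h], P x := by
  obtain ⟨s, hs, hcov⟩ := exists_countable_atlas_cover (M := M)
  rw [← Measure.restrict_univ (μ := vol[h]), ← hcov, ae_restrict_biUnion_iff _ hs]
  intro x _
  set ψ := chartAt ℂ x with hψ
  rw [riemannianVolume_restrict_of_mem_atlas h (chart_mem_atlas ℂ x)]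
  obtain ⟨Z, hZ, hZm, hZ0⟩ := exists_measurable_superset_of_null
    (ae_iff.1 (hP ψ (chart_mem_atlas ℂ x)))
  have hsub : {z | ¬ P z} ⊆ (ψ.source ∩ ψ ⁻¹' Z) ∪ ψ.sourceᶜ := by
    intro z hz
    by_cases hzs : z ∈ ψ.source
    · left
      refine ⟨hzs, hZ ?_⟩
      show ¬ (ψ z ∈ ψ.target → P (ψ.symm (ψ z)))
      rw [ψ.left_inv hzs]
      exact fun hc => hz (hc (ψ.map_source hzs))
    · exact Or.inr hzs
  refine measure_mono_null hsub (measure_union_null ?_ ?_)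
  · rw [chartVolume_apply h ψ (measurableSet_source_inter_preimage ψ hZm)]
    refine setLIntegral_measure_zero _ _ (measure_mono_null ?_ hZ0)
    rintro y ⟨hy, -, hyZ⟩
    rwa [mem_preimage, ψ.right_inv hy] at hyZ
  · rw [← chartVolume_restrict_source, Measure.restrict_apply ψ.open_source.measurableSet.compl,
      compl_inter_self, measure_empty]

theorem IsSmoothChart.aemeasurable_ofReal_chartDensity (hφ : IsSmoothChart φ)
    (h : SurfaceMetric M) :
    AEMeasurable (fun y => ofReal (chartDensity h φ y)) (volume.restrict φ.target) :=
  ((hφ.continuousOn_chartDensity h).aemeasurable φ.open_target.measurableSet).ennreal_ofReal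

/-- The density is positive on the chart, so null sets of the surface are null in the chart. -/
theorem IsSmoothChart.ae_chart (hφ : IsSmoothChart φ) (h : SurfaceMetric M) {P : M → Prop}
    (hP : ∀ᵐ x ∂vol[h], P x) : ∀ᵐ y, y ∈ φ.target → P (φ.symm y) := by
  have h1 := ae_restrict_of_ae (s := φ.source) hP
  rw [hφ.riemannianVolume_restrict h, chartVolume] at h1
  have h2 := (ae_withDensity_iff' (hφ.aemeasurable_ofReal_chartDensity h)).1
    (ae_of_ae_map (aemeasurable_symm_withDensity φ _) h1)
  rw [ae_restrict_iff' φ.open_target.measurableSet] at h2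
  filter_upwards [h2] with y hy hyt
  exact hy hyt (ENNReal.ofReal_pos.2 (hφ.chartDensity_pos h hyt)).ne'

theorem IsSmoothChart.setLIntegral_source (hφ : IsSmoothChart φ) (h : SurfaceMetric M)
    {g : M → ℝ≥0∞} (hg : AEMeasurable g vol[h]) : ∫⁻ x in φ.source, g x ∂vol[h] =
      ∫⁻ y in φ.target, ofReal (chartDensity h φ y) * g (φ.symm y) := by
  have hg1 := hg.restrict (s := φ.source)
  rw [hφ.riemannianVolume_restrict h] at hg1 ⊢
  have hd := hφ.aemeasurable_ofReal_chartDensity h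
  rw [chartVolume] at hg1 ⊢
  rw [lintegral_map' hg1 (aemeasurable_symm_withDensity φ _)]
  exact lintegral_withDensity_eq_lintegral_mul₀' hd
    (hg1.comp_aemeasurable (aemeasurable_symm_withDensity φ _))

variable {G : Type*} [NormedAddCommGroup G] [NormedSpace ℝ G]

theorem IsSmoothChart.setIntegral_source (hφ : IsSmoothChart φ) (h : SurfaceMetric M)
    {g : M → G} (hg : AEStronglyMeasurable g vol[h]) : ∫ x in φ.source, g x ∂vol[h] =
      ∫ y in φ.target, chartDensity h φ y • g (φ.symm y) := by
  have hg1 := hg.restrict (s := φ.source)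
  rw [hφ.riemannianVolume_restrict h] at hg1 ⊢
  have hd := hφ.aemeasurable_ofReal_chartDensity h
  rw [chartVolume] at hg1 ⊢
  rw [integral_map (aemeasurable_symm_withDensity φ _) hg1]
  refine (integral_withDensity_eq_integral_toReal_smul₀ hd (by simp) _).trans ?_
  refine setIntegral_congr_fun φ.open_target.measurableSet fun y _ => ?_
  rw [ENNReal.toReal_ofReal (show 0 ≤ chartDensity h φ y from Real.sqrt_nonneg _)]

theorem IsSmoothChart.integrableOn_chart (hφ : IsSmoothChart φ) (h : SurfaceMetric M)
    {g : M → G} (hg : IntegrableOn g φ.source vol[h]) :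
    IntegrableOn (fun y => chartDensity h φ y • g (φ.symm y)) φ.target := by
  have hd := hφ.aemeasurable_ofReal_chartDensity h
  rw [IntegrableOn, hφ.riemannianVolume_restrict h, chartVolume] at hg
  have h1 := hg.comp_aemeasurable (aemeasurable_symm_withDensity φ _)
  have h2 := (integrable_withDensity_iff_integrable_smul₀' hd (by simp)).1 h1
  refine h2.congr (ae_of_all _ fun y => ?_)
  change (ofReal (chartDensity h φ y)).toReal • _ = _
  rw [ENNReal.toReal_ofReal (show 0 ≤ chartDensity h φ y from Real.sqrt_nonneg _)]
  rfl

instance isFiniteMeasureOnCompacts_riemannianVolume [T2Space M] (h : SurfaceMetric M) :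
    IsFiniteMeasureOnCompacts vol[h] := by
  have : LocallyCompactSpace M := ChartedSpace.locallyCompactSpace ℂ M
  have : IsLocallyFiniteMeasure vol[h] := by
    refine ⟨fun x => ?_⟩
    set ψ := chartAt ℂ x with hψ
    have hs := isSmoothChart_chartAt x
    have hx : x ∈ ψ.source := mem_chart_source ℂ x
    obtain ⟨r, hr, hball⟩ := Metric.isOpen_iff.1 ψ.open_target (ψ x) (ψ.map_source hx)
    have hsub : Metric.closedBall (ψ x) (r / 2) ⊆ ψ.target :=
      (Metric.closedBall_subset_ball (by linarith)).trans hball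
    refine ⟨ψ.source ∩ ψ ⁻¹' Metric.ball (ψ x) (r / 2),
      (ψ.isOpen_inter_preimage Metric.isOpen_ball).mem_nhds ⟨hx, Metric.mem_ball_self (by linarith)⟩,
      ?_⟩
    rw [← Measure.restrict_eq_self _ inter_subset_left, riemannianVolume_restrict_of_mem_atlas h
      (chart_mem_atlas ℂ x), chartVolume_apply h ψ
        (ψ.isOpen_inter_preimage Metric.isOpen_ball).measurableSet]
    obtain ⟨C, hC⟩ := (isCompact_closedBall (ψ x) (r / 2)).exists_bound_of_continuousOn
      ((hs.continuousOn_chartDensity h).mono hsub)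
    refine ((lintegral_mono_set (t := Metric.closedBall (ψ x) (r / 2)) ?_).trans
      (setLIntegral_mono' (g := fun _ => ofReal C) measurableSet_closedBall fun y hy =>
        ENNReal.ofReal_le_ofReal ((le_abs_self _).trans (hC y hy)))).trans_lt ?_
    · rintro y ⟨hy, -, hy2⟩
      rw [mem_preimage, ψ.right_inv hy] at hy2
      exact Metric.ball_subset_closedBall hy2
    rw [setLIntegral_const]
    exact ENNReal.mul_lt_top ENNReal.ofReal_lt_top measure_closedBall_lt_top
  infer_instance

end Volume

/-! ### Classical differentials, conformal charts, extension by zero -/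

section ClassicalDifferential

variable {φ : Chart[M]}

/-- The classical differential of a map to a vector space. -/
def cdiff (u : M → F) (x : M) : T*[x, F] :=
  mfderiv 𝓘₂ 𝓘(ℝ, F) u x

/-- The product `du · dw` of classical differentials. -/
def dInner (h : SurfaceMetric M) (u w : M → F) (x : M) : ℝ :=
  pairing h x (cdiff u x) (cdiff w x)

theorem IsSmoothChart.fderiv_comp_symm_eq_cdiff (hφ : IsSmoothChart φ) {y : ℂ} (hy : y ∈ φ.target)
    {w : M → F} (hw : DiffAt[F] w (φ.symm y)) :
    fderiv ℝ (fun z => w (φ.symm z)) y = (cdiff w (φ.symm y)).comp (chartDifferential φ y) :=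
  mfderiv_eq_fderiv.symm.trans (mfderiv_comp y hw (hφ.mdifferentiableAt_symm hy))

/-- The Euclidean product of two linear maps on the plane. -/
def flatPairing (A B : ℂ →L[ℝ] F) : ℝ :=
  inner ℝ (A 1) (B 1) + inner ℝ (A I) (B I)

theorem dInner_self_nonneg (h : SurfaceMetric M) (u : M → F) (x : M) : 0 ≤ dInner h u u x :=
  pairing_self_nonneg _ _ _

theorem flatPairing_self (A : ℂ →L[ℝ] F) : flatPairing A A = ‖A 1‖ ^ 2 + ‖A I‖ ^ 2 := by
  simp [flatPairing]

theorem flatPairing_self_nonneg (A : ℂ →L[ℝ] F) : 0 ≤ flatPairing A A := by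
  rw [flatPairing_self]; positivity

theorem flatPairing_le_norm_sq (A : ℂ →L[ℝ] F) : flatPairing A A ≤ 2 * ‖A‖ ^ 2 := by
  rw [flatPairing_self]
  have h1 := A.le_opNorm 1
  have h2 := A.le_opNorm I
  simp only [norm_one, Complex.norm_I, mul_one] at h1 h2
  nlinarith [norm_nonneg (A 1), norm_nonneg (A I)]

theorem mdifferentiableAt_of_contMDiffOn {u : M → F} {O : Set M} (hO : IsOpen O)
    (hu : SmoothOn[F] u O) {x : M} (hx : x ∈ O) : DiffAt[F] u x :=
  (hu.contMDiffAt (hO.mem_nhds hx)).mdifferentiableAt (by simp)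

theorem IsSmoothChart.contDiffOn_comp_symm (hφ : IsSmoothChart φ) {u : M → F} {O : Set M}
    (hu : SmoothOn[F] u O) : ContDiffOn ℝ ∞ (fun y => u (φ.symm y)) (φ.target ∩ φ.symm ⁻¹' O) :=
  contMDiffOn_iff_contDiffOn.1
    (hu.comp (hφ.contMDiffOn_symm.mono inter_subset_left) fun _ hy => hy.2)

theorem isOpen_target_inter (φ : Chart[M]) {O : Set M} (hO : IsOpen O) :
    IsOpen (φ.target ∩ φ.symm ⁻¹' O) := φ.symm.isOpen_inter_preimage hO

/-- In a chart the product is a finite sum of inverse metric coefficients times inner products of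
partial derivatives. -/
theorem continuousOn_dInner (h : SurfaceMetric M) {u w : M → F} {O : Set M} (hO : IsOpen O)
    (hu : SmoothOn[F] u O) (hw : SmoothOn[F] w O) : ContinuousOn (dInner h u w) O := by
  intro x hx
  set ψ := chartAt ℂ x with hψdef
  have hψ : IsSmoothChart ψ := isSmoothChart_chartAt x
  have hxs : x ∈ ψ.source := mem_chart_source ℂ x
  set Ω := ψ.target ∩ ψ.symm ⁻¹' O with hΩ
  have hΩo : IsOpen Ω := isOpen_target_inter ψ hO
  have hfu := (hψ.contDiffOn_comp_symm hu).continuousOn_fderiv_of_isOpen hΩo (by simp)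
  have hfw := (hψ.contDiffOn_comp_symm hw).continuousOn_fderiv_of_isOpen hΩo (by simp)
  have hc : ContinuousOn (fun y => ∑ i, ∑ j, (chartGram h ψ y)⁻¹ i j *
      inner ℝ (fderiv ℝ (fun z => u (ψ.symm z)) y (stdFrame i))
        (fderiv ℝ (fun z => w (ψ.symm z)) y (stdFrame j))) Ω := by
    refine continuousOn_finsetSum _ fun i _ => continuousOn_finsetSum _ fun j _ => ?_
    refine ((hψ.continuousOn_chartGram_inv h i j).mono inter_subset_left).mul ?_
    exact (hfu.clm_apply continuousOn_const).inner (𝕜 := ℝ) (hfw.clm_apply continuousOn_const)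
  have hxΩ : ψ x ∈ Ω := ⟨ψ.map_source hxs, by rw [mem_preimage, ψ.left_inv hxs]; exact hx⟩
  have hcx := (hc.continuousAt (hΩo.mem_nhds hxΩ)).comp (ψ.continuousAt hxs)
  have heq : dInner h u w =ᶠ[𝓝 x] (fun y => ∑ i, ∑ j, (chartGram h ψ y)⁻¹ i j *
      inner ℝ (fderiv ℝ (fun z => u (ψ.symm z)) y (stdFrame i))
        (fderiv ℝ (fun z => w (ψ.symm z)) y (stdFrame j))) ∘ ψ := by
    filter_upwards [ψ.open_source.mem_nhds hxs, hO.mem_nhds hx] with z hz hzO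
    have hzt := ψ.map_source hz
    have hu' := mdifferentiableAt_of_contMDiffOn hO hu hzO
    have hw' := mdifferentiableAt_of_contMDiffOn hO hw hzO
    rw [← ψ.left_inv hz] at hu' hw'
    conv_lhs => rw [← ψ.left_inv hz]
    simp only [Function.comp_apply]
    rw [dInner, hψ.pairing_chart h hzt, hψ.fderiv_comp_symm_eq_cdiff hzt hu',
      hψ.fderiv_comp_symm_eq_cdiff hzt hw']
    rfl
  exact (hcx.congr heq.symm).continuousWithinAt

theorem cdiff_congr {u w : M → F} {x : M} (huw : u =ᶠ[𝓝 x] w) : cdiff u x = cdiff w x :=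
  huw.mfderiv_eq

theorem cdiff_const (c : F) (x : M) : cdiff (fun _ : M => c) x = 0 := mfderiv_const

theorem cdiff_eq_zero_of_notMem_tsupport {w : M → F} {x : M} (hx : x ∉ tsupport w) :
    cdiff w x = 0 :=
  (cdiff_congr (notMem_tsupport_iff_eventuallyEq.1 hx)).trans (cdiff_const 0 x)

section Rules

variable {u w : M → F} {x : M}

theorem cdiff_add (hu : DiffAt[F] u x) (hw : DiffAt[F] w x) :
    cdiff (fun z => u z + w z) x = cdiff u x + cdiff w x :=
  mfderiv_add hu hw

theorem cdiff_sub (hu : DiffAt[F] u x) (hw : DiffAt[F] w x) :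
    cdiff (fun z => u z - w z) x = cdiff u x - cdiff w x :=
  mfderiv_sub hu hw

theorem hasMFDerivAt_prodMk_space {F' : Type*} [NormedAddCommGroup F'] [InnerProductSpace ℝ F']
    {w : M → F'} (hu : DiffAt[F] u x) (hw : DiffAt[F'] w x) :
    HasMFDerivAt 𝓘₂ 𝓘(ℝ, F × F') (fun z => (u z, w z)) x ((cdiff u x).prod (cdiff w x)) :=
  ⟨hu.hasMFDerivAt.1.prodMk hw.hasMFDerivAt.1, hu.hasMFDerivAt.2.prodMk hw.hasMFDerivAt.2⟩

theorem cdiff_smul_apply {f : M → ℝ} (hf : DiffAt[ℝ] f x) (hu : DiffAt[F] u x) (v : T[x]) :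
    cdiff (fun z => f z • u z) x v = f x • cdiff u x v + cdiff f x v • u x := by
  have h1 : HasFDerivAt (fun q : ℝ × F => q.1 • q.2) _ (f x, u x) :=
    (hasFDerivAt_fst (𝕜 := ℝ) (p := (f x, u x))).smul (hasFDerivAt_snd (𝕜 := ℝ) (p := (f x, u x)))
  have h2 := (HasMFDerivAt.comp (f := fun z => (f z, u z)) x h1.hasMFDerivAt
    (hasMFDerivAt_prodMk_space hf hu)).mfderiv
  exact congrArg (fun A => A v) h2

theorem cdiff_inner_apply (hu : DiffAt[F] u x) (hw : DiffAt[F] w x) (v : T[x]) :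
    cdiff (fun z => inner ℝ (u z) (w z)) x v =
      inner ℝ (u x) (cdiff w x v) + inner ℝ (cdiff u x v) (w x) := by
  have h1 : HasFDerivAt (fun q : F × F => inner ℝ q.1 q.2) _ (u x, w x) :=
    (hasFDerivAt_fst (𝕜 := ℝ) (p := (u x, w x))).inner ℝ (hasFDerivAt_snd (𝕜 := ℝ) (p := (u x, w x)))
  have h2 := (HasMFDerivAt.comp (f := fun z => (u z, w z)) x h1.hasMFDerivAt
    (hasMFDerivAt_prodMk_space hu hw)).mfderiv
  exact congrArg (fun A => A v) h2

end Rules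

theorem dInner_eq_zero_of_notMem_tsupport (h : SurfaceMetric M) (u : M → F) {w : M → F} {x : M}
    (hx : x ∉ tsupport w) : dInner h u w x = 0 := by
  rw [dInner, cdiff_eq_zero_of_notMem_tsupport hx, pairing_zero_right]

/-- A conformal chart, with conformal factor `r`. -/
structure IsConformalWith (h : SurfaceMetric M) (φ : Chart[M]) (r : ℂ → ℝ) :
    Prop where
  isSmoothChart : IsSmoothChart φ
  pos : ∀ y ∈ φ.target, 0 < r y
  inner_eq : ∀ y ∈ φ.target, ∀ v v' : ℂ,
    h.inner (φ.symm y) (chartDifferential φ y v) (chartDifferential φ y v') = r y * inner ℝ v v'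

theorem IsConformalChart.exists_factor {h : SurfaceMetric M} (hφ : IsConformalChart h φ) :
    ∃ r : ℂ → ℝ, IsConformalWith h φ r := by
  choose! r hr using hφ.conformal
  exact ⟨r, isSmoothChart_of_mem_maximalAtlas hφ.mem_maximalAtlas, fun y hy => (hr y hy).1,
    fun y hy => (hr y hy).2⟩

variable {h : SurfaceMetric M} {r : ℂ → ℝ}

/-- The vectors `1` and `i`, pushed to the surface and divided by `√r`, form an orthonormal frame.
Since the volume density is `r` (`IsConformalWith.chartDensity_eq`), the two factors cancel in
Dirichlet integrals: this is their conformal invariance. -/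
theorem IsConformalWith.pairing_eq (hφ : IsConformalWith h φ r) {y : ℂ} (hy : y ∈ φ.target)
    (A B : T*[(φ.symm y), F]) : pairing h (φ.symm y) A B = (r y)⁻¹ *
      flatPairing (A.comp (chartDifferential φ y)) (B.comp (chartDifferential φ y)) := by
  have hr := hφ.pos y hy
  have hs : √(r y) * √(r y) = r y := Real.mul_self_sqrt hr.le
  have hs0 : 0 < √(r y) := Real.sqrt_pos.2 hr
  have hf : IsOrthoFrame h (φ.symm y) ((√(r y))⁻¹ • chartDifferential φ y 1)
      ((√(r y))⁻¹ • chartDifferential φ y I) := by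
    refine ⟨?_, ?_, ?_, fun v => ?_⟩
    iterate 2
      simp only [map_smul, _root_.smul_apply, smul_eq_mul, hφ.inner_eq y hy,
        real_inner_self_eq_norm_sq, norm_one, Complex.norm_I]
      field_simp
      nlinarith
    · simp [hφ.inner_eq y hy, Complex.inner]
    · set z : ℂ := mfderiv 𝓘₂ 𝓘₂ φ (φ.symm y) v with hz
      refine ⟨√(r y) * z.re, √(r y) * z.im, ?_⟩
      rw [← hφ.isSmoothChart.chartDifferential_comp_mfderiv hy v, ← hz]
      conv_lhs => rw [exists_comb_std z]
      rw [map_add, map_smul, map_smul, smul_smul, smul_smul]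
      congr 2 <;> field_simp
  rw [hf.pairing_eq, flatPairing]
  simp only [map_smul, inner_smul_left, inner_smul_right, RCLike.conj_to_real,
    ContinuousLinearMap.comp_apply]
  have : (√(r y))⁻¹ * (√(r y))⁻¹ = (r y)⁻¹ := by rw [← mul_inv, hs]
  linear_combination (inner ℝ (A (chartDifferential φ y 1)) (B (chartDifferential φ y 1)) +
    inner ℝ (A (chartDifferential φ y I)) (B (chartDifferential φ y I))) * this

theorem IsConformalWith.dInner_eq (hφ : IsConformalWith h φ r) {y : ℂ} (hy : y ∈ φ.target)
    {u w : M → F} (hu : DiffAt[F] u (φ.symm y)) (hw : DiffAt[F] w (φ.symm y)) :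
    dInner h u w (φ.symm y) = (r y)⁻¹ *
      flatPairing (fderiv ℝ (fun z => u (φ.symm z)) y) (fderiv ℝ (fun z => w (φ.symm z)) y) := by
  rw [dInner, hφ.pairing_eq hy, hφ.isSmoothChart.fderiv_comp_symm_eq_cdiff hy hu,
    hφ.isSmoothChart.fderiv_comp_symm_eq_cdiff hy hw]

theorem IsConformalWith.chartDensity_eq (hφ : IsConformalWith h φ r) {y : ℂ} (hy : y ∈ φ.target) :
    chartDensity h φ y = r y := by
  have hr := hφ.pos y hy
  have : (chartGram h φ y).det = r y ^ 2 := by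
    rw [Matrix.det_fin_two]
    simp only [chartGram, Matrix.of_apply, hφ.inner_eq y hy]
    simp [stdFrame, Complex.inner]
    ring
  rw [chartDensity, this, Real.sqrt_sq hr.le]

/-- The function on `M` given by `η` in the chart `φ`, extended by zero. -/
def chartExtend (φ : Chart[M]) (η : ℂ → F) : M → F :=
  φ.source.indicator fun x => η (φ x)

theorem chartExtend_symm (φ : Chart[M]) (η : ℂ → F) {y : ℂ} (hy : y ∈ φ.target) :
    chartExtend φ η (φ.symm y) = η y := by
  rw [chartExtend, indicator_of_mem (φ.map_target hy), φ.right_inv hy]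

theorem chartExtend_of_mem (φ : Chart[M]) (η : ℂ → F) {x : M} (hx : x ∈ φ.source) :
    chartExtend φ η x = η (φ x) := indicator_of_mem hx _

theorem chartExtend_of_notMem (φ : Chart[M]) (η : ℂ → F) {x : M}
    (hx : x ∉ φ.source) : chartExtend φ η x = 0 := indicator_of_notMem hx _

variable [T2Space M] {η : ℂ → F}

theorem isCompact_symm_image_tsupport (hc : HasCompactSupport η) (hs : tsupport η ⊆ φ.target) :
    IsCompact (φ.symm '' tsupport η) :=
  hc.isCompact.image_of_continuousOn (φ.continuousOn_symm.mono hs)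

theorem tsupport_chartExtend_subset (hc : HasCompactSupport η) (hs : tsupport η ⊆ φ.target) :
    tsupport (chartExtend φ η) ⊆ φ.symm '' tsupport η := by
  refine closure_minimal ?_ (isCompact_symm_image_tsupport hc hs).isClosed
  intro x hx
  by_cases hxs : x ∈ φ.source
  · rw [Function.mem_support, chartExtend_of_mem φ η hxs] at hx
    exact ⟨φ x, subset_tsupport _ hx, φ.left_inv hxs⟩
  · exact absurd (chartExtend_of_notMem φ η hxs) hx

theorem hasCompactSupport_chartExtend (hc : HasCompactSupport η) (hs : tsupport η ⊆ φ.target) :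
    HasCompactSupport (chartExtend φ η) :=
  (isCompact_symm_image_tsupport hc hs).of_isClosed_subset (isClosed_tsupport _)
    (tsupport_chartExtend_subset hc hs)

theorem tsupport_chartExtend_subset_source (hc : HasCompactSupport η) (hs : tsupport η ⊆ φ.target) :
    tsupport (chartExtend φ η) ⊆ φ.source := by
  refine (tsupport_chartExtend_subset hc hs).trans ?_
  rintro _ ⟨y, hy, rfl⟩
  exact φ.map_target (hs hy)

/-- Smoothness has to be checked on the support only, and the support lies in the chart domain
because the image of a compact set is closed. -/
theorem IsSmoothChart.contMDiff_chartExtend (hφ : IsSmoothChart φ) (hη : ContDiff ℝ ∞ η)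
    (hc : HasCompactSupport η) (hs : tsupport η ⊆ φ.target) : Smooth[F] (chartExtend φ η) := by
  refine contMDiff_of_tsupport fun x hx => ?_
  have hxs := tsupport_chartExtend_subset_source hc hs hx
  have h1 : ContMDiffAt 𝓘₂ 𝓘(ℝ, F) ∞ (fun x => η (φ x)) x :=
    hη.contMDiff.contMDiffAt.comp x (hφ.contMDiffOn.contMDiffAt (φ.open_source.mem_nhds hxs))
  refine h1.congr_of_eventuallyEq ?_
  filter_upwards [φ.open_source.mem_nhds hxs] with z hz using chartExtend_of_mem φ η hz

end ClassicalDifferential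

/-! ### Smooth fields with compact support -/

section TestFields

/-- Smooth maps with compact support in `O`. -/
def testFields (F : Type*) [NormedAddCommGroup F] [InnerProductSpace ℝ F] (O : Set M) :
    Submodule ℝ (M → F) where
  carrier := {w | Smooth[F] w ∧ HasCompactSupport w ∧ tsupport w ⊆ O}
  zero_mem' := ⟨contMDiff_const, HasCompactSupport.zero, by simp [tsupport]⟩
  add_mem' := fun {v w} hv hw => ⟨hv.1.add hw.1, hv.2.1.add hw.2.1,
    (tsupport_add v w).trans (union_subset hv.2.2 hw.2.2)⟩
  smul_mem' := fun c w hw => ⟨(contMDiff_const (c := c) (I' := 𝓘(ℝ, ℝ))).smul hw.1, hw.2.1.smul_left (f := fun _ => c),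
    (tsupport_smul_subset_right (fun _ => c) w).trans hw.2.2⟩

theorem tsupport_sum_subset {ι : Type*} [Fintype ι] {N : Set M} {t : ι → M → F} (c : ι → ℝ)
    (ht : ∀ i, tsupport (t i) ⊆ N) : tsupport (∑ i, c i • t i) ⊆ N := by
  refine subset_trans (closure_minimal (fun x hx => ?_) (isClosed_iUnion_of_finite fun i =>
    isClosed_tsupport (t i))) (iUnion_subset ht)
  by_contra h
  refine hx ?_
  rw [Finset.sum_apply]
  refine Finset.sum_eq_zero fun i _ => ?_
  rw [Pi.smul_apply, image_eq_zero_of_notMem_tsupport fun h1 => h (mem_iUnion.2 ⟨i, h1⟩), smul_zero]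

theorem sum_mem_testFields {ι : Type*} [Fintype ι] {O : Set M} {t : ι → M → F}
    (ht : ∀ i, t i ∈ testFields F O) (c : ι → ℝ) : ∑ i, c i • t i ∈ testFields F O :=
  Submodule.sum_mem _ fun i _ => Submodule.smul_mem _ _ (ht i)

variable [MeasurableSpace M] [BorelSpace M] [SecondCountableTopology M] [T2Space M]

theorem continuous_of_continuousOn_of_eq_zero {G : Type*} [NormedAddCommGroup G] {g : M → G}
    {O K : Set M} (hO : IsOpen O) (hg : ContinuousOn g O) (hK : IsCompact K) (hKO : K ⊆ O)
    (h0 : ∀ x ∉ K, g x = 0) : Continuous g ∧ HasCompactSupport g := by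
  have hts : tsupport g ⊆ K := closure_minimal (fun x hx => by
    by_contra hxK; exact hx (h0 x hxK)) hK.isClosed
  refine ⟨?_, hK.of_isClosed_subset (isClosed_tsupport _) hts⟩
  exact continuous_of_tsupport fun x hx => hg.continuousAt (hO.mem_nhds (hKO (hts hx)))

/-- This serves integrands such as `|du|² |w|²`, where `u` is smooth on `O` only: vanishing off a
compact subset of `O` makes them continuous everywhere. -/
theorem integrable_of_continuousOn_of_eq_zero (h : SurfaceMetric M) {g : M → ℝ}
    {O K : Set M} (hO : IsOpen O) (hg : ContinuousOn g O) (hK : IsCompact K) (hKO : K ⊆ O)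
    (h0 : ∀ x ∉ K, g x = 0) : Integrable g vol[h] := by
  obtain ⟨h1, h2⟩ := continuous_of_continuousOn_of_eq_zero hO hg hK hKO h0
  exact h1.integrable_of_hasCompactSupport h2

end TestFields

/-! ### Weak derivatives in the plane -/

section WeakDeriv

variable {Ω : Set ℂ} {f : ℂ → F} {A B : ℂ → ℂ →L[ℝ] F}

theorem integrable_smul_of_tsupport_subset {G : Type*} [NormedAddCommGroup G] [NormedSpace ℝ G]
    {g : ℂ → G} (hg : LocallyIntegrableOn g Ω) {η : ℂ → ℝ} (hη : Continuous η)
    (hc : HasCompactSupport η) (hs : tsupport η ⊆ Ω) : Integrable fun y => η y • g y := by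
  have h1 := hg.integrableOn_compact_subset hs hc.isCompact
  have h2 := h1.continuousOn_smul hη.continuousOn hc.isCompact
  rwa [integrableOn_iff_integrable_of_support_subset] at h2
  exact (Function.support_smul_subset_left η g).trans (subset_tsupport η)

theorem locallyIntegrableOn_clm_comp {G H : Type*} [NormedAddCommGroup G] [NormedSpace ℝ G]
    [NormedAddCommGroup H] [NormedSpace ℝ H] (T : G →L[ℝ] H) {g : ℂ → G}
    (hg : LocallyIntegrableOn g Ω) : LocallyIntegrableOn (fun y => T (g y)) Ω := by
  intro x hx
  obtain ⟨s, hs, hi⟩ := hg x hx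
  exact ⟨s, hs, T.integrable_comp hi⟩

theorem IsWeakDerivOn.mono (hf : IsWeakDerivOn Ω f A) {Ω' : Set ℂ} (h : Ω' ⊆ Ω) :
    IsWeakDerivOn Ω' f A :=
  ⟨hf.locallyIntegrable.mono_set h, hf.locallyIntegrable_deriv.mono_set h,
    fun η h1 h2 h3 v => hf.integral_eq η h1 h2 (h3.trans h) v⟩

theorem IsWeakDerivOn.locallyIntegrable_apply (hf : IsWeakDerivOn Ω f A) (v : ℂ) :
    LocallyIntegrableOn (fun y => A y v) Ω :=
  locallyIntegrableOn_clm_comp (ContinuousLinearMap.apply ℝ F v) hf.locallyIntegrable_deriv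

theorem integrable_fderiv_smul {g : ℂ → F} (hg : LocallyIntegrableOn g Ω) {η : ℂ → ℝ}
    (hη : ContDiff ℝ ∞ η) (hc : HasCompactSupport η) (hs : tsupport η ⊆ Ω) (v : ℂ) :
    Integrable fun y => fderiv ℝ η y v • g y :=
  integrable_smul_of_tsupport_subset hg
    ((hη.continuous_fderiv (by simp)).clm_apply continuous_const) (hc.fderiv_apply ℝ v)
    ((tsupport_fderiv_apply_subset ℝ v).trans hs)

theorem clm_eq_of_apply {A B : ℂ →L[ℝ] F} (h1 : A 1 = B 1) (hI : A I = B I) : A = B := by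
  ext v
  rw [exists_comb_std v, map_add, map_add, map_smul, map_smul, map_smul, map_smul, h1, hI]

/-- The fundamental lemma of the calculus of variations, applied to the directional derivatives
along `1` and `i`. -/
theorem IsWeakDerivOn.ae_eq [CompleteSpace F] (hΩ : IsOpen Ω) (hA : IsWeakDerivOn Ω f A)
    (hB : IsWeakDerivOn Ω f B) : ∀ᵐ y, y ∈ Ω → A y = B y := by
  have key : ∀ v : ℂ, ∀ᵐ y, y ∈ Ω → A y v - B y v = 0 := by
    intro v
    have hAv := hA.locallyIntegrable_apply v
    have hBv := hB.locallyIntegrable_apply v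
    refine hΩ.ae_eq_zero_of_integral_contDiff_smul_eq_zero (hAv.sub hBv) fun η h1 h2 h3 => ?_
    have e1 := integrable_smul_of_tsupport_subset hAv h1.continuous h2 h3
    have e2 := integrable_smul_of_tsupport_subset hBv h1.continuous h2 h3
    have e3 := hA.integral_eq η h1 h2 h3 v
    rw [← hB.integral_eq η h1 h2 h3 v] at e3
    simp only [smul_sub]
    exact (integral_sub e1 e2).trans (sub_eq_zero.2 e3)
  filter_upwards [key 1, key I] with y h1 hI hy
  exact clm_eq_of_apply (sub_eq_zero.1 (h1 hy)) (sub_eq_zero.1 (hI hy))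

theorem contDiff_smul_of_tsupport_subset (hΩ : IsOpen Ω) {η : ℂ → ℝ} (hη : ContDiff ℝ ∞ η)
    (hs : tsupport η ⊆ Ω) (hf : ContDiffOn ℝ ∞ f Ω) : ContDiff ℝ ∞ fun y => η y • f y := by
  rw [← contMDiff_iff_contDiff]
  refine contMDiff_of_tsupport fun y hy => ?_
  rw [contMDiffAt_iff_contDiffAt]
  have hyΩ : y ∈ Ω := hs (tsupport_smul_subset_left η f hy)
  exact hη.contDiffAt.smul (hf.contDiffAt (hΩ.mem_nhds hyΩ))

theorem integral_fderiv_apply_eq_zero {g : ℂ → F} (hg : ContDiff ℝ ∞ g) (hc : HasCompactSupport g)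
    (v : ℂ) : ∫ y, fderiv ℝ g y v = 0 := by
  have h1 := ((hg.continuous_fderiv (by simp)).clm_apply (continuous_const (y := v))).integrable_of_hasCompactSupport (μ := volume)
    (hc.fderiv_apply ℝ v)
  have h2 := integral_smul_fderiv_eq_neg_fderiv_smul_of_integrable (μ := (volume : Measure ℂ))
    (f := fun _ : ℂ => (1 : ℝ)) (g := g) (v := v) (by simp) (by simpa using h1)
    (by simpa using hg.continuous.integrable_of_hasCompactSupport hc) (fun _ _ => by fun_prop)
    (fun y _ => hg.differentiable (by simp) y)
  simpa using h2

theorem integral_smul_fderiv_of_contDiffOn (hΩ : IsOpen Ω) {η : ℂ → ℝ} (hη : ContDiff ℝ ∞ η)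
    (hc : HasCompactSupport η) (hs : tsupport η ⊆ Ω) (hf : ContDiffOn ℝ ∞ f Ω) (v : ℂ) :
    ∫ y, η y • fderiv ℝ f y v = - ∫ y, fderiv ℝ η y v • f y := by
  have h1 := contDiff_smul_of_tsupport_subset hΩ hη hs hf
  have h2 := integral_fderiv_apply_eq_zero h1 (hc.smul_right (f' := f)) v
  have hfl : LocallyIntegrableOn f Ω := hf.continuousOn.locallyIntegrableOn hΩ.measurableSet
  have hfd : LocallyIntegrableOn (fun y => fderiv ℝ f y v) Ω :=
    ((hf.continuousOn_fderiv_of_isOpen hΩ (by simp)).clm_apply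
      continuousOn_const).locallyIntegrableOn hΩ.measurableSet
  have e1 := integrable_smul_of_tsupport_subset hfd hη.continuous hc hs
  have e2 := integrable_fderiv_smul hfl hη hc hs v
  have h3 : ∀ y, fderiv ℝ (fun y => η y • f y) y v = η y • fderiv ℝ f y v +
      fderiv ℝ η y v • f y := by
    intro y
    by_cases hy : y ∈ tsupport η
    · have hfy := (hf.contDiffAt (hΩ.mem_nhds (hs hy))).differentiableAt (by simp)
      rw [fderiv_fun_smul (hη.differentiable (by simp) y) hfy]
      simp
    · have z1 : η =ᶠ[𝓝 y] fun _ => 0 := notMem_tsupport_iff_eventuallyEq.1 hy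
      have z2 : (fun y => η y • f y) =ᶠ[𝓝 y] fun _ => 0 := by
        filter_upwards [z1] with z hz; rw [hz, zero_smul]
      rw [z2.fderiv_eq, z1.fderiv_eq, z1.eq_of_nhds]
      simp
  simp only [h3] at h2
  rw [integral_add e1 e2] at h2
  exact eq_neg_of_add_eq_zero_left h2

theorem isWeakDerivOn_of_contDiffOn (hΩ : IsOpen Ω) (hf : ContDiffOn ℝ ∞ f Ω) :
    IsWeakDerivOn Ω f (fderiv ℝ f) :=
  ⟨hf.continuousOn.locallyIntegrableOn hΩ.measurableSet,
    (hf.continuousOn_fderiv_of_isOpen hΩ (by simp)).locallyIntegrableOn hΩ.measurableSet,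
    fun _ h1 h2 h3 v => integral_smul_fderiv_of_contDiffOn hΩ h1 h2 h3 hf v⟩

theorem locallyIntegrableOn_congr {G : Type*} [NormedAddCommGroup G] (hΩ : IsOpen Ω) {g k : ℂ → G}
    (hg : LocallyIntegrableOn g Ω) (hgk : ∀ y ∈ Ω, g y = k y) : LocallyIntegrableOn k Ω := by
  intro x hx
  obtain ⟨s, hs, hi⟩ := hg x hx
  rw [hΩ.nhdsWithin_eq hx] at hs ⊢
  obtain ⟨t, hts, hto, hxt⟩ := mem_nhds_iff.1 (inter_mem hs (hΩ.mem_nhds hx))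
  refine ⟨t, hto.mem_nhds hxt, ?_⟩
  exact (hi.mono_set fun y hy => (hts hy).1).congr_fun (fun y hy => hgk y (hts hy).2)
    hto.measurableSet

theorem IsWeakDerivOn.congr (hΩ : IsOpen Ω) (hf : IsWeakDerivOn Ω f A) {g : ℂ → F}
    {B : ℂ → ℂ →L[ℝ] F}
    (hfg : ∀ y ∈ Ω, f y = g y) (hAB : ∀ y ∈ Ω, A y = B y) : IsWeakDerivOn Ω g B := by
  refine ⟨?_, ?_, fun η h1 h2 h3 v => ?_⟩
  · exact locallyIntegrableOn_congr hΩ hf.locallyIntegrable hfg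
  · exact locallyIntegrableOn_congr hΩ hf.locallyIntegrable_deriv hAB
  · have := hf.integral_eq η h1 h2 h3 v
    have hd0 : ∀ y ∉ Ω, fderiv ℝ η y v = 0 := fun y hy => by
      rw [fderiv_of_notMem_tsupport ℝ fun h => hy (h3 h)]; rfl
    have hη0 : ∀ y ∉ Ω, η y = 0 := fun y hy => image_eq_zero_of_notMem_tsupport fun h => hy (h3 h)
    have e1 : ∀ y, η y • A y v = η y • B y v := fun y => by
      by_cases hy : y ∈ Ω
      · rw [hAB y hy]
      · rw [hη0 y hy, zero_smul, zero_smul]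
    have e2 : ∀ y, fderiv ℝ η y v • f y = fderiv ℝ η y v • g y := fun y => by
      by_cases hy : y ∈ Ω
      · rw [hfg y hy]
      · rw [hd0 y hy, zero_smul, zero_smul]
    simpa only [e1, e2] using this

theorem IsWeakDerivOn.add {g : ℂ → F} (hf : IsWeakDerivOn Ω f A) (hg : IsWeakDerivOn Ω g B) :
    IsWeakDerivOn Ω (fun y => f y + g y) (fun y => A y + B y) := by
  refine ⟨hf.locallyIntegrable.add hg.locallyIntegrable,
    LocallyIntegrableOn.add (f := A) (g := B) hf.locallyIntegrable_deriv
      hg.locallyIntegrable_deriv, fun η h1 h2 h3 v => ?_⟩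
  have i1 := integrable_smul_of_tsupport_subset (hf.locallyIntegrable_apply v) h1.continuous h2 h3
  have i2 := integrable_smul_of_tsupport_subset (hg.locallyIntegrable_apply v) h1.continuous h2 h3
  have i3 := integrable_fderiv_smul hf.locallyIntegrable h1 h2 h3 v
  have i4 := integrable_fderiv_smul hg.locallyIntegrable h1 h2 h3 v
  have e1 : ∀ y, η y • (A y + B y) v = η y • A y v + η y • B y v := fun y => by
    rw [_root_.add_apply, smul_add]
  have e2 : ∀ y, fderiv ℝ η y v • (f y + g y) = fderiv ℝ η y v • f y + fderiv ℝ η y v • g y :=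
    fun y => smul_add _ _ _
  rw [integral_congr_ae (Eventually.of_forall e1), integral_congr_ae (Eventually.of_forall e2),
    integral_add i1 i2, integral_add i3 i4, neg_add, ← hf.integral_eq η h1 h2 h3 v,
    ← hg.integral_eq η h1 h2 h3 v]

theorem IsWeakDerivOn.const_smul (hf : IsWeakDerivOn Ω f A) (c : ℝ) :
    IsWeakDerivOn Ω (fun y => c • f y) (fun y => c • A y) := by
  refine ⟨hf.locallyIntegrable.smul c, hf.locallyIntegrable_deriv.smul c, fun η h1 h2 h3 v => ?_⟩
  simp only [_root_.smul_apply, smul_comm _ c]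
  rw [integral_smul, integral_smul, hf.integral_eq η h1 h2 h3 v, smul_neg]

/-- The product of a weakly differentiable map with a cut-off function, extended by zero. -/
theorem IsWeakDerivOn.cutoff_smul (hf : IsWeakDerivOn Ω f A) {r : ℂ → ℝ}
    (hr : ContDiff ℝ ∞ r) (hc : HasCompactSupport r) (hs : tsupport r ⊆ Ω) :
    IsWeakDerivOn univ (fun y => r y • f y)
      (fun y => r y • A y + (fderiv ℝ r y).smulRight (f y)) := by
  have hdr : ∀ v, Continuous fun y => fderiv ℝ r y v := fun v =>
    (hr.continuous_fderiv (by simp)).clm_apply continuous_const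
  have htr : ∀ v, tsupport (fun y => fderiv ℝ r y v) ⊆ Ω := fun v =>
    (tsupport_fderiv_apply_subset ℝ v).trans hs
  -- Integrability is read off from this splitting: continuous scalar coefficients times images of
  -- `f` under fixed linear maps.
  have hdec : ∀ y, (fderiv ℝ r y).smulRight (f y) = fderiv ℝ r y 1 • Complex.reCLM.smulRight (f y) +
        fderiv ℝ r y I • Complex.imCLM.smulRight (f y) := by
    intro y
    apply clm_eq_of_apply <;> simp
  have hT : ∀ T : ℂ →L[ℝ] ℝ, LocallyIntegrableOn (fun y => T.smulRight (f y)) Ω := fun T =>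
    locallyIntegrableOn_clm_comp (ContinuousLinearMap.smulRightL ℝ ℂ F T) hf.locallyIntegrable
  refine ⟨?_, ?_, fun η h1 h2 _ v => ?_⟩
  · exact (integrable_smul_of_tsupport_subset hf.locallyIntegrable hr.continuous hc
      hs).locallyIntegrable.locallyIntegrableOn _
  · refine Integrable.locallyIntegrable ?_ |>.locallyIntegrableOn _
    simp only [hdec]
    exact (integrable_smul_of_tsupport_subset hf.locallyIntegrable_deriv hr.continuous hc hs).add
      ((integrable_smul_of_tsupport_subset (hT _) (hdr _) (hc.fderiv_apply ℝ _) (htr _)).add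
        (integrable_smul_of_tsupport_subset (hT _) (hdr _) (hc.fderiv_apply ℝ _) (htr _)))
  · have hp : ContDiff ℝ ∞ fun y => η y * r y := h1.mul hr
    have hpc : HasCompactSupport fun y => η y * r y := hc.mul_left
    have hps : tsupport (fun y => η y * r y) ⊆ Ω := (tsupport_mul_subset_right).trans hs
    have key := hf.integral_eq _ hp hpc hps v
    have hd : ∀ y, fderiv ℝ (fun y => η y * r y) y v = η y * fderiv ℝ r y v +
        r y * fderiv ℝ η y v := by
      intro y
      rw [fderiv_fun_mul (h1.differentiable (by simp) y) (hr.differentiable (by simp) y)]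
      simp
    have i1 := integrable_smul_of_tsupport_subset (hf.locallyIntegrable_apply v) hp.continuous hpc hps
    have i2 : Integrable fun y => (η y * fderiv ℝ r y v) • f y :=
      integrable_smul_of_tsupport_subset hf.locallyIntegrable (h1.continuous.mul (hdr v))
        ((hc.fderiv_apply ℝ v).mul_left) ((tsupport_mul_subset_right).trans (htr v))
    have i3 : Integrable fun y => (r y * fderiv ℝ η y v) • f y :=
      integrable_smul_of_tsupport_subset hf.locallyIntegrable
        (hr.continuous.mul ((h1.continuous_fderiv (by simp)).clm_apply continuous_const))
        hc.mul_right ((tsupport_mul_subset_left).trans hs)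
    simp only [hd, add_smul] at key
    rw [integral_add i2 i3] at key
    have e1 : ∀ y, η y • (r y • A y + (fderiv ℝ r y).smulRight (f y)) v =
        (η y * r y) • A y v + (η y * fderiv ℝ r y v) • f y := by
      intro y
      simp [smul_add, smul_smul]
    have e2 : ∀ y, fderiv ℝ η y v • r y • f y = (r y * fderiv ℝ η y v) • f y := by
      intro y; rw [smul_smul, mul_comm]
    simp only [e1, e2]
    rw [integral_add i1 i2, key]
    abel

end WeakDeriv

/-! ### Weak differentials on the surface -/

section WeakDifferential

variable {w : M → F}

theorem WeaklyDifferentiable.isWeakDifferential (hw : WeaklyDifferentiable w) :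
    IsWeakDifferential w (weakDifferential w) := by
  rw [weakDifferential, dif_pos (show ∃ G, IsWeakDifferential w G from hw)]
  exact Exists.choose_spec hw

theorem isWeakDifferential_cdiff (hw : Smooth[F] w) : IsWeakDifferential w (cdiff w) := by
  intro ψ hψ
  have hs := isSmoothChart_of_mem_atlas hψ
  have h1 : ContDiffOn ℝ ∞ (fun y => w (ψ.symm y)) ψ.target := by
    have := hs.contDiffOn_comp_symm (O := univ) hw.contMDiffOn
    simpa using this
  refine (isWeakDerivOn_of_contDiffOn ψ.open_target h1).congr ψ.open_target (fun _ _ => rfl)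
    fun y hy => ?_
  exact hs.fderiv_comp_symm_eq_cdiff hy (hw.mdifferentiable (by simp) _)

variable [MeasurableSpace M] [BorelSpace M] [SecondCountableTopology M] [CompleteSpace F]

theorem IsWeakDifferential.ae_eq (h : SurfaceMetric M) {G H : (x : M) → T*[x, F]}
    (hG : IsWeakDifferential w G) (hH : IsWeakDifferential w H) : ∀ᵐ x ∂vol[h], G x = H x := by
  refine ae_riemannianVolume_of_charts h fun ψ hψ => ?_
  filter_upwards [(hG ψ hψ).ae_eq ψ.open_target (hH ψ hψ)] with y hy hyt
  exact (isSmoothChart_of_mem_atlas hψ).comp_chartDifferential_injective hyt (hy hyt)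

theorem IsWeakDifferential.ae_eq_weakDifferential (h : SurfaceMetric M)
    {G : (x : M) → T*[x, F]} (hG : IsWeakDifferential w G) :
    ∀ᵐ x ∂vol[h], weakDifferential w x = G x :=
  IsWeakDifferential.ae_eq h (WeaklyDifferentiable.isWeakDifferential ⟨G, hG⟩) hG

theorem weakDifferential_ae_eq_cdiff (h : SurfaceMetric M) (hw : Smooth[F] w) :
    ∀ᵐ x ∂vol[h], weakDifferential w x = cdiff w x :=
  (isWeakDifferential_cdiff hw).ae_eq_weakDifferential h

/-- On an open set where a weakly differentiable map is smooth, its weak differential is the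
classical one. -/
theorem WeaklyDifferentiable.ae_eq_cdiff_on (h : SurfaceMetric M) (hw : WeaklyDifferentiable w)
    {O : Set M} (hO : IsOpen O) (hs : SmoothOn[F] w O) :
    ∀ᵐ x ∂vol[h], x ∈ O → weakDifferential w x = cdiff w x := by
  refine ae_riemannianVolume_of_charts h fun ψ hψ => ?_
  have hsm := isSmoothChart_of_mem_atlas hψ
  have hΩ := isOpen_target_inter ψ hO
  have h1 := (hw.isWeakDifferential ψ hψ).mono (Ω' := ψ.target ∩ ψ.symm ⁻¹' O) inter_subset_left
  have h2 := isWeakDerivOn_of_contDiffOn hΩ (hsm.contDiffOn_comp_symm hs)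
  filter_upwards [h1.ae_eq hΩ h2] with y hy hyt hyO
  refine hsm.comp_chartDifferential_injective hyt ((hy ⟨hyt, hyO⟩).trans ?_)
  exact hsm.fderiv_comp_symm_eq_cdiff hyt (mdifferentiableAt_of_contMDiffOn hO hs hyO)

theorem IsWeakDifferential.add {v : M → F} {G H : (x : M) → T*[x, F]}
    (hG : IsWeakDifferential w G) (hH : IsWeakDifferential v H) :
    IsWeakDifferential (fun x => w x + v x) (fun x => G x + H x) := fun ψ hψ =>
  (hG ψ hψ).add (hH ψ hψ)

theorem IsWeakDifferential.const_smul {G : (x : M) → T*[x, F]}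
    (hG : IsWeakDifferential w G) (c : ℝ) :
    IsWeakDifferential (fun x => c • w x) (fun x => c • G x) := fun ψ hψ =>
  (hG ψ hψ).const_smul c

variable [T2Space M] {O : Set M}

theorem integrable_dInner_of_mem_testFields (h : SurfaceMetric M) {u w : M → F}
    (hO : IsOpen O) (hu : SmoothOn[F] u O) (hw : w ∈ testFields F O) :
    Integrable (dInner h u w) vol[h] :=
  integrable_of_continuousOn_of_eq_zero h hO (continuousOn_dInner h hO hu hw.1.contMDiffOn)
    hw.2.1.isCompact hw.2.2 fun _ hx => dInner_eq_zero_of_notMem_tsupport h u hx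

theorem memW12_of_mem_testFields (h : SurfaceMetric M) (hw : w ∈ testFields F O) : MemW12 h w := by
  refine ⟨⟨_, isWeakDifferential_cdiff hw.1⟩, ?_, ?_⟩
  · exact hw.1.continuous.memLp_of_hasCompactSupport hw.2.1
  · have hw' : w ∈ testFields F (univ : Set M) := ⟨hw.1, hw.2.1, subset_univ _⟩
    refine (integrable_dInner_of_mem_testFields h isOpen_univ hw.1.contMDiffOn hw').congr ?_
    filter_upwards [weakDifferential_ae_eq_cdiff h hw.1] with x hx
    rw [gradSq, gradInner, hx, dInner]

end WeakDifferential

/-! ### A differential inequality with exponential decay -/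

section Ode

variable {f f' f'' : ℝ → ℝ} {T α β : ℝ}

theorem le_of_hasDerivAt_nonneg_Icc {g g' : ℝ → ℝ} {s t : ℝ} (hst : s ≤ t)
    (hg : ∀ x ∈ Icc s t, HasDerivAt g (g' x) x) (h0 : ∀ x ∈ Icc s t, 0 ≤ g' x) : g s ≤ g t := by
  refine monotoneOn_of_deriv_nonneg (convex_Icc s t) (fun x hx => ?_) (fun x hx => ?_)
    (fun x hx => ?_) (left_mem_Icc.2 hst) (right_mem_Icc.2 hst) hst
  · exact (hg x hx).continuousAt.continuousWithinAt
  · exact (hg x (interior_subset hx)).differentiableAt.differentiableWithinAt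
  · rw [(hg x (interior_subset hx)).deriv]
    exact h0 x (interior_subset hx)

theorem monotoneOn_Ici_of_hasDerivAt {g g' : ℝ → ℝ} {a : ℝ} (hg : ∀ t ≥ a, HasDerivAt g (g' t) t)
    (h0 : ∀ t ≥ a, 0 ≤ g' t) {s t : ℝ} (hs : a ≤ s) (hst : s ≤ t) : g s ≤ g t :=
  le_of_hasDerivAt_nonneg_Icc hst (fun x hx => hg x (hs.trans hx.1)) fun x hx => h0 x (hs.trans hx.1)

/-- A nonnegative integrable solution of `f'' ≥ -β f³` has no tall spikes, since a spike of any
height carries a fixed amount of mass. -/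
theorem le_two_mul_of_integral_le (hβ : 0 < β) (hf : ∀ t > T, HasDerivAt f (f' t) t)
    (hf' : ∀ t > T, HasDerivAt f' (f'' t) t) (h0 : ∀ t > T, 0 ≤ f t)
    (hode : ∀ t > T, -(β * f t ^ 3) ≤ f'' t) {T₀ ε : ℝ} (hT₀ : T < T₀) (hε : 0 < ε)
    (hε' : 4 * β * ε ^ 2 < 1) (hint : ∀ s t, T₀ ≤ s → s ≤ t → ∫ x in s..t, f x ≤ ε) {t : ℝ}
    (ht : T₀ + 1 ≤ t) : f t ≤ 2 * ε := by
  have hcont : ∀ s > T, ContinuousAt f s := fun s hs => (hf s hs).continuousAt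
  have hii : ∀ s t, T < s → s ≤ t → IntervalIntegrable f volume s t := fun s t hs hst =>
    ContinuousOn.intervalIntegrable_of_Icc hst
      fun x hx => (hcont x (hs.trans_le hx.1)).continuousWithinAt
  have hex : ∀ s, T₀ ≤ s → ∃ x ∈ Icc s (s + 1), f x ≤ ε := by
    intro s hs
    by_contra! hcon
    have h1 : ∫ x in s..(s + 1), f x > ∫ x in s..(s + 1), ε := by
      refine intervalIntegral.integral_lt_integral_of_continuousOn_of_le_of_exists_lt (by linarith)
        continuousOn_const (fun x hx => (hcont x ((hT₀.trans_le hs).trans_le hx.1)).continuousWithinAt)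
        (fun x hx => (hcon x ⟨hx.1.le, hx.2⟩).le) ⟨s, left_mem_Icc.2 (by linarith),
          hcon s (left_mem_Icc.2 (by linarith))⟩
    simp only [intervalIntegral.integral_const, add_sub_cancel_left, one_smul] at h1
    exact absurd (hint s (s + 1) hs (by linarith)) (not_le.2 h1)
  obtain ⟨ta, hta, hfa⟩ := hex (t - 1) (by linarith)
  obtain ⟨tb, htb, hfb⟩ := hex t (by linarith)
  have htat : ta ≤ t := by linarith [hta.2]
  have hatb : ta ≤ tb := htat.trans htb.1
  have hTa : T < ta := by linarith [hta.1]
  -- If the maximum over `[ta, tb]` exceeds `2 ε`, then it is attained in the interior, since both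
  -- endpoints have height at most `ε`, and the maximum point is critical.
  obtain ⟨m, hm, hmax⟩ := isCompact_Icc.exists_isMaxOn (nonempty_Icc.2 hatb)
    (fun x hx => (hcont x (hTa.trans_le hx.1)).continuousWithinAt : ContinuousOn f (Icc ta tb))
  have hmax' : ∀ x ∈ Icc ta tb, f x ≤ f m := hmax
  refine (hmax' t ⟨htat, htb.1⟩).trans ?_
  by_contra! hbig
  have hma : ta < m := lt_of_le_of_ne hm.1 fun h => by rw [← h] at hbig; linarith
  have hmb : m < tb := lt_of_le_of_ne hm.2 fun h => by rw [h] at hbig; linarith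
  have hTm : T < m := hTa.trans hma
  have hcrit : f' m = 0 := by
    exact IsLocalMax.hasDerivAt_eq_zero (mem_of_superset (Icc_mem_nhds hma hmb) hmax') (hf m hTm)
  set c := f m with hc
  have hc0 : 0 < c := by linarith
  -- Below the maximum `f³ ≤ c² f`, so integrating the inequality from the critical point bounds the
  -- descent of `f'` by the mass of `f`.
  have hslope : ∀ s ∈ Icc m tb, -(β * c ^ 2 * ε) ≤ f' s := by
    intro s hs
    have hP : ∀ x ∈ Icc m s, HasDerivAt (fun y => f' y + β * c ^ 2 * ∫ z in m..y, f z)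
        (f'' x + β * c ^ 2 * f x) x := by
      intro x hx
      have hTx := hTm.trans_le hx.1
      refine (hf' x hTx).add (HasDerivAt.const_mul _ ?_)
      refine intervalIntegral.integral_hasDerivAt_right (hii m x hTm hx.1) ?_ (hcont x hTx)
      refine ContinuousOn.stronglyMeasurableAtFilter isOpen_Ioi
        (fun y hy => (hcont y hy).continuousWithinAt) x (mem_Ioi.2 hTx)
    have h1 := le_of_hasDerivAt_nonneg_Icc hs.1 hP fun x hx => by
      have hxI : x ∈ Icc ta tb := ⟨hma.le.trans hx.1, hx.2.trans hs.2⟩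
      have hTx := hTm.trans_le hx.1
      have h2 := hode x hTx
      have h3 := h0 x hTx
      have h4 : f x ^ 3 ≤ c ^ 2 * f x := by
        have : f x ^ 2 ≤ c ^ 2 := pow_le_pow_left₀ h3 (hmax' x hxI) 2
        nlinarith
      nlinarith
    simp only [intervalIntegral.integral_same, hcrit, mul_zero, add_zero] at h1
    have h5 := hint m s (by linarith [hta.1]) hs.1
    nlinarith [mul_pos hβ (pow_pos hc0 2)]
  have hlow : ∀ s ∈ Icc m tb, c - β * c ^ 2 * ε * (s - m) ≤ f s := by
    intro s hs
    have hP : ∀ x ∈ Icc m s, HasDerivAt (fun y => f y + β * c ^ 2 * ε * (y - m))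
        (f' x + β * c ^ 2 * ε * 1) x := fun x hx =>
      (hf x (hTm.trans_le hx.1)).add (((hasDerivAt_id x).sub_const m).const_mul _)
    have h1 := le_of_hasDerivAt_nonneg_Icc hs.1 hP fun x hx => by
      linarith [hslope x ⟨hx.1, hx.2.trans hs.2⟩]
    simp only [sub_self, mul_zero, add_zero] at h1
    linarith
  -- With slope at least `-β c² ε` the function stays above `c / 2` for the length `L`. Either `tb`
  -- is reached before, at a height above `ε`, or the mass is at least `L c / 2 = 1 / (4 β ε)`,
  -- which exceeds `ε` by `hε'`.
  set L := 1 / (2 * β * c * ε) with hL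
  have hL0 : 0 < L := by positivity
  have hLe : β * c ^ 2 * ε * L = c / 2 := by rw [hL]; field_simp
  have hk : 0 < β * c ^ 2 * ε := by positivity
  rcases le_or_gt (tb - m) L with hcase | hcase
  · have h1 := hlow tb (right_mem_Icc.2 hmb.le)
    have h2 := mul_le_mul_of_nonneg_left hcase hk.le
    linarith
  · have h1 : ∫ x in m..(m + L), c / 2 ≤ ∫ x in m..(m + L), f x := by
      refine intervalIntegral.integral_mono_on (by linarith) (by simp) (hii _ _ hTm (by linarith)) ?_
      intro x hx
      have h2 := hlow x ⟨hx.1, by linarith [hx.2]⟩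
      have h3 := mul_le_mul_of_nonneg_left (show x - m ≤ L by linarith [hx.2]) hk.le
      linarith
    have h2 := h1.trans (hint m (m + L) (by linarith [hta.1]) (by linarith))
    simp only [intervalIntegral.integral_const, add_sub_cancel_left, smul_eq_mul] at h2
    have h3 : L * (c / 2) = 1 / (4 * β * ε) := by rw [hL]; field_simp; norm_num
    rw [h3, div_le_iff₀ (by positivity)] at h2
    nlinarith

/-- The tails of the integral are small, so `le_two_mul_of_integral_le` shows that `f` tends to `0`.
The cubic term is then at most half of the linear one, which leaves `f'' ≥ m² f` with `m² = α / 2`.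
Growing solutions are excluded because `f` is small, so `f' + m f ≤ 0` and `f e^{mt}` is
nonincreasing. -/
theorem exists_exponential_decay (hα : 0 < α) (hβ : 0 < β)
    (hf : ∀ t > T, HasDerivAt f (f' t) t) (hf' : ∀ t > T, HasDerivAt f' (f'' t) t)
    (h0 : ∀ t > T, 0 ≤ f t) (hode : ∀ t > T, α * f t - β * f t ^ 3 ≤ f'' t)
    (hint : IntegrableOn f (Ioi T)) :
    ∃ C m T₁ : ℝ, 0 < m ∧ T < T₁ ∧ ∀ t ≥ T₁, f t ≤ C * Real.exp (-(m * t)) := by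
  have hsmall : ∀ ε > 0, ∃ T₁ > T, ∀ t ≥ T₁, f t ≤ ε := by
    intro ε₀ hε₀
    obtain ⟨ε, hε, hε1, hε2⟩ : ∃ ε > 0, 2 * ε ≤ ε₀ ∧ 4 * β * ε ^ 2 < 1 := by
      have h1 : Tendsto (fun ε : ℝ => 4 * β * ε ^ 2) (𝓝[>] 0) (𝓝 0) := by
        refine (Continuous.tendsto' (by fun_prop) 0 0 ?_).mono_left nhdsWithin_le_nhds
        simp
      have h2 := h1.eventually_lt_const (show (0 : ℝ) < 1 by norm_num)
      have h3 : ∀ᶠ ε : ℝ in 𝓝[>] 0, ε < ε₀ / 2 :=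
        mem_nhdsWithin_of_mem_nhds (Iio_mem_nhds (by linarith))
      obtain ⟨ε, h4, h5, h6⟩ := (h2.and (h3.and self_mem_nhdsWithin)).exists
      exact ⟨ε, h6, by linarith, h4⟩
    have htend := intervalIntegral_tendsto_integral_Ioi T hint tendsto_id
    have hev := htend.eventually (lt_mem_nhds (show (∫ x in Ioi T, f x) - ε < ∫ x in Ioi T, f x by
      linarith))
    obtain ⟨T₀, hT₀, hT₀'⟩ := (hev.and (eventually_gt_atTop T)).exists
    have hii : ∀ s t, T ≤ s → s ≤ t → IntervalIntegrable f volume s t := fun s t hs hst =>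
      (intervalIntegrable_iff_integrableOn_Ioc_of_le hst).2
        (hint.mono_set fun x hx => hs.trans_lt hx.1)
    have hbound : ∀ s t, T₀ ≤ s → s ≤ t → ∫ x in s..t, f x ≤ ε := by
      intro s t hs hst
      have hTs : T ≤ s := hT₀'.le.trans hs
      have h1 : ∫ x in T..t, f x ≤ ∫ x in Ioi T, f x := by
        rw [intervalIntegral.integral_of_le (hTs.trans hst)]
        refine setIntegral_mono_set hint ?_ (Ioc_subset_Ioi_self.eventuallyLE)
        exact (ae_restrict_iff' measurableSet_Ioi).2 (ae_of_all _ fun x hx => h0 x hx)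
      have h2 := intervalIntegral.integral_add_adjacent_intervals (hii T T₀ le_rfl hT₀'.le)
        (hii T₀ s hT₀'.le hs)
      have h3 := intervalIntegral.integral_add_adjacent_intervals (hii T s le_rfl hTs)
        (hii s t hTs hst)
      have h4 : 0 ≤ ∫ x in T₀..s, f x :=
        intervalIntegral.integral_nonneg hs fun x hx => h0 x (hT₀'.trans_le hx.1)
      simp only [id] at hT₀
      linarith
    refine ⟨T₀ + 1, by linarith, fun t ht => ?_⟩
    refine (le_two_mul_of_integral_le hβ hf hf' h0 (fun t ht => ?_) hT₀' hε hε2 hbound ht).trans hε1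
    have := hode t ht
    nlinarith [h0 t ht]
  set m := √(α / 2) with hm
  have hm0 : 0 < m := Real.sqrt_pos.2 (by linarith)
  have hm2 : m * m = α / 2 := Real.mul_self_sqrt (by linarith)
  obtain ⟨T₁, hT₁, hT₁'⟩ := hsmall (√(α / (2 * β))) (Real.sqrt_pos.2 (by positivity))
  have hode' : ∀ t ≥ T₁, m * m * f t ≤ f'' t := by
    intro t ht
    have h1 := hode t (hT₁.trans_le ht)
    have h2 := h0 t (hT₁.trans_le ht)
    have h3 := pow_le_pow_left₀ h2 (hT₁' t ht) 2
    rw [Real.sq_sqrt (by positivity)] at h3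
    have h4 : β * f t ^ 2 ≤ α / 2 := by
      have := mul_le_mul_of_nonneg_left h3 hβ.le
      have e : β * (α / (2 * β)) = α / 2 := by field_simp
      linarith
    have h5 : β * f t ^ 3 ≤ α / 2 * f t := by
      have := mul_le_mul_of_nonneg_right h4 h2
      nlinarith
    rw [hm2]; linarith
  have hexp : ∀ (k t : ℝ), HasDerivAt (fun s => Real.exp (k * s)) (Real.exp (k * t) * k) t := by
    intro k t
    simpa using ((hasDerivAt_id t).const_mul k).exp
  -- `(f' + m f) e^{-mt}` is nondecreasing. Hence a positive value `c` of `f' + m f` persists as a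
  -- lower bound, and as `f` is small this bounds `f'` below by `c / 2`.
  have hneg : ∀ t ≥ T₁, f' t + m * f t ≤ 0 := by
    intro t₁ ht₁
    by_contra! hpos
    set c := f' t₁ + m * f t₁ with hc
    have hg : ∀ t ≥ t₁, c ≤ f' t + m * f t := by
      intro t ht
      have h1 := monotoneOn_Ici_of_hasDerivAt (a := t₁)
        (g := fun s => (f' s + m * f s) * Real.exp (-m * s))
        (fun s hs => ((hf' s (hT₁.trans_le (ht₁.trans hs))).add
          ((hf s (hT₁.trans_le (ht₁.trans hs))).const_mul m)).mul (hexp (-m) s)) (fun s hs => by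
          have e := Real.exp_pos (-m * s)
          have := hode' s (ht₁.trans hs)
          simp only [Pi.add_apply]
          nlinarith) le_rfl ht
      simp only [← hc] at h1
      have h2 : Real.exp (-m * t) ≤ Real.exp (-m * t₁) := Real.exp_le_exp.2 (by nlinarith)
      have h3 : c * Real.exp (-m * t) ≤ (f' t + m * f t) * Real.exp (-m * t) :=
        (mul_le_mul_of_nonneg_left h2 hpos.le).trans h1
      exact le_of_mul_le_mul_right h3 (Real.exp_pos _)
    obtain ⟨t₂, ht₂, ht₂'⟩ := hsmall (c / (2 * m)) (by positivity)
    set t₃ := max t₁ t₂ with ht₃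
    have hlin : ∀ t ≥ t₃, c / 2 ≤ f' t := by
      intro t ht
      have h1 := hg t ((le_max_left _ _).trans ht)
      have h2 := mul_le_mul_of_nonneg_left (ht₂' t ((le_max_right _ _).trans ht)) hm0.le
      have e : m * (c / (2 * m)) = c / 2 := by field_simp
      linarith
    have hT₃ : T < t₃ := hT₁.trans_le (ht₁.trans (le_max_left _ _))
    -- In time `2 / m` the slope `c / 2` produces the rise `c / m`, twice the bound `c / (2 m)` for
    -- `f` past `t₂`.
    set t := t₃ + 2 / m with htdef
    have htt : t₃ < t := by rw [htdef]; linarith [show 0 < 2 / m by positivity]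
    have h1 := monotoneOn_Ici_of_hasDerivAt (a := t₃) (g := fun s => f s - c / 2 * s)
      (fun s hs => (hf s (hT₃.trans_le hs)).sub ((hasDerivAt_id s).const_mul (c / 2)))
      (fun s hs => by linarith [hlin s hs]) le_rfl htt.le
    have h2 := ht₂' t ((le_max_right _ _).trans htt.le)
    have h3 := h0 t₃ hT₃
    have e : c / 2 * (2 / m) = c / m := by ring
    have e2 : c / (2 * m) = c / m / 2 := by ring
    have h4 : 0 < c / m := by positivity
    have h5 : c / 2 * t = c / 2 * t₃ + c / m := by rw [htdef, mul_add, e]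
    linarith
  refine ⟨f T₁ * Real.exp (m * T₁), m, T₁, hm0, hT₁, fun t ht => ?_⟩
  have h1 := monotoneOn_Ici_of_hasDerivAt (a := T₁) (g := fun s => -(f s * Real.exp (m * s)))
    (fun s hs => ((hf s (hT₁.trans_le hs)).mul (hexp m s)).neg) (fun s hs => by
      have e := Real.exp_pos (m * s)
      have := hneg s hs
      nlinarith) le_rfl ht
  have h2 : f t * Real.exp (m * t) ≤ f T₁ * Real.exp (m * T₁) := by linarith
  rw [Real.exp_neg, ← div_eq_mul_inv, le_div_iff₀ (Real.exp_pos _)]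
  exact h2

end Ode

/-! ### Functions on half cylinders and their integrals over circles -/

section Cylinder

variable {G : ℂ → F} {T : ℝ}

/-- The half plane `re z > T`. -/
def halfPlane (T : ℝ) : Set ℂ := {z | T < z.re}

theorem isOpen_halfPlane (T : ℝ) : IsOpen (halfPlane T) :=
  isOpen_lt continuous_const Complex.continuous_re

/-- The partial derivative in the direction `1`. -/
def dRe (G : ℂ → F) (z : ℂ) : F := fderiv ℝ G z 1

/-- The partial derivative in the direction `i`. -/
def dIm (G : ℂ → F) (z : ℂ) : F := fderiv ℝ G z I

theorem contDiffOn_dRe {Ω : Set ℂ} (hΩ : IsOpen Ω) (hG : ContDiffOn ℝ ∞ G Ω) :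
    ContDiffOn ℝ ∞ (dRe G) Ω :=
  (hG.fderiv_of_isOpen hΩ (by simp)).clm_apply contDiffOn_const

theorem contDiffOn_dIm {Ω : Set ℂ} (hΩ : IsOpen Ω) (hG : ContDiffOn ℝ ∞ G Ω) :
    ContDiffOn ℝ ∞ (dIm G) Ω :=
  (hG.fderiv_of_isOpen hΩ (by simp)).clm_apply contDiffOn_const

theorem dRe_dIm {Ω : Set ℂ} (hΩ : IsOpen Ω) (hG : ContDiffOn ℝ ∞ G Ω) {z : ℂ} (hz : z ∈ Ω) :
    dRe (dIm G) z = dIm (dRe G) z := by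
  have hGz := hG.contDiffAt (hΩ.mem_nhds hz)
  have hd : DifferentiableAt ℝ (fderiv ℝ G) z :=
    (hGz.fderiv_right (m := 1) (by norm_cast)).differentiableAt (by simp)
  have hs : IsSymmSndFDerivAt ℝ G z := hGz.isSymmSndFDerivAt (by simp; norm_cast)
  have h1 : ∀ v w : ℂ, fderiv ℝ (fun y => fderiv ℝ G y v) z w = fderiv ℝ (fderiv ℝ G) z w v := by
    intro v w
    rw [fderiv_clm_apply hd (differentiableAt_const v)]
    simp
  exact (h1 _ _).trans ((hs _ _).trans (h1 _ _).symm)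

theorem hasDerivAt_re (t θ : ℝ) : HasDerivAt (fun t : ℝ => (⟨t, θ⟩ : ℂ)) 1 t := by
  have h1 : (fun t : ℝ => (⟨t, θ⟩ : ℂ)) = fun t : ℝ => (t : ℂ) + θ * I := by
    funext t; exact Complex.mk_eq_add_mul_I t θ
  rw [h1]
  exact (Complex.ofRealCLM.hasDerivAt (x := t)).add_const _

theorem hasDerivAt_im (t θ : ℝ) : HasDerivAt (fun θ : ℝ => (⟨t, θ⟩ : ℂ)) I θ := by
  have h1 : (fun θ : ℝ => (⟨t, θ⟩ : ℂ)) = fun θ : ℝ => (t : ℂ) + θ * I := by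
    funext θ; exact Complex.mk_eq_add_mul_I t θ
  rw [h1]
  have := ((Complex.ofRealCLM.hasDerivAt (x := θ)).mul_const I).const_add (t : ℂ)
  simpa using this

theorem continuous_mk : Continuous fun q : ℝ × ℝ => (⟨q.1, q.2⟩ : ℂ) := by
  have : (fun q : ℝ × ℝ => (⟨q.1, q.2⟩ : ℂ)) = Complex.equivRealProdCLM.symm := by
    funext q; rfl
  rw [this]; exact Complex.equivRealProdCLM.symm.continuous

theorem hasDerivAt_comp_re {Ω : Set ℂ} (hΩ : IsOpen Ω) (hG : ContDiffOn ℝ ∞ G Ω) {t θ : ℝ}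
    (hz : (⟨t, θ⟩ : ℂ) ∈ Ω) : HasDerivAt (fun t : ℝ => G ⟨t, θ⟩) (dRe G ⟨t, θ⟩) t :=
  ((hG.contDiffAt (hΩ.mem_nhds hz)).differentiableAt (by simp)).hasFDerivAt.comp_hasDerivAt t
    (hasDerivAt_re t θ)

theorem hasDerivAt_comp_im {Ω : Set ℂ} (hΩ : IsOpen Ω) (hG : ContDiffOn ℝ ∞ G Ω) {t θ : ℝ}
    (hz : (⟨t, θ⟩ : ℂ) ∈ Ω) : HasDerivAt (fun θ : ℝ => G ⟨t, θ⟩) (dIm G ⟨t, θ⟩) θ :=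
  ((hG.contDiffAt (hΩ.mem_nhds hz)).differentiableAt (by simp)).hasFDerivAt.comp_hasDerivAt θ
    (hasDerivAt_im t θ)

/-- The integral over the circle `re z = t`. -/
def circ (G : ℂ → F) (t : ℝ) : F := ∫ θ in (-π)..π, G ⟨t, θ⟩

theorem continuous_circle (hG : ContinuousOn G (halfPlane T)) {t : ℝ} (ht : T < t) :
    Continuous fun θ : ℝ => G ⟨t, θ⟩ :=
  hG.comp_continuous (continuous_mk.comp (by fun_prop : Continuous fun θ : ℝ => (t, θ))) fun _ => ht

theorem intervalIntegrable_circle (hG : ContinuousOn G (halfPlane T)) {t : ℝ} (ht : T < t)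
    (a b : ℝ) : IntervalIntegrable (fun θ : ℝ => G ⟨t, θ⟩) volume a b :=
  (continuous_circle hG ht).intervalIntegrable a b

theorem hasDerivAt_circ (hG : ContDiffOn ℝ ∞ G (halfPlane T)) {t : ℝ} (ht : T < t) :
    HasDerivAt (circ G) (circ (dRe G) t) t := by
  have hH := isOpen_halfPlane T
  have hdc : ContinuousOn (dRe G) (halfPlane T) := (contDiffOn_dRe hH hG).continuousOn
  set ε := (t - T) / 2 with hε
  have hε0 : 0 < ε := by rw [hε]; linarith
  have hK : IsCompact ((fun q : ℝ × ℝ => (⟨q.1, q.2⟩ : ℂ)) ''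
      (Icc (t - ε) (t + ε) ×ˢ Icc (-π) π)) :=
    (isCompact_Icc.prod isCompact_Icc).image continuous_mk
  have hKH : ((fun q : ℝ × ℝ => (⟨q.1, q.2⟩ : ℂ)) ''
      (Icc (t - ε) (t + ε) ×ˢ Icc (-π) π)) ⊆ halfPlane T := by
    rintro _ ⟨q, ⟨hq, -⟩, rfl⟩
    have := hq.1
    show T < q.1
    linarith
  obtain ⟨C, hC⟩ := hK.exists_bound_of_continuousOn (hdc.mono hKH)
  have hmem : ∀ s ∈ Metric.ball t ε, T < s := by
    intro s hs
    rw [Real.ball_eq_Ioo] at hs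
    linarith [hs.1]
  refine (intervalIntegral.hasDerivAt_integral_of_dominated_loc_of_deriv_le
    (F := fun s θ => G ⟨s, θ⟩) (F' := fun s θ => dRe G ⟨s, θ⟩) (bound := fun _ => C)
    (Metric.ball_mem_nhds t hε0) ?_ (intervalIntegrable_circle hG.continuousOn ht _ _) ?_ ?_ (by simp) ?_).2
  · filter_upwards [Metric.ball_mem_nhds t hε0] with s hs
    exact (continuous_circle hG.continuousOn (hmem s hs)).aestronglyMeasurable
  · exact (continuous_circle hdc ht).aestronglyMeasurable
  · refine Eventually.of_forall fun θ hθ s hs => hC _ ⟨(s, θ), ⟨?_, ?_⟩, rfl⟩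
    · rw [Real.ball_eq_Ioo] at hs
      exact Ioo_subset_Icc_self hs
    · rw [uIoc_of_le (by linarith [Real.pi_pos])] at hθ
      exact Ioc_subset_Icc_self hθ
  · exact Eventually.of_forall fun θ _ s hs => hasDerivAt_comp_re hH hG (hmem s hs)

theorem circ_dIm_eq_zero [CompleteSpace F] (hG : ContDiffOn ℝ ∞ G (halfPlane T))
    (hper : ∀ z, G (z + 2 * π * I) = G z) {t : ℝ} (ht : T < t) : circ (dIm G) t = 0 := by
  have hH := isOpen_halfPlane T
  rw [circ, intervalIntegral.integral_eq_sub_of_hasDerivAt (f := fun θ => G ⟨t, θ⟩)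
    (fun θ _ => hasDerivAt_comp_im hH hG ht)
    (intervalIntegrable_circle (contDiffOn_dIm hH hG).continuousOn ht _ _)]
  have h1 := hper ⟨t, -π⟩
  have h2 : (⟨t, -π⟩ : ℂ) + 2 * π * I = ⟨t, π⟩ := by
    apply Complex.ext <;> simp
    ring
  rw [h2] at h1
  rw [h1, sub_self]

theorem fderiv_add_period (hper : ∀ z, G (z + 2 * π * I) = G z) (z : ℂ) :
    fderiv ℝ G (z + 2 * π * I) = fderiv ℝ G z := by
  rw [← fderiv_comp_add_right]
  congr 1
  funext y
  exact hper y

theorem circ_add {G₁ G₂ : ℂ → F} (h₁ : ContinuousOn G₁ (halfPlane T))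
    (h₂ : ContinuousOn G₂ (halfPlane T)) {t : ℝ} (ht : T < t) :
    circ (fun z => G₁ z + G₂ z) t = circ G₁ t + circ G₂ t :=
  intervalIntegral.integral_add (intervalIntegrable_circle h₁ ht _ _)
    (intervalIntegrable_circle h₂ ht _ _)

theorem circ_mono {G₁ G₂ : ℂ → ℝ} (h₁ : ContinuousOn G₁ (halfPlane T))
    (h₂ : ContinuousOn G₂ (halfPlane T)) {t : ℝ} (ht : T < t)
    (hle : ∀ θ ∈ Icc (-π) π, G₁ ⟨t, θ⟩ ≤ G₂ ⟨t, θ⟩) : circ G₁ t ≤ circ G₂ t :=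
  intervalIntegral.integral_mono_on (by linarith [Real.pi_pos])
    (intervalIntegrable_circle h₁ ht _ _) (intervalIntegrable_circle h₂ ht _ _) hle

theorem circ_const_mul (c : ℝ) (G : ℂ → ℝ) (t : ℝ) : circ (fun z => c * G z) t = c * circ G t :=
  intervalIntegral.integral_const_mul _ _

theorem circ_const (c : ℝ) (t : ℝ) : circ (fun _ => c) t = 2 * π * c := by
  rw [circ, intervalIntegral.integral_const, smul_eq_mul]; ring

theorem circ_congr {G₁ G₂ : ℂ → F} {t : ℝ} (h : ∀ θ : ℝ, G₁ ⟨t, θ⟩ = G₂ ⟨t, θ⟩) :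
    circ G₁ t = circ G₂ t := intervalIntegral.integral_congr fun θ _ => h θ

/-- On each circle a function is close to its mean. -/
theorem norm_sub_mean_le [CompleteSpace F] (hG : ContDiffOn ℝ ∞ G (halfPlane T)) {t : ℝ}
    (ht : T < t) {θ : ℝ} (hθ : θ ∈ Icc (-π) π) :
    ‖G ⟨t, θ⟩ - (2 * π)⁻¹ • circ G t‖ ≤ circ (fun z => ‖dIm G z‖) t := by
  have hH := isOpen_halfPlane T
  have hpi := Real.pi_pos
  have hdc := (contDiffOn_dIm hH hG).continuousOn
  have hnc : ContinuousOn (fun z => ‖dIm G z‖) (halfPlane T) := hdc.norm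
  have hosc : ∀ θ' ∈ Icc (-π) π, ‖G ⟨t, θ⟩ - G ⟨t, θ'⟩‖ ≤ circ (fun z => ‖dIm G z‖) t := by
    intro θ' hθ'
    rw [← intervalIntegral.integral_eq_sub_of_hasDerivAt (f := fun θ => G ⟨t, θ⟩)
      (fun θ _ => hasDerivAt_comp_im hH hG ht) (intervalIntegrable_circle hdc ht _ _)]
    refine (intervalIntegral.norm_integral_le_abs_integral_norm).trans ?_
    rw [circ]
    refine (intervalIntegral.abs_integral_mono_interval (c := -π) (d := π) ?_ ?_
      (intervalIntegrable_circle hnc ht _ _)).trans (le_of_eq (abs_of_nonneg ?_))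
    · rw [uIoc_of_le (by linarith : -π ≤ π)]
      exact Ioc_subset_Ioc (le_min hθ'.1 hθ.1) (max_le hθ'.2 hθ.2)
    · exact Eventually.of_forall fun _ => norm_nonneg _
    · exact intervalIntegral.integral_nonneg (by linarith) fun _ _ => norm_nonneg _
  have hmean : G ⟨t, θ⟩ - (2 * π)⁻¹ • circ G t =
      (2 * π)⁻¹ • ∫ θ' in (-π)..π, (G ⟨t, θ⟩ - G ⟨t, θ'⟩) := by
    rw [intervalIntegral.integral_sub (by simp) (intervalIntegrable_circle hG.continuousOn ht _ _),
      intervalIntegral.integral_const, smul_sub, smul_smul]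
    have : (2 * π)⁻¹ * (π - -π) = 1 := by field_simp; norm_num
    rw [this, one_smul]
    rfl
  rw [hmean, norm_smul, Real.norm_of_nonneg (by positivity)]
  have h1 := intervalIntegral.norm_integral_le_of_norm_le_const (a := -π) (b := π)
    (f := fun θ' => G ⟨t, θ⟩ - G ⟨t, θ'⟩) (C := circ (fun z => ‖dIm G z‖) t) fun θ' hθ' => by
      rw [uIoc_of_le (by linarith)] at hθ'
      exact hosc θ' (Ioc_subset_Icc_self hθ')
  rw [show π - -π = 2 * π by ring, abs_of_pos (by linarith)] at h1
  rw [inv_mul_le_iff₀ (by positivity)]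
  linarith

/-- Cauchy–Schwarz on a circle of length `2π`, from the pointwise inequality `2ab ≤ a² + b²` with
`b` the mean of the norm. -/
theorem sq_circ_norm_le (hG : ContinuousOn G (halfPlane T)) {t : ℝ} (ht : T < t) :
    circ (fun z => ‖G z‖) t ^ 2 ≤ 2 * π * circ (fun z => ‖G z‖ ^ 2) t := by
  have hpi := Real.pi_pos
  set c := circ (fun z => ‖G z‖) t with hc
  have hn : ContinuousOn (fun z => ‖G z‖) (halfPlane T) := hG.norm
  have hn2 : ContinuousOn (fun z => ‖G z‖ ^ 2) (halfPlane T) := hn.pow 2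
  have h1 : circ (fun z => (c / π) * ‖G z‖) t ≤
      circ (fun z => ‖G z‖ ^ 2 + (c / (2 * π)) ^ 2) t := by
    refine circ_mono (continuousOn_const.mul hn) (hn2.add continuousOn_const) ht fun θ _ => ?_
    have e : c / π = 2 * (c / (2 * π)) := by field_simp
    change c / π * ‖G ⟨t, θ⟩‖ ≤ ‖G ⟨t, θ⟩‖ ^ 2 + (c / (2 * π)) ^ 2
    rw [e]
    nlinarith [sq_nonneg (‖G ⟨t, θ⟩‖ - c / (2 * π))]
  rw [circ_const_mul, circ_add hn2 continuousOn_const ht, circ_const, ← hc] at h1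
  have h2 : 2 * π * (c / (2 * π)) ^ 2 = c ^ 2 / (2 * π) := by field_simp
  have h3 : c / π * c = c ^ 2 / (2 * π) + c ^ 2 / (2 * π) := by
    field_simp; norm_num
  rw [h2, h3] at h1
  have h4 : c ^ 2 / (2 * π) ≤ circ (fun z => ‖G z‖ ^ 2) t := by linarith
  rw [div_le_iff₀ (by positivity)] at h4
  linarith

theorem dRe_inner {G₁ G₂ : ℂ → F} {Ω : Set ℂ} (hΩ : IsOpen Ω) (h₁ : ContDiffOn ℝ ∞ G₁ Ω)
    (h₂ : ContDiffOn ℝ ∞ G₂ Ω) {z : ℂ} (hz : z ∈ Ω) : dRe (fun z => inner ℝ (G₁ z) (G₂ z)) z =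
      inner ℝ (G₁ z) (dRe G₂ z) + inner ℝ (dRe G₁ z) (G₂ z) :=
  fderiv_inner_apply ℝ ((h₁.contDiffAt (hΩ.mem_nhds hz)).differentiableAt (by simp))
    ((h₂.contDiffAt (hΩ.mem_nhds hz)).differentiableAt (by simp)) _

theorem dIm_inner {G₁ G₂ : ℂ → F} {Ω : Set ℂ} (hΩ : IsOpen Ω) (h₁ : ContDiffOn ℝ ∞ G₁ Ω)
    (h₂ : ContDiffOn ℝ ∞ G₂ Ω) {z : ℂ} (hz : z ∈ Ω) : dIm (fun z => inner ℝ (G₁ z) (G₂ z)) z =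
      inner ℝ (G₁ z) (dIm G₂ z) + inner ℝ (dIm G₁ z) (G₂ z) :=
  fderiv_inner_apply ℝ ((h₁.contDiffAt (hΩ.mem_nhds hz)).differentiableAt (by simp))
    ((h₂.contDiffAt (hΩ.mem_nhds hz)).differentiableAt (by simp)) _

end Cylinder

/-! ### Harmonic maps from half cylinders -/

section CylinderMap

/-- Harmonic maps from a half cylinder, with coordinate `z` modulo `2πi`, to the unit sphere. -/
structure IsCylinderMap (U : ℂ → F) (T : ℝ) : Prop where
  contDiffOn : ContDiffOn ℝ ∞ U (halfPlane T)
  periodic : ∀ z, U (z + 2 * π * I) = U z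
  norm_eq_one : ∀ z ∈ halfPlane T, ‖U z‖ = 1
  harmonic : ∀ z ∈ halfPlane T,
    dRe (dRe U) z + dIm (dIm U) z = -(‖dRe U z‖ ^ 2 + ‖dIm U z‖ ^ 2) • U z

variable {U : ℂ → F} {T : ℝ}

theorem fderiv_congr_of_eqOn {E : Type*} [NormedAddCommGroup E] [NormedSpace ℝ E] {f g : ℂ → E}
    {Ω : Set ℂ} (hΩ : IsOpen Ω) (hfg : ∀ z ∈ Ω, f z = g z) {z : ℂ} (hz : z ∈ Ω) :
    fderiv ℝ f z = fderiv ℝ g z :=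
  Filter.EventuallyEq.fderiv_eq (by filter_upwards [hΩ.mem_nhds hz] with y hy using hfg y hy)

theorem continuousOn_const_mul {f : ℂ → ℝ} {s : Set ℂ} (c : ℝ) (hf : ContinuousOn f s) :
    ContinuousOn (fun z => c * f z) s :=
  hf.const_smul c

theorem inner_dRe_eq_zero {Ω : Set ℂ} (hΩ : IsOpen Ω) (hU : ContDiffOn ℝ ∞ U Ω)
    (h1 : ∀ z ∈ Ω, ‖U z‖ = 1) {z : ℂ} (hz : z ∈ Ω) : inner ℝ (U z) (dRe U z) = 0 := by
  have h2 := dRe_inner hΩ hU hU hz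
  have h3 : dRe (fun z => inner ℝ (U z) (U z)) z = 0 := by
    rw [dRe, fderiv_congr_of_eqOn (g := fun _ => (1 : ℝ)) hΩ (fun y hy => by
      rw [real_inner_self_eq_norm_sq, h1 y hy, one_pow]) hz]
    simp
  rw [h3, real_inner_comm (U z) (dRe U z)] at h2
  linarith

theorem inner_dIm_eq_zero {Ω : Set ℂ} (hΩ : IsOpen Ω) (hU : ContDiffOn ℝ ∞ U Ω)
    (h1 : ∀ z ∈ Ω, ‖U z‖ = 1) {z : ℂ} (hz : z ∈ Ω) : inner ℝ (U z) (dIm U z) = 0 := by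
  have h2 := dIm_inner hΩ hU hU hz
  have h3 : dIm (fun z => inner ℝ (U z) (U z)) z = 0 := by
    rw [dIm, fderiv_congr_of_eqOn (g := fun _ => (1 : ℝ)) hΩ (fun y hy => by
      rw [real_inner_self_eq_norm_sq, h1 y hy, one_pow]) hz]
    simp
  rw [h3, real_inner_comm (U z) (dIm U z)] at h2
  linarith

namespace IsCylinderMap

variable (hU : IsCylinderMap U T)
include hU

theorem inner_dIm_dIm {z : ℂ} (hz : z ∈ halfPlane T) :
    inner ℝ (U z) (dIm (dIm U) z) = -‖dIm U z‖ ^ 2 := by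
  have hH := isOpen_halfPlane T
  have h2 := dIm_inner hH hU.contDiffOn (contDiffOn_dIm hH hU.contDiffOn) hz
  have h3 : dIm (fun z => inner ℝ (U z) (dIm U z)) z = 0 := by
    rw [dIm, fderiv_congr_of_eqOn (g := fun _ => (0 : ℝ)) hH (fun y hy =>
      inner_dIm_eq_zero hH hU.contDiffOn hU.norm_eq_one hy) hz]
    simp
  rw [h3, real_inner_self_eq_norm_sq] at h2
  linarith

theorem periodic_dRe (z : ℂ) : dRe U (z + 2 * π * I) = dRe U z := by
  rw [dRe, fderiv_add_period hU.periodic]; rfl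

theorem periodic_dIm (z : ℂ) : dIm U (z + 2 * π * I) = dIm U z := by
  rw [dIm, fderiv_add_period hU.periodic]; rfl

theorem periodic_dRe_dRe (z : ℂ) : dRe (dRe U) (z + 2 * π * I) = dRe (dRe U) z := by
  rw [dRe, fderiv_add_period hU.periodic_dRe]; rfl

/-- The difference of the radial and the angular energy of circles does not depend on the
circle. -/
theorem circ_sub_eq_const : ∃ c : ℝ, ∀ t > T,
    circ (fun z => ‖dRe U z‖ ^ 2) t = circ (fun z => ‖dIm U z‖ ^ 2) t + c := by
  have hH := isOpen_halfPlane T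
  have hs := hU.contDiffOn
  have h1 := contDiffOn_dRe hH hs
  have h2 := contDiffOn_dIm hH hs
  have hG₁ := h1.inner ℝ h1
  have hG₂ := h2.inner ℝ h2
  have hG₃ := h1.inner ℝ h2
  -- With `t`, `θ` the real and imaginary coordinates, `∂ₜ (|U_t|² - |U_θ|²) = -2 ∂_θ ⟨U_t, U_θ⟩`,
  -- because `ΔU` is parallel to `U` and hence orthogonal to `U_t`. The circle integral of an
  -- angular derivative vanishes. This is the real part of the holomorphy of the Hopf differential.
  have hder : ∀ t > T, HasDerivAt (fun t => circ (fun z => inner ℝ (dRe U z) (dRe U z)) t -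
      circ (fun z => inner ℝ (dIm U z) (dIm U z)) t) 0 t := by
    intro t ht
    have h3 := (hasDerivAt_circ hG₁ ht).sub (hasDerivAt_circ hG₂ ht)
    have h4 : circ (dRe fun z => inner ℝ (dRe U z) (dRe U z)) t =
        circ (fun z => dRe (fun z => inner ℝ (dIm U z) (dIm U z)) z +
          (-2) * dIm (fun z => inner ℝ (dRe U z) (dIm U z)) z) t := by
      refine circ_congr fun θ => ?_
      have hz : (⟨t, θ⟩ : ℂ) ∈ halfPlane T := ht
      rw [dRe_inner hH h1 h1 hz, dRe_inner hH h2 h2 hz, dIm_inner hH h1 h2 hz, dRe_dIm hH hs hz]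
      have h5 := congrArg (fun X => inner ℝ (dRe U ⟨t, θ⟩) X) (hU.harmonic _ hz)
      have h6 := inner_dRe_eq_zero hH hs hU.norm_eq_one hz
      simp only [inner_add_right, inner_smul_right, real_inner_comm (U _) (dRe U _), h6,
        mul_zero] at h5
      rw [real_inner_comm (dRe U ⟨t, θ⟩), real_inner_comm (dIm U ⟨t, θ⟩) (dIm (dRe U) ⟨t, θ⟩)]
      linarith
    rw [h4, circ_add (contDiffOn_dRe hH hG₂).continuousOn
      (continuousOn_const_mul _ (contDiffOn_dIm hH hG₃).continuousOn) ht, circ_const_mul,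
      circ_dIm_eq_zero hG₃ (fun z => by rw [hU.periodic_dRe, hU.periodic_dIm]) ht] at h3
    simp only [mul_zero, add_zero, sub_self] at h3
    exact h3
  refine ⟨circ (fun z => inner ℝ (dRe U z) (dRe U z)) (T + 1) -
      circ (fun z => inner ℝ (dIm U z) (dIm U z)) (T + 1), fun t ht => ?_⟩
  have h7 := (convex_Ioi T).is_const_of_fderivWithin_eq_zero (𝕜 := ℝ)
    (fun x hx => (hder x hx).differentiableAt.differentiableWithinAt) (fun x hx => by
      rw [fderivWithin_of_isOpen isOpen_Ioi hx, (hder x hx).hasFDerivAt.fderiv]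
      ext
      simp) ht (show T + 1 ∈ Ioi T by simp)
  simp only [← real_inner_self_eq_norm_sq]
  linarith

/-- The difference of the two energies is constant by `circ_sub_eq_const` and integrable over a half
line, hence zero. -/
theorem circ_dRe_eq_circ_dIm (hi₁ : IntegrableOn (circ fun z => ‖dRe U z‖ ^ 2) (Ioi T))
    (hi₂ : IntegrableOn (circ fun z => ‖dIm U z‖ ^ 2) (Ioi T)) {t : ℝ} (ht : T < t) :
    circ (fun z => ‖dRe U z‖ ^ 2) t = circ (fun z => ‖dIm U z‖ ^ 2) t := by
  obtain ⟨c, hc⟩ := hU.circ_sub_eq_const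
  have h1 : IntegrableOn (fun _ : ℝ => c) (Ioi T) :=
    (hi₁.sub hi₂).congr_fun (fun s hs => by simp [hc s hs]) measurableSet_Ioi
  rw [integrableOn_const_iff] at h1
  have h2 : c = 0 := by
    simpa using h1
  rw [hc t ht, h2, add_zero]

/-- A Bochner-type identity for `|U_θ|²`. The first term on the right is an angular derivative and
drops out of circle integrals; the others come from commuting derivatives and inserting the harmonic
map equation. -/
theorem dRe_dRe_inner {z : ℂ} (hz : z ∈ halfPlane T) :
    dRe (dRe fun z => inner ℝ (dIm U z) (dIm U z)) z =
      2 * dIm (fun z => inner ℝ (dIm U z) (dRe (dRe U) z)) z +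
      (2 * ‖dIm (dIm U) z‖ ^ 2 + (-2) * ((‖dRe U z‖ ^ 2 + ‖dIm U z‖ ^ 2) * ‖dIm U z‖ ^ 2) +
        2 * ‖dRe (dIm U) z‖ ^ 2) := by
  have hH := isOpen_halfPlane T
  have hs := hU.contDiffOn
  have h1 := contDiffOn_dRe hH hs
  have h2 := contDiffOn_dIm hH hs
  have h11 := contDiffOn_dRe hH h1
  have h21 := contDiffOn_dRe hH h2
  have e1 : ∀ y ∈ halfPlane T, dRe (fun z => inner ℝ (dIm U z) (dIm U z)) y =
      2 * inner ℝ (dIm U y) (dRe (dIm U) y) := fun y hy => by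
    rw [dRe_inner hH h2 h2 hy, real_inner_comm (dIm U y) (dRe (dIm U) y)]; ring
  have hin := h2.inner ℝ h21
  have e2 : dRe (dRe fun z => inner ℝ (dIm U z) (dIm U z)) z =
      2 * dRe (fun z => inner ℝ (dIm U z) (dRe (dIm U) z)) z := by
    rw [dRe, fderiv_congr_of_eqOn hH e1 hz,
      fderiv_const_mul ((hin.contDiffAt (hH.mem_nhds hz)).differentiableAt (by simp))]
    rfl
  have e3 : dRe (dRe (dIm U)) z = dIm (dRe (dRe U)) z := by
    rw [dRe, fderiv_congr_of_eqOn hH (fun y hy => dRe_dIm hH hs hy) hz]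
    exact dRe_dIm hH h1 hz
  rw [e2, dRe_inner hH h2 h21 hz, e3, dIm_inner hH h2 h11 hz, real_inner_self_eq_norm_sq]
  have e4 : dRe (dRe U) z = -(‖dRe U z‖ ^ 2 + ‖dIm U z‖ ^ 2) • U z - dIm (dIm U) z := by
    rw [← hU.harmonic z hz]; abel
  have e5 : inner ℝ (dIm (dIm U) z) (dRe (dRe U) z) =
      (‖dRe U z‖ ^ 2 + ‖dIm U z‖ ^ 2) * ‖dIm U z‖ ^ 2 - ‖dIm (dIm U) z‖ ^ 2 := by
    rw [e4, inner_sub_right, inner_smul_right, real_inner_comm, hU.inner_dIm_dIm hz,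
      real_inner_self_eq_norm_sq]
    ring
  rw [e5]
  ring

variable [CompleteSpace F]

/-- Poincaré inequality on the circle: `dIm U` has mean zero by periodicity. -/
theorem circ_le_circ_dIm {t : ℝ} (ht : T < t) : circ (fun z => ‖dIm U z‖ ^ 2) t ≤
      4 * π ^ 2 * circ (fun z => ‖dIm (dIm U) z‖ ^ 2) t := by
  have hH := isOpen_halfPlane T
  have h2 := contDiffOn_dIm hH hU.contDiffOn
  have hc2 := h2.continuousOn.norm.fun_pow 2
  have h3 : ∀ θ ∈ Icc (-π) π, ‖dIm U ⟨t, θ⟩‖ ^ 2 ≤ circ (fun z => ‖dIm (dIm U) z‖) t ^ 2 := by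
    intro θ hθ
    have := norm_sub_mean_le h2 ht hθ
    rw [circ_dIm_eq_zero hU.contDiffOn hU.periodic ht, smul_zero, sub_zero] at this
    exact pow_le_pow_left₀ (norm_nonneg _) this 2
  have h4 := circ_mono hc2 continuousOn_const ht h3
  rw [circ_const] at h4
  have h5 := sq_circ_norm_le (contDiffOn_dIm hH h2).continuousOn ht
  have := mul_le_mul_of_nonneg_left h5 (show 0 ≤ 2 * π by positivity)
  linarith

/-- This bounds the only term of unfavourable sign in the second derivative of the angular energy
`f`. On a circle `|U_θ|²` is at most its mean plus the integral of the absolute value of its angular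
derivative, and the total energy is `2 f` by `heq`. The inequalities of Young and Poincaré then
leave half of `∫ |U_θθ|²` and a cubic term in `f`. -/
theorem circ_energy_mul_le {t : ℝ} (ht : T < t)
    (heq : circ (fun z => ‖dRe U z‖ ^ 2) t = circ (fun z => ‖dIm U z‖ ^ 2) t) :
    circ (fun z => (‖dRe U z‖ ^ 2 + ‖dIm U z‖ ^ 2) * ‖dIm U z‖ ^ 2) t ≤
      circ (fun z => ‖dIm (dIm U) z‖ ^ 2) t / 2 +
        (16 + 4 * π ^ 2) * circ (fun z => ‖dIm U z‖ ^ 2) t ^ 3 := by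
  have hH := isOpen_halfPlane T
  have hpi := Real.pi_pos
  have hs := hU.contDiffOn
  have h1 := contDiffOn_dRe hH hs
  have h2 := contDiffOn_dIm hH hs
  have h22 := contDiffOn_dIm hH h2
  have c1 := h1.continuousOn.norm.fun_pow 2
  have c2 := h2.continuousOn.norm.fun_pow 2
  have c22 := h22.continuousOn.norm.fun_pow 2
  have c12s := c1.fun_add c2
  have c122 := c12s.fun_mul c2
  set f := circ (fun z => ‖dIm U z‖ ^ 2) t with hf
  set a := circ (fun z => ‖dIm (dIm U) z‖ ^ 2) t with ha
  have hf0 : 0 ≤ f := intervalIntegral.integral_nonneg (by linarith) fun _ _ => by positivity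
  have ha0 : 0 ≤ a := intervalIntegral.integral_nonneg (by linarith) fun _ _ => by positivity
  have hfa := hU.circ_le_circ_dIm ht
  have hin := h2.inner ℝ h2
  set S := circ (fun z => ‖dIm (fun z => inner ℝ (dIm U z) (dIm U z)) z‖) t with hS
  have hsup : ∀ θ ∈ Icc (-π) π, ‖dIm U ⟨t, θ⟩‖ ^ 2 ≤ (2 * π)⁻¹ * f + S := by
    intro θ hθ
    have h3 := norm_sub_mean_le hin ht hθ
    rw [Real.norm_eq_abs] at h3
    have h4 := (abs_le.1 h3).2
    simp only [real_inner_self_eq_norm_sq, smul_eq_mul] at h4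
    rw [← hf] at h4
    simp only [hS, real_inner_self_eq_norm_sq]
    linarith
  have h5 : circ (fun z => (‖dRe U z‖ ^ 2 + ‖dIm U z‖ ^ 2) * ‖dIm U z‖ ^ 2) t ≤
      circ (fun z => ((2 * π)⁻¹ * f + S) * (‖dRe U z‖ ^ 2 + ‖dIm U z‖ ^ 2)) t := by
    refine circ_mono c122 (continuousOn_const_mul _ c12s) ht fun θ hθ => ?_
    show (‖dRe U ⟨t, θ⟩‖ ^ 2 + ‖dIm U ⟨t, θ⟩‖ ^ 2) * ‖dIm U ⟨t, θ⟩‖ ^ 2 ≤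
      ((2 * π)⁻¹ * f + S) * (‖dRe U ⟨t, θ⟩‖ ^ 2 + ‖dIm U ⟨t, θ⟩‖ ^ 2)
    rw [mul_comm]
    exact mul_le_mul_of_nonneg_right (hsup θ hθ) (by positivity)
  rw [circ_const_mul, circ_add c1 c2 ht, heq, ← hf] at h5
  have h6 : 2 * f * S ≤ a / 4 + 16 * f ^ 3 := by
    have h7 : circ (fun z => 2 * f * ‖dIm (fun z => inner ℝ (dIm U z) (dIm U z)) z‖) t ≤
        circ (fun z => (1 / 4) * ‖dIm (dIm U) z‖ ^ 2 + 16 * f ^ 2 * ‖dIm U z‖ ^ 2) t := by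
      refine circ_mono (continuousOn_const_mul _ (contDiffOn_dIm hH hin).continuousOn.norm)
        ((continuousOn_const_mul _ c22).add (continuousOn_const_mul _ c2)) ht fun θ _ => ?_
      have hz : (⟨t, θ⟩ : ℂ) ∈ halfPlane T := ht
      have h8 : ‖dIm (fun z => inner ℝ (dIm U z) (dIm U z)) ⟨t, θ⟩‖ ≤
          2 * (‖dIm U ⟨t, θ⟩‖ * ‖dIm (dIm U) ⟨t, θ⟩‖) := by
        rw [dIm_inner hH h2 h2 hz, real_inner_comm (dIm U ⟨t, θ⟩) (dIm (dIm U) ⟨t, θ⟩), ← two_mul,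
          Real.norm_eq_abs, abs_mul, abs_two]
        exact mul_le_mul_of_nonneg_left (abs_real_inner_le_norm _ _) (by norm_num)
      have h9 := mul_le_mul_of_nonneg_left h8 (show 0 ≤ 2 * f by positivity)
      show 2 * f * ‖dIm (fun z => inner ℝ (dIm U z) (dIm U z)) ⟨t, θ⟩‖ ≤
        (1 / 4) * ‖dIm (dIm U) ⟨t, θ⟩‖ ^ 2 + 16 * f ^ 2 * ‖dIm U ⟨t, θ⟩‖ ^ 2
      nlinarith [sq_nonneg ((1 / 2) * ‖dIm (dIm U) ⟨t, θ⟩‖ - 4 * f * ‖dIm U ⟨t, θ⟩‖)]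
    rw [circ_const_mul, circ_add (continuousOn_const_mul _ c22) (continuousOn_const_mul _ c2) ht,
      circ_const_mul, circ_const_mul, ← hS, ← hf, ← ha] at h7
    nlinarith
  have h10 : (2 * π)⁻¹ * f * (f + f) ≤ a / 4 + 4 * π ^ 2 * f ^ 3 := by
    have e : (2 * π)⁻¹ * f * (f + f) = π⁻¹ * f ^ 2 := by field_simp; ring
    have hpi1 : π⁻¹ ≤ 1 := inv_le_one_of_one_le₀ (by linarith [Real.pi_gt_three])
    have h11 : π⁻¹ * f ^ 2 ≤ f ^ 2 := by nlinarith [sq_nonneg f]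
    -- The arithmetic–geometric mean inequality splits `f²` between `f` and `f³`; Poincaré turns the
    -- linear part into `a / 4`.
    have h12 : f ^ 2 ≤ f / (16 * π ^ 2) + 4 * π ^ 2 * f ^ 3 := by
      have h13 : f / (16 * π ^ 2) + 4 * π ^ 2 * f ^ 3 - f ^ 2 =
          f * (1 / (4 * π) - 2 * π * f) ^ 2 := by
        field_simp; ring
      have := mul_nonneg hf0 (sq_nonneg (1 / (4 * π) - 2 * π * f))
      linarith
    have h14 : f / (16 * π ^ 2) ≤ a / 4 := by
      rw [div_le_iff₀ (by positivity)]
      linarith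
    rw [e]; linarith
  linarith

/-- A harmonic map of finite energy from a half cylinder to the sphere is almost constant near
the end of the cylinder. -/
theorem exists_norm_sub_le (hi₁ : IntegrableOn (circ fun z => ‖dRe U z‖ ^ 2) (Ioi T))
    (hi₂ : IntegrableOn (circ fun z => ‖dIm U z‖ ^ 2) (Ioi T)) {ε : ℝ} (hε : 0 < ε) :
    ∃ c : F, ∃ T' > T, ∀ t > T', ∀ θ ∈ Icc (-π) π, ‖U ⟨t, θ⟩ - c‖ ≤ ε := by
  have hH := isOpen_halfPlane T
  have hpi := Real.pi_pos
  have hs := hU.contDiffOn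
  have h1 := contDiffOn_dRe hH hs
  have h2 := contDiffOn_dIm hH hs
  have h22 := contDiffOn_dIm hH h2
  have heq := fun t (ht : T < t) => hU.circ_dRe_eq_circ_dIm hi₁ hi₂ ht
  have hin := h2.inner ℝ h2
  have hfeq : (circ fun z => ‖dIm U z‖ ^ 2) = circ fun z => inner ℝ (dIm U z) (dIm U z) := by
    simp only [real_inner_self_eq_norm_sq]
  have hX := h2.inner ℝ (contDiffOn_dRe hH h1)
  have c1 := h1.continuousOn.norm.fun_pow 2
  have c2 := h2.continuousOn.norm.fun_pow 2
  have c22 := h22.continuousOn.norm.fun_pow 2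
  have c122 := (c1.fun_add c2).fun_mul c2
  have c12 := (contDiffOn_dRe hH h2).continuousOn.norm.fun_pow 2
  -- The constants come from `f'' ≥ 2 a - 2 (a / 2 + (16 + 4 π²) f³)` and `a ≥ f / (4 π²)`, where `a
  -- = ∫ |U_θθ|²` over the circle.
  obtain ⟨C, m, T₁, hm, hT₁, hdecay⟩ := exists_exponential_decay
    (f := circ fun z => ‖dIm U z‖ ^ 2) (T := T) (α := 1 / (4 * π ^ 2))
    (β := 32 + 8 * π ^ 2) (by positivity) (by positivity)
    (fun t ht => by rw [hfeq]; exact hasDerivAt_circ hin ht)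
    (fun t ht => hasDerivAt_circ (contDiffOn_dRe hH hin) ht)
    (fun t _ => intervalIntegral.integral_nonneg (by linarith) fun _ _ => by positivity)
    (fun t ht => by
      have e1 : circ (dRe (dRe fun z => inner ℝ (dIm U z) (dIm U z))) t = circ (fun z =>
          2 * dIm (fun z => inner ℝ (dIm U z) (dRe (dRe U) z)) z +
          (2 * ‖dIm (dIm U) z‖ ^ 2 + (-2) * ((‖dRe U z‖ ^ 2 + ‖dIm U z‖ ^ 2) * ‖dIm U z‖ ^ 2) +
            2 * ‖dRe (dIm U) z‖ ^ 2)) t := circ_congr fun θ => hU.dRe_dRe_inner ht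
      rw [e1, circ_add (continuousOn_const_mul _ (contDiffOn_dIm hH hX).continuousOn)
        (ContinuousOn.fun_add (ContinuousOn.fun_add (continuousOn_const_mul _ c22)
          (continuousOn_const_mul _ c122)) (continuousOn_const_mul _ c12)) ht, circ_const_mul,
        circ_dIm_eq_zero hX (fun z => by rw [hU.periodic_dIm, hU.periodic_dRe_dRe]) ht,
        circ_add (ContinuousOn.fun_add (continuousOn_const_mul _ c22) (continuousOn_const_mul _ c122))
          (continuousOn_const_mul _ c12) ht,
        circ_add (continuousOn_const_mul _ c22) (continuousOn_const_mul _ c122) ht,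
        circ_const_mul, circ_const_mul, circ_const_mul]
      have e2 := hU.circ_energy_mul_le ht (heq t ht)
      have e3 := hU.circ_le_circ_dIm ht
      have e4 : 0 ≤ circ (fun z => ‖dRe (dIm U) z‖ ^ 2) t :=
        intervalIntegral.integral_nonneg (by linarith) fun _ _ => by positivity
      have e5 : 1 / (4 * π ^ 2) * circ (fun z => ‖dIm U z‖ ^ 2) t ≤
          circ (fun z => ‖dIm (dIm U) z‖ ^ 2) t := by
        rw [one_div, inv_mul_le_iff₀ (by positivity)]
        exact e3
      linarith)
    hi₂
  set D := √(2 * π * |C|) with hD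
  -- Half the rate, because the `L¹` norm on a circle is controlled by the square root of the
  -- energy.
  set k := m / 2 with hk
  have hk0 : 0 < k := by rw [hk]; linarith
  have hroot : ∀ (G : ℂ → F), ContinuousOn G (halfPlane T) → ∀ t ≥ T₁,
      circ (fun z => ‖G z‖ ^ 2) t ≤ C * Real.exp (-(m * t)) →
      circ (fun z => ‖G z‖) t ≤ D * Real.exp (-k * t) := by
    intro G hG t ht hle
    have h3 := sq_circ_norm_le hG (hT₁.trans_le ht)
    refine abs_le_of_sq_le_sq' ?_ (by positivity) |>.2
    have e : Real.exp (-(m * t)) = Real.exp (-k * t) ^ 2 := by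
      rw [← Real.exp_nat_mul]; congr 1; rw [hk]; push_cast; ring
    rw [mul_pow, hD, Real.sq_sqrt (by positivity), ← e]
    have h4 : C * Real.exp (-(m * t)) ≤ |C| * Real.exp (-(m * t)) :=
      mul_le_mul_of_nonneg_right (le_abs_self C) (Real.exp_pos _).le
    have h5 := mul_le_mul_of_nonneg_left (hle.trans h4) (show 0 ≤ 2 * π by positivity)
    linarith
  have hosc : ∀ t ≥ T₁, ∀ θ ∈ Icc (-π) π,
      ‖U ⟨t, θ⟩ - (2 * π)⁻¹ • circ U t‖ ≤ D * Real.exp (-k * t) := fun t ht θ hθ =>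
    (norm_sub_mean_le hs (hT₁.trans_le ht) hθ).trans (hroot _ h2.continuousOn t ht (hdecay t ht))
  have hE : ∀ t, HasDerivAt (fun s => Real.exp (-k * s)) (Real.exp (-k * t) * -k) t := by
    intro t
    have := ((hasDerivAt_id t).const_mul (-k)).exp
    simpa using this
  -- The circle means move with speed at most `D e^{-kt}`, since the radial energy equals the
  -- angular one and decays with it; `D / k e^{-ks}` bounds the length travelled after `s`.
  have hdrift : ∀ s t, T₁ ≤ s → s ≤ t →
      ‖(2 * π)⁻¹ • circ U t - (2 * π)⁻¹ • circ U s‖ ≤ D / k * Real.exp (-k * s) := by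
    intro s t hs' hst
    have hder : ∀ x ∈ Icc s t, HasDerivAt (fun x => (2 * π)⁻¹ • circ U x -
        (2 * π)⁻¹ • circ U s) ((2 * π)⁻¹ • circ (dRe U) x) x := fun x hx =>
      ((hasDerivAt_circ hs (hT₁.trans_le (hs'.trans hx.1))).const_smul _).sub_const _
    have h3 := image_norm_le_of_norm_deriv_right_le_deriv_boundary
      (f := fun x => (2 * π)⁻¹ • circ U x - (2 * π)⁻¹ • circ U s)
      (f' := fun x => (2 * π)⁻¹ • circ (dRe U) x) (a := s) (b := t)
      (B := fun x => D / k * (Real.exp (-k * s) - Real.exp (-k * x)))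
      (B' := fun x => D * Real.exp (-k * x))
      (fun x hx => (hder x hx).continuousAt.continuousWithinAt)
      (fun x hx => (hder x ⟨hx.1, hx.2.le⟩).hasDerivWithinAt) (by simp) (fun x => by
        have := ((hE x).const_sub (Real.exp (-k * s))).const_mul (D / k)
        convert! this using 1
        field_simp)
      (fun x hx => by
        have hTx := hs'.trans hx.1
        rw [norm_smul, Real.norm_of_nonneg (by positivity)]
        have h4 : ‖circ (dRe U) x‖ ≤ circ (fun z => ‖dRe U z‖) x :=
          intervalIntegral.norm_integral_le_integral_norm (by linarith)
        have h5 := hroot _ h1.continuousOn x hTx (by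
          rw [heq x (hT₁.trans_le hTx)]; exact hdecay x hTx)
        have h6 : (2 * π)⁻¹ ≤ 1 := inv_le_one_of_one_le₀ (by linarith [Real.pi_gt_three])
        exact (mul_le_of_le_one_left (norm_nonneg _) h6).trans (h4.trans h5))
      (right_mem_Icc.2 hst)
    refine h3.trans ?_
    have h7 : 0 ≤ D / k := by positivity
    have h8 := Real.exp_pos (-k * t)
    nlinarith
  have hlim : Tendsto (fun s : ℝ => D / k * Real.exp (-k * s) + D * Real.exp (-k * s)) atTop
      (𝓝 0) := by
    have h3 : Tendsto (fun s : ℝ => Real.exp (-k * s)) atTop (𝓝 0) :=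
      Real.tendsto_exp_atBot.comp (tendsto_id.const_mul_atTop_of_neg (by linarith))
    simpa using (h3.const_mul (D / k)).add (h3.const_mul D)
  obtain ⟨s, hs1, hs2⟩ := ((hlim.eventually_lt_const hε).and (eventually_ge_atTop T₁)).exists
  refine ⟨(2 * π)⁻¹ • circ U s, s, hT₁.trans_le hs2, fun t ht θ hθ => ?_⟩
  have h3 := hosc t (hs2.trans ht.le) θ hθ
  have h4 := hdrift s t hs2 ht.le
  have h5 : D * Real.exp (-k * t) ≤ D * Real.exp (-k * s) :=
    mul_le_mul_of_nonneg_left (Real.exp_le_exp.2 (by nlinarith [show s < t from ht]))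
      (Real.sqrt_nonneg _)
  calc ‖U ⟨t, θ⟩ - (2 * π)⁻¹ • circ U s‖ = ‖(U ⟨t, θ⟩ - (2 * π)⁻¹ • circ U t) +
        ((2 * π)⁻¹ • circ U t - (2 * π)⁻¹ • circ U s)‖ := by congr 1; abel
    _ ≤ _ := norm_add_le _ _
    _ ≤ ε := by linarith

end IsCylinderMap

end CylinderMap

/-! ### Punctured discs and exterior domains as half cylinders -/

section Exponential

/-- A smooth harmonic map from an open set of the plane to the unit sphere. -/
structure IsSphereHarmonicOn (f : ℂ → F) (Ω : Set ℂ) : Prop where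
  isOpen : IsOpen Ω
  contDiffOn : ContDiffOn ℝ ∞ f Ω
  norm_eq_one : ∀ z ∈ Ω, ‖f z‖ = 1
  harmonic : ∀ z ∈ Ω, dRe (dRe f) z + dIm (dIm f) z = -(‖dRe f z‖ ^ 2 + ‖dIm f z‖ ^ 2) • f z

/-- `p` and `p i` are the images of `1` and `i` under a similarity of ratio `‖p‖`, which rescales
the Hilbert–Schmidt norm. -/
theorem norm_sq_apply_add_mul_I (A : ℂ →L[ℝ] F) (p : ℂ) :
    ‖A p‖ ^ 2 + ‖A (p * I)‖ ^ 2 = ‖p‖ ^ 2 * (‖A 1‖ ^ 2 + ‖A I‖ ^ 2) := by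
  have e2 : p * I = (-p.im) • (1 : ℂ) + p.re • I := by
    apply Complex.ext <;> simp
  rw [e2]
  conv_lhs => rw [exists_comb_std p]
  simp only [map_add, map_smul, norm_add_sq_real, norm_smul, inner_smul_left, inner_smul_right,
    Real.norm_eq_abs, mul_pow, sq_abs]
  have e3 : ‖p‖ ^ 2 = p.re ^ 2 + p.im ^ 2 := by
    rw [← Complex.normSq_eq_norm_sq, Complex.normSq_apply]; ring
  rw [e3]
  simp
  ring

/-- The trace of a bilinear map scales under a similarity of the plane in the same way; symmetry
cancels the mixed terms. -/
theorem apply_apply_add_mul_I (A : ℂ →L[ℝ] ℂ →L[ℝ] F) (hA : A 1 I = A I 1) (p : ℂ) :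
    A p p + A (p * I) (p * I) = ‖p‖ ^ 2 • (A 1 1 + A I I) := by
  have e2 : p * I = (-p.im) • (1 : ℂ) + p.re • I := by
    apply Complex.ext <;> simp
  rw [e2]
  conv_lhs => rw [exists_comb_std p]
  have e3 : ‖p‖ ^ 2 = p.re ^ 2 + p.im ^ 2 := by
    rw [← Complex.normSq_eq_norm_sq, Complex.normSq_apply]; ring
  rw [e3]
  simp only [map_add, map_smul, _root_.add_apply, _root_.smul_apply, hA]
  simp
  module

variable {f : ℂ → F} {Ω : Set ℂ} {z₀ : ℂ} {σ T : ℝ}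

theorem hasFDerivAt_exp_end (z₀ : ℂ) (σ : ℝ) (ζ : ℂ) :
    HasFDerivAt (fun ζ : ℂ => z₀ + cexp (σ * ζ))
      ((ContinuousLinearMap.mul ℝ ℂ) ((σ : ℂ) * cexp (σ * ζ))) ζ := by
  have h1 : HasDerivAt (fun ζ : ℂ => z₀ + cexp (σ * ζ))
      ((σ : ℂ) * cexp (σ * ζ)) ζ := by
    have := (((hasDerivAt_id ζ).const_mul (σ : ℂ)).cexp).const_add z₀
    simpa [mul_comm] using this
  have h2 := h1.hasFDerivAt.restrictScalars ℝ
  refine h2.congr_fderiv ?_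
  ext x
  simp
  ring

theorem contDiff_exp_end (z₀ : ℂ) (σ : ℝ) : ContDiff ℝ ∞ (fun ζ : ℂ => z₀ + cexp (σ * ζ)) :=
  contDiff_const.add ((contDiff_const.mul contDiff_id).cexp)

namespace IsSphereHarmonicOn

variable (hf : IsSphereHarmonicOn f Ω)
include hf

theorem fderiv_exp_end {ζ : ℂ} (hζ : z₀ + cexp (σ * ζ) ∈ Ω) (v : ℂ) :
    fderiv ℝ (fun ζ : ℂ => f (z₀ + cexp (σ * ζ))) ζ v =
      fderiv ℝ f (z₀ + cexp (σ * ζ)) ((σ : ℂ) * cexp (σ * ζ) * v) := by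
  have h1 : HasFDerivAt f (fderiv ℝ f (z₀ + cexp (σ * ζ))) (z₀ + cexp (σ * ζ)) :=
    ((hf.contDiffOn.contDiffAt (hf.isOpen.mem_nhds hζ)).differentiableAt (by simp)).hasFDerivAt
  have h2 := h1.comp ζ (hasFDerivAt_exp_end z₀ σ ζ)
  have h3 : fderiv ℝ (fun ζ : ℂ => f (z₀ + cexp (σ * ζ))) ζ = _ := h2.fderiv
  rw [h3]
  simp

theorem norm_sq_exp_end {ζ : ℂ} (hζ : z₀ + cexp (σ * ζ) ∈ Ω) :
    ‖dRe (fun ζ : ℂ => f (z₀ + cexp (σ * ζ))) ζ‖ ^ 2 +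
      ‖dIm (fun ζ : ℂ => f (z₀ + cexp (σ * ζ))) ζ‖ ^ 2 =
    ‖(σ : ℂ) * cexp (σ * ζ)‖ ^ 2 *
      (‖dRe f (z₀ + cexp (σ * ζ))‖ ^ 2 + ‖dIm f (z₀ + cexp (σ * ζ))‖ ^ 2) := by
  rw [dRe, dIm, hf.fderiv_exp_end hζ, hf.fderiv_exp_end hζ, mul_one, norm_sq_apply_add_mul_I]
  rfl

/-- In this second-order chain rule the term with the first derivative of `f` is linear in `v ^ 2`.
It therefore cancels between `v = 1` and `v = i`, and the Laplacian transforms by a conformal factor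
alone. -/
theorem fderiv_fderiv_exp_end {Ω' : Set ℂ} (hΩ' : IsOpen Ω')
    (hm : ∀ ζ ∈ Ω', z₀ + cexp (σ * ζ) ∈ Ω) {ζ : ℂ} (hζ : ζ ∈ Ω') (v : ℂ) :
    fderiv ℝ (fun ζ => fderiv ℝ (fun ζ : ℂ => f (z₀ + cexp (σ * ζ))) ζ v) ζ v =
      fderiv ℝ (fderiv ℝ f) (z₀ + cexp (σ * ζ)) ((σ : ℂ) * cexp (σ * ζ) * v)
        ((σ : ℂ) * cexp (σ * ζ) * v) +
      fderiv ℝ f (z₀ + cexp (σ * ζ)) ((σ : ℂ) ^ 2 * cexp (σ * ζ) * v ^ 2) := by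
  rw [fderiv_congr_of_eqOn hΩ' (fun ζ hζ => hf.fderiv_exp_end (hm ζ hζ) v) hζ]
  have h0 : ContDiffOn ℝ ∞ (fderiv ℝ f) Ω :=
    hf.contDiffOn.fderiv_of_isOpen hf.isOpen (by norm_cast)
  have h1 : HasFDerivAt (fderiv ℝ f) (fderiv ℝ (fderiv ℝ f) (z₀ + cexp (σ * ζ)))
      (z₀ + cexp (σ * ζ)) :=
    ((h0.contDiffAt (hf.isOpen.mem_nhds (hm ζ hζ))).differentiableAt (by simp)).hasFDerivAt
  have h2 := h1.comp ζ (hasFDerivAt_exp_end z₀ σ ζ)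
  have h3 : HasFDerivAt (fun ζ : ℂ => (σ : ℂ) * cexp (σ * ζ) * v)
      ((ContinuousLinearMap.mul ℝ ℂ) ((σ : ℂ) ^ 2 * cexp (σ * ζ) * v)) ζ := by
    have h4 : HasDerivAt (fun ζ : ℂ => (σ : ℂ) * cexp (σ * ζ) * v)
        ((σ : ℂ) ^ 2 * cexp (σ * ζ) * v) ζ := by
      have := ((((hasDerivAt_id ζ).const_mul (σ : ℂ)).cexp).const_mul (σ : ℂ)).mul_const v
      refine this.congr_deriv ?_
      simp only [id]
      ring
    refine (h4.hasFDerivAt.restrictScalars ℝ).congr_fderiv ?_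
    ext x
    simp
    ring
  have h5 := h2.clm_apply h3
  have h6 : fderiv ℝ (fun ζ : ℂ => fderiv ℝ f (z₀ + cexp (σ * ζ))
      ((σ : ℂ) * cexp (σ * ζ) * v)) ζ = _ := h5.fderiv
  rw [h6]
  simp [add_comm, pow_two, mul_assoc]

theorem isCylinderMap (hσ : σ = 1 ∨ σ = -1) (hm : ∀ ζ ∈ halfPlane T, z₀ + cexp (σ * ζ) ∈ Ω) :
    IsCylinderMap (fun ζ : ℂ => f (z₀ + cexp (σ * ζ))) T where
  contDiffOn := hf.contDiffOn.comp (contDiff_exp_end z₀ σ).contDiffOn hm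
  periodic := fun ζ => by
    have : cexp (σ * (ζ + 2 * π * I)) = cexp (σ * ζ) := by
      rcases hσ with rfl | rfl
      · simp [Complex.exp_periodic ζ]
      · rw [mul_add, show ((-1 : ℝ) : ℂ) * (2 * π * I) = -(2 * π * I) by push_cast; ring]
        exact Complex.exp_periodic.neg _
    simp only [this]
  norm_eq_one := fun ζ hζ => hf.norm_eq_one _ (hm ζ hζ)
  harmonic := fun ζ hζ => by
    rw [hf.norm_sq_exp_end (hm ζ hζ)]
    have h1 := hf.fderiv_fderiv_exp_end (isOpen_halfPlane T) hm hζ 1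
    have h2 := hf.fderiv_fderiv_exp_end (isOpen_halfPlane T) hm hζ I
    set p := (σ : ℂ) * cexp (σ * ζ) with hp
    set z := z₀ + cexp (σ * ζ) with hz
    change fderiv ℝ (fun ζ => fderiv ℝ (fun ζ : ℂ => f (z₀ + cexp (σ * ζ))) ζ 1) ζ 1 +
      fderiv ℝ (fun ζ => fderiv ℝ (fun ζ : ℂ => f (z₀ + cexp (σ * ζ))) ζ I) ζ I = _
    have h0 : ContDiffOn ℝ ∞ (fderiv ℝ f) Ω :=
      hf.contDiffOn.fderiv_of_isOpen hf.isOpen (by norm_cast)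
    have hd : DifferentiableAt ℝ (fderiv ℝ f) z :=
      (h0.contDiffAt (hf.isOpen.mem_nhds (hm ζ hζ))).differentiableAt (by simp)
    have hdd : ∀ v w : ℂ, fderiv ℝ (fun z => fderiv ℝ f z v) z w =
        fderiv ℝ (fderiv ℝ f) z w v := fun v w => by
      rw [fderiv_clm_apply hd (differentiableAt_const v)]
      simp
    have hsymm : fderiv ℝ (fderiv ℝ f) z 1 I = fderiv ℝ (fderiv ℝ f) z I 1 := by
      rw [← hdd, ← hdd]
      exact dRe_dIm hf.isOpen hf.contDiffOn (hm ζ hζ)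
    rw [h1, h2, mul_one, one_pow, mul_one, Complex.I_sq, mul_neg_one, map_neg]
    have h4 := apply_apply_add_mul_I _ hsymm p
    have h5 := hf.harmonic z (hm ζ hζ)
    change fderiv ℝ (fun z => fderiv ℝ f z 1) z 1 + fderiv ℝ (fun z => fderiv ℝ f z I) z I = _ at h5
    rw [hdd, hdd] at h5
    rw [h5] at h4
    rw [neg_mul_eq_mul_neg, mul_smul, ← h4]
    abel

/-- The exponential is injective on the open strip, and its Jacobian is the factor that appears in
`norm_sq_exp_end`: the energy is conformally invariant. -/
theorem integrableOn_energy_exp_end (hσ : σ = 1 ∨ σ = -1)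
    (hm : ∀ ζ ∈ halfPlane T, z₀ + cexp (σ * ζ) ∈ Ω)
    (hi : IntegrableOn (fun z => ‖dRe f z‖ ^ 2 + ‖dIm f z‖ ^ 2) Ω) :
    IntegrableOn (fun ζ => ‖dRe (fun ζ : ℂ => f (z₀ + cexp (σ * ζ))) ζ‖ ^ 2 +
      ‖dIm (fun ζ : ℂ => f (z₀ + cexp (σ * ζ))) ζ‖ ^ 2)
      {ζ | T < ζ.re ∧ -π < ζ.im ∧ ζ.im < π} := by
  set s : Set ℂ := {ζ | T < ζ.re ∧ -π < ζ.im ∧ ζ.im < π} with hs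
  have hso : IsOpen s := (isOpen_lt continuous_const Complex.continuous_re).inter
    ((isOpen_lt continuous_const Complex.continuous_im).inter
      (isOpen_lt Complex.continuous_im continuous_const))
  have hinj : InjOn (fun ζ : ℂ => z₀ + cexp (σ * ζ)) s := by
    intro a ha b hb hab
    have h1 : cexp (σ * a) = cexp (σ * b) := add_left_cancel hab
    have h2 : (σ : ℂ) * a = σ * b := by
      rcases hσ with rfl | rfl <;>
      · refine Complex.exp_inj_of_neg_pi_lt_of_le_pi ?_ ?_ ?_ ?_ h1 <;>
        · simp; linarith [ha.2.1, ha.2.2, hb.2.1, hb.2.2]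
    refine mul_left_cancel₀ ?_ h2
    rcases hσ with rfl | rfl <;> simp
  have h3 := (integrableOn_image_iff_integrableOn_abs_det_fderiv_smul volume hso.measurableSet
    (fun ζ _ => (hasFDerivAt_exp_end z₀ σ ζ).hasFDerivWithinAt) hinj
    (fun z => ‖dRe f z‖ ^ 2 + ‖dIm f z‖ ^ 2)).1
    (hi.mono_set (by rintro _ ⟨ζ, hζ, rfl⟩; exact hm ζ hζ.1))
  refine h3.congr_fun (fun ζ hζ => ?_) hso.measurableSet
  simp only [smul_eq_mul]
  rw [hf.norm_sq_exp_end (hm ζ hζ.1), det_eq_re_im]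
  congr 1
  rw [← Complex.normSq_eq_norm_sq, Complex.normSq_apply, abs_of_nonneg]
  · simp
  · simp
    nlinarith [sq_nonneg ((σ : ℂ) * cexp (σ * ζ)).re,
      sq_nonneg ((σ : ℂ) * cexp (σ * ζ)).im]

end IsSphereHarmonicOn

/-- Fubini on the strip; leaving out the line `im = π` does not change the circle integrals. -/
theorem integrableOn_circ {G : ℂ → ℝ} {T : ℝ}
    (hi : IntegrableOn G {ζ | T < ζ.re ∧ -π < ζ.im ∧ ζ.im < π}) :
    IntegrableOn (circ G) (Ioi T) := by
  have h1 : IntegrableOn (fun q : ℝ × ℝ => G ⟨q.1, q.2⟩) (Ioi T ×ˢ Ioo (-π) π) := by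
    have := Complex.volume_preserving_equiv_real_prod.symm.integrableOn_comp_preimage
      Complex.measurableEquivRealProd.symm.measurableEmbedding (f := G)
      (s := {ζ | T < ζ.re ∧ -π < ζ.im ∧ ζ.im < π})
    exact this.2 hi
  rw [IntegrableOn, Measure.volume_eq_prod, ← Measure.prod_restrict] at h1
  refine h1.integral_prod_left.congr (ae_of_all _ fun t => ?_)
  show ∫ y in Ioo (-π) π, G ⟨t, y⟩ = _
  rw [circ, intervalIntegral.integral_of_le (by linarith [Real.pi_pos]), integral_Ioc_eq_integral_Ioo]

/-- A harmonic map of finite energy is almost constant near a puncture (`σ = -1`) and near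
infinity (`σ = 1`). -/
theorem IsSphereHarmonicOn.exists_norm_sub_le [CompleteSpace F] (hf : IsSphereHarmonicOn f Ω)
    (hσ : σ = 1 ∨ σ = -1) (hm : ∀ z, z ≠ z₀ → T < σ * Real.log ‖z - z₀‖ → z ∈ Ω)
    (hi : IntegrableOn (fun z => ‖dRe f z‖ ^ 2 + ‖dIm f z‖ ^ 2) Ω) {ε : ℝ} (hε : 0 < ε) :
    ∃ c : F, ∃ T' > T, ∀ z, z ≠ z₀ → T' < σ * Real.log ‖z - z₀‖ → ‖f z - c‖ ≤ ε := by
  have hσ2 : σ * σ = 1 := by rcases hσ with rfl | rfl <;> norm_num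
  have hm' : ∀ ζ ∈ halfPlane T, z₀ + cexp (σ * ζ) ∈ Ω := fun ζ hζ => by
    refine hm _ (by simp) ?_
    rw [add_sub_cancel_left, Complex.norm_exp, Real.log_exp, Complex.re_ofReal_mul, ← mul_assoc,
      hσ2, one_mul]
    exact hζ
  have hU := hf.isCylinderMap hσ hm'
  have hH := isOpen_halfPlane T
  have h1 := (contDiffOn_dRe hH hU.contDiffOn).continuousOn
  have h2 := (contDiffOn_dIm hH hU.contDiffOn).continuousOn
  have hE := hf.integrableOn_energy_exp_end hσ hm' hi
  have hso : IsOpen {ζ : ℂ | T < ζ.re ∧ -π < ζ.im ∧ ζ.im < π} :=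
    (isOpen_lt continuous_const Complex.continuous_re).inter
    ((isOpen_lt continuous_const Complex.continuous_im).inter
      (isOpen_lt Complex.continuous_im continuous_const))
  have hsub : {ζ : ℂ | T < ζ.re ∧ -π < ζ.im ∧ ζ.im < π} ⊆ halfPlane T :=
    fun ζ hζ => hζ.1
  obtain ⟨c, T', hT', hc⟩ := hU.exists_norm_sub_le (integrableOn_circ (hE.mono'
      (((h1.norm.pow 2).mono hsub).aestronglyMeasurable hso.measurableSet) (ae_of_all _ fun ζ => by
        rw [Real.norm_of_nonneg (by positivity)]; exact le_add_of_nonneg_right (by positivity))))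
    (integrableOn_circ (hE.mono'
      (((h2.norm.pow 2).mono hsub).aestronglyMeasurable hso.measurableSet) (ae_of_all _ fun ζ => by
        rw [Real.norm_of_nonneg (by positivity)]; exact le_add_of_nonneg_left (by positivity))))
    hε
  refine ⟨c, T', hT', fun z hz hlog => ?_⟩
  have hz' : z - z₀ ≠ 0 := sub_ne_zero.2 hz
  -- The point of the cylinder is `σ log (z - z₀)` with the principal logarithm, so that its
  -- imaginary part lies in `[-π, π]` for both signs `σ`.
  have h3 := hc (σ * Real.log ‖z - z₀‖) hlog (σ * (z - z₀).arg) (by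
    have := Complex.neg_pi_lt_arg (z - z₀)
    have := Complex.arg_le_pi (z - z₀)
    rcases hσ with rfl | rfl <;> constructor <;> linarith)
  have h4 : (σ : ℂ) * (⟨σ * Real.log ‖z - z₀‖, σ * (z - z₀).arg⟩ : ℂ) = Complex.log (z - z₀) := by
    apply Complex.ext
    · rw [Complex.re_ofReal_mul, ← mul_assoc, hσ2, one_mul, Complex.log_re]
    · rw [Complex.im_ofReal_mul, ← mul_assoc, hσ2, one_mul, Complex.log_im]
  simp only [h4, Complex.exp_log hz', add_sub_cancel] at h3
  exact h3

end Exponential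

/-! ### Smooth harmonic maps in conformal charts -/

section HarmonicOn

variable [MeasurableSpace M]

/-- A map to the unit sphere, smooth and harmonic on the open set `O`, of finite energy. -/
structure IsHarmonicOn (h : SurfaceMetric M) (u : M → F) (O : Set M) : Prop where
  isOpen : IsOpen O
  contMDiffOn : SmoothOn[F] u O
  norm_eq_one : ∀ x, ‖u x‖ = 1
  integrableOn : IntegrableOn (dInner h u u) O vol[h]
  integral_eq : ∀ ξ ∈ testFields F O, ∫ x, dInner h u ξ x ∂vol[h] =
      ∫ x, dInner h u u x * inner ℝ (u x) (ξ x) ∂vol[h]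

variable [BorelSpace M] [SecondCountableTopology M] [T2Space M] [CompleteSpace F]
variable {h : SurfaceMetric M} {u : M → F} {O : Set M}

/-- For `p = 2` the weights are `1`. On `O` the weak differential is the classical one, and fields
supported in `O` see nothing else. -/
theorem IsPHarmonic.isHarmonicOn (hu : IsPHarmonic h 2 u) (hO : IsOpen O)
    (hs : SmoothOn[F] u O) : IsHarmonicOn h u O where
  isOpen := hO
  contMDiffOn := hs
  norm_eq_one := hu.memSphereW1.norm_eq_one
  integrableOn := by
    have h1 := hu.memSphereW1.integrable_gradSq.integrableOn (s := O)
    refine h1.congr ?_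
    rw [EventuallyEq, ae_restrict_iff' hO.measurableSet]
    filter_upwards [hu.memSphereW1.weaklyDifferentiable.ae_eq_cdiff_on h hO hs] with x hx hxO
    rw [gradSq, gradInner, hx hxO, div_self two_ne_zero, Real.rpow_one]
    rfl
  integral_eq := fun ξ hξ => by
    have h1 := hu.eulerLagrange ξ hξ.1 hξ.2.1
    have h2 := hu.memSphereW1.weaklyDifferentiable.ae_eq_cdiff_on h hO hs
    have e : (2 / 2 - 1 : ℝ) = 0 := by norm_num
    simp only [e, Real.rpow_zero, one_mul] at h1
    refine (integral_congr_ae ?_).trans (h1.trans (integral_congr_ae ?_))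
    · filter_upwards [h2] with x hx
      by_cases hxO : x ∈ O
      · rw [hx hxO]; rfl
      · have h3 : cdiff ξ x = 0 :=
          cdiff_eq_zero_of_notMem_tsupport fun hx' => hxO (hξ.2.2 hx')
        change pairing h x _ (cdiff ξ x) = pairing h x _ (cdiff ξ x)
        rw [h3, pairing_zero_right, pairing_zero_right]
    · filter_upwards [h2] with x hx
      by_cases hxO : x ∈ O
      · rw [gradSq, gradInner, hx hxO]; rfl
      · rw [image_eq_zero_of_notMem_tsupport fun hx' => hxO (hξ.2.2 hx')]
        simp

variable {φ : Chart[M]} {r : ℂ → ℝ}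

theorem chartExtend_mem_testFields (hφ : IsSmoothChart φ) {Ω : Set ℂ} {η : ℂ → F}
    (hη : ContDiff ℝ ∞ η) (hc : HasCompactSupport η) (hs : tsupport η ⊆ Ω) (hΩ : Ω ⊆ φ.target) :
    chartExtend φ η ∈ testFields F (φ.source ∩ φ ⁻¹' Ω) := by
  refine ⟨hφ.contMDiff_chartExtend hη hc (hs.trans hΩ),
    hasCompactSupport_chartExtend hc (hs.trans hΩ),
    (tsupport_chartExtend_subset hc (hs.trans hΩ)).trans ?_⟩
  rintro _ ⟨y, hy, rfl⟩
  have hy' := hΩ (hs hy)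
  exact ⟨φ.map_target hy', by rw [mem_preimage, φ.right_inv hy']; exact hs hy⟩

theorem contMDiffOn_of_comp_symm (hφ : IsSmoothChart φ) {Ω : Set ℂ} 
    (hs : ContDiffOn ℝ ∞ (fun y => u (φ.symm y)) Ω) : SmoothOn[F] u (φ.source ∩ φ ⁻¹' Ω) := by
  have h1 : SmoothOn[F] (fun y => u (φ.symm y)) Ω := hs.contMDiffOn
  refine (h1.comp (hφ.contMDiffOn.mono inter_subset_left) fun x hx => hx.2).congr fun x hx => ?_
  simp [φ.left_inv hx.1]

/-- Change of variables for the integral of a function supported in a conformal chart. -/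
theorem IsConformalWith.integral_eq (hφ : IsConformalWith h φ r) {g : M → ℝ} {k : ℂ → ℝ}
    (hg : AEStronglyMeasurable g vol[h]) (h0 : ∀ x ∉ φ.source, g x = 0)
    (hk0 : ∀ y ∉ φ.target, k y = 0) (hk : ∀ y ∈ φ.target, r y * g (φ.symm y) = k y) :
    ∫ x, g x ∂vol[h] = ∫ y, k y := by
  rw [← setIntegral_eq_integral_of_forall_compl_eq_zero (fun x hx => h0 x hx),
    hφ.isSmoothChart.setIntegral_source h hg,
    ← setIntegral_eq_integral_of_forall_compl_eq_zero (fun x hx => hk0 x hx)]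
  refine setIntegral_congr_fun φ.open_target.measurableSet fun y hy => ?_
  simp only [smul_eq_mul]
  rw [hφ.chartDensity_eq hy, hk y hy]

theorem fderiv_eq_zero_of_notMem_tsupport {E : Type*} [NormedAddCommGroup E] [NormedSpace ℝ E]
    {η : ℂ → E} {y : ℂ} (hy : y ∉ tsupport η) : fderiv ℝ η y = 0 :=
  image_eq_zero_of_notMem_tsupport fun h' => hy (tsupport_fderiv_subset ℝ h')

/-- Conformal invariance of the weak equation: the flat test field is extended by zero from the
chart, and the factors `r` of the volume and `r⁻¹` of the pairing cancel. -/
theorem IsHarmonicOn.flat_integral_eq (hu : IsHarmonicOn h u O) (hφ : IsConformalWith h φ r)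
    {Ω : Set ℂ} (hΩ : Ω ⊆ φ.target) (hΩO : ∀ y ∈ Ω, φ.symm y ∈ O) {η : ℂ → F}
    (hη : ContDiff ℝ ∞ η) (hc : HasCompactSupport η) (hs : tsupport η ⊆ Ω) :
    ∫ y, flatPairing (fderiv ℝ (fun y => u (φ.symm y)) y) (fderiv ℝ η y) =
      ∫ y, flatPairing (fderiv ℝ (fun y => u (φ.symm y)) y) (fderiv ℝ (fun y => u (φ.symm y)) y) *
        inner ℝ (u (φ.symm y)) (η y) := by
  have hsm := hφ.isSmoothChart
  have hsub : φ.source ∩ φ ⁻¹' Ω ⊆ O := fun x hx => by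
    have := hΩO _ hx.2
    rwa [φ.left_inv hx.1] at this
  have hξ := chartExtend_mem_testFields hsm hη hc hs hΩ
  have hξ' : chartExtend φ η ∈ testFields F O := ⟨hξ.1, hξ.2.1, hξ.2.2.trans hsub⟩
  have hd : ∀ y ∈ tsupport η, DiffAt[F] u (φ.symm y) := fun y hy =>
    mdifferentiableAt_of_contMDiffOn hu.isOpen hu.contMDiffOn (hΩO y (hs hy))
  have hξd : ∀ x, DiffAt[F] (chartExtend φ η) x := fun x =>
    (hξ.1 x).mdifferentiableAt (by simp)
  have hev : ∀ y ∈ φ.target, fderiv ℝ (fun z => chartExtend φ η (φ.symm z)) y = fderiv ℝ η y :=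
    fun y hy => fderiv_congr_of_eqOn φ.open_target (fun z hz => chartExtend_symm φ η hz) hy
  have h0 : ∀ y ∈ φ.target, y ∉ tsupport η → φ.symm y ∉ tsupport (chartExtend φ η) := by
    intro y hy hy' hmem
    obtain ⟨z, hz, hzy⟩ := tsupport_chartExtend_subset hc (hs.trans hΩ) hmem
    rw [φ.symm.injOn (hΩ (hs hz)) hy hzy] at hz
    exact hy' hz
  have h1 := hu.integral_eq _ hξ'
  rw [hφ.integral_eq (k := fun y => flatPairing (fderiv ℝ (fun y => u (φ.symm y)) y)
      (fderiv ℝ η y)) (integrable_dInner_of_mem_testFields h hu.isOpen hu.contMDiffOn hξ').1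
      (fun x hx => dInner_eq_zero_of_notMem_tsupport h u fun hx' => hx (hξ.2.2 hx').1)
      (fun y hy => by
        rw [fderiv_eq_zero_of_notMem_tsupport fun hy' => hy (hΩ (hs hy'))]
        simp [flatPairing])
      (fun y hy => by
        by_cases hys : y ∈ tsupport η
        · rw [hφ.dInner_eq hy (hd y hys) (hξd _), hev y hy, ← mul_assoc,
            mul_inv_cancel₀ (hφ.pos y hy).ne', one_mul]
        · rw [dInner_eq_zero_of_notMem_tsupport h u (h0 y hy hys),
            fderiv_eq_zero_of_notMem_tsupport hys]
          simp [flatPairing])] at h1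
  rw [h1]
  refine hφ.integral_eq (integrable_of_continuousOn_of_eq_zero h hu.isOpen
    ((continuousOn_dInner h hu.isOpen hu.contMDiffOn hu.contMDiffOn).mul
      (hu.contMDiffOn.continuousOn.inner hξ.1.continuous.continuousOn)) hξ'.2.1 hξ'.2.2
      (fun x hx => by simp [image_eq_zero_of_notMem_tsupport hx])).1 (fun x hx => by
        simp [chartExtend_of_notMem φ η hx])
      (fun y hy => by
        simp [image_eq_zero_of_notMem_tsupport fun hy' => hy (hΩ (hs hy'))])
      (fun y hy => ?_)
  by_cases hys : y ∈ tsupport η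
  · rw [hφ.dInner_eq hy (hd y hys) (hd y hys), chartExtend_symm φ η hy, ← mul_assoc, ← mul_assoc,
      mul_inv_cancel₀ (hφ.pos y hy).ne', one_mul]
  · rw [chartExtend_symm φ η hy, image_eq_zero_of_notMem_tsupport hys]
    simp

/-- The harmonic map equation in a conformal chart. -/
theorem IsHarmonicOn.isSphereHarmonicOn (hu : IsHarmonicOn h u O) (hφ : IsConformalWith h φ r) :
    IsSphereHarmonicOn (fun y => u (φ.symm y)) (φ.target ∩ φ.symm ⁻¹' O) where
  isOpen := isOpen_target_inter φ hu.isOpen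
  contDiffOn := hφ.isSmoothChart.contDiffOn_comp_symm hu.contMDiffOn
  norm_eq_one := fun y _ => hu.norm_eq_one _
  harmonic := by
    set f := fun y => u (φ.symm y) with hf
    set Ω := φ.target ∩ φ.symm ⁻¹' O with hΩ
    have hΩo : IsOpen Ω := isOpen_target_inter φ hu.isOpen
    have hfs : ContDiffOn ℝ ∞ f Ω := hφ.isSmoothChart.contDiffOn_comp_symm hu.contMDiffOn
    have h1 := contDiffOn_dRe hΩo hfs
    have h2 := contDiffOn_dIm hΩo hfs
    have h11 := contDiffOn_dRe hΩo h1
    have h22 := contDiffOn_dIm hΩo h2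
    set X := fun z => dRe (dRe f) z + dIm (dIm f) z + (‖dRe f z‖ ^ 2 + ‖dIm f z‖ ^ 2) • f z
      with hXdef
    have hX : ContinuousOn X Ω := (h11.continuousOn.add h22.continuousOn).add
      (((h1.continuousOn.norm.pow 2).add (h2.continuousOn.norm.pow 2)).smul hfs.continuousOn)
    -- Testing with `θ e` for a fixed vector `e` and integrating by parts shows that the continuous
    -- function `⟨X, e⟩` integrates to zero against every `θ`.
    have key : ∀ e : F, ∀ z ∈ Ω, inner ℝ (X z) e = 0 := by
      intro e
      have hXe := hX.inner (𝕜 := ℝ) (continuousOn_const (c := e))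
      have hae : ∀ᵐ z, z ∈ Ω → inner ℝ (X z) e = 0 := by
        refine hΩo.ae_eq_zero_of_integral_contDiff_smul_eq_zero
          (hXe.locallyIntegrableOn hΩo.measurableSet) fun θ hθ hc hs => ?_
        have hη : ContDiff ℝ ∞ fun y => θ y • e := hθ.smul contDiff_const
        have hηs : tsupport (fun y => θ y • e) ⊆ Ω := (tsupport_smul_subset_left θ _).trans hs
        have h3 := hu.flat_integral_eq hφ (inter_subset_left) (fun y hy => hy.2) hη
          hc.smul_right hηs
        have c1 := h1.inner ℝ (contDiffOn_const (c := e))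
        have c2 := h2.inner ℝ (contDiffOn_const (c := e))
        have i1 := integral_smul_fderiv_of_contDiffOn hΩo hθ hc hs c1 1
        have i2 := integral_smul_fderiv_of_contDiffOn hΩo hθ hc hs c2 I
        have l0 : ∀ g : ℂ → ℝ, ContinuousOn g Ω → Integrable fun y => θ y • g y := fun g hg =>
          integrable_smul_of_tsupport_subset (hg.locallyIntegrableOn hΩo.measurableSet)
            hθ.continuous hc hs
        have l1 : ∀ g : ℂ → ℝ, ContinuousOn g Ω → ∀ v : ℂ,
            Integrable fun y => fderiv ℝ θ y v • g y := fun g hg v =>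
          integrable_smul_of_tsupport_subset (hg.locallyIntegrableOn hΩo.measurableSet)
            ((hθ.continuous_fderiv (by simp)).clm_apply continuous_const)
            (hc.fderiv_apply ℝ v) ((tsupport_fderiv_apply_subset ℝ v).trans hs)
        have d1 : ∀ z ∈ Ω, fderiv ℝ (fun z => inner ℝ (dRe f z) e) z 1 =
            inner ℝ (dRe (dRe f) z) e := fun z hz => by
          have := dRe_inner (G₂ := fun _ => e) hΩo h1 contDiffOn_const hz
          simpa [dRe] using this
        have d2 : ∀ z ∈ Ω, fderiv ℝ (fun z => inner ℝ (dIm f z) e) z I =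
            inner ℝ (dIm (dIm f) z) e := fun z hz => by
          have := dIm_inner (G₂ := fun _ => e) hΩo h2 contDiffOn_const hz
          simpa [dIm] using this
        have z0 : ∀ z ∉ Ω, θ z = 0 := fun z hz =>
          image_eq_zero_of_notMem_tsupport fun hz' => hz (hs hz')
        have a1 : ∫ y, flatPairing (fderiv ℝ f y) (fderiv ℝ (fun y => θ y • e) y) =
            (∫ y, fderiv ℝ θ y 1 • inner ℝ (dRe f y) e) +
              ∫ y, fderiv ℝ θ y I • inner ℝ (dIm f y) e := by
          rw [← integral_add (l1 _ c1.continuousOn 1) (l1 _ c2.continuousOn I)]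
          refine integral_congr_fun (fun y => ?_)
          have : fderiv ℝ (fun y => θ y • e) y = (fderiv ℝ θ y).smulRight e :=
            ((hθ.differentiable (by simp) y).hasFDerivAt.smul_const e).fderiv
          simp only [this, flatPairing, ContinuousLinearMap.smulRight_apply, inner_smul_right,
            smul_eq_mul]
          rfl
        rw [a1] at h3
        have b1 : ∫ y, θ y • fderiv ℝ (fun z => inner ℝ (dRe f z) e) y 1 =
            ∫ y, θ y • inner ℝ (dRe (dRe f) y) e :=
          integral_congr_fun (fun y => by
            by_cases hy : y ∈ Ω
            · simp only [d1 y hy]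
            · simp [z0 y hy])
        have b2 : ∫ y, θ y • fderiv ℝ (fun z => inner ℝ (dIm f z) e) y I =
            ∫ y, θ y • inner ℝ (dIm (dIm f) y) e :=
          integral_congr_fun (fun y => by
            by_cases hy : y ∈ Ω
            · simp only [d2 y hy]
            · simp [z0 y hy])
        rw [b1] at i1
        rw [b2] at i2
        have cV : ContinuousOn (fun z => (‖dRe f z‖ ^ 2 + ‖dIm f z‖ ^ 2) * inner ℝ (f z) e) Ω :=
          ((h1.continuousOn.norm.pow 2).add (h2.continuousOn.norm.pow 2)).mul
            (hfs.continuousOn.inner continuousOn_const)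
        have e3 : ∫ y, flatPairing (fderiv ℝ f y) (fderiv ℝ f y) * inner ℝ (f y) (θ y • e) =
            ∫ y, θ y • ((‖dRe f y‖ ^ 2 + ‖dIm f y‖ ^ 2) * inner ℝ (f y) e) :=
          integral_congr_fun (fun y => by
            simp only [flatPairing_self, inner_smul_right, smul_eq_mul, dRe, dIm]; ring)
        rw [e3] at h3
        have hsum : ∫ y, θ y • inner ℝ (X y) e = (∫ y, θ y • inner ℝ (dRe (dRe f) y) e) +
            (∫ y, θ y • inner ℝ (dIm (dIm f) y) e) +
            ∫ y, θ y • ((‖dRe f y‖ ^ 2 + ‖dIm f y‖ ^ 2) * inner ℝ (f y) e) := by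
          have l1 := l0 _ (h11.continuousOn.inner (continuousOn_const (c := e)))
          have l2 := l0 _ (h22.continuousOn.inner (continuousOn_const (c := e)))
          rw [← integral_add l1 l2, ← integral_add (l1.fun_add l2) (l0 _ cV)]
          refine integral_congr_fun (fun y => ?_)
          simp only [hXdef, inner_add_left, inner_smul_left, smul_eq_mul]
          simp
          ring
        rw [hsum, i1, i2]
        linarith
      exact Measure.eqOn_open_of_ae_eq ((ae_restrict_iff' hΩo.measurableSet).2 hae) hΩo hXe
        continuousOn_const
    intro z hz
    have h4 : X z = 0 := ext_inner_right ℝ fun e => by rw [key e z hz, inner_zero_left]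
    rw [neg_smul]
    exact eq_neg_of_add_eq_zero_left h4

theorem IsHarmonicOn.integrableOn_energy (hu : IsHarmonicOn h u O) (hφ : IsConformalWith h φ r) :
    IntegrableOn (fun z => ‖dRe (fun y => u (φ.symm y)) z‖ ^ 2 +
      ‖dIm (fun y => u (φ.symm y)) z‖ ^ 2) (φ.target ∩ φ.symm ⁻¹' O) := by
  have h1 : IntegrableOn (O.indicator (dInner h u u)) φ.source vol[h] :=
    ((integrable_indicator_iff hu.isOpen.measurableSet).2 hu.integrableOn).integrableOn
  have h2 := (hφ.isSmoothChart.integrableOn_chart h h1).mono_set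
    (inter_subset_left (t := φ.symm ⁻¹' O))
  refine h2.congr_fun (fun y hy => ?_) (isOpen_target_inter φ hu.isOpen).measurableSet
  have hd := mdifferentiableAt_of_contMDiffOn hu.isOpen hu.contMDiffOn hy.2
  simp only [smul_eq_mul]
  rw [indicator_of_mem (show φ.symm y ∈ O from hy.2), hφ.dInner_eq hy.1 hd hd,
    hφ.chartDensity_eq hy.1, ← mul_assoc, mul_inv_cancel₀ (hφ.pos y hy.1).ne', one_mul,
    flatPairing_self]
  rfl

end HarmonicOn

theorem isConformalWith_refl :
    IsConformalWith flatMetric (OpenPartialHomeomorph.refl ℂ) fun _ => 1 where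
  isSmoothChart := isSmoothChart_of_mem_atlas (by simp)
  pos := fun _ _ => one_pos
  inner_eq := fun y _ v v' => by
    have h1 : chartDifferential (OpenPartialHomeomorph.refl ℂ) y = ContinuousLinearMap.id ℝ ℂ :=
      mfderiv_id
    rw [h1, one_mul]
    rfl

/-! ### The potential term of the second variation -/

section Potential

variable [MeasurableSpace M] [BorelSpace M] [SecondCountableTopology M] [T2Space M]
variable [CompleteSpace F]

theorem exists_cutoff {K O : Set M} (hK : IsCompact K) (hO : IsOpen O) (hKO : K ⊆ O) :
    ∃ χ : M → ℝ, Smooth[ℝ] χ ∧ HasCompactSupport χ ∧ tsupport χ ⊆ O ∧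
      (∀ᶠ x in 𝓝ˢ K, χ x = 1) ∧ ∀ x, χ x ∈ Icc (0 : ℝ) 1 := by
  have : LocallyCompactSpace M := ChartedSpace.locallyCompactSpace ℂ M
  obtain ⟨L, hL, hKL, hLO⟩ := exists_compact_between hK hO hKO
  obtain ⟨f, hf1, hf2, hf3⟩ := exists_contMDiffMap_one_nhds_of_subset_interior 𝓘₂
    (n := (⊤ : ℕ∞)) hK.isClosed hKL
  have hs : tsupport f ⊆ L := closure_minimal (fun x hx => by
    by_contra hxL
    exact hx (hf2 x hxL)) hL.isClosed
  exact ⟨f, f.contMDiff, hL.of_isClosed_subset (isClosed_tsupport _) hs, hs.trans hLO, hf1, hf3⟩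

theorem mem_testFields_of_contMDiffOn {O K : Set M} (hO : IsOpen O) {g : M → F}
    (hg : SmoothOn[F] g O) (hK : IsCompact K) (hKO : K ⊆ O)
    (h0 : ∀ x ∉ K, g x = 0) : g ∈ testFields F O := by
  have hs : tsupport g ⊆ K := closure_minimal (fun x hx => by
    by_contra hxL
    exact hx (h0 x hxL)) hK.isClosed
  refine ⟨fun x => ?_, hK.of_isClosed_subset (isClosed_tsupport _) hs, hs.trans hKO⟩
  by_cases hx : x ∈ K
  · exact (hg x (hKO hx)).contMDiffAt (hO.mem_nhds (hKO hx))
  · refine (contMDiffAt_const (c := (0 : F))).congr_of_eventuallyEq ?_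
    filter_upwards [hK.isClosed.isOpen_compl.mem_nhds hx] with y hy using h0 y hy

/-- The Dirichlet energy. -/
def dirichlet (h : SurfaceMetric M) (w : M → F) : ℝ :=
  ∫ x, dInner h w w x ∂vol[h]

/-- The potential term of the second variation of the Dirichlet energy at `u`. -/
def potential (h : SurfaceMetric M) (u w : M → F) : ℝ :=
  ∫ x, dInner h u u x * ‖w x‖ ^ 2 ∂vol[h]

/-- Outside compact sets the map `u` is almost constant. -/
def IsAlmostConstantAtEnd (u : M → F) (O : Set M) : Prop :=
  ∀ ε > 0, ∃ c : F, ∃ K ⊆ O, IsCompact K ∧ ∀ x ∈ O, x ∉ K → ‖u x - c‖ ≤ ε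

variable {h : SurfaceMetric M} {u w : M → F} {O : Set M}

theorem integrable_dInner_self (hw : w ∈ testFields F O) : Integrable (dInner h w w) vol[h] :=
  integrable_dInner_of_mem_testFields h isOpen_univ hw.1.contMDiffOn ⟨hw.1, hw.2.1, subset_univ _⟩

theorem integrable_norm_sq (hw : w ∈ testFields F O) : Integrable (fun x => ‖w x‖ ^ 2) vol[h] :=
  integrable_of_continuousOn_of_eq_zero h isOpen_univ (hw.1.continuous.norm.pow 2).continuousOn
    hw.2.1 (subset_univ _) fun x hx => by simp [image_eq_zero_of_notMem_tsupport hx]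

theorem integrable_potential (hO : IsOpen O) (hu : SmoothOn[F] u O) (hw : w ∈ testFields F O) :
    Integrable (fun x => dInner h u u x * ‖w x‖ ^ 2) vol[h] :=
  integrable_of_continuousOn_of_eq_zero h hO
    ((continuousOn_dInner h hO hu hu).mul (hw.1.continuous.norm.pow 2).continuousOn)
    hw.2.1 hw.2.2 fun x hx => by simp [image_eq_zero_of_notMem_tsupport hx]

/-- By the product rule `du · d(|w|² (u - c))` is `|w|² |du|²` plus a sum of terms `2 ⟨w, dw⟩ ⟨du, u
- c⟩`. The latter are absorbed by `|u - c| ≤ ε` and `2ab ≤ a² + b²`. -/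
theorem dInner_smul_sub_ge {x : M} {ε : ℝ} {c : F} (h : SurfaceMetric M)
    (hu : DiffAt[F] u x) (hw : DiffAt[F] w x) (hε : ‖u x - c‖ ≤ ε) :
    ‖w x‖ ^ 2 * dInner h u u x - ε * (dInner h u u x * ‖w x‖ ^ 2 + dInner h w w x) ≤
      dInner h u (fun z => inner ℝ (w z) (w z) • (u z - c)) x := by
  obtain ⟨f₁, f₂, hf⟩ := exists_orthoFrame h x
  have hww : DiffAt[ℝ] (fun z => inner ℝ (w z) (w z)) x := by
    have h1 := hasMFDerivAt_prodMk_space hw hw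
    exact (((contDiff_inner (𝕜 := ℝ) (E := F) (n := 1)).contMDiff.mdifferentiableAt
      (by simp)).comp x h1.mdifferentiableAt)
  have huc : DiffAt[F] (fun z => u z - c) x :=
    hu.sub mdifferentiableAt_const
  have hd : ∀ v, cdiff (fun z => inner ℝ (w z) (w z) • (u z - c)) x v =
      ‖w x‖ ^ 2 • cdiff u x v + (2 * inner ℝ (w x) (cdiff w x v)) • (u x - c) := by
    intro v
    rw [cdiff_smul_apply hww huc, cdiff_inner_apply hw hw,
      cdiff_sub hu mdifferentiableAt_const, cdiff_const, sub_zero,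
      real_inner_comm (w x) (cdiff w x v), ← two_mul, real_inner_self_eq_norm_sq]
  have hv : ∀ v, ‖w x‖ ^ 2 * ‖cdiff u x v‖ ^ 2 -
      ε * (‖cdiff u x v‖ ^ 2 * ‖w x‖ ^ 2 + ‖cdiff w x v‖ ^ 2) ≤
      inner ℝ (cdiff u x v) (cdiff (fun z => inner ℝ (w z) (w z) • (u z - c)) x v) := by
    intro v
    rw [hd v, inner_add_right, inner_smul_right, inner_smul_right, real_inner_self_eq_norm_sq]
    have h1 := abs_real_inner_le_norm (w x) (cdiff w x v)
    have h2 := abs_real_inner_le_norm (cdiff u x v) (u x - c)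
    have h3 : |2 * inner ℝ (w x) (cdiff w x v) * inner ℝ (cdiff u x v) (u x - c)| ≤
        2 * (‖w x‖ * ‖cdiff w x v‖) * (‖cdiff u x v‖ * ε) := by
      rw [abs_mul, abs_mul, abs_two]
      exact mul_le_mul (by linarith)
        (h2.trans (mul_le_mul_of_nonneg_left hε (norm_nonneg _))) (abs_nonneg _) (by positivity)
    have h4 := neg_abs_le (2 * inner ℝ (w x) (cdiff w x v) * inner ℝ (cdiff u x v) (u x - c))
    have hε0 := (norm_nonneg _).trans hε
    have h5 : 2 * (‖w x‖ * ‖cdiff w x v‖) * (‖cdiff u x v‖ * ε) ≤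
        ε * (‖cdiff u x v‖ ^ 2 * ‖w x‖ ^ 2 + ‖cdiff w x v‖ ^ 2) := by
      have := mul_nonneg hε0 (sq_nonneg (‖cdiff u x v‖ * ‖w x‖ - ‖cdiff w x v‖))
      nlinarith
    linarith
  rw [dInner, dInner, dInner, hf.pairing_eq, hf.pairing_eq, hf.pairing_eq,
    real_inner_self_eq_norm_sq (cdiff u x f₁), real_inner_self_eq_norm_sq (cdiff u x f₂),
    real_inner_self_eq_norm_sq (cdiff w x f₁), real_inner_self_eq_norm_sq (cdiff w x f₂)]
  have h1 := hv f₁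
  have h2 := hv f₂
  linarith

/-- Where `u` is almost constant, the potential is dominated by the Dirichlet energy. -/
theorem IsHarmonicOn.potential_le (hu : IsHarmonicOn h u O) {ε : ℝ} {c : F} {K : Set M}
    (hK : IsCompact K) (hε : ∀ x ∈ O, x ∉ K → ‖u x - c‖ ≤ ε) (hw : w ∈ testFields F (O \ K)) :
    (1 - 2 * ε) * potential h u w ≤ ε * dirichlet h w := by
  have hOK : IsOpen (O \ K) := hu.isOpen.sdiff hK.isClosed
  have hus : SmoothOn[F] u (O \ K) := hu.contMDiffOn.mono sdiff_subset
  have hwO : w ∈ testFields F O := ⟨hw.1, hw.2.1, hw.2.2.trans sdiff_subset⟩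
  -- The test field is `|w|² (u - c)`. With P the potential and D the Dirichlet energy, the left
  -- side of the weak equation is at least `P - ε (P + D)` and the right side at most `ε P`.
  have hξ : (fun z => inner ℝ (w z) (w z) • (u z - c)) ∈ testFields F O := by
    refine mem_testFields_of_contMDiffOn hu.isOpen (K := tsupport w) ?_ hw.2.1 hwO.2.2
      fun x hx => by simp [image_eq_zero_of_notMem_tsupport hx]
    have h1 : Smooth[ℝ] fun z => inner ℝ (w z) (w z) :=
      (contDiff_inner (𝕜 := ℝ) (E := F) (n := ∞)).contMDiff.comp (hw.1.prodMk_space hw.1)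
    exact h1.contMDiffOn.smul (hu.contMDiffOn.sub contMDiffOn_const)
  have h1 := hu.integral_eq _ hξ
  have i1 := integrable_dInner_of_mem_testFields h hu.isOpen hu.contMDiffOn hξ
  have i2 := integrable_potential (h := h) hu.isOpen hu.contMDiffOn hwO
  have i3 := integrable_dInner_self (h := h) hw
  have h2 : ∫ x, dInner h u u x * inner ℝ (u x) (inner ℝ (w x) (w x) • (u x - c)) ∂vol[h] ≤
      ε * potential h u w := by
    rw [potential, ← integral_const_mul]
    refine integral_mono (integrable_of_continuousOn_of_eq_zero h hu.isOpen
      ((continuousOn_dInner h hu.isOpen hu.contMDiffOn hu.contMDiffOn).mul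
        (hu.contMDiffOn.continuousOn.inner hξ.1.continuous.continuousOn)) hξ.2.1 hξ.2.2
        fun x hx => by
          have h0 := image_eq_zero_of_notMem_tsupport hx
          beta_reduce at h0
          rw [h0, inner_zero_right, mul_zero]) (i2.const_mul ε) fun x => ?_
    by_cases hx : x ∈ O \ K
    · simp only [inner_smul_right, real_inner_self_eq_norm_sq]
      have h3 : inner ℝ (u x) (u x - c) ≤ ε := by
        refine (real_inner_le_norm _ _).trans ?_
        rw [hu.norm_eq_one, one_mul]
        exact hε x hx.1 hx.2
      have h4 := mul_le_mul_of_nonneg_left h3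
        (mul_nonneg (dInner_self_nonneg h u x) (sq_nonneg ‖w x‖))
      linarith
    · simp [image_eq_zero_of_notMem_tsupport fun h' => hx (hw.2.2 h')]
  have h3 : potential h u w - ε * (potential h u w + dirichlet h w) ≤
      ∫ x, dInner h u (fun z => inner ℝ (w z) (w z) • (u z - c)) x ∂vol[h] := by
    have i4 : Integrable (fun x => ε * (dInner h u u x * ‖w x‖ ^ 2 + dInner h w w x))
        vol[h] := (i2.add i3).const_mul ε
    rw [potential, dirichlet, ← integral_add i2 i3, ← integral_const_mul, ← integral_sub i2 i4]
    refine integral_mono (i2.sub i4) i1 fun x => ?_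
    by_cases hx : x ∈ O \ K
    · have := dInner_smul_sub_ge h (mdifferentiableAt_of_contMDiffOn hu.isOpen hu.contMDiffOn hx.1)
        ((hw.1 x).mdifferentiableAt (by simp)) (hε x hx.1 hx.2)
      rw [mul_comm (‖w x‖ ^ 2)] at this
      exact this
    · have h4 : x ∉ tsupport w := fun h' => hx (hw.2.2 h')
      have h5 : x ∉ tsupport (fun z => inner ℝ (w z) (w z) • (u z - c)) := fun h' => by
        refine h4 (closure_mono (fun z hz => ?_) h')
        intro h0
        simp [h0] at hz
      rw [dInner_eq_zero_of_notMem_tsupport h u h5]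
      simp [image_eq_zero_of_notMem_tsupport h4, dInner_eq_zero_of_notMem_tsupport h w h4]
  linarith

theorem dInner_smul_self_le {x : M} {f : M → ℝ} (h : SurfaceMetric M)
    (hf : DiffAt[ℝ] f x) (hw : DiffAt[F] w x) :
    dInner h (fun z => f z • w z) (fun z => f z • w z) x ≤
      2 * (f x ^ 2 * dInner h w w x) + 2 * (dInner h f f x * ‖w x‖ ^ 2) := by
  obtain ⟨f₁, f₂, hfr⟩ := exists_orthoFrame h x
  have hv : ∀ v, ‖cdiff (fun z => f z • w z) x v‖ ^ 2 ≤
      2 * (f x ^ 2 * ‖cdiff w x v‖ ^ 2) + 2 * (‖cdiff f x v‖ ^ 2 * ‖w x‖ ^ 2) := by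
    intro v
    rw [cdiff_smul_apply hf hw]
    have h1 := pow_le_pow_left₀ (norm_nonneg _)
      (norm_add_le (f x • cdiff w x v) (cdiff f x v • w x)) 2
    rw [norm_smul, norm_smul] at h1
    have h2 : (‖f x‖ * ‖cdiff w x v‖) ^ 2 = f x ^ 2 * ‖cdiff w x v‖ ^ 2 := by
      rw [mul_pow, Real.norm_eq_abs, sq_abs]
    have h3 := sq_nonneg (‖f x‖ * ‖cdiff w x v‖ - ‖cdiff f x v‖ * ‖w x‖)
    nlinarith
  rw [dInner, dInner, dInner, hfr.pairing_eq, hfr.pairing_eq, hfr.pairing_eq]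
  simp only [real_inner_self_eq_norm_sq]
  have h1 := hv f₁
  have h2 := hv f₂
  linarith

theorem continuous_dInner {w w' : M → F} (h : SurfaceMetric M)
    (hw : Smooth[F] w) (hw' : Smooth[F] w') : Continuous (dInner h w w') :=
  continuousOn_univ.1 (continuousOn_dInner h isOpen_univ hw.contMDiffOn hw'.contMDiffOn)

/-- Up to a term of order zero on a compact set, the potential is dominated by a quarter of the
Dirichlet energy. -/
theorem IsHarmonicOn.exists_potential_le (hu : IsHarmonicOn h u O)
    (hc : IsAlmostConstantAtEnd u O) : ∃ K ⊆ O, IsCompact K ∧ ∃ C : ℝ, 0 ≤ C ∧ ∀ w ∈ testFields F O,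
      potential h u w ≤ dirichlet h w / 4 + C * ∫ x in K, ‖w x‖ ^ 2 ∂vol[h] := by
  -- With `ε = 1 / 10` the potential off `K` is at most an eighth of the Dirichlet energy; the
  -- factor `2` lost to the cut-off makes this a quarter.
  obtain ⟨c, K, hKO, hK, hcK⟩ := hc (1 / 10) (by norm_num)
  obtain ⟨χ, hχ, hχc, hχO, hχ1, hχI⟩ := exists_cutoff hK hu.isOpen hKO
  obtain ⟨A, hA⟩ := hχc.isCompact.exists_bound_of_continuousOn
    ((continuousOn_dInner h hu.isOpen hu.contMDiffOn hu.contMDiffOn).mono hχO)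
  obtain ⟨B, hB⟩ := hχc.isCompact.exists_bound_of_continuousOn
    (continuous_dInner h hχ hχ).continuousOn
  have hmeas : MeasurableSet (tsupport χ) := (isClosed_tsupport χ).measurableSet
  refine ⟨tsupport χ, hχO, hχc, |A| + |B|, by positivity, fun w hw => ?_⟩
  have hψ : Smooth[ℝ] fun x => 1 - χ x := contMDiff_const.sub hχ
  have hw' : (fun x => (1 - χ x) • w x) ∈ testFields F (O \ K) := by
    refine ⟨hψ.smul hw.1, hw.2.1.smul_left (f := fun x => 1 - χ x), fun x hx => ⟨?_, fun hxK => ?_⟩⟩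
    · exact hw.2.2 (tsupport_smul_subset_right (fun x => 1 - χ x) w hx)
    · have h1 : ∀ᶠ y in 𝓝 x, χ y = 1 := hχ1.filter_mono (nhds_le_nhdsSet hxK)
      rw [← notMem_compl_iff] at hx
      refine hx ?_
      rw [mem_compl_iff, notMem_tsupport_iff_eventuallyEq]
      filter_upwards [h1] with y hy
      simp [hy]
  have h1 := hu.potential_le hK hcK hw'
  have i1 := integrable_potential (h := h) hu.isOpen hu.contMDiffOn hw
  have i2 := integrable_potential (h := h) hu.isOpen hu.contMDiffOn (w := fun x => (1 - χ x) • w x)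
    ⟨hw'.1, hw'.2.1, hw'.2.2.trans sdiff_subset⟩
  have i3 := integrable_dInner_self (h := h) hw
  have i4 := integrable_dInner_self (h := h) hw'
  have i5 := integrable_norm_sq (h := h) hw
  have i6 := i5.indicator hmeas
  have h2 : potential h u w ≤ potential h u (fun x => (1 - χ x) • w x) +
      |A| * ∫ x in tsupport χ, ‖w x‖ ^ 2 ∂vol[h] := by
    rw [← integral_indicator hmeas, potential, potential, ← integral_const_mul,
      ← integral_add i2 (i6.const_mul _)]
    refine integral_mono i1 (i2.add (i6.const_mul _)) fun x => ?_
    simp only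
    by_cases hx : x ∈ tsupport χ
    · rw [indicator_of_mem hx]
      have h3 := (le_abs_self _).trans ((hA x hx).trans (le_abs_self A))
      have h4 := mul_le_mul_of_nonneg_right h3 (sq_nonneg ‖w x‖)
      have h5 := mul_nonneg (dInner_self_nonneg h u x) (sq_nonneg ‖(1 - χ x) • w x‖)
      linarith
    · rw [indicator_of_notMem hx, image_eq_zero_of_notMem_tsupport hx]
      simp
  have h3 : dirichlet h (fun x => (1 - χ x) • w x) ≤
      2 * dirichlet h w + 2 * (|B| * ∫ x in tsupport χ, ‖w x‖ ^ 2 ∂vol[h]) := by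
    rw [← integral_indicator hmeas, dirichlet, dirichlet, ← integral_const_mul,
      ← integral_const_mul, ← integral_const_mul, ← integral_add (i3.const_mul _)
      ((i6.const_mul _).const_mul _)]
    refine integral_mono i4 ((i3.const_mul _).add ((i6.const_mul _).const_mul _)) fun x => ?_
    have h4 := dInner_smul_self_le h ((hψ x).mdifferentiableAt (by simp))
      ((hw.1 x).mdifferentiableAt (by simp))
    refine h4.trans ?_
    have h5 : (1 - χ x) ^ 2 ≤ 1 := by nlinarith [(hχI x).1, (hχI x).2]
    have h6 := mul_le_mul_of_nonneg_right h5 (dInner_self_nonneg h w x)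
    have h7 : dInner h (fun x => 1 - χ x) (fun x => 1 - χ x) x = dInner h χ χ x := by
      rw [dInner, dInner, cdiff_sub mdifferentiableAt_const ((hχ x).mdifferentiableAt (by simp)),
        cdiff_const, zero_sub, ← neg_one_smul ℝ, pairing_smul_left, pairing_smul_right]
      ring
    rw [h7]
    by_cases hx : x ∈ tsupport χ
    · rw [indicator_of_mem hx]
      have h8 := (le_abs_self _).trans ((hB x hx).trans (le_abs_self B))
      have h9 := mul_le_mul_of_nonneg_right h8 (sq_nonneg ‖w x‖)
      linarith
    · rw [indicator_of_notMem hx, dInner_eq_zero_of_notMem_tsupport h χ hx]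
      linarith
  have h4 : 0 ≤ |B| * ∫ x in tsupport χ, ‖w x‖ ^ 2 ∂vol[h] :=
    mul_nonneg (abs_nonneg _) (integral_nonneg fun x => sq_nonneg _)
  linarith

/-- A harmonic map of finite energy is almost constant near a puncture. -/
theorem IsHarmonicOn.isAlmostConstantAtEnd_puncture [CompactSpace M] {q : M}
    (hu : IsHarmonicOn h u {q}ᶜ) {φ : Chart[M]} {r : ℂ → ℝ}
    (hφ : IsConformalWith h φ r) (hq : q ∈ φ.source) : IsAlmostConstantAtEnd u {q}ᶜ := by
  intro ε hε
  obtain ⟨ρ, hρ, hball⟩ := Metric.isOpen_iff.1 φ.open_target _ (φ.map_source hq)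
  obtain ⟨c, T', hT', hc⟩ := (hu.isSphereHarmonicOn hφ).exists_norm_sub_le (z₀ := φ q) (σ := -1)
    (T := -Real.log ρ) (Or.inr rfl) (fun z hz hlt => by
      have h0 : 0 < ‖z - φ q‖ := norm_pos_iff.2 (sub_ne_zero.2 hz)
      have h1 : ‖z - φ q‖ < ρ := (Real.log_lt_log_iff h0 hρ).1 (by linarith)
      have h2 : z ∈ φ.target := hball (by rwa [mem_ball_iff_norm])
      refine ⟨h2, fun h3 => hz ?_⟩
      rw [← φ.right_inv h2, show φ.symm z = q from h3])
    (hu.integrableOn_energy hφ) hε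
  have hexp : Real.exp (-T') < ρ := by
    rw [← Real.exp_log hρ]
    exact Real.exp_lt_exp.2 (by linarith)
  set B := φ.source ∩ φ ⁻¹' Metric.ball (φ q) (Real.exp (-T')) with hB
  have hBo : IsOpen B := φ.isOpen_inter_preimage Metric.isOpen_ball
  refine ⟨c, Bᶜ, ?_, hBo.isClosed_compl.isCompact, fun x hx hxB => ?_⟩
  · rw [compl_subset_compl, singleton_subset_iff]
    exact ⟨hq, Metric.mem_ball_self (Real.exp_pos _)⟩
  · rw [notMem_compl_iff] at hxB
    have hne : φ x ≠ φ q := fun h1 => hx (φ.injOn hxB.1 hq h1)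
    have h1 := hc (φ x) hne (by
      have h2 : ‖φ x - φ q‖ < Real.exp (-T') := mem_ball_iff_norm.1 hxB.2
      have h3 := Real.log_lt_log (norm_pos_iff.2 (sub_ne_zero.2 hne)) h2
      rw [Real.log_exp] at h3
      linarith)
    simpa [φ.left_inv hxB.1] using h1

/-- A harmonic map of finite energy from the plane is almost constant near infinity. -/
theorem IsHarmonicOn.isAlmostConstantAtEnd_plane {v : ℂ → F}
    (hv : IsHarmonicOn flatMetric v univ) : IsAlmostConstantAtEnd v univ := by
  intro ε hε
  obtain ⟨c, T', -, hc⟩ := (hv.isSphereHarmonicOn isConformalWith_refl).exists_norm_sub_le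
    (z₀ := 0) (σ := 1) (T := 0) (Or.inl rfl) (fun z _ _ => by simp)
    (hv.integrableOn_energy isConformalWith_refl) hε
  refine ⟨c, Metric.closedBall 0 (Real.exp T'), subset_univ _, isCompact_closedBall _ _,
    fun z _ hz => ?_⟩
  rw [mem_closedBall_zero_iff, not_le] at hz
  refine hc z (fun h0 => ?_) ?_
  · rw [h0, norm_zero] at hz
    exact (Real.exp_pos T').not_gt hz
  · rw [sub_zero, one_mul, ← Real.log_exp T']
    exact Real.log_lt_log (Real.exp_pos _) hz

end Potential

/-! ### The Poincaré inequality on convex sets -/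

section Poincare

variable [CompleteSpace F]
variable {f : ℂ → F} {S : Set ℂ} {D : ℝ}

/-- Only the half of the segment from the midpoint to `y` is used. There the ratio `t` is at least
`1 / 2`, so the homotheties with centre `x` have Jacobian bounded below; on the whole segment `t`
would come down to `0`. -/
theorem norm_sub_midpoint_sq_le (hf : ContDiff ℝ 1 f) {x y : ℂ} (hD : ‖y - x‖ ≤ D) :
    ‖f y - f (x + (1 / 2 : ℝ) • (y - x))‖ ^ 2 ≤
      D ^ 2 / 2 * ∫ t in (1 / 2 : ℝ)..1, ‖fderiv ℝ f (x + t • (y - x))‖ ^ 2 := by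
  have hc : Continuous fun t : ℝ => fderiv ℝ f (x + t • (y - x)) :=
    (hf.continuous_fderiv one_ne_zero).comp (by fun_prop)
  have hd : ∀ t : ℝ, HasDerivAt (fun t : ℝ => f (x + t • (y - x)))
      (fderiv ℝ f (x + t • (y - x)) (y - x)) t := by
    intro t
    have h1 : HasDerivAt (fun t : ℝ => x + t • (y - x)) (y - x) t := by
      simpa using ((hasDerivAt_id t).smul_const (y - x)).const_add x
    exact ((hf.differentiable one_ne_zero _).hasFDerivAt).comp_hasDerivAt t h1
  have h2 := intervalIntegral.integral_eq_sub_of_hasDerivAt (a := 1 / 2) (b := 1)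
    (fun t _ => hd t) ((hc.clm_apply continuous_const).intervalIntegrable _ _)
  rw [one_smul, add_sub_cancel] at h2
  have hn : IntervalIntegrable (fun t : ℝ => ‖fderiv ℝ f (x + t • (y - x))‖) volume (1 / 2) 1 :=
    hc.norm.intervalIntegrable _ _
  have h3 : ‖f y - f (x + (1 / 2 : ℝ) • (y - x))‖ ≤
      ∫ t in (1 / 2 : ℝ)..1, D * ‖fderiv ℝ f (x + t • (y - x))‖ := by
    rw [← h2]
    refine (intervalIntegral.norm_integral_le_integral_norm (by norm_num)).trans
      (intervalIntegral.integral_mono_on (by norm_num)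
        ((hc.clm_apply continuous_const).norm.intervalIntegrable _ _) (hn.const_mul D) fun t _ => ?_)
    refine (ContinuousLinearMap.le_opNorm _ _).trans ?_
    rw [mul_comm]
    exact mul_le_mul_of_nonneg_right hD (norm_nonneg _)
  set I := ∫ t in (1 / 2 : ℝ)..1, ‖fderiv ℝ f (x + t • (y - x))‖ with hI
  set J := ∫ t in (1 / 2 : ℝ)..1, ‖fderiv ℝ f (x + t • (y - x))‖ ^ 2 with hJ
  rw [intervalIntegral.integral_const_mul, ← hI] at h3
  have h4 : 2 * I ^ 2 ≤ J := by
    have h5 : ∫ t in (1 / 2 : ℝ)..1, (4 * I * ‖fderiv ℝ f (x + t • (y - x))‖ - 4 * I ^ 2) ≤ J := by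
      refine intervalIntegral.integral_mono_on (by norm_num)
        ((hn.const_mul _).sub (by simp)) ((hc.norm.pow 2).intervalIntegrable _ _) fun t _ => ?_
      nlinarith [sq_nonneg (‖fderiv ℝ f (x + t • (y - x))‖ - 2 * I)]
    rw [intervalIntegral.integral_sub (hn.const_mul _) (by simp),
      intervalIntegral.integral_const_mul, ← hI, intervalIntegral.integral_const] at h5
    norm_num at h5
    nlinarith
  have h5 := pow_le_pow_left₀ (norm_nonneg _) h3 2
  have h6 := mul_le_mul_of_nonneg_left h4 (sq_nonneg D)
  nlinarith

/-- The homothety maps the convex set into itself, and its Jacobian `t²` is at least `1 / 4`. -/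
theorem setLIntegral_homothety_le (hS : Convex ℝ S) (hm : MeasurableSet S) (G : ℂ → ℝ≥0∞)
    {x : ℂ} (hx : x ∈ S) {t : ℝ} (ht : t ∈ Ioc (1 / 2 : ℝ) 1) :
    ∫⁻ y in S, G (x + t • (y - x)) ≤ 4 * ∫⁻ y in S, G y := by
  have ht0 : (0 : ℝ) < t := by linarith [ht.1]
  have hd : ∀ y ∈ S, HasFDerivWithinAt (fun y => x + t • (y - x))
      (t • ContinuousLinearMap.id ℝ ℂ) S y := fun y _ =>
    ((((hasFDerivAt_id y).sub_const x).const_smul t).const_add x).hasFDerivWithinAt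
  have hinj : InjOn (fun y : ℂ => x + t • (y - x)) S := fun a _ b _ hab => by
    have := smul_right_injective ℂ ht0.ne' (add_left_cancel hab)
    simpa using this
  have h1 := lintegral_image_eq_lintegral_abs_det_fderiv_mul volume hm hd hinj G
  have hdet : (t • ContinuousLinearMap.id ℝ ℂ).det = t ^ 2 := by
    rw [det_eq_re_im]; simp [pow_two]
  have hsub : (fun y : ℂ => x + t • (y - x)) '' S ⊆ S := by
    rintro _ ⟨y, hy, rfl⟩
    have := hS hx hy (a := 1 - t) (b := t) (by linarith [ht.2]) ht0.le (by ring)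
    convert! this using 1
    module
  simp only [hdet, abs_of_nonneg (sq_nonneg t)] at h1
  have h2 : ∫⁻ y in S, G (x + t • (y - x)) ≤
      4 * ∫⁻ y in S, ofReal (t ^ 2) * G (x + t • (y - x)) := by
    rw [← lintegral_const_mul' _ _ (by norm_num)]
    refine lintegral_mono fun y => ?_
    rw [← mul_assoc]
    refine le_mul_of_one_le_left zero_le ?_
    rw [show (4 : ℝ≥0∞) = ofReal 4 by simp, ← ENNReal.ofReal_mul (by norm_num),
      ← ENNReal.ofReal_one]
    exact ENNReal.ofReal_le_ofReal (by nlinarith [ht.1])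
  exact h2.trans (mul_le_mul_right (h1 ▸ lintegral_mono_set hsub) 4)

/-- The Poincaré inequality on a bounded convex set. -/
theorem poincare_of_convex (hf : ContDiff ℝ 1 f) (hS : Convex ℝ S) (hm : MeasurableSet S)
    (hb : Bornology.IsBounded S) (hD : ∀ x ∈ S, ∀ y ∈ S, ‖y - x‖ ≤ D) (h0 : ∫ y in S, f y = 0) :
    ∫⁻ y in S, ofReal (‖f y‖ ^ 2) ≤
      ofReal (4 * D ^ 2) * ∫⁻ y in S, ofReal (‖fderiv ℝ f y‖ ^ 2) := by
  have hfin : volume S ≠ ⊤ := hb.measure_lt_top.ne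
  rcases eq_or_ne (volume S) 0 with hS0 | hS0
  · rw [setLIntegral_measure_zero _ _ hS0]; exact zero_le
  have hD' : Continuous (fderiv ℝ f) := hf.continuous_fderiv one_ne_zero
  set G : ℂ → ℝ≥0∞ := fun z => ofReal (‖fderiv ℝ f z‖ ^ 2) with hG
  have hGm : Continuous G := ENNReal.continuous_ofReal.comp (hD'.norm.pow 2)
  have hint : ∀ g : ℂ → ℝ, Continuous g → IntegrableOn g S := fun g hg =>
    (hg.continuousOn.integrableOn_compact hb.isCompact_closure).mono_set subset_closure
  have i1 : IntegrableOn f S :=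
    (hf.continuous.continuousOn.integrableOn_compact hb.isCompact_closure).mono_set subset_closure
  -- The mean of `f` vanishes, so the cross term in `‖f x - f y‖²` integrates to zero over `y`.
  have key : ∀ x ∈ S, volume S * ofReal (‖f x‖ ^ 2) ≤ ∫⁻ y in S, ofReal (‖f x - f y‖ ^ 2) := by
    intro x _
    have i2 := hint (fun y => ‖f y‖ ^ 2) (hf.continuous.norm.pow 2)
    have i3 := hint (fun y => inner ℝ (f x) (f y)) (continuous_const.inner hf.continuous)
    have i4 : IntegrableOn (fun _ : ℂ => ‖f x‖ ^ 2) S := hint _ continuous_const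
    have i5 : IntegrableOn (fun y => ‖f x‖ ^ 2 - 2 * inner ℝ (f x) (f y)) S :=
      i4.sub (i3.const_mul 2)
    have h1 : volume.real S * ‖f x‖ ^ 2 ≤ ∫ y in S, ‖f x - f y‖ ^ 2 := by
      simp only [norm_sub_sq_real]
      rw [integral_add i5 i2, integral_sub i4 (i3.const_mul 2), integral_const_mul,
        integral_inner i1, h0, inner_zero_right, setIntegral_const, smul_eq_mul]
      have : 0 ≤ ∫ y in S, ‖f y‖ ^ 2 := integral_nonneg fun _ => sq_nonneg _
      linarith
    rw [← ofReal_integral_eq_lintegral_ofReal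
      (hint (fun y => ‖f x - f y‖ ^ 2) ((continuous_const.sub hf.continuous).norm.pow 2))
      (ae_of_all _ fun _ => sq_nonneg _)]
    refine le_trans (le_of_eq ?_) (ENNReal.ofReal_le_ofReal h1)
    rw [ENNReal.ofReal_mul measureReal_nonneg, ofReal_measureReal hfin]
  -- The midpoint is symmetric in `x` and `y`, so both halves of the segment contribute the same
  -- double integral.
  set mid : ℂ → ℂ → ℂ := fun x y => x + (1 / 2 : ℝ) • (y - x) with hmid
  have hmids : ∀ x y, mid x y = mid y x := fun x y => by simp only [hmid]; module
  have hE : ∫⁻ x in S, ∫⁻ y in S, ofReal (‖f y - f (mid x y)‖ ^ 2) ≤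
      ofReal (D ^ 2) * (volume S * ∫⁻ y in S, G y) := by
    have h1 : ∀ x ∈ S, ∫⁻ y in S, ofReal (‖f y - f (mid x y)‖ ^ 2) ≤
        ofReal (D ^ 2) * ∫⁻ y in S, G y := by
      intro x hx
      have h2 : ∀ y ∈ S, ofReal (‖f y - f (mid x y)‖ ^ 2) ≤
          ofReal (D ^ 2 / 2) * ∫⁻ t in Ioc (1 / 2 : ℝ) 1, G (x + t • (y - x)) := by
        intro y hy
        have h3 := norm_sub_midpoint_sq_le hf (hD x hx y hy)
        refine (ENNReal.ofReal_le_ofReal h3).trans (le_of_eq ?_)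
        have hc : Continuous fun t : ℝ => ‖fderiv ℝ f (x + t • (y - x))‖ ^ 2 :=
          (hD'.comp (by fun_prop : Continuous fun t : ℝ => x + t • (y - x))).norm.pow 2
        rw [ENNReal.ofReal_mul (by positivity), intervalIntegral.integral_of_le (by norm_num),
          ofReal_integral_eq_lintegral_ofReal (hc.integrableOn_Ioc)
          (ae_of_all _ fun _ => sq_nonneg _)]
      calc ∫⁻ y in S, ofReal (‖f y - f (mid x y)‖ ^ 2) ≤ ∫⁻ y in S, ofReal (D ^ 2 / 2) *
              ∫⁻ t in Ioc (1 / 2 : ℝ) 1, G (x + t • (y - x)) := setLIntegral_mono' hm h2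
        _ = ofReal (D ^ 2 / 2) * ∫⁻ t in Ioc (1 / 2 : ℝ) 1, ∫⁻ y in S, G (x + t • (y - x)) := by
            rw [lintegral_const_mul' _ _ ENNReal.ofReal_ne_top, lintegral_lintegral_swap]
            exact (hGm.comp (by fun_prop :
              Continuous fun q : ℂ × ℝ => x + q.2 • (q.1 - x))).measurable.aemeasurable
        _ ≤ ofReal (D ^ 2 / 2) * ∫⁻ t in Ioc (1 / 2 : ℝ) 1, 4 * ∫⁻ y in S, G y := by
            refine mul_le_mul_right (setLIntegral_mono' measurableSet_Ioc fun t ht => ?_) _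
            exact setLIntegral_homothety_le hS hm G hx ht
        -- `D² / 2` from the segment, `1 / 2` from the length of the interval of `t`, and `4` from
        -- the Jacobian.
        _ = ofReal (D ^ 2) * ∫⁻ y in S, G y := by
            rw [setLIntegral_const, Real.volume_Ioc, mul_comm (4 * _), ← mul_assoc, ← mul_assoc]
            congr 1
            rw [show (4 : ℝ≥0∞) = ofReal 4 by simp, mul_assoc,
              ← ENNReal.ofReal_mul (by norm_num), ← ENNReal.ofReal_mul (by positivity)]
            congr 1
            ring
    refine (setLIntegral_mono' hm h1).trans (le_of_eq ?_)
    rw [setLIntegral_const]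
    ring
  have hmc : Continuous fun q : ℂ × ℂ => mid q.1 q.2 := by fun_prop
  have hm1 : Measurable fun q : ℂ × ℂ => ofReal (‖f q.1 - f (mid q.1 q.2)‖ ^ 2) :=
    (ENNReal.continuous_ofReal.comp ((((hf.continuous.comp continuous_fst).sub
      (hf.continuous.comp hmc)).norm).pow 2)).measurable
  have hE' : ∫⁻ x in S, ∫⁻ y in S, ofReal (‖f x - f (mid x y)‖ ^ 2) =
      ∫⁻ x in S, ∫⁻ y in S, ofReal (‖f y - f (mid x y)‖ ^ 2) := by
    rw [lintegral_lintegral_swap hm1.aemeasurable]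
    simp only [hmids]
  have hall : volume S * ∫⁻ x in S, ofReal (‖f x‖ ^ 2) ≤
      volume S * (ofReal (4 * D ^ 2) * ∫⁻ y in S, G y) := by
    calc volume S * ∫⁻ x in S, ofReal (‖f x‖ ^ 2) = ∫⁻ x in S, volume S * ofReal (‖f x‖ ^ 2) :=
          (lintegral_const_mul' _ _ hfin).symm
      _ ≤ ∫⁻ x in S, ∫⁻ y in S, ofReal (‖f x - f y‖ ^ 2) := setLIntegral_mono' hm key
      _ ≤ ∫⁻ x in S, ∫⁻ y in S, (2 * ofReal (‖f x - f (mid x y)‖ ^ 2) +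
            2 * ofReal (‖f y - f (mid x y)‖ ^ 2)) := by
          refine lintegral_mono fun x => lintegral_mono fun y => ?_
          rw [show (2 : ℝ≥0∞) = ofReal 2 by simp, ← ENNReal.ofReal_mul (by norm_num),
            ← ENNReal.ofReal_mul (by norm_num), ← ENNReal.ofReal_add (by positivity)
            (by positivity)]
          refine ENNReal.ofReal_le_ofReal ?_
          have h1 := norm_sub_le (f x - f (mid x y)) (f y - f (mid x y))
          rw [sub_sub_sub_cancel_right] at h1
          have h2 := pow_le_pow_left₀ (norm_nonneg _) h1 2
          nlinarith [sq_nonneg (‖f x - f (mid x y)‖ - ‖f y - f (mid x y)‖)]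
      _ = 2 * (∫⁻ x in S, ∫⁻ y in S, ofReal (‖f x - f (mid x y)‖ ^ 2)) +
            2 * ∫⁻ x in S, ∫⁻ y in S, ofReal (‖f y - f (mid x y)‖ ^ 2) := by
          have e1 : ∀ x, ∫⁻ y in S, (2 * ofReal (‖f x - f (mid x y)‖ ^ 2) +
              2 * ofReal (‖f y - f (mid x y)‖ ^ 2)) =
              2 * (∫⁻ y in S, ofReal (‖f x - f (mid x y)‖ ^ 2)) +
              2 * ∫⁻ y in S, ofReal (‖f y - f (mid x y)‖ ^ 2) := fun x => by
            rw [lintegral_add_left (Measurable.const_mul (show Measurable fun y =>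
                ofReal (‖f x - f (mid x y)‖ ^ 2) from hm1.comp measurable_prodMk_left) 2),
              lintegral_const_mul' _ _ (by norm_num), lintegral_const_mul' _ _ (by norm_num)]
          simp only [e1]
          rw [lintegral_add_left (hm1.lintegral_prod_right'.const_mul 2),
            lintegral_const_mul' _ _ (by norm_num), lintegral_const_mul' _ _ (by norm_num)]
      _ ≤ 4 * (ofReal (D ^ 2) * (volume S * ∫⁻ y in S, G y)) := by
          rw [hE', ← two_mul, ← mul_assoc, show (2 : ℝ≥0∞) * 2 = 4 by norm_num]
          exact mul_le_mul_right hE 4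
      _ = _ := by
          rw [ENNReal.ofReal_mul (by norm_num), show ofReal 4 = 4 by simp]
          ring
  exact (ENNReal.mul_le_mul_iff_right hS0 hfin).1 hall

end Poincare

/-! ### Smallness of the L² norm on subspaces of finite codimension -/

section FiniteRank

/-- The square of side `s` of the standard grid that contains `z`. -/
def gridCell (s : ℝ) (z : ℂ) : ℤ × ℤ := (⌊z.re / s⌋, ⌊z.im / s⌋)

theorem setOf_floor_div_eq {s : ℝ} (hs : 0 < s) (a : ℤ) :
    {x : ℝ | ⌊x / s⌋ = a} = Ico (a * s) ((a + 1) * s) := by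
  ext x
  rw [mem_ofPred_eq, Int.floor_eq_iff, mem_Ico, le_div_iff₀ hs, div_lt_iff₀ hs]

theorem gridCell_preimage {s : ℝ} (hs : 0 < s) (j : ℤ × ℤ) :
    gridCell s ⁻¹' {j} = Complex.re ⁻¹' Ico (j.1 * s) ((j.1 + 1) * s) ∩
      Complex.im ⁻¹' Ico (j.2 * s) ((j.2 + 1) * s) := by
  rw [← setOf_floor_div_eq hs, ← setOf_floor_div_eq hs]
  ext z
  simp [gridCell, Prod.ext_iff]

theorem measurableSet_gridCell {s : ℝ} (hs : 0 < s) (j : ℤ × ℤ) :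
    MeasurableSet (gridCell s ⁻¹' {j}) := by
  rw [gridCell_preimage hs]
  exact (Complex.measurable_re measurableSet_Ico).inter (Complex.measurable_im measurableSet_Ico)

theorem convex_gridCell {s : ℝ} (hs : 0 < s) (j : ℤ × ℤ) : Convex ℝ (gridCell s ⁻¹' {j}) := by
  rw [gridCell_preimage hs]
  exact ((convex_Ico _ _).linear_preimage Complex.reLm).inter
    ((convex_Ico _ _).linear_preimage Complex.imLm)

theorem norm_sub_le_of_gridCell {s : ℝ} (hs : 0 < s) {j : ℤ × ℤ} {x y : ℂ}
    (hx : x ∈ gridCell s ⁻¹' {j}) (hy : y ∈ gridCell s ⁻¹' {j}) : ‖y - x‖ ≤ 2 * s := by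
  rw [gridCell_preimage hs] at hx hy
  obtain ⟨⟨h1, h2⟩, h3, h4⟩ := hx
  obtain ⟨⟨h5, h6⟩, h7, h8⟩ := hy
  refine (Complex.norm_le_abs_re_add_abs_im _).trans ?_
  rw [Complex.sub_re, Complex.sub_im]
  have e1 : |y.re - x.re| ≤ s := abs_le.2 ⟨by linarith, by linarith⟩
  have e2 : |y.im - x.im| ≤ s := abs_le.2 ⟨by linarith, by linarith⟩
  linarith

theorem finite_gridCell_image {s : ℝ} (hs : 0 < s) {B : Set ℂ} (hB : Bornology.IsBounded B) :
    (gridCell s '' B).Finite := by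
  obtain ⟨R, hR⟩ := hB.exists_norm_le
  refine ((finite_Icc ⌊-R / s⌋ ⌊R / s⌋).prod (finite_Icc ⌊-R / s⌋ ⌊R / s⌋)).subset ?_
  rintro _ ⟨z, hz, rfl⟩
  have h1 := abs_le.1 ((Complex.abs_re_le_norm z).trans (hR z hz))
  have h2 := abs_le.1 ((Complex.abs_im_le_norm z).trans (hR z hz))
  refine ⟨⟨Int.floor_le_floor ?_, Int.floor_le_floor ?_⟩,
    Int.floor_le_floor ?_, Int.floor_le_floor ?_⟩ <;>
  exact div_le_div_of_nonneg_right (by linarith) hs.le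

variable [CompleteSpace F]

/-- If the averages of `f` over the cells of the ball vanish, then `f` is controlled by its
derivative. -/
theorem setLIntegral_le_of_gridCell_integral_eq_zero {f : ℂ → F} (hf : ContDiff ℝ 1 f) {s r : ℝ}
    (hs : 0 < s) {y₀ : ℂ} (h0 : ∀ j ∈ gridCell s '' Metric.ball y₀ r,
      ∫ y in Metric.ball y₀ r ∩ gridCell s ⁻¹' {j}, f y = 0) :
    ∫⁻ y in Metric.ball y₀ r, ofReal (‖f y‖ ^ 2) ≤ ofReal (16 * s ^ 2) *
      ∫⁻ y in Metric.ball y₀ r, ofReal (‖fderiv ℝ f y‖ ^ 2) := by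
  set B := Metric.ball y₀ r with hB
  have hfin := finite_gridCell_image hs (Metric.isBounded_ball (x := y₀) (r := r))
  set J := hfin.toFinset with hJ
  have hcover : B = ⋃ j ∈ J, B ∩ gridCell s ⁻¹' {j} := by
    ext z
    simp only [mem_iUnion, hJ, Finite.mem_toFinset, mem_inter_iff, exists_prop]
    exact ⟨fun hz => ⟨gridCell s z, mem_image_of_mem _ hz, hz, rfl⟩, fun ⟨_, _, hz, _⟩ => hz⟩
  have hm : ∀ j ∈ J, MeasurableSet (B ∩ gridCell s ⁻¹' {j}) := fun j _ =>
    measurableSet_ball.inter (measurableSet_gridCell hs j)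
  have hd : Set.PairwiseDisjoint (↑J : Set (ℤ × ℤ)) fun j => B ∩ gridCell s ⁻¹' {j} := by
    intro j _ j' _ hne
    refine disjoint_left.2 fun z hz hz' => hne ?_
    rw [← show gridCell s z = j from hz.2, ← show gridCell s z = j' from hz'.2]
  have hsplit : ∀ G : ℂ → ℝ≥0∞, ∫⁻ y in B, G y =
      ∑ j ∈ J, ∫⁻ y in B ∩ gridCell s ⁻¹' {j}, G y := fun G => by
    conv_lhs => rw [hcover]
    exact lintegral_biUnion_finset hd hm G
  rw [hsplit, hsplit, Finset.mul_sum]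
  refine Finset.sum_le_sum fun j hj => ?_
  -- The cells have diameter at most `2 s`, and `4 (2 s)² = 16 s²`.
  have h1 := poincare_of_convex hf ((convex_ball y₀ r).inter (convex_gridCell hs j)) (hm j hj)
    (Metric.isBounded_ball.subset inter_subset_left) (D := 2 * s)
    (fun x hx y hy => norm_sub_le_of_gridCell hs hx.2 hy.2) (h0 j (hfin.mem_toFinset.1 hj))
  refine h1.trans (le_of_eq ?_)
  congr 2
  ring

variable [MeasurableSpace M] [BorelSpace M] [SecondCountableTopology M] [T2Space M]
variable {h : SurfaceMetric M} {φ : Chart[M]} {O : Set M}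

theorem IsSmoothChart.setLIntegral_preimage (hφ : IsSmoothChart φ) (h : SurfaceMetric M)
    {g : M → ℝ≥0∞} (hg : AEMeasurable g vol[h]) {S : Set ℂ} (hS : MeasurableSet S)
    (hSt : S ⊆ φ.target) : ∫⁻ x in φ.source ∩ φ ⁻¹' S, g x ∂vol[h] =
      ∫⁻ y in S, ofReal (chartDensity h φ y) * g (φ.symm y) := by
  have hm := measurableSet_source_inter_preimage φ hS
  have h1 := hφ.setLIntegral_source h (hg.indicator hm)
  rw [lintegral_indicator hm, Measure.restrict_restrict hm,
    inter_eq_self_of_subset_left inter_subset_left] at h1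
  have h2 : ∫⁻ y in S, ofReal (chartDensity h φ y) * g (φ.symm y) = ∫⁻ y in φ.target,
      S.indicator (fun y => ofReal (chartDensity h φ y) * g (φ.symm y)) y := by
    rw [lintegral_indicator hS, Measure.restrict_restrict hS, inter_eq_self_of_subset_left hSt]
  rw [h1, h2]
  refine setLIntegral_congr_fun φ.open_target.measurableSet fun y hy => ?_
  by_cases hyS : y ∈ S
  · simp only [indicator_of_mem hyS]
    rw [indicator_of_mem (show φ.symm y ∈ φ.source ∩ φ ⁻¹' S from
      ⟨φ.map_target hy, by rwa [mem_preimage, φ.right_inv hy]⟩)]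
  · simp only [indicator_of_notMem hyS]
    rw [indicator_of_notMem, mul_zero]
    rintro ⟨-, h2⟩
    rw [mem_preimage, φ.right_inv hy] at h2
    exact hyS h2

/-- `L` records the integrals over the finitely many grid cells that meet the ball. On its kernel
the Poincaré inequality holds cell by cell with a constant of order `s²`, and the mesh `s` is free.
-/
theorem exists_linearMap_of_ball (h : SurfaceMetric M) (hφ : IsSmoothChart φ) {y₀ : ℂ} {r : ℝ}
    (hr : Metric.closedBall y₀ r ⊆ φ.target) {ε : ℝ} (hε : 0 < ε) :
    ∃ J : Finset (ℤ × ℤ), ∃ L : testFields F (univ : Set M) →ₗ[ℝ] (J → F),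
      ∀ w, L w = 0 → ∫⁻ x in φ.source ∩ φ ⁻¹' Metric.ball y₀ r,
        ofReal (‖(w : M → F) x‖ ^ 2) ∂vol[h] ≤ ofReal (ε * dirichlet h (w : M → F)) := by
  have hK := isCompact_closedBall y₀ r
  obtain ⟨C, hC, hcomp⟩ := hφ.exists_comparison (F := F) h hK hr
  -- `C` enters once for the volume density on the left, and twice on the right, for the comparison
  -- of the Euclidean derivative with `dInner` and for the density again.
  set s := √(ε / (16 * C ^ 3)) with hs
  have hs0 : 0 < s := Real.sqrt_pos.2 (by positivity)
  have hs2 : 16 * s ^ 2 * C ^ 3 = ε := by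
    rw [hs, Real.sq_sqrt (by positivity)]; field_simp
  set B := Metric.ball y₀ r with hB
  have hBK : B ⊆ Metric.closedBall y₀ r := Metric.ball_subset_closedBall
  have hfin := finite_gridCell_image hs0 (Metric.isBounded_ball (x := y₀) (r := r))
  have hsm : ∀ w ∈ testFields F (univ : Set M), ContDiffOn ℝ ∞ (fun y => w (φ.symm y)) φ.target :=
    fun w hw => by
      have := hφ.contDiffOn_comp_symm (u := w) (O := univ) hw.1.contMDiffOn
      rwa [preimage_univ, inter_univ] at this
  have hi : ∀ w ∈ testFields F (univ : Set M), ∀ S ⊆ B,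
      IntegrableOn (fun y => w (φ.symm y)) S := fun w hw S hS =>
    (((hsm w hw).continuousOn.mono hr).integrableOn_compact hK).mono_set (hS.trans hBK)
  refine ⟨hfin.toFinset,
    { toFun := fun w j => ∫ y in B ∩ gridCell s ⁻¹' {j.1}, (w : M → F) (φ.symm y)
      map_add' := fun w w' => by
        ext j
        exact integral_add (hi _ w.2 _ inter_subset_left) (hi _ w'.2 _ inter_subset_left)
      map_smul' := fun c w => by
        ext j
        exact integral_smul c _ }, fun w hw => ?_⟩
  obtain ⟨θ, hθ, hθc, hθt, hθ1, -⟩ := exists_cutoff hK φ.open_target hr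
  have hf : ContDiff ℝ ∞ fun y => θ y • (w : M → F) (φ.symm y) :=
    contDiff_smul_of_tsupport_subset φ.open_target hθ.contDiff hθt (hsm _ w.2)
  have hθB : ∀ y ∈ B, θ y • (w : M → F) (φ.symm y) = (w : M → F) (φ.symm y) := fun y hy => by
    rw [hθ1.self_of_nhdsSet y (hBK hy), one_smul]
  have h1 := setLIntegral_le_of_gridCell_integral_eq_zero
    (hf.of_le (m := 1) (by exact_mod_cast le_top)) hs0 (y₀ := y₀) (r := r) fun j hj => by
      rw [setIntegral_congr_fun (g := fun y => (w : M → F) (φ.symm y))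
        (measurableSet_ball.inter (measurableSet_gridCell hs0 j)) fun y hy => hθB y hy.1]
      exact congrFun hw ⟨j, hfin.mem_toFinset.2 hj⟩
  have hmeas : Measurable fun x => ofReal (‖(w : M → F) x‖ ^ 2) :=
    (ENNReal.continuous_ofReal.comp (w.2.1.continuous.norm.pow 2)).measurable
  have hmeas' : Measurable fun x => ofReal (dInner h (w : M → F) w x) :=
    (ENNReal.continuous_ofReal.comp (continuous_dInner h w.2.1 w.2.1)).measurable
  calc ∫⁻ x in φ.source ∩ φ ⁻¹' B, ofReal (‖(w : M → F) x‖ ^ 2) ∂vol[h]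
      = ∫⁻ y in B, ofReal (chartDensity h φ y) * ofReal (‖(w : M → F) (φ.symm y)‖ ^ 2) :=
        hφ.setLIntegral_preimage h hmeas.aemeasurable measurableSet_ball (hBK.trans hr)
    _ ≤ ∫⁻ y in B, ofReal C * ofReal (‖θ y • (w : M → F) (φ.symm y)‖ ^ 2) := by
        refine setLIntegral_mono' measurableSet_ball fun y hy => ?_
        rw [hθB y hy]
        exact mul_le_mul_left (ENNReal.ofReal_le_ofReal (hcomp y (hBK hy)).1) _
    _ ≤ ofReal C * (ofReal (16 * s ^ 2) * ∫⁻ y in B,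
          ofReal (‖fderiv ℝ (fun y => θ y • (w : M → F) (φ.symm y)) y‖ ^ 2)) := by
        rw [lintegral_const_mul' _ _ ENNReal.ofReal_ne_top]
        exact mul_le_mul_right h1 _
    _ ≤ ofReal C * (ofReal (16 * s ^ 2) * ∫⁻ y in B, ofReal (C ^ 2) * (ofReal (chartDensity h φ y) *
            ofReal (dInner h (w : M → F) w (φ.symm y)))) := by
        refine mul_le_mul_right (mul_le_mul_right
          (setLIntegral_mono' measurableSet_ball fun y hy => ?_) _) _
        obtain ⟨-, c2, c3⟩ := hcomp y (hBK hy)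
        rw [fderiv_congr_of_eqOn Metric.isOpen_ball hθB hy, hφ.fderiv_comp_symm_eq_cdiff
          (hr (hBK hy)) ((w.2.1 _).mdifferentiableAt (by simp)),
          ← ENNReal.ofReal_mul (hφ.chartDensity_pos h (hr (hBK hy))).le, ← ENNReal.ofReal_mul (by positivity)]
        refine ENNReal.ofReal_le_ofReal ((c3 _).2.trans ?_)
        have h2 := mul_le_mul_of_nonneg_right c2 (mul_nonneg hC.le
          (dInner_self_nonneg h (w : M → F) (φ.symm y)))
        calc C * dInner h (w : M → F) w (φ.symm y)
            ≤ C * chartDensity h φ y * (C * dInner h (w : M → F) w (φ.symm y)) := by linarith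
          _ = _ := by ring
    _ = ofReal ε * ∫⁻ x in φ.source ∩ φ ⁻¹' B, ofReal (dInner h (w : M → F) w x) ∂vol[h] := by
        rw [hφ.setLIntegral_preimage h hmeas'.aemeasurable measurableSet_ball (hBK.trans hr),
          lintegral_const_mul' _ _ ENNReal.ofReal_ne_top, ← mul_assoc, ← mul_assoc,
          ← ENNReal.ofReal_mul hC.le, ← ENNReal.ofReal_mul (by positivity)]
        congr 2
        rw [← hs2]; ring
    _ ≤ ofReal ε * ofReal (dirichlet h (w : M → F)) := by
        refine mul_le_mul_right ?_ _
        rw [dirichlet, ofReal_integral_eq_lintegral_ofReal (integrable_dInner_self w.2)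
          (ae_of_all _ fun x => dInner_self_nonneg h _ x)]
        exact setLIntegral_le_lintegral _ _
    _ = ofReal (ε * dirichlet h (w : M → F)) := (ENNReal.ofReal_mul hε.le).symm

theorem dirichlet_nonneg (h : SurfaceMetric M) (w : M → F) : 0 ≤ dirichlet h w :=
  integral_nonneg fun x => dInner_self_nonneg h w x

theorem lintegral_biUnion_finset_le {X ι : Type*} [MeasurableSpace X] {μ : Measure X}
    (t : Finset ι) (B : ι → Set X) (g : X → ℝ≥0∞) :
    ∫⁻ x in ⋃ i ∈ t, B i, g x ∂μ ≤ ∑ i ∈ t, ∫⁻ x in B i, g x ∂μ := by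
  classical
  induction t using Finset.induction_on with
  | empty => simp
  | insert a t ha ih =>
    rw [Finset.set_biUnion_insert, Finset.sum_insert ha]
    exact (lintegral_union_le g _ _).trans (by gcongr)

/-- Rank–nullity; `N` is the total dimension of the targets and does not depend on `W`. -/
theorem exists_ne_zero_forall_eq_zero {V : Type*} [AddCommGroup V] [Module ℝ V]
    {P : Submodule ℝ V} {ι : Type*} (t : Finset ι) {E : ι → Type*} [∀ i, AddCommGroup (E i)]
    [∀ i, Module ℝ (E i)] [∀ i, FiniteDimensional ℝ (E i)] (L : ∀ i, P →ₗ[ℝ] E i) :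
    ∃ N : ℕ, ∀ W : Submodule ℝ V, ∀ hW : W ≤ P, N < Module.finrank ℝ W →
      ∃ w : W, w ≠ 0 ∧ ∀ i ∈ t, L i ⟨w.1, hW w.2⟩ = 0 := by
  refine ⟨Module.finrank ℝ ((i : t) → E i), fun W hW hN => ?_⟩
  have : FiniteDimensional ℝ W := Module.finite_of_finrank_pos (by omega)
  set Φ : W →ₗ[ℝ] ((i : t) → E i) :=
    LinearMap.pi fun i => (L i.1).comp (Submodule.inclusion hW) with hΦ
  obtain ⟨w, hw, hw0⟩ := (Submodule.ne_bot_iff _).1 (LinearMap.ker_ne_bot_of_finrank_lt (f := Φ) hN)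
  exact ⟨w, hw0, fun i hi => congrFun (LinearMap.mem_ker.1 hw) ⟨i, hi⟩⟩

variable [FiniteDimensional ℝ F]

/-- In a space of test fields of large dimension there is a nonzero field whose `L²` norm on `K`
is small compared to its Dirichlet energy. -/
theorem exists_ne_zero_setIntegral_le (h : SurfaceMetric M) {K : Set M} (hK : IsCompact K) {ε : ℝ}
    (hε : 0 < ε) : ∃ N : ℕ, ∀ W : Submodule ℝ (M → F), W ≤ testFields F (univ : Set M) →
      N < Module.finrank ℝ W →
      ∃ w ∈ W, w ≠ 0 ∧ ∫ x in K, ‖w x‖ ^ 2 ∂vol[h] ≤ ε * dirichlet h w := by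
  have hball : ∀ x : M, ∃ r > 0, Metric.closedBall (chartAt ℂ x x) r ⊆ (chartAt ℂ x).target := by
    intro x
    exact Metric.nhds_basis_closedBall.mem_iff.1
      ((chartAt ℂ x).open_target.mem_nhds (mem_chart_target ℂ x))
  choose r hr hrt using hball
  set B : M → Set M := fun x => (chartAt ℂ x).source ∩ chartAt ℂ x ⁻¹' Metric.ball (chartAt ℂ x x) (r x)
    with hB
  have hBo : ∀ x, IsOpen (B x) := fun x =>
    (chartAt ℂ x).isOpen_inter_preimage Metric.isOpen_ball
  obtain ⟨t, ht⟩ := hK.elim_finite_subcover B hBo fun x _ =>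
    mem_iUnion.2 ⟨x, mem_chart_source ℂ x, Metric.mem_ball_self (hr x)⟩
  -- The balls of the finite cover may overlap, and each contributes at most `δ` times the whole
  -- Dirichlet energy.
  set δ := ε / (t.card + 1) with hδ
  have hδ0 : 0 < δ := by positivity
  have hJL := fun x : M =>
    exists_linearMap_of_ball (F := F) h (isSmoothChart_chartAt x) (hrt x) hδ0
  choose J L hL using hJL
  obtain ⟨N, hN⟩ := exists_ne_zero_forall_eq_zero t L
  refine ⟨N, fun W hW hlt => ?_⟩
  obtain ⟨w, hw0, hLw⟩ := hN W hW hlt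
  refine ⟨w, w.2, fun h0 => hw0 (Subtype.ext h0), ?_⟩
  have hD0 := dirichlet_nonneg h (w : M → F)
  have hint := integrable_norm_sq (h := h) (hW w.2)
  rw [← ENNReal.ofReal_le_ofReal_iff (by positivity),
    ofReal_integral_eq_lintegral_ofReal hint.integrableOn (ae_of_all _ fun x => sq_nonneg _)]
  calc ∫⁻ x in K, ofReal (‖(w : M → F) x‖ ^ 2) ∂vol[h]
      ≤ ∫⁻ x in ⋃ i ∈ t, B i, ofReal (‖(w : M → F) x‖ ^ 2) ∂vol[h] :=
        lintegral_mono_set ht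
    _ ≤ ∑ i ∈ t, ∫⁻ x in B i, ofReal (‖(w : M → F) x‖ ^ 2) ∂vol[h] :=
        lintegral_biUnion_finset_le t B _
    _ ≤ ∑ i ∈ t, ofReal (δ * dirichlet h (w : M → F)) :=
        Finset.sum_le_sum fun i hi => hL i ⟨w.1, hW w.2⟩ (hLw i hi)
    _ = ofReal (t.card * (δ * dirichlet h (w : M → F))) := by
        rw [Finset.sum_const, nsmul_eq_mul, ENNReal.ofReal_mul (p := (t.card : ℝ)) (Nat.cast_nonneg _),
          ENNReal.ofReal_natCast]
    _ ≤ ofReal (ε * dirichlet h (w : M → F)) := by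
        refine ENNReal.ofReal_le_ofReal ?_
        rw [← mul_assoc]
        refine mul_le_mul_of_nonneg_right ?_ hD0
        rw [hδ, mul_div_assoc', div_le_iff₀ (by positivity)]
        nlinarith

/-- The dimension of spaces of test fields on which the second variation of the Dirichlet energy
is negative definite is bounded. -/
theorem IsHarmonicOn.exists_finrank_le {u : M → F} (hu : IsHarmonicOn h u O)
    (hc : IsAlmostConstantAtEnd u O) : ∃ N : ℕ, ∀ W : Submodule ℝ (M → F), W ≤ testFields F O →
      (∀ w ∈ W, w ≠ 0 → dirichlet h w < potential h u w) → Module.finrank ℝ W ≤ N := by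
  obtain ⟨K, -, hK, C, hC, hpot⟩ := hu.exists_potential_le hc
  -- For this `ε` the term of order zero costs at most half of the Dirichlet energy. Together with
  -- the quarter in `hpot` the potential stays below the Dirichlet energy, contrary to negativity.
  obtain ⟨N, hN⟩ := exists_ne_zero_setIntegral_le (F := F) h hK
    (ε := 1 / (2 * (C + 1))) (by positivity)
  refine ⟨N, fun W hW hneg => ?_⟩
  by_contra! hlt
  obtain ⟨w, hw, hw0, hle⟩ := hN W (fun w hw => ⟨(hW hw).1, (hW hw).2.1, subset_univ _⟩) hlt
  have h1 := hpot w (hW hw)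
  have h2 := hneg w hw hw0
  have h3 := mul_le_mul_of_nonneg_left hle hC
  have h4 := dirichlet_nonneg h w
  have h5 : C * (1 / (2 * (C + 1)) * dirichlet h w) ≤ 1 / 2 * dirichlet h w := by
    rw [← mul_assoc]
    refine mul_le_mul_of_nonneg_right ?_ h4
    rw [mul_one_div, div_le_div_iff₀ (by positivity) (by norm_num)]
    linarith
  linarith

end FiniteRank

/-! ### Mollification in L² -/

section Mollification

variable {E : Type*} [NormedAddCommGroup E] [NormedSpace ℝ E]

theorem lintegral_ofReal_norm_sq_eq {X : Type*} [MeasurableSpace X] {μ : Measure X} (g : X → E) :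
    ∫⁻ x, ofReal (‖g x‖ ^ 2) ∂μ = eLpNorm g 2 μ ^ 2 := by
  have h1 := eLpNorm_nnreal_pow_eq_lintegral (f := g) (μ := μ) (p := 2) two_ne_zero
  simp only [NNReal.coe_ofNat, ENNReal.rpow_ofNat, ENNReal.coe_ofNat] at h1
  rw [h1]
  refine lintegral_congr fun x => ?_
  rw [ENNReal.ofReal_pow (norm_nonneg _), ofReal_norm]

/-- Translations act continuously on `L²`; this is continuity at the identity. -/
theorem exists_translate_sub_le {f : ℂ → E} (hf : MemLp f 2) {ε : ℝ} (hε : 0 < ε) :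
    ∃ δ > 0, ∀ t : ℂ, ‖t‖ ≤ δ → ∫⁻ x, ofReal (‖f (x - t) - f x‖ ^ 2) ≤ ofReal ε := by
  let g : ℂ → C(ℂ, ℂ) := fun t => ⟨fun x => x - t, by fun_prop⟩
  have hg : Continuous g := ContinuousMap.continuous_of_continuous_uncurry _
    (show Continuous fun q : ℂ × ℂ => q.2 - q.1 by fun_prop)
  have hgm : ∀ t, MeasurePreserving (g t) volume volume := fun t =>
    measurePreserving_sub_right volume t
  have h1 : Tendsto (fun t => Lp.compMeasurePreserving (g t) (hgm t) (hf.toLp f)) (𝓝 0)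
      (𝓝 (Lp.compMeasurePreserving (g 0) (hgm 0) (hf.toLp f))) :=
    tendsto_const_nhds.compMeasurePreservingLp (hg.tendsto 0) hgm (hgm 0) (by norm_num)
  have h2 := (Metric.tendsto_nhds_nhds.1 h1) (√ε) (Real.sqrt_pos.2 hε)
  obtain ⟨δ, hδ, h3⟩ := h2
  refine ⟨δ / 2, by positivity, fun t ht => ?_⟩
  have h4 := h3 (show dist t 0 < δ by rw [dist_zero_right]; linarith)
  rw [dist_eq_norm, Lp.toLp_compMeasurePreserving, Lp.toLp_compMeasurePreserving,
    ← MemLp.toLp_sub, Lp.norm_toLp] at h4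
  rw [lintegral_ofReal_norm_sq_eq]
  have h5 : eLpNorm (fun x => f (x - t) - f x) 2 volume = eLpNorm (f ∘ g t - f ∘ g 0) 2 volume := by
    congr 1
    ext x
    simp [g]
  have h6 : MemLp (f ∘ g t - f ∘ g 0) 2 volume :=
    (hf.comp_measurePreserving (hgm t)).sub (hf.comp_measurePreserving (hgm 0))
  rw [h5, ← ENNReal.ofReal_toReal h6.eLpNorm_ne_top, ← ENNReal.ofReal_pow ENNReal.toReal_nonneg]
  refine ENNReal.ofReal_le_ofReal ?_
  rw [← Real.sq_sqrt hε.le]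
  exact pow_le_pow_left₀ ENNReal.toReal_nonneg h4.le 2

/-- The mollification of `f` with the kernel `ρ`. -/
def mollify (ρ : ℂ → ℝ) (f : ℂ → E) (x : ℂ) : E := ∫ t, ρ t • f (x - t)

theorem integrable_bounded_smul {ρ : ℂ → ℝ} (hρ : Continuous ρ) (hc : HasCompactSupport ρ)
    {f : ℂ → E} (hf : Integrable f) : Integrable fun t => ρ t • f t := by
  obtain ⟨C, hC⟩ := hρ.bounded_above_of_compact_support hc
  exact hf.bdd_smul C hρ.aestronglyMeasurable (Eventually.of_forall hC)

variable [CompleteSpace E]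

/-- Jensen's inequality for the probability measure `ρ dt`, obtained by integrating `0 ≤ (‖f (x - t)
- f x‖ - I)²` with `I` the mean of the norm. -/
theorem norm_mollify_sub_sq_le {ρ : ℂ → ℝ} (hρ : Continuous ρ) (hc : HasCompactSupport ρ)
    (h0 : ∀ t, 0 ≤ ρ t) (h1 : ∫ t, ρ t = 1) {f : ℂ → E} (hf : Integrable f) (hf2 : MemLp f 2)
    (x : ℂ) : ofReal (‖mollify ρ f x - f x‖ ^ 2) ≤
      ∫⁻ t, ofReal (ρ t) * ofReal (‖f (x - t) - f x‖ ^ 2) := by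
  have hfx : Integrable fun t => f (x - t) := hf.comp_sub_left x
  have hρi : Integrable ρ := hρ.integrable_of_hasCompactSupport hc
  have i1 : Integrable fun t => ρ t • f (x - t) := integrable_bounded_smul hρ hc hfx
  have i2 : Integrable fun t => ρ t • f x := hρi.smul_const _
  have i3 : Integrable fun t => ρ t • (f (x - t) - f x) := by
    simp only [smul_sub]
    exact i1.sub i2
  have i4 : Integrable fun t => ρ t * ‖f (x - t) - f x‖ := by
    refine i3.norm.congr (ae_of_all _ fun t => ?_)
    simp only [norm_smul, Real.norm_of_nonneg (h0 t)]
  have hm : AEStronglyMeasurable (fun t => f (x - t) - f x) volume :=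
    hfx.1.sub aestronglyMeasurable_const
  have i5 : Integrable fun t => ρ t * ‖f (x - t) - f x‖ ^ 2 := by
    have j1 : Integrable fun t => ‖f (x - t)‖ ^ 2 := by
      have := ((memLp_two_iff_integrable_sq_norm hf2.1).1 hf2).comp_sub_left x
      exact this
    have j2 : Integrable fun t => ρ t • (2 * ‖f (x - t)‖ ^ 2) :=
      integrable_bounded_smul hρ hc (j1.const_mul 2)
    refine Integrable.mono' (j2.add (hρi.mul_const (2 * ‖f x‖ ^ 2)))
      (hρ.aestronglyMeasurable.mul (hm.norm.pow 2)) (ae_of_all _ fun t => ?_)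
    rw [Real.norm_of_nonneg (mul_nonneg (h0 t) (sq_nonneg _))]
    simp only [Pi.add_apply, smul_eq_mul]
    rw [← mul_add]
    refine mul_le_mul_of_nonneg_left ?_ (h0 t)
    have h2 := pow_le_pow_left₀ (norm_nonneg _) (norm_sub_le (f (x - t)) (f x)) 2
    nlinarith [sq_nonneg (‖f (x - t)‖ - ‖f x‖)]
  have e1 : mollify ρ f x - f x = ∫ t, ρ t • (f (x - t) - f x) := by
    simp only [smul_sub]
    rw [integral_sub i1 i2, integral_smul_const, h1, one_smul]
    rfl
  set I := ∫ t, ρ t * ‖f (x - t) - f x‖ with hI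
  have h2 : ‖mollify ρ f x - f x‖ ≤ I := by
    rw [e1]
    refine (norm_integral_le_integral_norm _).trans (le_of_eq ?_)
    refine integral_congr_fun (fun t => ?_)
    simp only [norm_smul, Real.norm_of_nonneg (h0 t)]
  have h3 : I ^ 2 ≤ ∫ t, ρ t * ‖f (x - t) - f x‖ ^ 2 := by
    have i6 : Integrable fun t => 2 * I * (ρ t * ‖f (x - t) - f x‖) - I ^ 2 * ρ t :=
      (i4.const_mul _).sub (hρi.const_mul _)
    have h4 : ∫ t, (2 * I * (ρ t * ‖f (x - t) - f x‖) - I ^ 2 * ρ t) ≤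
        ∫ t, ρ t * ‖f (x - t) - f x‖ ^ 2 := by
      refine integral_mono i6 i5 fun t => ?_
      have := mul_nonneg (h0 t) (sq_nonneg (‖f (x - t) - f x‖ - I))
      simp only
      nlinarith
    rw [integral_sub (i4.const_mul _) (hρi.const_mul _), integral_const_mul, integral_const_mul,
      h1, ← hI] at h4
    linarith
  have h4 := (pow_le_pow_left₀ (norm_nonneg _) h2 2).trans h3
  refine (ENNReal.ofReal_le_ofReal h4).trans (le_of_eq ?_)
  rw [ofReal_integral_eq_lintegral_ofReal i5 (ae_of_all _ fun t => mul_nonneg (h0 t) (sq_nonneg _))]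
  exact lintegral_congr fun t => ENNReal.ofReal_mul (h0 t)

theorem lintegral_mollify_sub_le {ρ : ℂ → ℝ} (hρ : Continuous ρ) (hc : HasCompactSupport ρ)
    (h0 : ∀ t, 0 ≤ ρ t) (h1 : ∫ t, ρ t = 1) {f : ℂ → E} (hf : Integrable f) (hf2 : MemLp f 2)
    {ε : ℝ} (hε : ∀ t, ρ t ≠ 0 → ∫⁻ x, ofReal (‖f (x - t) - f x‖ ^ 2) ≤ ofReal ε) :
    ∫⁻ x, ofReal (‖mollify ρ f x - f x‖ ^ 2) ≤ ofReal ε := by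
  have hm : AEStronglyMeasurable (fun q : ℂ × ℂ => f (q.1 - q.2) - f q.1) (volume.prod volume) :=
    (hf.1.comp_quasiMeasurePreserving (quasiMeasurePreserving_sub volume volume)).sub
      (hf.1.comp_quasiMeasurePreserving Measure.quasiMeasurePreserving_fst)
  calc ∫⁻ x, ofReal (‖mollify ρ f x - f x‖ ^ 2)
      ≤ ∫⁻ x, ∫⁻ t, ofReal (ρ t) * ofReal (‖f (x - t) - f x‖ ^ 2) :=
        lintegral_mono fun x => norm_mollify_sub_sq_le hρ hc h0 h1 hf hf2 x
    _ = ∫⁻ t, ∫⁻ x, ofReal (ρ t) * ofReal (‖f (x - t) - f x‖ ^ 2) := by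
        rw [lintegral_lintegral_swap]
        exact ((ENNReal.continuous_ofReal.comp
          (hρ.comp continuous_snd)).measurable.aemeasurable).mul
          (hm.norm.aemeasurable.pow_const 2).ennreal_ofReal
    _ ≤ ∫⁻ t, ofReal (ρ t) * ofReal ε := by
        refine lintegral_mono fun t => ?_
        rw [lintegral_const_mul' _ _ ENNReal.ofReal_ne_top]
        by_cases ht : ρ t = 0
        · simp [ht]
        · exact mul_le_mul_right (hε t ht) _
    _ = ofReal ε := by
        rw [lintegral_mul_const' _ _ ENNReal.ofReal_ne_top,
          ← ofReal_integral_eq_lintegral_ofReal (hρ.integrable_of_hasCompactSupport hc)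
          (Eventually.of_forall h0), h1, ENNReal.ofReal_one, one_mul]

theorem mollify_eq_convolution (ρ : ℂ → ℝ) (f : ℂ → E) :
    mollify ρ f = convolution ρ f (ContinuousLinearMap.lsmul ℝ ℝ) volume := rfl

end Mollification

/-! ### Smooth approximation of Sobolev functions in the plane -/

section WeakDerivMollification

variable [CompleteSpace F]
variable {f : ℂ → F} {A : ℂ → ℂ →L[ℝ] F}

/-- The derivative falls on the kernel. For fixed `x` the function `s ↦ ρ (x - s)` is a test
function, so the definition of the weak derivative moves it onto `f`. -/
theorem IsWeakDerivOn.fderiv_mollify (hf : IsWeakDerivOn univ f A) (hfi : Integrable f)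
    (hAi : Integrable A) {ρ : ℂ → ℝ} (hρ : ContDiff ℝ ∞ ρ) (hc : HasCompactSupport ρ) (x : ℂ) :
    fderiv ℝ (mollify ρ f) x = mollify ρ A x := by
  have h1 := hc.hasFDerivAt_convolution_left (ContinuousLinearMap.lsmul ℝ ℝ (E := F))
    (hρ.of_le (by exact_mod_cast le_top)) hfi.locallyIntegrable x
  rw [mollify_eq_convolution, h1.fderiv]
  have hdc : Continuous (fderiv ℝ ρ) := hρ.continuous_fderiv (by simp)
  ext v
  have e1 : (convolution (fderiv ℝ ρ) f
      ((ContinuousLinearMap.lsmul ℝ ℝ (E := F)).precompL ℂ) volume x) v =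
      ∫ t, fderiv ℝ ρ t v • f (x - t) := by
    rw [convolution, ContinuousLinearMap.integral_apply]
    · rfl
    · exact ((hc.fderiv ℝ).convolutionExists_left _ hdc hfi.locallyIntegrable x).integrable
  have i1 : Integrable fun t => ρ t • A (x - t) :=
    integrable_bounded_smul hρ.continuous hc (hAi.comp_sub_left x)
  have e2 : (mollify ρ A x) v = ∫ t, ρ t • A (x - t) v := by
    rw [mollify, ContinuousLinearMap.integral_apply i1]
    rfl
  rw [e1, e2]
  have hη : ContDiff ℝ ∞ fun s => ρ (x - s) := hρ.comp (contDiff_const.sub contDiff_id)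
  have hηc : HasCompactSupport fun s => ρ (x - s) :=
    hc.comp_homeomorph (Homeomorph.subLeft x)
  have key := hf.integral_eq _ hη hηc (subset_univ _) v
  have hd : ∀ s, fderiv ℝ (fun s => ρ (x - s)) s v = -fderiv ℝ ρ (x - s) v := fun s => by
    have h3 := ((hρ.differentiable (by simp) (x - s)).hasFDerivAt).comp s
      ((hasFDerivAt_id s).const_sub x)
    have h4 : fderiv ℝ (fun s => ρ (x - s)) s = _ := h3.fderiv
    rw [h4]
    simp
  simp only [hd, neg_smul, integral_neg, neg_neg] at key
  have s1 := integral_sub_left_eq_self (fun s => fderiv ℝ ρ (x - s) v • f s) volume x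
  have s2 := integral_sub_left_eq_self (fun s => ρ (x - s) • A s v) volume x
  simp only [sub_sub_cancel] at s1 s2
  rw [s1, s2, key]

theorem integrable_of_memLp_two_of_eq_zero {E : Type*} [NormedAddCommGroup E] {g : ℂ → E}
    (hg : MemLp g 2) {k : Set ℂ} (hk : IsCompact k) (h0 : ∀ y ∉ k, g y = 0) : Integrable g := by
  have h1 : IntegrableOn g k := by
    have : IsFiniteMeasure (volume.restrict k) := ⟨by
      rw [Measure.restrict_apply_univ]; exact hk.measure_lt_top⟩
    exact (hg.restrict k).integrable (by norm_num)
  exact (integrableOn_iff_integrable_of_support_subset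
    (fun y hy => by by_contra hyk; exact hy (h0 y hyk))).1 h1

/-- Compactly supported Sobolev functions are approximated by smooth functions. -/
theorem IsWeakDerivOn.exists_smooth_approx (hf : IsWeakDerivOn univ f A) (hf2 : MemLp f 2)
    (hA2 : MemLp A 2) {k Ω : Set ℂ} (hk : IsCompact k) (hΩ : IsOpen Ω) (hkΩ : k ⊆ Ω)
    (hf0 : ∀ y ∉ k, f y = 0) (hA0 : ∀ y ∉ k, A y = 0) :
    ∃ k' ⊆ Ω, IsCompact k' ∧ k ⊆ k' ∧ ∀ ε > 0, ∃ g : ℂ → F, ContDiff ℝ ∞ g ∧ tsupport g ⊆ k' ∧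
      ∫⁻ y, ofReal (‖g y - f y‖ ^ 2) ≤ ofReal ε ∧
      ∫⁻ y, ofReal (‖fderiv ℝ g y - A y‖ ^ 2) ≤ ofReal ε := by
  obtain ⟨δ₀, hδ₀, hsub⟩ := hk.exists_cthickening_subset_open hΩ hkΩ
  refine ⟨Metric.cthickening δ₀ k, hsub, hk.cthickening, Metric.self_subset_cthickening k,
    fun ε hε => ?_⟩
  have hfi := integrable_of_memLp_two_of_eq_zero hf2 hk hf0
  have hAi := integrable_of_memLp_two_of_eq_zero hA2 hk hA0
  obtain ⟨δ₁, hδ₁, h1⟩ := exists_translate_sub_le hf2 hε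
  obtain ⟨δ₂, hδ₂, h2⟩ := exists_translate_sub_le hA2 hε
  -- One radius for three purposes: the support stays in the `δ₀`-thickening of `k`, and
  -- translations by at most `δ` move both `f` and `A` little in `L²`.
  set δ := min δ₀ (min δ₁ δ₂) with hδ
  have hδ0 : 0 < δ := lt_min hδ₀ (lt_min hδ₁ hδ₂)
  let b : ContDiffBump (0 : ℂ) := ⟨δ / 2, δ, by positivity, by linarith⟩
  set ρ := b.normed volume with hρd
  have hρ : ContDiff ℝ ∞ ρ := b.contDiff_normed
  have hc : HasCompactSupport ρ := b.hasCompactSupport_normed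
  have hsupp : ∀ t, ρ t ≠ 0 → ‖t‖ ≤ δ := fun t ht => by
    have h3 : t ∈ Function.support ρ := ht
    rw [hρd, b.support_normed_eq, mem_ball_zero_iff] at h3
    exact h3.le
  refine ⟨mollify ρ f, ?_, ?_, ?_, ?_⟩
  · rw [mollify_eq_convolution]
    exact hc.contDiff_convolution_left _ hρ hfi.locallyIntegrable
  · refine closure_minimal (fun x hx => ?_) Metric.isClosed_cthickening
    by_contra hxk
    refine hx ?_
    rw [mollify]
    refine integral_eq_zero_of_ae (ae_of_all _ fun t => ?_)
    by_cases ht : ρ t = 0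
    · simp [ht]
    · have h3 : x - t ∉ k := fun hxt => hxk (by
        refine Metric.mem_cthickening_of_dist_le x (x - t) δ₀ k hxt ?_
        rw [dist_eq_norm, sub_sub_cancel]
        exact (hsupp t ht).trans (min_le_left _ _))
      simp [hf0 _ h3]
  · exact lintegral_mollify_sub_le hρ.continuous hc b.nonneg_normed b.integral_normed hfi hf2
      fun t ht => h1 t ((hsupp t ht).trans ((min_le_right _ _).trans (min_le_left _ _)))
  · simp only [hf.fderiv_mollify hfi hAi hρ hc]
    exact lintegral_mollify_sub_le hρ.continuous hc b.nonneg_normed b.integral_normed hAi hA2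
      fun t ht => h2 t ((hsupp t ht).trans ((min_le_right _ _).trans (min_le_right _ _)))

end WeakDerivMollification

variable [MeasurableSpace M] [BorelSpace M] [SecondCountableTopology M] [T2Space M] [CompleteSpace F]

/-! ### Sobolev fields paired with their weak differentials -/

section SobolevPairs

/-- Here `r` is smooth on `Ω` only. For a given test function it may be multiplied by a cut-off that
equals `1` near the support of that function, which reduces the claim to
`IsWeakDerivOn.cutoff_smul`. -/
theorem IsWeakDerivOn.smul {Ω : Set ℂ} {f : ℂ → F} {A : ℂ → ℂ →L[ℝ] F} (hf : IsWeakDerivOn Ω f A)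
    (hΩ : IsOpen Ω) {r : ℂ → ℝ} (hr : ContDiffOn ℝ ∞ r Ω) : IsWeakDerivOn Ω (fun y => r y • f y)
      (fun y => r y • A y + (fderiv ℝ r y).smulRight (f y)) := by
  refine ⟨?_, ?_, fun η h1 h2 h3 v => ?_⟩
  · exact hf.locallyIntegrable.continuousOn_smul hΩ.isLocallyClosed hr.continuousOn
  · have hdr : ∀ v, ContinuousOn (fun y => fderiv ℝ r y v) Ω := fun v =>
      (hr.continuousOn_fderiv_of_isOpen hΩ (by simp)).clm_apply continuousOn_const
    have hdec : ∀ y, (fderiv ℝ r y).smulRight (f y) =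
        fderiv ℝ r y 1 • Complex.reCLM.smulRight (f y) +
          fderiv ℝ r y I • Complex.imCLM.smulRight (f y) := by
      intro y
      apply clm_eq_of_apply <;> simp
    have hT : ∀ T : ℂ →L[ℝ] ℝ, LocallyIntegrableOn (fun y => T.smulRight (f y)) Ω := fun T =>
      locallyIntegrableOn_clm_comp (ContinuousLinearMap.smulRightL ℝ ℂ F T) hf.locallyIntegrable
    simp only [hdec]
    exact (hf.locallyIntegrable_deriv.continuousOn_smul hΩ.isLocallyClosed hr.continuousOn).add
      (((hT _).continuousOn_smul hΩ.isLocallyClosed (hdr 1)).add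
        ((hT _).continuousOn_smul hΩ.isLocallyClosed (hdr I)))
  · obtain ⟨θ, hθ, hθc, hθΩ, hθ1, -⟩ := exists_cutoff h2.isCompact hΩ h3
    have hθr : ContDiff ℝ ∞ fun y => θ y * r y :=
      contDiff_smul_of_tsupport_subset hΩ hθ.contDiff hθΩ hr
    have key := (hf.cutoff_smul hθr hθc.mul_right ((tsupport_mul_subset_left).trans hθΩ)).integral_eq
      η h1 h2 (subset_univ _) v
    have e0 : ∀ y ∈ tsupport η, fderiv ℝ (fun y => θ y * r y) y = fderiv ℝ r y := fun y hy => by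
      refine Filter.EventuallyEq.fderiv_eq ?_
      filter_upwards [hθ1.filter_mono (nhds_le_nhdsSet hy)] with z hz
      rw [hz, one_mul]
    have e1 : ∀ y, η y • ((θ y * r y) • A y + (fderiv ℝ (fun y => θ y * r y) y).smulRight (f y)) v =
        η y • (r y • A y + (fderiv ℝ r y).smulRight (f y)) v := fun y => by
      by_cases hy : y ∈ tsupport η
      · rw [e0 y hy, hθ1.self_of_nhdsSet y hy, one_mul]
      · simp [image_eq_zero_of_notMem_tsupport hy]
    have e2 : ∀ y, fderiv ℝ η y v • ((θ y * r y) • f y) = fderiv ℝ η y v • (r y • f y) :=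
      fun y => by
      by_cases hy : y ∈ tsupport η
      · rw [hθ1.self_of_nhdsSet y hy, one_mul]
      · simp [fderiv_eq_zero_of_notMem_tsupport hy]
    simpa only [e1, e2] using key

/-- The integral of a non-integrable function is `0` by convention, so measurability and
integrability need not be known. -/
theorem integral_le_of_lintegral_le {X : Type*} [MeasurableSpace X] {μ : Measure X} {g : X → ℝ}
    (h0 : ∀ x, 0 ≤ g x) {ε : ℝ} (hε : 0 ≤ ε)
    (hle : ∫⁻ x, ofReal (g x) ∂μ ≤ ofReal ε) : ∫ x, g x ∂μ ≤ ε := by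
  by_cases hg : Integrable g μ
  · rw [← ofReal_integral_eq_lintegral_ofReal hg (Eventually.of_forall h0)] at hle
    exact (ENNReal.ofReal_le_ofReal_iff hε).1 hle
  · rw [integral_undef hg]
    exact hε

/-- `w` is a Sobolev function with weak differential `G`. -/
structure IsW12 (h : SurfaceMetric M) (w : M → F) (G : (x : M) → T*[x, F]) : Prop where
  weak : IsWeakDifferential w G
  memLp : MemLp w 2 vol[h]
  integrable : Integrable (fun x => pairing h x (G x) (G x)) vol[h]

/-- The square of the Sobolev norm. -/
def sobolevSq (h : SurfaceMetric M) (w : M → F) (G : (x : M) → T*[x, F]) : ℝ :=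
  ∫ x, (‖w x‖ ^ 2 + pairing h x (G x) (G x)) ∂vol[h]

theorem MemW12.isW12 {h : SurfaceMetric M} {w : M → F} (hw : MemW12 h w) :
    IsW12 h w (weakDifferential w) :=
  ⟨hw.weaklyDifferentiable.isWeakDifferential, hw.memLp, hw.integrable_gradSq⟩

variable {h : SurfaceMetric M} {w w' : M → F} {G G' : (x : M) → T*[x, F]}

theorem ae_of_mem_atlas (h : SurfaceMetric M) {P : M → Prop} {ψ : Chart[M]}
    (hψ : ψ ∈ atlas ℂ M) (h1 : ∀ᵐ y, y ∈ ψ.target → P (ψ.symm y)) :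
    ∀ᵐ x ∂vol[h].restrict ψ.source, P x := by
  rw [riemannianVolume_restrict_of_mem_atlas h hψ]
  rw [ae_iff] at h1
  obtain ⟨Z, hZ, hZm, hZ0⟩ := exists_measurable_superset_of_null h1
  have hsub : {z | ¬ P z} ⊆ (ψ.source ∩ ψ ⁻¹' Z) ∪ ψ.sourceᶜ := by
    intro z hz
    by_cases hzs : z ∈ ψ.source
    · left
      refine ⟨hzs, hZ ?_⟩
      show ¬ (ψ z ∈ ψ.target → P (ψ.symm (ψ z)))
      rw [ψ.left_inv hzs]
      exact fun hc => hz (hc (ψ.map_source hzs))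
    · exact Or.inr hzs
  refine measure_mono_null hsub (measure_union_null ?_ ?_)
  · rw [chartVolume_apply h ψ (measurableSet_source_inter_preimage ψ hZm)]
    have : volume (ψ.target ∩ ψ.symm ⁻¹' (ψ.source ∩ ψ ⁻¹' Z)) = 0 := by
      refine measure_mono_null ?_ hZ0
      rintro y ⟨hy, -, hyZ⟩
      rwa [mem_preimage, ψ.right_inv hy] at hyZ
    exact setLIntegral_measure_zero _ _ this
  · rw [← chartVolume_restrict_source, Measure.restrict_apply ψ.open_source.measurableSet.compl,
      compl_inter_self, measure_empty]

theorem aemeasurable_of_charts (h : SurfaceMetric M) {g : M → ℝ}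
    (hg : ∀ ψ ∈ atlas ℂ M, AEMeasurable (fun y => g (ψ.symm y)) (volume.restrict ψ.target)) :
    AEMeasurable g vol[h] := by
  obtain ⟨s, hs, hcov⟩ := exists_countable_atlas_cover (M := M)
  have : Countable s := hs.to_subtype
  rw [← Measure.restrict_univ (μ := vol[h]), ← hcov, biUnion_eq_iUnion, aemeasurable_iUnion_iff]
  intro x
  set ψ := chartAt ℂ (x : M) with hψ
  have hm := hg ψ (chart_mem_atlas ℂ _)
  have hmeas : Measurable (ψ.source.indicator fun z => hm.mk _ (ψ z)) := by
    intro S hS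
    rw [indicator_preimage]
    have e : ψ.source.ite ((fun z => hm.mk _ (ψ z)) ⁻¹' S) (0 ⁻¹' S) =
        (ψ.source ∩ ψ ⁻¹' (hm.mk _ ⁻¹' S)) ∪ ((0 : M → ℝ) ⁻¹' S \ ψ.source) := by
      ext z; simp [Set.ite, and_comm]
    rw [e]
    exact (measurableSet_source_inter_preimage ψ (hm.measurable_mk hS)).union
      ((measurable_zero hS).diff ψ.open_source.measurableSet)
  refine ⟨_, hmeas, ?_⟩
  refine ae_of_mem_atlas h (chart_mem_atlas ℂ _) ?_
  have h2 := hm.ae_eq_mk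
  rw [EventuallyEq, ae_restrict_iff' ψ.open_target.measurableSet] at h2
  filter_upwards [h2] with y hy hyt
  rw [indicator_of_mem (ψ.map_target hyt), ψ.right_inv hyt, hy hyt]

/-- The values of `G` lie in varying spaces, so measurability is available for the chart expressions
only; the pairing is a finite sum of products of these with continuous coefficients. -/
theorem aemeasurable_pairing (h : SurfaceMetric M) (hG : IsWeakDifferential w G)
    (hG' : IsWeakDifferential w' G') : AEMeasurable (fun x => pairing h x (G x) (G' x)) vol[h] := by
  refine aemeasurable_of_charts h fun ψ hψ => ?_
  have hs := isSmoothChart_of_mem_atlas hψ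
  have h1 : ∀ {w : M → F} {G : (x : M) → T*[x, F]},
      IsWeakDifferential w G → ∀ i, AEStronglyMeasurable
        (fun y => G (ψ.symm y) (chartDifferential ψ y (stdFrame i))) (volume.restrict ψ.target) :=
    fun hG i => (locallyIntegrableOn_clm_comp (ContinuousLinearMap.apply ℝ F (stdFrame i))
      (hG ψ hψ).locallyIntegrable_deriv).aestronglyMeasurable
  have h2 : AEMeasurable (fun y => ∑ i, ∑ j, (chartGram h ψ y)⁻¹ i j *
      inner ℝ (G (ψ.symm y) (chartDifferential ψ y (stdFrame i)))
        (G' (ψ.symm y) (chartDifferential ψ y (stdFrame j)))) (volume.restrict ψ.target) := by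
    refine Finset.aemeasurable_fun_sum _ fun i _ => Finset.aemeasurable_fun_sum _ fun j _ => ?_
    exact ((hs.continuousOn_chartGram_inv h i j).aemeasurable
      ψ.open_target.measurableSet).mul ((h1 hG i).inner (h1 hG' j)).aemeasurable
  refine h2.congr ?_
  rw [EventuallyEq, ae_restrict_iff' ψ.open_target.measurableSet]
  exact Eventually.of_forall fun y hy => (hs.pairing_chart h hy _ _).symm

theorem two_mul_abs_pairing_le (h : SurfaceMetric M) (x : M) (A B : T*[x, F]) :
    2 * |pairing h x A B| ≤ pairing h x A A + pairing h x B B := by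
  have h1 := abs_pairing_le h x A B
  have h2 := pnorm_sq h x A
  have h3 := pnorm_sq h x B
  nlinarith [sq_nonneg (pnorm h x A - pnorm h x B)]

theorem pairing_add_self_le (h : SurfaceMetric M) (x : M) (A B : T*[x, F]) :
    pairing h x (A + B) (A + B) ≤ 2 * pairing h x A A + 2 * pairing h x B B := by
  have h1 := two_mul_abs_pairing_le h x A B
  have h2 := le_abs_self (pairing h x A B)
  rw [pairing_add_left, pairing_add_right, pairing_add_right, pairing_comm h x B A]
  linarith

namespace IsW12

theorem integrable_norm_sq (hw : IsW12 h w G) : Integrable (fun x => ‖w x‖ ^ 2) vol[h] :=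
  (memLp_two_iff_integrable_sq_norm hw.memLp.1).1 hw.memLp

theorem integrable_pairing (hw : IsW12 h w G) (hw' : IsW12 h w' G') :
    Integrable (fun x => pairing h x (G x) (G' x)) vol[h] := by
  refine (hw.integrable.add hw'.integrable).mono'
    (aemeasurable_pairing h hw.weak hw'.weak).aestronglyMeasurable (ae_of_all _ fun x => ?_)
  have h1 := two_mul_abs_pairing_le h x (G x) (G' x)
  rw [Real.norm_eq_abs]
  simp only [Pi.add_apply]
  linarith [abs_nonneg (pairing h x (G x) (G' x))]

theorem add (hw : IsW12 h w G) (hw' : IsW12 h w' G') :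
    IsW12 h (fun x => w x + w' x) (fun x => G x + G' x) where
  weak := hw.weak.add hw'.weak
  memLp := hw.memLp.add hw'.memLp
  integrable := by
    refine ((hw.integrable.const_mul 2).add (hw'.integrable.const_mul 2)).mono'
      (aemeasurable_pairing h (hw.weak.add hw'.weak) (hw.weak.add hw'.weak)).aestronglyMeasurable
      (ae_of_all _ fun x => ?_)
    rw [Real.norm_of_nonneg (pairing_self_nonneg h x _)]
    exact pairing_add_self_le h x _ _

theorem const_smul (hw : IsW12 h w G) (c : ℝ) : IsW12 h (fun x => c • w x) (fun x => c • G x) where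
  weak := hw.weak.const_smul c
  memLp := hw.memLp.const_smul c
  integrable := by
    simp only [pairing_smul_left, pairing_smul_right]
    exact (hw.integrable.const_mul c).const_mul c

theorem sub (hw : IsW12 h w G) (hw' : IsW12 h w' G') :
    IsW12 h (fun x => w x - w' x) (fun x => G x - G' x) := by
  have := hw.add (hw'.const_smul (-1))
  simpa only [neg_smul, one_smul, ← sub_eq_add_neg] using this

theorem integrable_sobolev (hw : IsW12 h w G) :
    Integrable (fun x => ‖w x‖ ^ 2 + pairing h x (G x) (G x)) vol[h] :=
  hw.integrable_norm_sq.add hw.integrable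

theorem sobolevSq_add_le (hw : IsW12 h w G) (hw' : IsW12 h w' G') :
    sobolevSq h (fun x => w x + w' x) (fun x => G x + G' x) ≤
      2 * sobolevSq h w G + 2 * sobolevSq h w' G' := by
  rw [sobolevSq, sobolevSq, sobolevSq, ← integral_const_mul, ← integral_const_mul,
    ← integral_add (hw.integrable_sobolev.const_mul 2) (hw'.integrable_sobolev.const_mul 2)]
  refine integral_mono (hw.add hw').integrable_sobolev
    ((hw.integrable_sobolev.const_mul 2).add (hw'.integrable_sobolev.const_mul 2)) fun x => ?_
  have h1 := pairing_add_self_le h x (G x) (G' x)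
  have h2 := pow_le_pow_left₀ (norm_nonneg _) (norm_add_le (w x) (w' x)) 2
  simp only
  nlinarith [sq_nonneg (‖w x‖ - ‖w' x‖)]

end IsW12

theorem isW12_of_mem_testFields {O : Set M} (hw : w ∈ testFields F O) : IsW12 h w (cdiff w) where
  weak := isWeakDifferential_cdiff hw.1
  memLp := hw.1.continuous.memLp_of_hasCompactSupport hw.2.1
  integrable := integrable_dInner_self hw

theorem IsWeakDifferential.smul (hw : IsWeakDifferential w G) {ρ : M → ℝ} (hρ : Smooth[ℝ] ρ) :
    IsWeakDifferential (fun x => ρ x • w x) (fun x => ρ x • G x + (cdiff ρ x).smulRight (w x)) := by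
  intro ψ hψ
  have hs := isSmoothChart_of_mem_atlas hψ
  have hr : ContDiffOn ℝ ∞ (fun y => ρ (ψ.symm y)) ψ.target := by
    have := hs.contDiffOn_comp_symm (O := univ) hρ.contMDiffOn
    rwa [preimage_univ, inter_univ] at this
  refine ((hw ψ hψ).smul ψ.open_target hr).congr ψ.open_target (fun y _ => rfl) fun y hy => ?_
  rw [hs.fderiv_comp_symm_eq_cdiff hy ((hρ _).mdifferentiableAt (by simp))]
  rfl

theorem pairing_smulRight_self (h : SurfaceMetric M) (x : M) (A : T*[x, ℝ]) (v : F) :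
    pairing h x (A.smulRight v) (A.smulRight v) = pairing h x A A * ‖v‖ ^ 2 := by
  obtain ⟨f₁, f₂, hf⟩ := exists_orthoFrame h x
  rw [hf.pairing_eq, hf.pairing_eq]
  simp only [ContinuousLinearMap.smulRight_apply, inner_smul_left, inner_smul_right,
    real_inner_self_eq_norm_sq]
  simp
  ring

theorem IsW12.smul (hw : IsW12 h w G) {ρ : M → ℝ} (hρ : Smooth[ℝ] ρ) {B : ℝ}
    (hB : ∀ x, |ρ x| ≤ B) (hB' : ∀ x, dInner h ρ ρ x ≤ B) :
    IsW12 h (fun x => ρ x • w x) (fun x => ρ x • G x + (cdiff ρ x).smulRight (w x)) where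
  weak := hw.weak.smul hρ
  memLp := by
    refine hw.memLp.of_le_mul (c := B) (hρ.continuous.aestronglyMeasurable.smul hw.memLp.1)
      (ae_of_all _ fun x => ?_)
    rw [norm_smul, Real.norm_eq_abs]
    exact mul_le_mul_of_nonneg_right (hB x) (norm_nonneg _)
  integrable := by
    have hwk := hw.weak.smul hρ
    refine ((hw.integrable.const_mul (2 * B ^ 2)).add
      (hw.integrable_norm_sq.const_mul (2 * B))).mono'
      (aemeasurable_pairing h hwk hwk).aestronglyMeasurable (ae_of_all _ fun x => ?_)
    rw [Real.norm_of_nonneg (pairing_self_nonneg h x _)]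
    refine (pairing_add_self_le h x _ _).trans ?_
    rw [pairing_smulRight_self, pairing_smul_left, pairing_smul_right]
    have h1 : ρ x ^ 2 ≤ B ^ 2 := sq_le_sq' (abs_le.1 (hB x)).1 (abs_le.1 (hB x)).2
    have h2 := mul_le_mul_of_nonneg_right h1 (pairing_self_nonneg h x (G x))
    have h3 := mul_le_mul_of_nonneg_right (hB' x) (sq_nonneg ‖w x‖)
    simp only [Pi.add_apply]
    change _ ≤ 2 * B ^ 2 * pairing h x (G x) (G x) + 2 * B * ‖w x‖ ^ 2
    change pairing h x (cdiff ρ x) (cdiff ρ x) * ‖w x‖ ^ 2 ≤ _ at h3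
    linarith

end SobolevPairs

/-! ### Density of test fields -/

section Density

/-- The pair `(w, G)` is a limit in `W^{1,2}` of smooth fields with compact support in `O`. -/
def IsApproximable (h : SurfaceMetric M) (O : Set M) (w : M → F) (G : (x : M) → T*[x, F]) : Prop :=
  ∀ ε > 0, ∃ v ∈ testFields F O, sobolevSq h (fun x => v x - w x) (fun x => cdiff v x - G x) ≤ ε

variable {h : SurfaceMetric M} {O : Set M} {w w' : M → F}
  {G G' : (x : M) → T*[x, F]}

theorem setLIntegral_eq_of_eq_zero {X : Type*} [MeasurableSpace X] {μ : Measure X} {S : Set X}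
    (hS : MeasurableSet S) {g : X → ℝ≥0∞} (hg : ∀ x ∉ S, g x = 0) :
    ∫⁻ x in S, g x ∂μ = ∫⁻ x, g x ∂μ := by
  rw [← lintegral_indicator hS, indicator_eq_self.2 fun x hx => by_contra fun h => hx (hg x h)]

theorem mdifferentiableAt_of_mem_testFields (hw : w ∈ testFields F O) (x : M) : DiffAt[F] w x :=
  (hw.1 x).mdifferentiableAt (by simp)

theorem IsApproximable.of_close (hw : IsW12 h w G)
    (H : ∀ ε > 0, ∃ (v : M → F) (A : (x : M) → T*[x, F]), IsW12 h v A ∧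
      IsApproximable h O v A ∧ sobolevSq h (fun x => v x - w x) (fun x => A x - G x) ≤ ε) :
    IsApproximable h O w G := by
  intro ε hε
  obtain ⟨v, A, hv, ha, hle⟩ := H (ε / 4) (by positivity)
  obtain ⟨g, hg, hgle⟩ := ha (ε / 4) (by positivity)
  refine ⟨g, hg, ?_⟩
  have hs := ((isW12_of_mem_testFields (h := h) hg).sub hv).sobolevSq_add_le (hv.sub hw)
  simp only [sub_add_sub_cancel] at hs
  linarith

theorem IsApproximable.add (hw : IsW12 h w G) (hw' : IsW12 h w' G')
    (ha : IsApproximable h O w G) (ha' : IsApproximable h O w' G') :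
    IsApproximable h O (fun x => w x + w' x) (fun x => G x + G' x) := by
  intro ε hε
  obtain ⟨v, hv, hle⟩ := ha (ε / 4) (by positivity)
  obtain ⟨v', hv', hle'⟩ := ha' (ε / 4) (by positivity)
  refine ⟨v + v', (testFields F O).add_mem hv hv', ?_⟩
  have hs := ((isW12_of_mem_testFields (h := h) hv).sub hw).sobolevSq_add_le
    ((isW12_of_mem_testFields (h := h) hv').sub hw')
  have e : ∀ x, cdiff (v + v') x = cdiff v x + cdiff v' x := fun x =>
    cdiff_add (mdifferentiableAt_of_mem_testFields hv x)
      (mdifferentiableAt_of_mem_testFields hv' x)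
  simp only [sub_add_sub_comm, ← e] at hs
  exact hs.trans (by linarith)

/-- In the chart the pair becomes a compactly supported Sobolev function of the plane. It is
mollified and extended back by zero, and the comparison of metric and Euclidean quantities on a
compact set carries the estimates to the surface. -/
theorem IsW12.isApproximable_of_chart {ψ : Chart[M]} (hψ : ψ ∈ atlas ℂ M)
    (hw : IsW12 h w G) {k : Set ℂ} (hk : IsCompact k) (hkt : k ⊆ ψ.target)
    (h0 : ∀ x ∉ ψ.symm '' k, w x = 0 ∧ G x = 0) : IsApproximable h univ w G := by
  have hs := isSmoothChart_of_mem_atlas hψ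
  obtain ⟨θ, hθ, hθc, hθt, hθ1, -⟩ := exists_cutoff hk ψ.open_target hkt
  rw [contMDiff_iff_contDiff] at hθ
  set f : ℂ → F := fun y => θ y • w (ψ.symm y) with hf
  set A : ℂ → ℂ →L[ℝ] F := fun y => θ y • (G (ψ.symm y)).comp (chartDifferential ψ y) with hA
  have hθk : ∀ y ∈ k, θ y = 1 := fun y hy => hθ1.self_of_nhdsSet y hy
  have hout : ∀ y ∉ k, y ∈ ψ.target → w (ψ.symm y) = 0 ∧ G (ψ.symm y) = 0 := by
    intro y hy hyt
    refine h0 _ ?_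
    rintro ⟨z, hz, hzy⟩
    exact hy (ψ.symm.injOn (hkt hz) hyt hzy ▸ hz)
  have h00 : ∀ y ∉ k, f y = 0 ∧ A y = 0 := by
    intro y hy
    by_cases hyt : y ∈ ψ.target
    · simp only [hf, hA, hout y hy hyt, smul_zero, ContinuousLinearMap.zero_comp, and_self]
    · simp only [hf, hA, image_eq_zero_of_notMem_tsupport fun hy' => hyt (hθt hy'), zero_smul,
        and_self]
  have hf0 := fun y hy => (h00 y hy).1
  have hA0 := fun y hy => (h00 y hy).2
  have hfw : ∀ y ∈ ψ.target, f y = w (ψ.symm y) := by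
    intro y hy
    by_cases hyk : y ∈ k
    · simp only [hf, hθk y hyk, one_smul]
    · rw [hf0 y hyk, (hout y hyk hy).1]
  have hAG : ∀ y ∈ ψ.target, A y = (G (ψ.symm y)).comp (chartDifferential ψ y) := by
    intro y hy
    by_cases hyk : y ∈ k
    · simp only [hA, hθk y hyk, one_smul]
    · rw [hA0 y hyk, (hout y hyk hy).2, ContinuousLinearMap.zero_comp]
  have hweak : IsWeakDerivOn univ f A := by
    refine ((hw.weak ψ hψ).cutoff_smul hθ hθc hθt).congr isOpen_univ (fun y _ => rfl) ?_
    intro y _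
    have : (fderiv ℝ θ y).smulRight (w (ψ.symm y)) = 0 := by
      by_cases hyk : y ∈ k
      · have : fderiv ℝ θ y = 0 := by
          have : θ =ᶠ[𝓝 y] fun _ => 1 := (eventually_nhdsSet_iff_forall.1 hθ1) y hyk
          rw [this.fderiv_eq, fderiv_const_apply]
        rw [this]; ext; simp
      by_cases hyt : y ∈ ψ.target
      · rw [(hout y hyk hyt).1]; ext; simp
      · rw [fderiv_eq_zero_of_notMem_tsupport fun hy' => hyt (hθt hy')]; ext; simp
    rw [this, add_zero]
  obtain ⟨C, hC, hcomp⟩ := hs.exists_comparison h hk hkt (F := F)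
  have hmem : ∀ {E : Type _} [NormedAddCommGroup E] [NormedSpace ℝ E] {g : ℂ → E} {e : M → ℝ}
      {D : ℝ}, LocallyIntegrableOn g univ → Integrable e vol[h] →
      (∀ y ∉ k, g y = 0) → (∀ y ∈ k, ‖g y‖ ^ 2 ≤ D * (chartDensity h ψ y * e (ψ.symm y))) →
      MemLp g 2 := by
    intro E _ _ g e D hg he hg0 hge
    have hgm : AEStronglyMeasurable g := by simpa using hg.aestronglyMeasurable
    rw [memLp_two_iff_integrable_sq_norm hgm]
    have hon : IntegrableOn (fun y => ‖g y‖ ^ 2) k := by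
      have h1 : IntegrableOn (fun y => D * (chartDensity h ψ y • e (ψ.symm y))) k :=
        ((hs.integrableOn_chart h he.integrableOn).mono_set hkt).const_mul D
      refine h1.mono' (hgm.norm.pow 2).restrict ?_
      filter_upwards [ae_restrict_mem hk.measurableSet] with y hy
      rw [Real.norm_of_nonneg (by positivity)]
      exact hge y hy
    exact (integrableOn_iff_integrable_of_support_subset fun y hy =>
      by_contra fun hyk => hy (by simp [hg0 y hyk])).1 hon
  have hf2 : MemLp f 2 := by
    refine hmem (D := C) hweak.locallyIntegrable hw.integrable_norm_sq hf0 fun y hy => ?_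
    rw [hfw y (hkt hy), ← mul_assoc]
    exact le_mul_of_one_le_left (by positivity) (hcomp y hy).2.1
  have hA2 : MemLp A 2 := by
    refine hmem (D := C * C) hweak.locallyIntegrable_deriv hw.integrable hA0 fun y hy => ?_
    rw [hAG y (hkt hy)]
    refine ((hcomp y hy).2.2 (G (ψ.symm y))).2.trans ?_
    have := pairing_self_nonneg h (ψ.symm y) (G (ψ.symm y))
    rw [mul_assoc, ← mul_assoc C (chartDensity h ψ y)]
    exact mul_le_mul_of_nonneg_left (le_mul_of_one_le_left this (hcomp y hy).2.1) hC.le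
  -- The compact set `k'` is fixed before the accuracy, so that its comparison constant `C'` may
  -- enter the choice of the accuracy.
  obtain ⟨k', hk't, hk', hkk', happ⟩ :=
    hweak.exists_smooth_approx hf2 hA2 hk ψ.open_target hkt hf0 hA0
  obtain ⟨C', hC', hcomp'⟩ := hs.exists_comparison h hk' hk't (F := F)
  intro ε hε
  obtain ⟨g, hg, hgs, hg1, hg2⟩ := happ (ε / (C' + C' * C')) (by positivity)
  have hgc : HasCompactSupport g := hk'.of_isClosed_subset (isClosed_tsupport g) hgs
  have hgt := hgs.trans hk't
  have hv : chartExtend ψ g ∈ testFields F (univ : Set M) :=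
    ⟨hs.contMDiff_chartExtend hg hgc hgt, hasCompactSupport_chartExtend hgc hgt, subset_univ _⟩
  refine ⟨_, hv, integral_le_of_lintegral_le
    (fun x => add_nonneg (by positivity) (pairing_self_nonneg h x _)) hε.le ?_⟩
  have hm := ((isW12_of_mem_testFields (h := h) hv).sub hw).integrable_sobolev
    |>.aestronglyMeasurable.aemeasurable.ennreal_ofReal
  set S : Set M := ψ.source ∩ ψ ⁻¹' k' with hSdef
  have hSm : MeasurableSet S := measurableSet_source_inter_preimage ψ hk'.measurableSet
  have hzero : ∀ x ∉ S, ofReal (‖chartExtend ψ g x - w x‖ ^ 2 +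
      pairing h x (cdiff (chartExtend ψ g) x - G x) (cdiff (chartExtend ψ g) x - G x)) = 0 := by
    intro x hx
    have hx1 : x ∉ ψ.symm '' k := by
      rintro ⟨y, hy, rfl⟩
      exact hx ⟨ψ.map_target (hkt hy), by simpa [ψ.right_inv (hkt hy)] using hkk' hy⟩
    have hx2 : x ∉ tsupport (chartExtend ψ g) := by
      intro hx'
      obtain ⟨y, hy, rfl⟩ := tsupport_chartExtend_subset hgc hgt hx'
      exact hx ⟨ψ.map_target (hgt hy), by simpa [ψ.right_inv (hgt hy)] using hgs hy⟩
    rw [(h0 x hx1).1, (h0 x hx1).2, image_eq_zero_of_notMem_tsupport hx2,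
      cdiff_eq_zero_of_notMem_tsupport hx2]
    simp [pairing_zero_left]
  rw [← setLIntegral_eq_of_eq_zero hSm hzero, hs.setLIntegral_preimage h hm hk'.measurableSet hk't]
  have hpt : ∀ y ∈ k', ofReal (chartDensity h ψ y) *
      ofReal (‖chartExtend ψ g (ψ.symm y) - w (ψ.symm y)‖ ^ 2 +
        pairing h (ψ.symm y) (cdiff (chartExtend ψ g) (ψ.symm y) - G (ψ.symm y))
          (cdiff (chartExtend ψ g) (ψ.symm y) - G (ψ.symm y))) ≤
      ofReal C' * ofReal (‖g y - f y‖ ^ 2) +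
        ofReal (C' * C') * ofReal (‖fderiv ℝ g y - A y‖ ^ 2) := by
    intro y hy
    have hyt := hk't hy
    have e1 : (cdiff (chartExtend ψ g) (ψ.symm y) - G (ψ.symm y)).comp (chartDifferential ψ y) =
        fderiv ℝ g y - A y := by
      have hd := hs.fderiv_comp_symm_eq_cdiff hyt
        (mdifferentiableAt_of_mem_testFields hv (ψ.symm y))
      have hc : (fun z => chartExtend ψ g (ψ.symm z)) =ᶠ[𝓝 y] g := by
        filter_upwards [ψ.open_target.mem_nhds hyt] with z hz using chartExtend_symm ψ g hz
      rw [hc.fderiv_eq] at hd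
      rw [hd, hAG y hyt]
      rfl
    rw [chartExtend_symm ψ g hyt, ← hfw y hyt, ← ENNReal.ofReal_mul (hs.chartDensity_pos h hyt).le,
      ← ENNReal.ofReal_mul hC'.le, ← ENNReal.ofReal_mul (by positivity),
      ← ENNReal.ofReal_add (by positivity) (by positivity)]
    apply ENNReal.ofReal_le_ofReal
    have hp := ((hcomp' y hy).2.2 (cdiff (chartExtend ψ g) (ψ.symm y) - G (ψ.symm y))).1
    rw [e1] at hp
    have hp0 := pairing_self_nonneg h (ψ.symm y) (cdiff (chartExtend ψ g) (ψ.symm y) - G (ψ.symm y))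
    calc _ ≤ C' * (‖g y - f y‖ ^ 2 + C' * ‖fderiv ℝ g y - A y‖ ^ 2) :=
          mul_le_mul (hcomp' y hy).1 (by gcongr) (by positivity) hC'.le
      _ = _ := by ring
  refine (setLIntegral_mono' hk'.measurableSet hpt).trans ((setLIntegral_le_lintegral _ _).trans ?_)
  calc _ = ofReal C' * (∫⁻ y, ofReal (‖g y - f y‖ ^ 2)) +
        ofReal (C' * C') * ∫⁻ y, ofReal (‖fderiv ℝ g y - A y‖ ^ 2) := by
        rw [lintegral_add_left', lintegral_const_mul' _ _ ENNReal.ofReal_ne_top,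
          lintegral_const_mul' _ _ ENNReal.ofReal_ne_top]
        exact (((hg.continuous.aestronglyMeasurable.sub hf2.1).norm.pow 2).aemeasurable
          |>.ennreal_ofReal).const_mul _
    _ ≤ ofReal C' * ofReal (ε / (C' + C' * C')) +
        ofReal (C' * C') * ofReal (ε / (C' + C' * C')) := by gcongr
    _ = ofReal ε := by
        rw [← add_mul, ← ENNReal.ofReal_add hC'.le (by positivity),
          ← ENNReal.ofReal_mul (by positivity)]
        congr 1
        field_simp

end Density

/-! ### Density for fields with compact support -/

section DensityCompact

variable {h : SurfaceMetric M} {O : Set M} {w w' : M → F}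
  {G G' : (x : M) → T*[x, F]}

theorem exists_dInner_self_le (h : SurfaceMetric M) {w : M → F}
    (hw : Smooth[F] w) (hc : HasCompactSupport w) : ∃ B : ℝ, 0 ≤ B ∧ ∀ x, dInner h w w x ≤ B := by
  have hcs : HasCompactSupport (dInner h w w) := by
    refine HasCompactSupport.intro hc fun x hx => dInner_eq_zero_of_notMem_tsupport h w hx
  obtain ⟨B, hB⟩ := hcs.exists_bound_of_continuous (continuous_dInner h hw hw)
  exact ⟨max B 0, le_max_right _ _, fun x =>
    ((Real.le_norm_self _).trans (hB x)).trans (le_max_left _ _)⟩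

theorem IsW12.smul_of_hasCompactSupport (hw : IsW12 h w G) {ρ : M → ℝ}
    (hρ : Smooth[ℝ] ρ) (hc : HasCompactSupport ρ) :
    IsW12 h (fun x => ρ x • w x) (fun x => ρ x • G x + (cdiff ρ x).smulRight (w x)) := by
  obtain ⟨B, hB0, hB⟩ := exists_dInner_self_le h hρ hc
  obtain ⟨B', hB'⟩ := hc.exists_bound_of_continuous hρ.continuous
  exact hw.smul hρ (B := max B B') (fun x => (hB' x).trans (le_max_right _ _))
    (fun x => (hB x).trans (le_max_left _ _))

/-- Induction on the number of charts that cover the support: a cut-off splits off a part supported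
in one chart, and the remainder is supported where the other charts suffice. -/
theorem IsW12.isApproximable_of_finset (t : Finset M) : ∀ {w : M → F}
    {G : (x : M) → T*[x, F]}, IsW12 h w G → ∀ K : Set M, IsCompact K →
    K ⊆ ⋃ a ∈ t, (chartAt ℂ a).source → (∀ x ∉ K, w x = 0 ∧ G x = 0) →
    IsApproximable h univ w G := by
  classical
  induction t using Finset.induction_on with
  | empty =>
    intro w G hw K hK hKt h0
    have hKe : K = ∅ := by simpa using hKt
    intro ε hε
    refine ⟨0, zero_mem _, ?_⟩
    have : sobolevSq h (fun x => (0 : M → F) x - w x) (fun x => cdiff (0 : M → F) x - G x) = 0 := by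
      refine integral_eq_zero_of_ae (ae_of_all _ fun x => ?_)
      have hx := h0 x (by simp [hKe])
      have hc : cdiff (0 : M → F) x = 0 := cdiff_const 0 x
      simp [hx.1, hx.2, hc, pairing_zero_left]
    rw [this]; exact hε.le
  | insert a t hat ih =>
    intro w G hw K hK hKt h0
    rw [Finset.set_biUnion_insert] at hKt
    obtain ⟨K₁, K₂, hK₁, hK₂, hK₁s, hK₂s, hK12⟩ := hK.binary_compact_cover
      (chartAt ℂ a).open_source (isOpen_biUnion fun b _ => (chartAt ℂ b).open_source) hKt
    obtain ⟨χ, hχ, hχc, hχs, hχ1, -⟩ := exists_cutoff hK₁ (chartAt ℂ a).open_source hK₁s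
    have hw1 := hw.smul_of_hasCompactSupport hχ hχc
    have hw2 := hw.sub hw1
    have ha1 : IsApproximable h univ (fun x => χ x • w x)
        (fun x => χ x • G x + (cdiff χ x).smulRight (w x)) := by
      refine hw1.isApproximable_of_chart (chart_mem_atlas ℂ a) (k := chartAt ℂ a '' tsupport χ)
        (hχc.image_of_continuousOn ((chartAt ℂ a).continuousOn.mono hχs)) ?_ fun x hx => ?_
      · rintro _ ⟨x, hx, rfl⟩
        exact (chartAt ℂ a).map_source (hχs hx)
      · have hx' : x ∉ tsupport χ := fun hx' =>
          hx ⟨chartAt ℂ a x, mem_image_of_mem _ hx', (chartAt ℂ a).left_inv (hχs hx')⟩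
        rw [image_eq_zero_of_notMem_tsupport hx', cdiff_eq_zero_of_notMem_tsupport hx']
        refine ⟨zero_smul _ _, ?_⟩
        ext v
        simp
    -- `w - χ w` and its differential vanish on the interior of `{χ = 1}`. This interior contains
    -- `K₁`, so what remains of `K` lies in `K₂`.
    have ha2 := ih hw2 (K \ interior {x | χ x = 1}) (hK.diff isOpen_interior) ?_ ?_
    · have := ha1.add hw1 hw2 ha2
      simpa only [add_sub_cancel] using this
    · rintro x ⟨hxK, hx⟩
      rw [hK12] at hxK
      rcases hxK with hx1 | hx2
      · exact absurd (mem_interior_iff_mem_nhds.2 ((eventually_nhdsSet_iff_forall.1 hχ1) x hx1)) hx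
      · exact hK₂s hx2
    · intro x hx
      by_cases hxK : x ∈ K
      · have hx1 : χ =ᶠ[𝓝 x] fun _ => 1 := by
          by_contra hcon
          exact hx ⟨hxK, fun hi => hcon (mem_interior_iff_mem_nhds.1 hi)⟩
        have hc : cdiff χ x = 0 := (cdiff_congr hx1).trans (cdiff_const 1 x)
        rw [hx1.self_of_nhds, hc]
        refine ⟨by simp, ?_⟩
        ext v
        simp
      · rw [(h0 x hxK).1, (h0 x hxK).2]
        refine ⟨by simp, ?_⟩
        ext v
        simp

theorem IsW12.isApproximable_of_isCompact (hw : IsW12 h w G) {K : Set M} (hK : IsCompact K)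
    (h0 : ∀ x ∉ K, w x = 0 ∧ G x = 0) : IsApproximable h univ w G := by
  obtain ⟨t, -, ht⟩ := hK.elim_nhds_subcover (fun x => (chartAt ℂ x).source)
    fun x _ => (chartAt ℂ x).open_source.mem_nhds (mem_chart_source ℂ x)
  exact IsW12.isApproximable_of_finset t hw K hK ht h0

theorem IsW12.isApproximable_of_compactSpace [CompactSpace M] (hw : IsW12 h w G) :
    IsApproximable h univ w G :=
  hw.isApproximable_of_isCompact isCompact_univ fun x hx => absurd (mem_univ x) hx

end DensityCompact

/-! ### Density on the plane -/

section DensityPlane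

variable {w : ℂ → F} {G : (x : ℂ) → T*[x, F]}

theorem dInner_flatMetric_self_le {w : ℂ → F} (hw : ContDiff ℝ ∞ w) (z : ℂ) :
    dInner flatMetric w w z ≤ 2 * ‖fderiv ℝ w z‖ ^ 2 := by
  have hd : DiffAt[F] w z :=
    (hw.contDiffAt.differentiableAt (by simp)).mdifferentiableAt
  have := isConformalWith_refl.dInner_eq (y := z) (mem_univ z) hd hd
  rw [OpenPartialHomeomorph.refl_symm] at this
  simp only [OpenPartialHomeomorph.refl_apply, inv_one, one_mul] at this
  change dInner flatMetric w w z = flatPairing (fderiv ℝ w z) (fderiv ℝ w z) at this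
  rw [this]
  exact flatPairing_le_norm_sq _

theorem IsW12.isApproximable_plane (hw : IsW12 flatMetric w G) :
    IsApproximable flatMetric univ w G := by
  refine IsApproximable.of_close hw fun ε hε => ?_
  obtain ⟨θ, hθ, hθc, -, hθ1, hθ01⟩ := exists_cutoff (isCompact_closedBall (0 : ℂ) 1) isOpen_univ
    (subset_univ _)
  rw [contMDiff_iff_contDiff] at hθ
  obtain ⟨B, hB⟩ := (hθc.fderiv (𝕜 := ℝ)).exists_bound_of_continuous
    (hθ.continuous_fderiv (by simp))
  -- Cut-offs at scale `n + 1`. Their gradients are bounded uniformly in `n`, which gives an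
  -- integrable dominating function, and each point has a neighbourhood where they are eventually
  -- `1`.
  set χ : ℕ → ℂ → ℝ := fun n z => θ (((n : ℝ) + 1)⁻¹ • z) with hχ
  have hpos : ∀ n : ℕ, (0 : ℝ) < ((n : ℝ) + 1)⁻¹ := fun n => by positivity
  have hle1 : ∀ n : ℕ, ((n : ℝ) + 1)⁻¹ ≤ 1 := fun n =>
    inv_le_one_of_one_le₀ (by linarith [n.cast_nonneg (α := ℝ)])
  have hχs : ∀ n, ContDiff ℝ ∞ (χ n) := fun n => hθ.comp (contDiff_const_smul _)
  have hχc : ∀ n, HasCompactSupport (χ n) := fun n => hθc.comp_smul (hpos n).ne'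
  have hχd : ∀ n z, dInner flatMetric (χ n) (χ n) z ≤ 2 * B ^ 2 := by
    intro n z
    refine (dInner_flatMetric_self_le (hχs n) z).trans ?_
    have : fderiv ℝ (χ n) z = ((n : ℝ) + 1)⁻¹ • fderiv ℝ θ (((n : ℝ) + 1)⁻¹ • z) :=
      fderiv_comp_smul _
    rw [this, norm_smul, Real.norm_of_nonneg (hpos n).le]
    have h1 := hB (((n : ℝ) + 1)⁻¹ • z)
    gcongr
    exact (mul_le_of_le_one_left (norm_nonneg _) (hle1 n)).trans h1
  have hχ1 : ∀ z, ∀ᶠ n in atTop, χ n =ᶠ[𝓝 z] fun _ => 1 := by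
    intro z
    obtain ⟨N, hN⟩ := exists_nat_gt ‖z‖
    filter_upwards [eventually_ge_atTop N] with n hn
    have hz : ((n : ℝ) + 1)⁻¹ • z ∈ Metric.closedBall (0 : ℂ) 1 := by
      rw [mem_closedBall_zero_iff, norm_smul, Real.norm_of_nonneg (hpos n).le,
        inv_mul_le_iff₀ (by positivity)]
      have : (N : ℝ) ≤ n := by exact_mod_cast hn
      linarith
    have := (eventually_nhdsSet_iff_forall.1 hθ1) _ hz
    exact (continuous_const_smul (((n : ℝ) + 1)⁻¹)).continuousAt.eventually this
  have hwn := fun n => hw.smul_of_hasCompactSupport (contMDiff_iff_contDiff.2 (hχs n)) (hχc n)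
  have hlim : Tendsto (fun n => sobolevSq flatMetric (fun x => χ n x • w x - w x)
      (fun x => χ n x • G x + (cdiff (χ n) x).smulRight (w x) - G x)) atTop (𝓝 0) := by
    have h0 : (0 : ℝ) = ∫ _ : ℂ, (0 : ℝ) ∂vol[flatMetric] := by simp
    rw [h0]
    refine tendsto_integral_of_dominated_convergence
      (fun x => (1 + 2 * (2 * B ^ 2)) * (‖w x‖ ^ 2 + 2 * pairing flatMetric x (G x) (G x)))
      (fun n => ((hwn n).sub hw).integrable_sobolev.aestronglyMeasurable) ?_
      (fun n => Eventually.of_forall fun x => ?_) (ae_of_all _ fun x => ?_)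
    · exact (hw.integrable_norm_sq.add (hw.integrable.const_mul 2)).const_mul _
    · have hp := pairing_self_nonneg flatMetric x (G x)
      have hp' := pairing_self_nonneg flatMetric x
        (χ n x • G x + (cdiff (χ n) x).smulRight (w x) - G x)
      rw [Real.norm_of_nonneg (by positivity)]
      obtain ⟨h0, h1⟩ := hθ01 (((n : ℝ) + 1)⁻¹ • x)
      have e1 : χ n x • w x - w x = (χ n x - 1) • w x := by rw [sub_smul, one_smul]
      have e2 : χ n x • G x + (cdiff (χ n) x).smulRight (w x) - G x =
          (χ n x - 1) • G x + (cdiff (χ n) x).smulRight (w x) := by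
        rw [sub_smul, one_smul]; abel
      have hsq : (χ n x - 1) ^ 2 ≤ 1 := by
        have h0' : 0 ≤ χ n x := h0
        have h1' : χ n x ≤ 1 := h1
        nlinarith
      have hadd := pairing_add_self_le flatMetric x ((χ n x - 1) • G x)
        ((cdiff (χ n) x).smulRight (w x))
      rw [pairing_smulRight_self, pairing_smul_left, pairing_smul_right] at hadd
      have hd : pairing flatMetric x (cdiff (χ n) x) (cdiff (χ n) x) ≤ 2 * B ^ 2 := hχd n x
      have hb1 := mul_le_mul_of_nonneg_right hd (sq_nonneg ‖w x‖)
      have hb2 := mul_le_mul_of_nonneg_right hsq hp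
      have hb3 := mul_le_mul_of_nonneg_right hsq (sq_nonneg ‖w x‖)
      beta_reduce
      rw [e2, e1, norm_smul, mul_pow, Real.norm_eq_abs, sq_abs]
      nlinarith [mul_nonneg (sq_nonneg B) hp]
    · refine Tendsto.congr' ?_ tendsto_const_nhds
      filter_upwards [hχ1 x] with n hn
      have hc : cdiff (χ n) x = 0 := (cdiff_congr hn).trans (cdiff_const 1 x)
      have hz : (0 : T*[x, ℝ]).smulRight (w x) = 0 := by ext v; simp
      rw [hn.self_of_nhds, hc, hz]
      simp [pairing_zero_left]
  obtain ⟨n, hn⟩ := (hlim.eventually (eventually_le_nhds hε)).exists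
  refine ⟨_, _, hwn n, (hwn n).isApproximable_of_isCompact (hχc n) fun x hx => ?_, hn⟩
  rw [image_eq_zero_of_notMem_tsupport hx, cdiff_eq_zero_of_notMem_tsupport hx]
  refine ⟨zero_smul _ _, ?_⟩
  ext v
  simp

end DensityPlane

/-! ### Points have capacity zero -/

section Capacity

theorem norm_sum_sq_of_disjoint {ι E : Type*} [NormedAddCommGroup E] (s : Finset ι) (v : ι → E)
    (hv : ∀ i ∈ s, ∀ j ∈ s, i ≠ j → v i = 0 ∨ v j = 0) :
    ‖∑ i ∈ s, v i‖ ^ 2 = ∑ i ∈ s, ‖v i‖ ^ 2 := by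
  by_cases hz : ∃ i ∈ s, v i ≠ 0
  · obtain ⟨i, hi, hiv⟩ := hz
    have h0 : ∀ j ∈ s, j ≠ i → v j = 0 := fun j hj hji =>
      (hv i hi j hj (Ne.symm hji)).resolve_left hiv
    rw [Finset.sum_eq_single_of_mem i hi h0, Finset.sum_eq_single_of_mem i hi]
    intro j hj hji
    simp [h0 j hj hji]
  · push Not at hz
    rw [Finset.sum_eq_zero hz, Finset.sum_eq_zero fun i hi => by simp [hz i hi]]
    simp

theorem integrable_norm_fderiv_sq {E : Type*} [NormedAddCommGroup E] [NormedSpace ℝ E] {b : ℂ → E}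
    (hb : ContDiff ℝ ∞ b) (hbc : HasCompactSupport b) : Integrable fun z => ‖fderiv ℝ b z‖ ^ 2 := by
  refine ((hb.continuous_fderiv (by simp)).norm.pow 2).integrable_of_hasCompactSupport
    (HasCompactSupport.intro hbc fun x hx => ?_)
  simp [fderiv_eq_zero_of_notMem_tsupport hx]

/-- Cutoff functions of the plane with small support and small energy. -/
theorem exists_plane_capacity (y₀ : ℂ) {ρ ε : ℝ} (hρ : 0 < ρ) (hε : 0 < ε) :
    ∃ η : ℂ → ℝ, ContDiff ℝ ∞ η ∧ tsupport η ⊆ Metric.closedBall y₀ ρ ∧ (∀ᶠ y in 𝓝 y₀, η y = 1) ∧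
      (∀ y, η y ∈ Icc (0 : ℝ) 1) ∧ ∫ y, ‖fderiv ℝ η y‖ ^ 2 ≤ ε := by
  obtain ⟨b, hb, hbc, hbt, hb1, hb01⟩ := exists_cutoff (isCompact_closedBall (0 : ℂ) 1)
    (Metric.isOpen_ball (x := (0 : ℂ)) (ε := 2)) (Metric.closedBall_subset_ball (by norm_num))
  rw [contMDiff_iff_contDiff] at hb
  have hbd : ∀ z, fderiv ℝ b z ≠ 0 → 1 < ‖z‖ ∧ ‖z‖ < 2 := by
    intro z hz
    refine ⟨?_, ?_⟩ <;> by_contra! hle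
    · have := (eventually_nhdsSet_iff_forall.1 hb1) z (mem_closedBall_zero_iff.2 hle)
      exact hz (by rw [EventuallyEq.fderiv_eq this, fderiv_const_apply])
    · exact hz (fderiv_eq_zero_of_notMem_tsupport fun hz' =>
        hle.not_gt (mem_ball_zero_iff.1 (hbt hz')))
  set I := ∫ z, ‖fderiv ℝ b z‖ ^ 2 with hI
  have hI0 : 0 ≤ I := integral_nonneg fun z => by positivity
  -- The cut-off is the average of `N` copies of `b` at scales shrinking by factors of `4`. In
  -- dimension two every copy has the same energy `I`, and their gradients live in disjoint annuli,
  -- so the average has energy `N I / N² = I / N`.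
  obtain ⟨N, hN⟩ := exists_nat_gt (I / ε)
  have hN0 : (0 : ℝ) < N := (div_nonneg hI0 hε.le).trans_lt hN
  set s : ℕ → ℝ := fun i => 2 / ρ * 4 ^ i with hs
  have hspos : ∀ i, 0 < s i := fun i => by positivity
  set e : ℕ → ℂ → ℝ := fun i y => b (s i • (y - y₀)) with he
  have hes : ∀ i, ContDiff ℝ ∞ (e i) := fun i => hb.comp (by fun_prop)
  have hed : ∀ i y, fderiv ℝ (e i) y = s i • fderiv ℝ b (s i • (y - y₀)) := by
    intro i y
    have h1 : HasFDerivAt (fun y : ℂ => s i • (y - y₀)) (s i • ContinuousLinearMap.id ℝ ℂ) y :=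
      ((hasFDerivAt_id y).sub_const y₀).const_smul (s i)
    have h2 := (hb.differentiable (by simp) (s i • (y - y₀))).hasFDerivAt.comp y h1
    rw [show fderiv ℝ (e i) y = _ from h2.fderiv]
    ext v
    simp
  have hdisj : ∀ y i j, i < j → fderiv ℝ (e i) y = 0 ∨ fderiv ℝ (e j) y = 0 := by
    intro y i j hij
    by_contra! hne
    rw [hed, hed] at hne
    have h1 := (hbd _ (right_ne_zero_of_smul hne.1)).1
    have h2 := (hbd _ (right_ne_zero_of_smul hne.2)).2
    rw [norm_smul, Real.norm_of_nonneg (hspos _).le] at h1 h2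
    have h3 : s i * 4 ≤ s j := by
      have : (4 : ℝ) ^ (i + 1) ≤ 4 ^ j := pow_le_pow_right₀ (by norm_num) hij
      calc s i * 4 = 2 / ρ * 4 ^ (i + 1) := by simp only [hs]; ring
        _ ≤ _ := by simp only [hs]; gcongr
    nlinarith [norm_nonneg (y - y₀)]
  have hint0 := integrable_norm_fderiv_sq hb hbc
  have hint : ∀ i, Integrable fun y => ‖fderiv ℝ (e i) y‖ ^ 2 := by
    intro i
    simp only [hed, norm_smul, mul_pow]
    exact ((hint0.comp_smul (hspos i).ne').comp_sub_right y₀).const_mul _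
  have hval : ∀ i, ∫ y, ‖fderiv ℝ (e i) y‖ ^ 2 = I := by
    intro i
    simp only [hed, norm_smul, mul_pow]
    rw [integral_const_mul, integral_sub_right_eq_self (fun y : ℂ => ‖fderiv ℝ b (s i • y)‖ ^ 2) y₀,
      Measure.integral_comp_smul volume (fun z : ℂ => ‖fderiv ℝ b z‖ ^ 2),
      Complex.finrank_real_complex, ← hI, smul_eq_mul, abs_of_pos (by have := hspos i; positivity),
      Real.norm_of_nonneg (hspos i).le]
    have := (hspos i).ne'
    field_simp
  have het : ∀ i, tsupport (e i) ⊆ Metric.closedBall y₀ ρ := by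
    intro i
    refine closure_minimal (fun y hy => ?_) Metric.isClosed_closedBall
    have hy' : s i • (y - y₀) ∈ Metric.ball (0 : ℂ) 2 := hbt (subset_tsupport b hy)
    rw [mem_ball_zero_iff, norm_smul, Real.norm_of_nonneg (hspos i).le] at hy'
    rw [mem_closedBall_iff_norm]
    have h1 : (1 : ℝ) ≤ 4 ^ i := one_le_pow₀ (by norm_num)
    have h2 : 2 / ρ ≤ s i := le_mul_of_one_le_right (by positivity) h1
    have h3 : 2 / ρ * ‖y - y₀‖ ≤ 2 :=
      (mul_le_mul_of_nonneg_right h2 (norm_nonneg _)).trans hy'.le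
    rw [div_mul_eq_mul_div, div_le_iff₀ hρ] at h3
    linarith
  refine ⟨fun y => (N : ℝ)⁻¹ * ∑ i ∈ Finset.range N, e i y,
    contDiff_const.mul (ContDiff.sum fun i _ => hes i), ?_, ?_, ?_, ?_⟩
  · refine closure_minimal (fun y hy => ?_) Metric.isClosed_closedBall
    by_contra hy'
    refine hy (mul_eq_zero_of_right _ (Finset.sum_eq_zero fun i _ => ?_))
    exact image_eq_zero_of_notMem_tsupport fun hm => hy' (het i hm)
  · have : ∀ i, ∀ᶠ y in 𝓝 y₀, e i y = 1 := by
      intro i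
      have h1 := (eventually_nhdsSet_iff_forall.1 hb1) (s i • (y₀ - y₀)) (by simp)
      have hc : ContinuousAt (fun y => s i • (y - y₀)) y₀ := by fun_prop
      exact hc.eventually h1
    filter_upwards [(Finset.range N).eventually_all.2 fun i _ => this i] with y hy
    rw [Finset.sum_congr rfl hy]
    simp [hN0.ne']
  · intro y
    have h01 : ∀ i, e i y ∈ Icc (0 : ℝ) 1 := fun i => hb01 _
    refine ⟨mul_nonneg (by positivity) (Finset.sum_nonneg fun i _ => (h01 i).1), ?_⟩
    rw [inv_mul_le_iff₀ hN0, mul_one]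
    exact (Finset.sum_le_sum fun i _ => (h01 i).2).trans_eq (by simp)
  · have hfd : ∀ y, ‖fderiv ℝ (fun y => (N : ℝ)⁻¹ * ∑ i ∈ Finset.range N, e i y) y‖ ^ 2 =
        ((N : ℝ)⁻¹) ^ 2 * ∑ i ∈ Finset.range N, ‖fderiv ℝ (e i) y‖ ^ 2 := by
      intro y
      have hd : ∀ i ∈ Finset.range N, DifferentiableAt ℝ (e i) y := fun i _ =>
        (hes i).differentiable (by simp) y
      rw [fderiv_const_mul (DifferentiableAt.fun_sum hd), fderiv_fun_sum hd, norm_smul, mul_pow,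
        norm_sum_sq_of_disjoint, Real.norm_of_nonneg (by positivity)]
      intro i _ j _ hij
      rcases hij.lt_or_gt with hlt | hlt
      · exact hdisj y i j hlt
      · exact (hdisj y j i hlt).symm
    simp only [hfd]
    rw [integral_const_mul, integral_finsetSum _ fun i _ => hint i]
    simp only [hval, Finset.sum_const, Finset.card_range, nsmul_eq_mul]
    rw [div_lt_iff₀ hε] at hN
    have : ((N : ℝ)⁻¹) ^ 2 * (N * I) = I / N := by field_simp
    rw [this, div_le_iff₀ hN0]
    linarith

variable {h : SurfaceMetric M} {w : M → F} {G : (x : M) → T*[x, F]}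
variable {φ : Chart[M]} {r : ℂ → ℝ} {q : M}

/-- Conformal invariance carries the small energy of the plane cut-off over to the surface; the `L²`
norm is small because the support lies in a small ball. -/
theorem IsConformalWith.exists_capacity (hφ : IsConformalWith h φ r) (hq : q ∈ φ.source) {ε : ℝ}
    (hε : 0 < ε) : ∃ β : M → ℝ, Smooth[ℝ] β ∧ HasCompactSupport β ∧
      (∀ᶠ x in 𝓝 q, β x = 1) ∧ dirichlet h β ≤ ε ∧ ∫ x, β x ^ 2 ∂vol[h] ≤ ε := by
  have hs := hφ.isSmoothChart
  obtain ⟨ρ₀, hρ₀, hball⟩ := Metric.nhds_basis_closedBall.mem_iff.1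
    (φ.open_target.mem_nhds (φ.map_source hq))
  obtain ⟨C, hC, hcomp⟩ := hs.exists_comparison h (isCompact_closedBall (φ q) ρ₀) hball (F := ℝ)
  have hr : ∀ y ∈ Metric.closedBall (φ q) ρ₀, r y ≤ C := fun y hy =>
    hφ.chartDensity_eq (hball hy) ▸ (hcomp y hy).1
  obtain ⟨ρ, hρ, hρρ₀, hρε⟩ : ∃ ρ > 0, ρ ≤ ρ₀ ∧ C * (ρ ^ 2 * π) ≤ ε := by
    refine ⟨min ρ₀ (min 1 (ε / (C * π))), by positivity, min_le_left _ _, ?_⟩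
    have h1 : min ρ₀ (min 1 (ε / (C * π))) ≤ 1 := (min_le_right _ _).trans (min_le_left _ _)
    have h2 : min ρ₀ (min 1 (ε / (C * π))) ≤ ε / (C * π) :=
      (min_le_right _ _).trans (min_le_right _ _)
    have h3 : 0 < min ρ₀ (min 1 (ε / (C * π))) := by positivity
    set m := min ρ₀ (min 1 (ε / (C * π)))
    rw [le_div_iff₀ (by positivity)] at h2
    have h4 : m ^ 2 ≤ m := by nlinarith
    calc C * (m ^ 2 * π) ≤ C * (m * π) := by gcongr
      _ ≤ ε := by linarith
  obtain ⟨η, hη, hηt, hη1, hη01, hηE⟩ := exists_plane_capacity (φ q) hρ (half_pos hε)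
  have hηc : HasCompactSupport η :=
    (isCompact_closedBall (φ q) ρ).of_isClosed_subset (isClosed_tsupport η) hηt
  have hballt : Metric.closedBall (φ q) ρ ⊆ φ.target :=
    (Metric.closedBall_subset_closedBall hρρ₀).trans hball
  have hηs : tsupport η ⊆ φ.target := hηt.trans hballt
  have hβ := hs.contMDiff_chartExtend hη hηc hηs
  have hβc := hasCompactSupport_chartExtend hηc hηs
  have hβt := tsupport_chartExtend_subset_source hηc hηs
  refine ⟨chartExtend φ η, hβ, hβc, ?_, ?_, ?_⟩
  · filter_upwards [φ.open_source.mem_nhds hq, (φ.continuousAt hq).eventually hη1] with x hx hx1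
    rw [chartExtend_of_mem φ η hx, hx1]
  · have hd := hβ.mdifferentiable (by simp)
    have e := hφ.integral_eq (g := dInner h (chartExtend φ η) (chartExtend φ η))
      (k := fun y => flatPairing (fderiv ℝ η y) (fderiv ℝ η y))
      (continuous_dInner h hβ hβ).aestronglyMeasurable
      (fun x hx => dInner_eq_zero_of_notMem_tsupport h _ fun hx' => hx (hβt hx')) (fun y hy => by
        rw [fderiv_eq_zero_of_notMem_tsupport fun hy' => hy (hηs hy')]; simp [flatPairing])
      (fun y hy => by
        have hc : (fun z => chartExtend φ η (φ.symm z)) =ᶠ[𝓝 y] η := by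
          filter_upwards [φ.open_target.mem_nhds hy] with z hz using chartExtend_symm φ η hz
        rw [hφ.dInner_eq hy (hd _) (hd _), hc.fderiv_eq, mul_inv_cancel_left₀ (hφ.pos y hy).ne'])
    rw [dirichlet, e]
    have hi := integrable_norm_fderiv_sq hη hηc
    calc _ ≤ ∫ y, 2 * ‖fderiv ℝ η y‖ ^ 2 :=
          integral_mono_of_nonneg (ae_of_all _ fun y => flatPairing_self_nonneg _)
            (hi.const_mul 2) (ae_of_all _ fun y => flatPairing_le_norm_sq _)
      _ = 2 * ∫ y, ‖fderiv ℝ η y‖ ^ 2 := integral_const_mul _ _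
      _ ≤ ε := by linarith
  · have e := hφ.integral_eq (g := fun x => chartExtend φ η x ^ 2) (k := fun y => r y * η y ^ 2)
      (hβ.continuous.pow 2).aestronglyMeasurable
      (fun x hx => by simp [chartExtend_of_notMem φ η hx]) (fun y hy => by
        simp [image_eq_zero_of_notMem_tsupport fun hy' => hy (hηs hy')])
      (fun y hy => by rw [chartExtend_symm φ η hy])
    rw [e]
    have hle : ∀ y, r y * η y ^ 2 ≤ (Metric.closedBall (φ q) ρ).indicator (fun _ => C) y := by
      intro y
      by_cases hy : y ∈ Metric.closedBall (φ q) ρ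
      · rw [indicator_of_mem hy]
        have h1 := hr y (Metric.closedBall_subset_closedBall hρρ₀ hy)
        have h2 : η y ^ 2 ≤ 1 := pow_le_one₀ (hη01 y).1 (hη01 y).2
        nlinarith [hφ.pos y (hballt hy)]
      · rw [indicator_of_notMem hy, image_eq_zero_of_notMem_tsupport fun hy' => hy (hηt hy')]
        simp
    have h0 : ∀ y, 0 ≤ r y * η y ^ 2 := by
      intro y
      by_cases hy : y ∈ φ.target
      · exact mul_nonneg (hφ.pos y hy).le (sq_nonneg _)
      · rw [image_eq_zero_of_notMem_tsupport fun hy' => hy (hηs hy')]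
        simp
    calc _ ≤ ∫ y, (Metric.closedBall (φ q) ρ).indicator (fun _ => C) y :=
          integral_mono_of_nonneg (Eventually.of_forall h0)
            ((integrable_indicator_iff measurableSet_closedBall).2
              (integrableOn_const (isCompact_closedBall _ _).measure_ne_top))
            (Eventually.of_forall hle)
      _ = C * (ρ ^ 2 * π) := by
          rw [integral_indicator measurableSet_closedBall, setIntegral_const, Measure.real,
            Complex.volume_closedBall, smul_eq_mul, mul_comm]
          simp only [ENNReal.toReal_mul, ENNReal.toReal_pow, ENNReal.toReal_ofReal hρ.le]
          rfl
      _ ≤ ε := hρε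

/-- A smooth approximation `v` is replaced by `(1 - β) v`, with `β` equal to `1` near `q`. As `v`
and `dv` are bounded, the error is controlled by the `L²` norm and the energy of `β`. -/
theorem IsW12.isApproximable_puncture [CompactSpace M] (hw : IsW12 h w G)
    (hφ : IsConformalWith h φ r) (hq : q ∈ φ.source) : IsApproximable h {q}ᶜ w G := by
  refine IsApproximable.of_close hw fun ε hε => ?_
  obtain ⟨v, hv, hle⟩ := hw.isApproximable_of_compactSpace ε hε
  refine ⟨v, cdiff v, isW12_of_mem_testFields hv, ?_, hle⟩
  clear hle hε ε
  intro ε hε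
  obtain ⟨B₁, hB₁, hvB₁⟩ := exists_dInner_self_le h hv.1 hv.2.1
  obtain ⟨B₂, hvB₂⟩ := hv.2.1.exists_bound_of_continuous hv.1.continuous
  have hB₂ : 0 ≤ B₂ := (norm_nonneg _).trans (hvB₂ q)
  set B := B₂ ^ 2 + 2 * B₁ + 1 with hB
  have hBpos : 0 < B := by positivity
  obtain ⟨β, hβ, hβc, hβ1, hβE, hβ2⟩ := hφ.exists_capacity hq (ε := ε / (3 * B)) (by positivity)
  have hβv : Smooth[F] fun x => β x • v x := hβ.smul hv.1
  have hdβ := hβ.mdifferentiable (by simp)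
  have hdv := mdifferentiableAt_of_mem_testFields hv
  have hdβv := hβv.mdifferentiable (by simp)
  have hmem : (fun x => v x - β x • v x) ∈ testFields F ({q}ᶜ : Set M) := by
    refine ⟨hv.1.sub hβv, HasCompactSupport.of_compactSpace _, ?_⟩
    rw [subset_compl_singleton_iff, notMem_tsupport_iff_eventuallyEq]
    filter_upwards [hβ1] with x hx
    simp [hx]
  refine ⟨_, hmem, ?_⟩
  have hi1 : Integrable (dInner h β β) vol[h] :=
    integrable_dInner_self (F := ℝ) (O := univ) ⟨hβ, hβc, subset_univ _⟩
  have hi2 : Integrable (fun x => β x ^ 2) vol[h] := by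
    have := HarmonicIndex.integrable_norm_sq (h := h) (w := β) (O := univ) ⟨hβ, hβc, subset_univ _⟩
    simpa only [Real.norm_eq_abs, sq_abs] using this
  calc _ ≤ ∫ x, (B * β x ^ 2 + 2 * B * dInner h β β x) ∂vol[h] := by
        refine integral_mono_of_nonneg (ae_of_all _ fun x =>
          add_nonneg (by positivity) (pairing_self_nonneg h x _))
          ((hi2.const_mul _).add (hi1.const_mul _)) (ae_of_all _ fun x => ?_)
        beta_reduce
        have e1 : v x - β x • v x - v x = -(β x • v x) := by abel
        have e2 : cdiff (fun x => v x - β x • v x) x - cdiff v x =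
            (-1 : ℝ) • cdiff (fun x => β x • v x) x := by
          rw [cdiff_sub (hdv x) (hdβv x), neg_one_smul]; abel
        rw [e1, e2, norm_neg, norm_smul, pairing_smul_left, pairing_smul_right]
        have h1 := dInner_smul_self_le h (hdβ x) (hdv x)
        change pairing h x _ _ ≤ _ at h1
        have h2 : ‖v x‖ ^ 2 ≤ B₂ ^ 2 := pow_le_pow_left₀ (norm_nonneg _) (hvB₂ x) 2
        have h3 := hvB₁ x
        have h4 := dInner_self_nonneg h β x
        rw [mul_pow, Real.norm_eq_abs, sq_abs]
        have h5 := mul_le_mul_of_nonneg_left h2 (sq_nonneg (β x))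
        have h6 := mul_le_mul_of_nonneg_left h3 (sq_nonneg (β x))
        have h7 := mul_le_mul_of_nonneg_left h2 h4
        have h8 : B * β x ^ 2 = β x ^ 2 * B₂ ^ 2 + 2 * (β x ^ 2 * B₁) + β x ^ 2 := by
          rw [hB]; ring
        have h9 : 2 * B * dInner h β β x = 2 * (dInner h β β x * B₂ ^ 2) +
          4 * B₁ * dInner h β β x + 2 * dInner h β β x := by rw [hB]; ring
        nlinarith [sq_nonneg (β x), mul_nonneg hB₁ h4]
    _ = B * (∫ x, β x ^ 2 ∂vol[h]) + 2 * B * dirichlet h β := by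
        rw [integral_add (hi2.const_mul _) (hi1.const_mul _), integral_const_mul,
          integral_const_mul, dirichlet]
    _ ≤ B * (ε / (3 * B)) + 2 * B * (ε / (3 * B)) := by gcongr
    _ = ε := by field_simp; ring

end Capacity

/-! ### Negative definite forms are stable under perturbations -/

section BilinForms

variable {V : Type*} [AddCommGroup V] [Module ℝ V]

theorem continuous_form_sum_smul (B : LinearMap.BilinForm ℝ V) {m : ℕ} (e : Fin m → V) :
    Continuous fun c : Fin m → ℝ => B (∑ i, c i • e i) (∑ i, c i • e i) := by
  simp only [map_sum, map_smul, LinearMap.sum_apply, LinearMap.smul_apply, smul_eq_mul]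
  fun_prop

/-- A form that is negative definite on a finite family dominates any other form there. -/
theorem exists_form_le_neg_mul (B N : LinearMap.BilinForm ℝ V) {m : ℕ} (e : Fin m → V)
    (hB : ∀ c : Fin m → ℝ, c ≠ 0 → B (∑ i, c i • e i) (∑ i, c i • e i) < 0) :
    ∃ μ > 0, ∀ c : Fin m → ℝ, B (∑ i, c i • e i) (∑ i, c i • e i) ≤
      -μ * N (∑ i, c i • e i) (∑ i, c i • e i) := by
  set f : (Fin m → ℝ) → ℝ := fun c => B (∑ i, c i • e i) (∑ i, c i • e i) with hf
  set g : (Fin m → ℝ) → ℝ := fun c => N (∑ i, c i • e i) (∑ i, c i • e i) with hg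
  have hfc : Continuous f := continuous_form_sum_smul B e
  have hgc : Continuous g := continuous_form_sum_smul N e
  have hscale : ∀ (T : LinearMap.BilinForm ℝ V) (t : ℝ) (c : Fin m → ℝ),
      T (∑ i, (t • c) i • e i) (∑ i, (t • c) i • e i) =
        t ^ 2 * T (∑ i, c i • e i) (∑ i, c i • e i) := by
    intro T t c
    have : ∑ i, (t • c) i • e i = t • ∑ i, c i • e i := by
      simp [Finset.smul_sum, smul_smul]
    rw [this]
    simp only [map_smul, LinearMap.smul_apply, smul_eq_mul]
    ring
  have hS : IsCompact (Metric.sphere (0 : Fin m → ℝ) 1) := isCompact_sphere 0 1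
  obtain ⟨ν, hν⟩ := hS.exists_bound_of_continuousOn hgc.continuousOn
  obtain ⟨κ, hκ, hfκ⟩ : ∃ κ > 0, ∀ c ∈ Metric.sphere (0 : Fin m → ℝ) 1, f c ≤ -κ := by
    rcases (Metric.sphere (0 : Fin m → ℝ) 1).eq_empty_or_nonempty with he | hne
    · exact ⟨1, one_pos, fun c hc => absurd hc (by simp [he])⟩
    · obtain ⟨c₀, hc₀, hmax⟩ := hS.exists_isMaxOn hne hfc.continuousOn
      have h0 : c₀ ≠ 0 := by
        rintro rfl
        simp at hc₀
      exact ⟨-f c₀, neg_pos.2 (hB c₀ h0), fun c hc => by simpa using hmax hc⟩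
  refine ⟨κ / (|ν| + 1), by positivity, fun c => ?_⟩
  rcases eq_or_ne c 0 with rfl | hc
  · simp
  have hn : 0 < ‖c‖ := norm_pos_iff.2 hc
  set c' := ‖c‖⁻¹ • c with hc'
  have hcc : c = ‖c‖ • c' := by rw [hc', smul_smul, mul_inv_cancel₀ hn.ne', one_smul]
  have hs : c' ∈ Metric.sphere (0 : Fin m → ℝ) 1 := by
    rw [mem_sphere_zero_iff_norm, hc', norm_smul, norm_inv, norm_norm, inv_mul_cancel₀ hn.ne']
  have hT : ∀ T : LinearMap.BilinForm ℝ V, T (∑ i, c i • e i) (∑ i, c i • e i) =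
      ‖c‖ ^ 2 * T (∑ i, c' i • e i) (∑ i, c' i • e i) := fun T => by
    have := hscale T ‖c‖ c'
    rwa [← hcc] at this
  rw [hT B, hT N]
  have h1 : f c' ≤ -κ := hfκ c' hs
  have h2 : g c' ≤ |ν| + 1 := ((Real.le_norm_self _).trans (hν c' hs)).trans
    ((le_abs_self ν).trans (by linarith))
  have h3 : κ / (|ν| + 1) * g c' ≤ κ := by
    rw [div_mul_eq_mul_div, div_le_iff₀ (by positivity)]
    exact mul_le_mul_of_nonneg_left h2 hκ.le
  have h4 : f c' ≤ -(κ / (|ν| + 1)) * g c' := by linarith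
  calc _ ≤ ‖c‖ ^ 2 * (-(κ / (|ν| + 1)) * g c') := mul_le_mul_of_nonneg_left h4 (sq_nonneg _)
    _ = _ := by ring

theorem form_sum_le (N : LinearMap.BilinForm ℝ V) (hN : ∀ v w, 2 * |N v w| ≤ N v v + N w w)
    {ι : Type*} (s : Finset ι) (v : ι → V) :
    N (∑ i ∈ s, v i) (∑ i ∈ s, v i) ≤ 2 ^ s.card * ∑ i ∈ s, N (v i) (v i) := by
  classical
  have h0 : ∀ v, 0 ≤ N v v := fun v => by
    have := hN v v
    linarith [abs_nonneg (N v v)]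
  induction s using Finset.induction_on with
  | empty => simp
  | insert a s ha ih =>
    rw [Finset.sum_insert ha, Finset.sum_insert ha, Finset.card_insert_of_notMem ha]
    simp only [map_add, LinearMap.add_apply]
    have h1 := hN (v a) (∑ i ∈ s, v i)
    have h2 := hN (∑ i ∈ s, v i) (v a)
    have h3 := le_abs_self (N (v a) (∑ i ∈ s, v i))
    have h4 := le_abs_self (N (∑ i ∈ s, v i) (v a))
    have h5 : (1 : ℝ) ≤ 2 ^ s.card := one_le_pow₀ (by norm_num)
    have h6 := mul_le_mul_of_nonneg_right h5 (h0 (v a))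
    rw [pow_succ]
    nlinarith

/-- Negativity on the family gives two bounds by compactness, `B ≤ -μ N` and `B ≤ -κ ∑ cᵢ²`. With
`d` the error of the combination, the cross terms of `B` are absorbed by the first bound up to a
multiple of `N d d`, and `N d d`, being of order `ε ∑ cᵢ²`, by the second. -/
theorem exists_pos_form_neg_of_close (B N : LinearMap.BilinForm ℝ V)
    (hN : ∀ v w, 2 * |N v w| ≤ N v v + N w w)
    (hB : ∀ v w, 2 * |B v w| ≤ N v v + N w w) {m : ℕ} (e : Fin m → V)
    (hneg : ∀ c : Fin m → ℝ, c ≠ 0 → B (∑ i, c i • e i) (∑ i, c i • e i) < 0) :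
    ∃ ε > 0, ∀ e' : Fin m → V, (∀ i, N (e' i - e i) (e' i - e i) ≤ ε) →
      ∀ c : Fin m → ℝ, c ≠ 0 → B (∑ i, c i • e' i) (∑ i, c i • e' i) < 0 := by
  have h0 : ∀ v, 0 ≤ N v v := fun v => by
    have := hN v v
    linarith [abs_nonneg (N v v)]
  obtain ⟨μ, hμ, hle⟩ := exists_form_le_neg_mul B N e hneg
  -- dominate the sum of squares of the coefficients
  set D : (Fin m → ℝ) → ℝ := fun c => ∑ i, c i ^ 2 with hD
  obtain ⟨κ, hκ, hfκ⟩ : ∃ κ > 0, ∀ c : Fin m → ℝ,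
      B (∑ i, c i • e i) (∑ i, c i • e i) ≤ -κ * D c := by
    -- The sum of squares is a form in the coefficients and not in the vector. On pairs of
    -- coefficients and vector both forms are defined, and `exists_form_le_neg_mul` applies.
    let b : Fin m → ((Fin m → ℝ) × V) := fun i => (Pi.single i 1, e i)
    let T : LinearMap.BilinForm ℝ ((Fin m → ℝ) × V) :=
      B.compl₁₂ (LinearMap.snd ℝ _ _) (LinearMap.snd ℝ _ _)
    let T' : LinearMap.BilinForm ℝ ((Fin m → ℝ) × V) :=
      ∑ i, (LinearMap.mul ℝ ℝ).compl₁₂ ((LinearMap.proj i).comp (LinearMap.fst ℝ (Fin m → ℝ) V))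
        ((LinearMap.proj i).comp (LinearMap.fst ℝ (Fin m → ℝ) V))
    have hb : ∀ c : Fin m → ℝ, ∑ i, c i • b i = (c, ∑ i, c i • e i) := by
      intro c
      refine Prod.ext ?_ ?_
      · rw [Prod.fst_sum]
        funext j
        simp [b, Finset.sum_apply, Pi.single_apply]
      · rw [Prod.snd_sum]
        simp [b]
    have hT : ∀ c v, T (c, v) (c, v) = B v v := fun c v => rfl
    have hT' : ∀ c v, T' (c, v) (c, v) = D c := by
      intro c v
      simp [T', D, LinearMap.sum_apply, sq]
    obtain ⟨κ, hκ, hk⟩ := exists_form_le_neg_mul T T' b fun c hc => by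
      rw [hb, hT]; exact hneg c hc
    refine ⟨κ, hκ, fun c => ?_⟩
    have := hk c
    rwa [hb, hT, hT'] at this
  -- Weight in the weighted Young inequality: the cross terms cost at most `(μ / 2) N v v`, which
  -- half of the bound `-μ N v v` pays for. The factor `1 / t` on `N d d` is compensated in the
  -- choice of `ε`.
  set t := min 1 (μ / 2) with ht
  have htpos : 0 < t := by positivity
  refine ⟨κ / (4 * (1 + 1 / t) * 2 ^ m), by positivity, fun e' he' c hc => ?_⟩
  set v := ∑ i, c i • e i with hv
  set d := ∑ i, c i • (e' i - e i) with hd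
  have hsum : ∑ i, c i • e' i = v + d := by
    simp [hv, hd, smul_sub, Finset.sum_sub_distrib]
  have hDpos : 0 < D c := by
    obtain ⟨i, hi⟩ := Function.ne_iff.1 hc
    exact Finset.sum_pos' (fun i _ => sq_nonneg _) ⟨i, Finset.mem_univ i, by
      have : c i ≠ 0 := hi
      positivity⟩
  have hdle : N d d ≤ κ / (4 * (1 + 1 / t)) * D c := by
    refine (form_sum_le N hN Finset.univ _).trans ?_
    rw [Finset.card_univ, Fintype.card_fin]
    have : ∑ i, N (c i • (e' i - e i)) (c i • (e' i - e i)) ≤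
        ∑ i, c i ^ 2 * (κ / (4 * (1 + 1 / t) * 2 ^ m)) := by
      refine Finset.sum_le_sum fun i _ => ?_
      simp only [map_smul, LinearMap.smul_apply, smul_eq_mul]
      rw [← mul_assoc, ← sq]
      exact mul_le_mul_of_nonneg_left (he' i) (sq_nonneg _)
    calc _ ≤ 2 ^ m * ∑ i, c i ^ 2 * (κ / (4 * (1 + 1 / t) * 2 ^ m)) := by gcongr
      _ = κ / (4 * (1 + 1 / t)) * D c := by
        rw [← Finset.sum_mul]
        field_simp
        rfl
  have hcross : ∀ v w, 2 * |B v w| ≤ t * N v v + 1 / t * N w w := by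
    intro v w
    have hst : 0 < √t := Real.sqrt_pos.2 htpos
    have hsq : √t * √t = t := Real.mul_self_sqrt htpos.le
    have h1 := hB (√t • v) ((√t)⁻¹ • w)
    simp only [map_smul, LinearMap.smul_apply, smul_eq_mul, ← mul_assoc] at h1
    rw [inv_mul_cancel₀ hst.ne', one_mul, hsq, ← mul_inv, hsq] at h1
    rwa [one_div]
  have h1 := hle c
  have h2 := hfκ c
  have h3 := hcross v d
  have h4 := hcross d v
  have h5 := le_abs_self (B v d)
  have h6 := le_abs_self (B d v)
  have h7 := hB d v
  have h8 : B d d ≤ N d d := by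
    have := hB d d
    linarith [le_abs_self (B d d)]
  have h9 : |B d v| ≤ (t * N v v + 1 / t * N d d) / 2 := by
    have hst : 0 < √t := Real.sqrt_pos.2 htpos
    have hsq : √t * √t = t := Real.mul_self_sqrt htpos.le
    have h1 := hB ((√t)⁻¹ • d) (√t • v)
    simp only [map_smul, LinearMap.smul_apply, smul_eq_mul, ← mul_assoc] at h1
    rw [mul_inv_cancel₀ hst.ne', one_mul, hsq, ← mul_inv, hsq] at h1
    rw [one_div]
    linarith
  rw [hsum]
  simp only [map_add, LinearMap.add_apply]
  have h10 : t * N v v ≤ μ / 2 * N v v := mul_le_mul_of_nonneg_right (min_le_right _ _) (h0 v)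
  have h11 : (1 + 1 / t) * N d d ≤ κ / 4 * D c := by
    calc _ ≤ (1 + 1 / t) * (κ / (4 * (1 + 1 / t)) * D c) := by gcongr
      _ = _ := by field_simp
  have h12 : 0 < κ * D c := by positivity
  linarith

end BilinForms

/-! ### The space of Sobolev pairs with finite potential energy -/

section Pairs

theorem integrable_weight_norm_sq_add {X : Type*} [MeasurableSpace X] {μ : Measure X} {ρ : X → ℝ}
    (hρ : AEMeasurable ρ μ) (h0 : ∀ x, 0 ≤ ρ x) {w w' : X → F} (hw : AEStronglyMeasurable w μ)
    (hw' : AEStronglyMeasurable w' μ) (hi : Integrable (fun x => ρ x * ‖w x‖ ^ 2) μ)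
    (hi' : Integrable (fun x => ρ x * ‖w' x‖ ^ 2) μ) :
    Integrable (fun x => ρ x * ‖w x + w' x‖ ^ 2) μ := by
  refine ((hi.add hi').const_mul 2).mono'
    (hρ.aestronglyMeasurable.mul ((hw.add hw').norm.pow 2)) (ae_of_all _ fun x => ?_)
  rw [Real.norm_of_nonneg (mul_nonneg (h0 x) (sq_nonneg _))]
  have h1 : ‖w x + w' x‖ ^ 2 ≤ 2 * ‖w x‖ ^ 2 + 2 * ‖w' x‖ ^ 2 := by
    have := pow_le_pow_left₀ (norm_nonneg _) (norm_add_le (w x) (w' x)) 2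
    nlinarith [sq_nonneg (‖w x‖ - ‖w' x‖)]
  have h2 := mul_le_mul_of_nonneg_left h1 (h0 x)
  simp only [Pi.add_apply]
  linarith

/-- The pairs `(w, G)` in `W^{1,2}` with `∫ ρ |w|² < ∞`. -/
def weightedPairs (F : Type*) [NormedAddCommGroup F] [InnerProductSpace ℝ F] [CompleteSpace F]
    (h : SurfaceMetric M) {ρ : M → ℝ} (hρ : AEMeasurable ρ vol[h]) (h0 : ∀ x, 0 ≤ ρ x) :
    Submodule ℝ ((M → F) × ((x : M) → T*[x, F])) where
  carrier := {p | IsW12 h p.1 p.2 ∧ Integrable (fun x => ρ x * ‖p.1 x‖ ^ 2) vol[h]}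
  zero_mem' := by
    have hz := isW12_of_mem_testFields (h := h) (O := (univ : Set M)) (zero_mem (testFields F univ))
    have hc : cdiff (0 : M → F) = fun _ => 0 := funext fun x => cdiff_const 0 x
    rw [hc] at hz
    exact ⟨hz, by simp⟩
  add_mem' := fun {p p'} hp hp' => ⟨hp.1.add hp'.1, integrable_weight_norm_sq_add hρ h0
    hp.1.memLp.1 hp'.1.memLp.1 hp.2 hp'.2⟩
  smul_mem' := fun c p hp => ⟨hp.1.const_smul c, by
    have := hp.2.const_mul (c ^ 2)
    refine this.congr (ae_of_all _ fun x => ?_)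
    simp only [Prod.smul_fst, Pi.smul_apply, norm_smul, mul_pow, Real.norm_eq_abs, sq_abs]
    ring⟩

/-- The vector space `weightedPairs`. -/
def PairSpace (F : Type*) [NormedAddCommGroup F] [InnerProductSpace ℝ F] [CompleteSpace F]
    (h : SurfaceMetric M) {ρ : M → ℝ} (hρ : AEMeasurable ρ vol[h]) (h0 : ∀ x, 0 ≤ ρ x) : Type _ :=
  weightedPairs F h hρ h0

variable {h : SurfaceMetric M} {ρ : M → ℝ} (hρ : AEMeasurable ρ vol[h])
  (h0 : ∀ x, 0 ≤ ρ x)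

noncomputable instance : AddCommGroup (PairSpace F h hρ h0) :=
  inferInstanceAs (AddCommGroup (weightedPairs F h hρ h0))

noncomputable instance : Module ℝ (PairSpace F h hρ h0) :=
  inferInstanceAs (Module ℝ (weightedPairs F h hρ h0))

/-- The field of a pair. -/
def PairSpace.field : PairSpace F h hρ h0 →ₗ[ℝ] (M → F) :=
  (LinearMap.fst ℝ _ _).comp (weightedPairs F h hρ h0).subtype

theorem integrable_energyForm (σ τ : ℝ) (p p' : PairSpace F h hρ h0) :
    Integrable (fun x => pairing h x (p.1.2 x) (p'.1.2 x) +
      (σ * ρ x + τ) * inner ℝ (p.1.1 x) (p'.1.1 x)) vol[h] := by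
  refine (p.2.1.integrable_pairing p'.2.1).add ?_
  have hm : AEStronglyMeasurable (fun x => (σ * ρ x + τ) * inner ℝ (p.1.1 x) (p'.1.1 x)) vol[h] :=
    ((hρ.const_mul σ).add_const τ).aestronglyMeasurable.mul (p.2.1.memLp.1.inner p'.2.1.memLp.1)
  have hb1 : Integrable (fun x => |σ| * (ρ x * ‖p.1.1 x‖ ^ 2 + ρ x * ‖p'.1.1 x‖ ^ 2))
      vol[h] := (p.2.2.add p'.2.2).const_mul _
  have hb2 : Integrable (fun x => |τ| * (‖p.1.1 x‖ ^ 2 + ‖p'.1.1 x‖ ^ 2))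
      vol[h] := (p.2.1.integrable_norm_sq.add p'.2.1.integrable_norm_sq).const_mul _
  refine (hb1.add hb2).mono' hm (ae_of_all _ fun x => ?_)
  have h1 : |inner ℝ (p.1.1 x) (p'.1.1 x)| ≤ ‖p.1.1 x‖ ^ 2 + ‖p'.1.1 x‖ ^ 2 := by
    have := abs_real_inner_le_norm (p.1.1 x) (p'.1.1 x)
    nlinarith [sq_nonneg (‖p.1.1 x‖ - ‖p'.1.1 x‖), sq_nonneg ‖p.1.1 x‖, sq_nonneg ‖p'.1.1 x‖]
  have h2 : |σ * ρ x + τ| ≤ |σ| * ρ x + |τ| := by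
    refine (abs_add_le _ _).trans ?_
    rw [abs_mul, abs_of_nonneg (h0 x)]
  have hx := h0 x
  simp only [Pi.add_apply]
  rw [Real.norm_eq_abs, abs_mul]
  calc _ ≤ (|σ| * ρ x + |τ|) * (‖p.1.1 x‖ ^ 2 + ‖p'.1.1 x‖ ^ 2) := by gcongr
    _ = _ := by ring

/-- The form `∫ G · G' + (σ ρ + τ) ⟨w, w'⟩`. -/
def energyForm (σ τ : ℝ) : LinearMap.BilinForm ℝ (PairSpace F h hρ h0) :=
  LinearMap.mk₂ ℝ (fun p p' => ∫ x, (pairing h x (p.1.2 x) (p'.1.2 x) +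
      (σ * ρ x + τ) * inner ℝ (p.1.1 x) (p'.1.1 x)) ∂vol[h]) (fun p₁ p₂ p' => by
      rw [← integral_add (integrable_energyForm hρ h0 σ τ p₁ p')
        (integrable_energyForm hρ h0 σ τ p₂ p')]
      congr 1
      funext x
      change pairing h x (p₁.1.2 x + p₂.1.2 x) _ + _ * inner ℝ (p₁.1.1 x + p₂.1.1 x) _ = _
      rw [pairing_add_left, inner_add_left]
      ring)
    (fun c p p' => by
      rw [smul_eq_mul, ← integral_const_mul]
      congr 1
      funext x
      change pairing h x (c • p.1.2 x) _ + _ * inner ℝ (c • p.1.1 x) _ = _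
      rw [pairing_smul_left, real_inner_smul_left]
      ring)
    (fun p p₁ p₂ => by
      rw [← integral_add (integrable_energyForm hρ h0 σ τ p p₁)
        (integrable_energyForm hρ h0 σ τ p p₂)]
      congr 1
      funext x
      change pairing h x _ (p₁.1.2 x + p₂.1.2 x) + _ * inner ℝ _ (p₁.1.1 x + p₂.1.1 x) = _
      rw [pairing_add_right, inner_add_right]
      ring)
    (fun c p p' => by
      rw [smul_eq_mul, ← integral_const_mul]
      congr 1
      funext x
      change pairing h x _ (c • p'.1.2 x) + _ * inner ℝ _ (c • p'.1.1 x) = _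
      rw [pairing_smul_right, real_inner_smul_right]
      ring)

theorem energyForm_apply (σ τ : ℝ) (p p' : PairSpace F h hρ h0) :
    energyForm hρ h0 σ τ p p' = ∫ x, (pairing h x (p.1.2 x) (p'.1.2 x) +
      (σ * ρ x + τ) * inner ℝ (p.1.1 x) (p'.1.1 x)) ∂vol[h] := rfl

/-- Pointwise Cauchy–Schwarz. The form with `σ = τ = 1` thus plays the role of the squared norm, and
half the second variation of the Dirichlet energy is the case `σ = -1`, `τ = 0`. -/
theorem two_mul_abs_energyForm_le {σ τ : ℝ} (hσ : |σ| ≤ 1) (hτ : |τ| ≤ 1)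
    (p p' : PairSpace F h hρ h0) : 2 * |energyForm hρ h0 σ τ p p'| ≤
      energyForm hρ h0 1 1 p p + energyForm hρ h0 1 1 p' p' := by
  simp only [energyForm_apply]
  rw [← integral_add (integrable_energyForm hρ h0 1 1 p p)
    (integrable_energyForm hρ h0 1 1 p' p'), ← abs_two (α := ℝ), ← abs_mul,
    ← integral_const_mul, ← Real.norm_eq_abs]
  refine norm_integral_le_of_norm_le ((integrable_energyForm hρ h0 1 1 p p).add
    (integrable_energyForm hρ h0 1 1 p' p')) (ae_of_all _ fun x => ?_)
  have h1 := two_mul_abs_pairing_le h x (p.1.2 x) (p'.1.2 x)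
  have h2 : 2 * |inner ℝ (p.1.1 x) (p'.1.1 x)| ≤ ‖p.1.1 x‖ ^ 2 + ‖p'.1.1 x‖ ^ 2 := by
    have := abs_real_inner_le_norm (p.1.1 x) (p'.1.1 x)
    nlinarith [sq_nonneg (‖p.1.1 x‖ - ‖p'.1.1 x‖)]
  have h3 : |σ * ρ x + τ| ≤ ρ x + 1 := by
    refine (abs_add_le _ _).trans ?_
    rw [abs_mul, abs_of_nonneg (h0 x)]
    have := mul_le_mul_of_nonneg_right hσ (h0 x)
    linarith
  have hx := h0 x
  rw [real_inner_self_eq_norm_sq, real_inner_self_eq_norm_sq, Real.norm_eq_abs, abs_mul, abs_two]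
  have h4 := abs_add_le (pairing h x (p.1.2 x) (p'.1.2 x))
    ((σ * ρ x + τ) * inner ℝ (p.1.1 x) (p'.1.1 x))
  rw [abs_mul] at h4
  have h5 : |σ * ρ x + τ| * (2 * |inner ℝ (p.1.1 x) (p'.1.1 x)|) ≤
      (ρ x + 1) * (‖p.1.1 x‖ ^ 2 + ‖p'.1.1 x‖ ^ 2) := by gcongr
  linarith

end Pairs

/-! ### Weak differentials of tangent fields -/

section WeakProduct

variable {Ω : Set ℂ} {f : ℂ → F} {A : ℂ → ℂ →L[ℝ] F}

theorem IsWeakDerivOn.clm_comp {F' : Type*} [NormedAddCommGroup F']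
    [InnerProductSpace ℝ F'] [CompleteSpace F'] (hf : IsWeakDerivOn Ω f A) (T : F →L[ℝ] F') :
    IsWeakDerivOn Ω (fun y => T (f y)) (fun y => T.comp (A y)) where
  locallyIntegrable := locallyIntegrableOn_clm_comp T hf.locallyIntegrable
  locallyIntegrable_deriv :=
    locallyIntegrableOn_clm_comp (ContinuousLinearMap.compL ℝ ℂ F F' T) hf.locallyIntegrable_deriv
  integral_eq η hη hc hs v := by
    have h1 := integrable_smul_of_tsupport_subset (hf.locallyIntegrable_apply v) hη.continuous hc hs
    have h2 := integrable_fderiv_smul hf.locallyIntegrable hη hc hs v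
    have e := congrArg T (hf.integral_eq η hη hc hs v)
    rw [map_neg, ← T.integral_comp_comm h1, ← T.integral_comp_comm h2] at e
    simpa only [map_smul, ContinuousLinearMap.comp_apply] using e

theorem isWeakDerivOn_zero : IsWeakDerivOn Ω (fun _ => (0 : F)) (fun _ => 0) where
  locallyIntegrable := locallyIntegrable_zero.locallyIntegrableOn Ω
  locallyIntegrable_deriv :=
    (locallyIntegrable_const (0 : ℂ →L[ℝ] F)).locallyIntegrableOn Ω
  integral_eq η hη hc hs v := by simp

theorem IsWeakDerivOn.finset_sum {ι : Type*} (s : Finset ι) {f : ι → ℂ → F}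
    {A : ι → ℂ → ℂ →L[ℝ] F} (hf : ∀ i ∈ s, IsWeakDerivOn Ω (f i) (A i)) :
    IsWeakDerivOn Ω (fun y => ∑ i ∈ s, f i y) (fun y => ∑ i ∈ s, A i y) := by
  classical
  induction s using Finset.induction_on with
  | empty => simpa using isWeakDerivOn_zero
  | insert a s ha ih =>
    simp only [Finset.sum_insert ha]
    exact (hf a (Finset.mem_insert_self a s)).add
      (ih fun i hi => hf i (Finset.mem_insert_of_mem hi))

/-- The inner product is expanded in an orthonormal basis; every summand is the product of a weakly
differentiable scalar function with a smooth one. -/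
theorem IsWeakDerivOn.inner [FiniteDimensional ℝ F] (hf : IsWeakDerivOn Ω f A)
    (hΩ : IsOpen Ω) {g : ℂ → F} (hg : ContDiffOn ℝ ∞ g Ω) :
    IsWeakDerivOn Ω (fun y => inner ℝ (f y) (g y))
      (fun y => (innerSL ℝ (g y)).comp (A y) + (innerSL ℝ (f y)).comp (fderiv ℝ g y)) := by
  let b := stdOrthonormalBasis ℝ F
  have h1 := fun i => (hf.clm_comp (innerSL ℝ (b i))).smul hΩ
    (r := fun y => (innerSL ℝ (b i)) (g y)) ((innerSL ℝ (b i)).contDiff.comp_contDiffOn hg)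
  refine (IsWeakDerivOn.finset_sum Finset.univ fun i _ => h1 i).congr hΩ (fun y _ => ?_)
    fun y hy => ?_
  · rw [← b.sum_inner_mul_inner (f y) (g y)]
    refine Finset.sum_congr rfl fun i _ => ?_
    simp only [innerSL_apply_apply, smul_eq_mul]
    rw [real_inner_comm (f y) (b i)]
    ring
  · ext v
    have hgd : DifferentiableAt ℝ g y :=
      ((hg y hy).contDiffAt (hΩ.mem_nhds hy)).differentiableAt (by simp)
    have hfd : ∀ i, fderiv ℝ (fun y => (innerSL ℝ (b i)) (g y)) y =
        (innerSL ℝ (b i)).comp (fderiv ℝ g y) := fun i =>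
      ((innerSL ℝ (b i)).hasFDerivAt.comp y hgd.hasFDerivAt).fderiv
    simp only [hfd]
    simp only [_root_.sum_apply, _root_.add_apply, _root_.smul_apply,
      ContinuousLinearMap.comp_apply, ContinuousLinearMap.smulRight_apply, innerSL_apply_apply,
      smul_eq_mul]
    rw [← b.sum_inner_mul_inner (g y) (A y v), ← b.sum_inner_mul_inner (f y) (fderiv ℝ g y v),
      ← Finset.sum_add_distrib]
    refine Finset.sum_congr rfl fun i _ => ?_
    rw [real_inner_comm (g y) (b i), real_inner_comm (f y) (b i)]
    ring

/-- The zero section is also a weak derivative of `f`, and weak derivatives are unique. -/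
theorem IsWeakDerivOn.ae_eq_zero (hΩ : IsOpen Ω) (hf : IsWeakDerivOn Ω f A)
    (h0 : ∀ᵐ y, y ∈ Ω → f y = 0) : ∀ᵐ y, y ∈ Ω → A y = 0 := by
  refine hf.ae_eq hΩ (B := fun _ => 0) ⟨hf.locallyIntegrable, isWeakDerivOn_zero.2, ?_⟩
  intro η hη hc hs v
  have : (fun y => fderiv ℝ η y v • f y) =ᵐ[volume] fun _ => 0 := by
    filter_upwards [h0] with y hy
    by_cases hyΩ : y ∈ Ω
    · rw [hy hyΩ, smul_zero]
    · rw [fderiv_eq_zero_of_notMem_tsupport fun hy' => hyΩ (hs hy')]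
      simp
  rw [integral_congr_ae this]
  simp

end WeakProduct

/-! ### Tangential projection along a map to the sphere -/

section TangentFields

variable {h : SurfaceMetric M} {O : Set M} {u w : M → F}
  {G : (x : M) → T*[x, F]}

/-- The function `⟨u, w⟩` vanishes almost everywhere, hence so does its weak differential, which the
product rule computes. -/
theorem IsWeakDifferential.inner_add_inner_eq_zero [FiniteDimensional ℝ F]
    (hw : IsWeakDifferential w G) (h : SurfaceMetric M) (hO : IsOpen O) (hu : SmoothOn[F] u O)
    (htan : ∀ᵐ x ∂vol[h], inner ℝ (u x) (w x) = 0) : ∀ᵐ x ∂vol[h], x ∈ O → ∀ v : T[x],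
      inner ℝ (u x) (G x v) + inner ℝ (w x) (cdiff u x v) = 0 := by
  refine ae_riemannianVolume_of_charts h fun ψ hψ => ?_
  have hs := isSmoothChart_of_mem_atlas hψ
  have hΩ := isOpen_target_inter ψ hO
  have hg := hs.contDiffOn_comp_symm hu
  have h1 := ((hw ψ hψ).mono inter_subset_left).inner hΩ hg
  have h2 := h1.ae_eq_zero hΩ (by
    filter_upwards [hs.ae_chart h htan] with y hy hyΩ
    rw [real_inner_comm]
    exact hy hyΩ.1)
  filter_upwards [h2] with y hy hyt hyO v
  have h3 := hy ⟨hyt, hyO⟩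
  rw [hs.fderiv_comp_symm_eq_cdiff hyt (mdifferentiableAt_of_contMDiffOn hO hu hyO)] at h3
  obtain ⟨v', rfl⟩ := (hs.equiv hyt).surjective v
  exact congrArg (fun T : ℂ →L[ℝ] ℝ => T v') h3

/-- The projection of `w` to the tangent spaces of the sphere along `u`. -/
def tangentProj (u w : M → F) (x : M) : F := w x - inner ℝ (u x) (w x) • u x

theorem inner_tangentProj {x : M} (hu : ‖u x‖ = 1) : inner ℝ (u x) (tangentProj u w x) = 0 := by
  rw [tangentProj, inner_sub_right, real_inner_smul_right, real_inner_self_eq_norm_sq, hu]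
  ring

theorem contMDiffOn_tangentProj (hu : SmoothOn[F] u O) (hw : SmoothOn[F] w O) :
    SmoothOn[F] (tangentProj u w) O := by
  have hd : ContDiff ℝ ∞ fun p : F × F => p.2 - inner ℝ p.1 p.2 • p.1 :=
    contDiff_snd.sub ((contDiff_fst.inner ℝ contDiff_snd).smul contDiff_fst)
  exact hd.contMDiff.comp_contMDiffOn (hu.prodMk_space hw)

theorem tangentProj_mem_testFields (hO : IsOpen O) (hu : SmoothOn[F] u O)
    (hw : w ∈ testFields F O) : tangentProj u w ∈ testFields F O := by
  refine mem_testFields_of_contMDiffOn hO (contMDiffOn_tangentProj hu hw.1.contMDiffOn)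
    hw.2.1 hw.2.2 fun x hx => ?_
  simp [tangentProj, image_eq_zero_of_notMem_tsupport hx]

theorem cdiff_tangentProj_apply {x : M} (hu : DiffAt[F] u x) (hw : DiffAt[F] w x) (v : T[x]) :
    cdiff (tangentProj u w) x v = cdiff w x v - (inner ℝ (u x) (w x) • cdiff u x v +
      (inner ℝ (u x) (cdiff w x v) + inner ℝ (cdiff u x v) (w x)) • u x) := by
  have hi : DiffAt[ℝ] (fun z => inner ℝ (u z) (w z)) x := by
    have hd : ContDiff ℝ 1 fun p : F × F => inner ℝ p.1 p.2 :=
      contDiff_fst.inner ℝ contDiff_snd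
    exact (hd.differentiable (by simp) (u x, w x)).mdifferentiableAt.comp x
      (hasMFDerivAt_prodMk_space hu hw).mdifferentiableAt
  have hsm : DiffAt[F] (fun z => inner ℝ (u z) (w z) • u z) x :=
    hi.smul hu
  have e : cdiff (tangentProj u w) x =
      cdiff w x - cdiff (fun z => inner ℝ (u z) (w z) • u z) x := cdiff_sub hw hsm
  rw [e]
  change cdiff w x v - cdiff (fun z => inner ℝ (u z) (w z) • u z) x v = _
  rw [cdiff_smul_apply hi hu, cdiff_inner_apply hu hw]

theorem norm_sub_inner_smul_le {e d : F} (he : ‖e‖ = 1) : ‖d - inner ℝ e d • e‖ ≤ ‖d‖ := by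
  refine (sq_le_sq₀ (norm_nonneg _) (norm_nonneg _)).1 ?_
  have : ‖d - inner ℝ e d • e‖ ^ 2 = ‖d‖ ^ 2 - inner ℝ e d ^ 2 := by
    rw [norm_sub_sq_real, norm_smul, he, real_inner_smul_right, real_inner_comm d e,
      Real.norm_eq_abs, mul_pow, sq_abs]
    ring
  rw [this]
  linarith [sq_nonneg (inner ℝ e d)]

/-- The distance of a tangent field `w` to the projection of `v` is controlled by its distance
to `v`. -/
theorem tangentProj_sub_le (h : SurfaceMetric M) {v : M → F} {x : M} (hux : ‖u x‖ = 1)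
    (hu : DiffAt[F] u x) (hv : DiffAt[F] v x) (htan : inner ℝ (u x) (w x) = 0)
    (hG : ∀ ξ : T[x], inner ℝ (u x) (G x ξ) + inner ℝ (w x) (cdiff u x ξ) = 0) :
    ‖tangentProj u v x - w x‖ ≤ ‖v x - w x‖ ∧
      pairing h x (cdiff (tangentProj u v) x - G x) (cdiff (tangentProj u v) x - G x) ≤
        2 * pairing h x (cdiff v x - G x) (cdiff v x - G x) +
          8 * (dInner h u u x * ‖v x - w x‖ ^ 2) := by
  have e1 : tangentProj u v x - w x = (v x - w x) - inner ℝ (u x) (v x - w x) • u x := by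
    rw [tangentProj, inner_sub_right, htan, sub_zero]
    abel
  refine ⟨e1 ▸ norm_sub_inner_smul_le hux, ?_⟩
  have key : ∀ ξ : T[x], ‖(cdiff (tangentProj u v) x - G x) ξ‖ ^ 2 ≤
      2 * ‖(cdiff v x - G x) ξ‖ ^ 2 + 8 * (‖cdiff u x ξ‖ ^ 2 * ‖v x - w x‖ ^ 2) := by
    intro ξ
    set D := cdiff v x ξ - G x ξ with hD
    set d := v x - w x with hd
    -- Tangency of `w` and its differentiated form `hG` let `w` be subtracted in every term. The
    -- difference then depends on `v - w` and on `D` alone, and `D` enters through an orthogonal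
    -- projection.
    have e2 : (cdiff (tangentProj u v) x - G x) ξ = (D - inner ℝ (u x) D • u x) -
        (inner ℝ (u x) d • cdiff u x ξ + inner ℝ (cdiff u x ξ) d • u x) := by
      change cdiff (tangentProj u v) x ξ - G x ξ = _
      rw [cdiff_tangentProj_apply hu hv, hD, hd, inner_sub_right, inner_sub_right, inner_sub_right,
        htan, real_inner_comm (w x)]
      have h3 : inner ℝ (u x) (G x ξ) = -inner ℝ (w x) (cdiff u x ξ) := by linarith [hG ξ]
      rw [h3, real_inner_comm (cdiff u x ξ) (w x)]
      module
    have e3 : (cdiff v x - G x) ξ = D := rfl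
    rw [e2, e3]
    have n1 : ‖D - inner ℝ (u x) D • u x‖ ≤ ‖D‖ := norm_sub_inner_smul_le hux
    have n2 : ‖inner ℝ (u x) d • cdiff u x ξ‖ ≤ ‖d‖ * ‖cdiff u x ξ‖ := by
      rw [norm_smul]
      gcongr
      simpa [hux] using norm_inner_le_norm (𝕜 := ℝ) (u x) d
    have n3 : ‖inner ℝ (cdiff u x ξ) d • u x‖ ≤ ‖d‖ * ‖cdiff u x ξ‖ := by
      rw [norm_smul, hux, mul_one, mul_comm]
      exact norm_inner_le_norm (𝕜 := ℝ) _ _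
    have n4 : ‖(D - inner ℝ (u x) D • u x) -
        (inner ℝ (u x) d • cdiff u x ξ + inner ℝ (cdiff u x ξ) d • u x)‖ ≤
        ‖D‖ + 2 * (‖d‖ * ‖cdiff u x ξ‖) := by
      refine (norm_sub_le _ _).trans ?_
      have := norm_add_le (inner ℝ (u x) d • cdiff u x ξ) (inner ℝ (cdiff u x ξ) d • u x)
      linarith
    have n5 := pow_le_pow_left₀ (norm_nonneg _) n4 2
    nlinarith [sq_nonneg (‖D‖ - 2 * (‖d‖ * ‖cdiff u x ξ‖))]
  obtain ⟨f₁, f₂, hf⟩ := exists_orthoFrame h x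
  rw [hf.pairing_eq, hf.pairing_eq, dInner, hf.pairing_eq]
  simp only [real_inner_self_eq_norm_sq]
  have k1 := key f₁
  have k2 := key f₂
  linarith

end TangentFields

/-! ### The Morse index of a harmonic map is attained by smooth fields -/

section Reduction

variable {h : SurfaceMetric M} {O : Set M} {u w : M → F}
  {G : (x : M) → T*[x, F]}

theorem IsHarmonicOn.aemeasurable_dInner (hu : IsHarmonicOn h u O) (hfull : ∀ᵐ x ∂vol[h], x ∈ O) :
    AEMeasurable (dInner h u u) vol[h] := by
  have := (continuousOn_dInner h hu.isOpen hu.contMDiffOn hu.contMDiffOn).aestronglyMeasurable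
    (μ := vol[h]) hu.isOpen.measurableSet
  rw [Measure.restrict_eq_self_of_ae_mem hfull] at this
  exact this.aemeasurable

theorem sobolevSq_eq (hw : IsW12 h w G) : sobolevSq h w G = ∫ x, ‖w x‖ ^ 2 ∂vol[h] +
    ∫ x, pairing h x (G x) (G x) ∂vol[h] :=
  integral_add hw.integrable_norm_sq hw.integrable

theorem norm_sq_le_two_mul (a b : F) : ‖a‖ ^ 2 ≤ 2 * ‖b‖ ^ 2 + 2 * ‖b - a‖ ^ 2 := by
  have := pow_le_pow_left₀ (norm_nonneg _) (norm_sub_le b (b - a)) 2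
  rw [sub_sub_cancel] at this
  nlinarith [sq_nonneg (‖b‖ - ‖b - a‖)]

/-- For test fields this is `exists_potential_le`. The density `|du|²` may be unbounded near the
end, so it is truncated at height `n`: the truncated potential passes to limits in `L²`, and
monotone convergence removes the truncation. -/
theorem IsHarmonicOn.potential_le_sobolevSq (hu : IsHarmonicOn h u O)
    (hc : IsAlmostConstantAtEnd u O) (hfull : ∀ᵐ x ∂vol[h], x ∈ O)
    (hden : ∀ (w : M → F) (G : (x : M) → T*[x, F]), IsW12 h w G → IsApproximable h O w G) :
    ∃ C : ℝ, 0 ≤ C ∧ ∀ (w : M → F) (G : (x : M) → T*[x, F]), IsW12 h w G →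
      Integrable (fun x => dInner h u u x * ‖w x‖ ^ 2) vol[h] ∧
        potential h u w ≤ C * sobolevSq h w G := by
  obtain ⟨K, -, hK, C₀, hC₀, hpot⟩ := hu.exists_potential_le hc
  refine ⟨4 * (1 + C₀), by positivity, fun w G hw => ?_⟩
  set V := dInner h u u with hV
  have hV0 : ∀ x, 0 ≤ V x := dInner_self_nonneg h u
  have hVm : AEMeasurable V vol[h] := hu.aemeasurable_dInner hfull
  set S := sobolevSq h w G with hS
  have hS0 : 0 ≤ S := integral_nonneg fun x =>
    add_nonneg (sq_nonneg _) (pairing_self_nonneg h x _)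
  have hVn0 : ∀ (n : ℕ) x, 0 ≤ min (V x) n := fun n x => le_min (hV0 x) n.cast_nonneg
  have hint : ∀ (n : ℕ) (w : M → F), AEStronglyMeasurable w vol[h] →
      Integrable (fun x => ‖w x‖ ^ 2) vol[h] →
      Integrable (fun x => min (V x) n * ‖w x‖ ^ 2) vol[h] := by
    intro n w hwm hwi
    refine (hwi.const_mul n).mono' ((hVm.min aemeasurable_const).aestronglyMeasurable.mul
      (hwm.norm.pow 2)) (ae_of_all _ fun x => ?_)
    rw [Real.norm_of_nonneg (mul_nonneg (hVn0 n x) (sq_nonneg _))]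
    gcongr
    exact min_le_right _ _
  have htrunc : ∀ n : ℕ, ∫ x, min (V x) n * ‖w x‖ ^ 2 ∂vol[h] ≤ 4 * (1 + C₀) * S := by
    intro n
    refine le_of_forall_pos_le_add fun δ hδ => ?_
    -- The accuracy depends on `n`, but the resulting bound `4 (1 + C₀) S + δ` does not.
    obtain ⟨v, hv, hle⟩ := hden w G hw (δ / (4 * (1 + C₀) + 2 * n)) (by positivity)
    set ε := δ / (4 * (1 + C₀) + 2 * n) with hε
    have hvp := isW12_of_mem_testFields (h := h) hv
    have hd := hvp.sub hw
    have hpv : potential h u v ≤ (1 + C₀) * sobolevSq h v (cdiff v) := by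
      have h1 := hpot v hv
      have h2 : ∫ x in K, ‖v x‖ ^ 2 ∂vol[h] ≤ ∫ x, ‖v x‖ ^ 2 ∂vol[h] :=
        setIntegral_le_integral hvp.integrable_norm_sq (ae_of_all _ fun x => sq_nonneg _)
      have h3 := mul_le_mul_of_nonneg_left h2 hC₀
      have h4 := sobolevSq_eq hvp
      have h5 : ∫ x, pairing h x (cdiff v x) (cdiff v x) ∂vol[h] = dirichlet h v := rfl
      have h6 := dirichlet_nonneg h v
      have h7 : 0 ≤ ∫ x, ‖v x‖ ^ 2 ∂vol[h] := integral_nonneg fun x => sq_nonneg _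
      rw [h4, h5]
      nlinarith [mul_nonneg hC₀ h6]
    have hsv : sobolevSq h v (cdiff v) ≤ 2 * ε + 2 * S := by
      have := hd.sobolevSq_add_le hw
      have e1 : (fun x => v x - w x + w x) = v := by funext x; abel
      have e2 : (fun x => cdiff v x - G x + G x) = cdiff v := by funext x; abel
      rw [e1, e2] at this
      linarith
    have hdn : ∫ x, ‖v x - w x‖ ^ 2 ∂vol[h] ≤ ε := by
      refine le_trans ?_ hle
      rw [sobolevSq_eq hd]
      exact le_add_of_nonneg_right (integral_nonneg fun x => pairing_self_nonneg h x _)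
    have hip := HarmonicIndex.integrable_potential (h := h) hu.isOpen hu.contMDiffOn hv
    calc ∫ x, min (V x) n * ‖w x‖ ^ 2 ∂vol[h]
        ≤ ∫ x, (2 * (V x * ‖v x‖ ^ 2) + 2 * n * ‖v x - w x‖ ^ 2) ∂vol[h] := by
          refine integral_mono (hint n w hw.memLp.1 hw.integrable_norm_sq)
            ((hip.const_mul 2).add (hd.integrable_norm_sq.const_mul _)) fun x => ?_
          have h1 := mul_le_mul_of_nonneg_left (norm_sq_le_two_mul (w x) (v x)) (hVn0 n x)
          have h2 := mul_le_mul_of_nonneg_right (min_le_left (V x) (n : ℝ)) (sq_nonneg ‖v x‖)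
          have h3 := mul_le_mul_of_nonneg_right (min_le_right (V x) (n : ℝ)) (sq_nonneg ‖v x - w x‖)
          beta_reduce
          linarith
      _ = 2 * potential h u v + 2 * n * ∫ x, ‖v x - w x‖ ^ 2 ∂vol[h] := by
          rw [integral_add (hip.const_mul 2) (hd.integrable_norm_sq.const_mul _),
            integral_const_mul, integral_const_mul, potential]
      _ ≤ 2 * ((1 + C₀) * (2 * ε + 2 * S)) + 2 * n * ε := by
          have := mul_le_mul_of_nonneg_left hsv (by positivity : 0 ≤ 1 + C₀)
          gcongr
          exact hpv.trans this
      _ = 4 * (1 + C₀) * S + δ := by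
          rw [hε]
          field_simp
          ring
  have hm : AEStronglyMeasurable (fun x => V x * ‖w x‖ ^ 2) vol[h] :=
    hVm.aestronglyMeasurable.mul (hw.memLp.1.norm.pow 2)
  have hlin : ∫⁻ x, ofReal (V x * ‖w x‖ ^ 2) ∂vol[h] ≤ ofReal (4 * (1 + C₀) * S) := by
    refine le_of_tendsto' (lintegral_tendsto_of_tendsto_of_monotone
      (f := fun (n : ℕ) x => ofReal (min (V x) n * ‖w x‖ ^ 2))
      (fun n => (hint n w hw.memLp.1 hw.integrable_norm_sq).1.aemeasurable.ennreal_ofReal)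
      (ae_of_all _ fun x n m hnm => ?_) (ae_of_all _ fun x => ?_)) fun n => ?_
    · beta_reduce
      gcongr
    · refine Tendsto.congr' ?_ tendsto_const_nhds
      obtain ⟨N, hN⟩ := exists_nat_gt (V x)
      filter_upwards [eventually_ge_atTop N] with n hn
      have : (N : ℝ) ≤ n := by exact_mod_cast hn
      rw [min_eq_left (by linarith)]
    · rw [← ofReal_integral_eq_lintegral_ofReal (hint n w hw.memLp.1 hw.integrable_norm_sq)
        (ae_of_all _ fun x => mul_nonneg (hVn0 n x) (sq_nonneg _))]
      exact ENNReal.ofReal_le_ofReal (htrunc n)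
  have hnn : ∀ x, 0 ≤ V x * ‖w x‖ ^ 2 := fun x => mul_nonneg (hV0 x) (sq_nonneg _)
  exact ⟨⟨hm, (hasFiniteIntegral_iff_ofReal (Eventually.of_forall hnn)).2
    (hlin.trans_lt ENNReal.ofReal_lt_top)⟩, integral_le_of_lintegral_le hnn (by positivity) hlin⟩

/-- Weak differentials agree almost everywhere, so the diagonal depends on the field alone. The form
is bilinear on pairs by construction, and this identifies it with integrals formed from the chosen
`weakDifferential`, whose choice need not be linear. -/
theorem energyForm_self_eq {ρ : M → ℝ} (hρ : AEMeasurable ρ vol[h])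
    (h0 : ∀ x, 0 ≤ ρ x) (σ τ : ℝ) (p : PairSpace F h hρ h0) (hp : p.1.1 = w)
    (hG : IsWeakDifferential w G) : energyForm hρ h0 σ τ p p =
      ∫ x, (pairing h x (G x) (G x) + (σ * ρ x + τ) * ‖w x‖ ^ 2) ∂vol[h] := by
  subst hp
  rw [energyForm_apply]
  refine integral_congr_ae ?_
  filter_upwards [p.2.1.weak.ae_eq h hG] with x hx
  rw [hx, real_inner_self_eq_norm_sq]

theorem secondVariation_two (hu : WeaklyDifferentiable u) (hO : IsOpen O)
    (hs : SmoothOn[F] u O) (hfull : ∀ᵐ x ∂vol[h], x ∈ O) (w : M → F) : secondVariation h 2 u w =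
      2 * ∫ x, (pairing h x (weakDifferential w x) (weakDifferential w x) +
        (-1 * dInner h u u x + 0) * ‖w x‖ ^ 2) ∂vol[h] := by
  rw [secondVariation, sub_self, mul_zero, zero_mul, zero_add]
  congr 1
  refine integral_congr_ae ?_
  filter_upwards [hu.ae_eq_cdiff_on h hO hs, hfull] with x hx hxO
  have : (2 : ℝ) / 2 - 1 = 0 := by norm_num
  rw [this, Real.rpow_zero, gradSq, gradSq, gradInner, gradInner, hx hxO, dInner]
  ring

theorem pairSpace_sum_field {ρ : M → ℝ} (hρ : AEMeasurable ρ vol[h])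
    (h0 : ∀ x, 0 ≤ ρ x) {m : ℕ} (c : Fin m → ℝ) (p : Fin m → PairSpace F h hρ h0) :
    (∑ i, c i • p i).1.1 = ∑ i, c i • (p i).1.1 := by
  change PairSpace.field hρ h0 _ = _
  rw [map_sum]
  simp only [map_smul]
  rfl

theorem IsHarmonicOn.energyForm_eq_sub (hu : IsHarmonicOn h u O)
    (hVm : AEMeasurable (dInner h u u) vol[h]) (hV0 : ∀ x, 0 ≤ dInner h u u x)
    (p : PairSpace F h hVm hV0) (hp : p.1.1 = w) (hw : w ∈ testFields F O) :
    energyForm hVm hV0 (-1) 0 p p = dirichlet h w - potential h u w := by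
  rw [energyForm_self_eq hVm hV0 _ _ _ hp (isWeakDifferential_cdiff hw.1), dirichlet, potential,
    ← integral_sub (integrable_dInner_self hw)
      (HarmonicIndex.integrable_potential hu.isOpen hu.contMDiffOn hw)]
  refine integral_congr_fun (fun x => ?_)
  simp only [dInner]
  ring

variable [FiniteDimensional ℝ F]

/-- A negative space can be replaced by smooth tangent fields with compact support. -/
theorem IsHarmonicOn.exists_family_of_isNegativeSpace (hu : IsHarmonicOn h u O)
    (hud : WeaklyDifferentiable u) (hc : IsAlmostConstantAtEnd u O) (hfull : ∀ᵐ x ∂vol[h], x ∈ O)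
    (hden : ∀ (w : M → F) (G : (x : M) → T*[x, F]),
      IsW12 h w G → IsApproximable h O w G) {W : Submodule ℝ (M → F)} [FiniteDimensional ℝ W]
    (hW : IsNegativeSpace h 2 u W) :
    ∃ e : Fin (Module.finrank ℝ W) → M → F, (∀ i, e i ∈ testFields F O) ∧
      (∀ i x, inner ℝ (u x) (e i x) = 0) ∧ ∀ c : Fin (Module.finrank ℝ W) → ℝ, c ≠ 0 →
        dirichlet h (∑ i, c i • e i) < potential h u (∑ i, c i • e i) := by
  obtain ⟨C, hC, hpot⟩ := hu.potential_le_sobolevSq hc hfull hden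
  have hVm := hu.aemeasurable_dInner hfull
  have hV0 : ∀ x, 0 ≤ dInner h u u x := dInner_self_nonneg h u
  let b := Module.finBasis ℝ W
  have hb12 : ∀ i, IsW12 h (b i).1 (weakDifferential (b i).1) := fun i =>
    (hW _ (b i).2).1.memW12.isW12
  let p : Fin (Module.finrank ℝ W) → PairSpace F h hVm hV0 := fun i =>
    ⟨((b i).1, weakDifferential (b i).1), hb12 i, (hpot _ _ (hb12 i)).1⟩
  have hneg : ∀ c : Fin (Module.finrank ℝ W) → ℝ, c ≠ 0 →
      energyForm hVm hV0 (-1) 0 (∑ i, c i • p i) (∑ i, c i • p i) < 0 := by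
    intro c hc0
    have hwc : (∑ i, c i • p i).1.1 = (∑ i, c i • b i : W).1 := by
      rw [pairSpace_sum_field]
      simp [p]
    have hne : (∑ i, c i • b i : W) ≠ 0 := fun h0 =>
      hc0 (funext fun i => Fintype.linearIndependent_iff.1 b.linearIndependent c h0 i)
    have hw := hW _ (∑ i, c i • b i : W).2
    have h1 := hw.2 fun h0 => hne (Subtype.ext h0)
    rw [secondVariation_two hud hu.isOpen hu.contMDiffOn hfull] at h1
    rw [energyForm_self_eq hVm hV0 _ _ _ hwc hw.1.memW12.isW12.weak]
    linarith
  obtain ⟨ε, hε, hclose⟩ := exists_pos_form_neg_of_close (energyForm hVm hV0 (-1) 0)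
    (energyForm hVm hV0 1 1) (two_mul_abs_energyForm_le hVm hV0 (by simp) (by simp))
    (two_mul_abs_energyForm_le hVm hV0 (by simp) (by simp)) p hneg
  -- Projecting costs `2` times the Sobolev norm and `9 = 8 + 1` times the potential of the
  -- difference, the latter being at most `C` times the Sobolev norm; hence `2 + 9 C`.
  have happ : ∀ i, ∃ v ∈ testFields F O, sobolevSq h (fun x => v x - (b i).1 x)
        (fun x => cdiff v x - weakDifferential (b i).1 x) ≤ ε / (2 + 9 * C) := fun i =>
    hden _ _ (hb12 i) _ (by positivity)
  choose v hv hvle using happ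
  have hmem := fun i => tangentProj_mem_testFields hu.isOpen hu.contMDiffOn (hv i)
  have hmem12 := fun i => isW12_of_mem_testFields (h := h) (hmem i)
  let p' : Fin (Module.finrank ℝ W) → PairSpace F h hVm hV0 := fun i =>
    ⟨(tangentProj u (v i), cdiff (tangentProj u (v i))), hmem12 i, (hpot _ _ (hmem12 i)).1⟩
  refine ⟨fun i => tangentProj u (v i), hmem, fun i x => inner_tangentProj (hu.norm_eq_one x),
    fun c hc0 => ?_⟩
  have hq := hclose p' (fun i => ?_) c hc0
  · have hmc : ∑ i, c i • tangentProj u (v i) ∈ testFields F O :=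
      Submodule.sum_mem _ fun i _ => Submodule.smul_mem _ _ (hmem i)
    rw [hu.energyForm_eq_sub hVm hV0 _ (pairSpace_sum_field hVm hV0 c p') hmc] at hq
    exact sub_neg.1 hq
  · have hd := (isW12_of_mem_testFields (h := h) (hv i)).sub (hb12 i)
    obtain ⟨hdi, hdle⟩ := hpot _ _ hd
    have htan := (hW _ (b i).2).1.tangent
    rw [energyForm_self_eq hVm hV0 1 1 (p' i - p i) rfl (p' i - p i).2.1.weak]
    have hR : Integrable (fun x => 2 * (‖v i x - (b i).1 x‖ ^ 2 +
        pairing h x (cdiff (v i) x - weakDifferential (b i).1 x)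
          (cdiff (v i) x - weakDifferential (b i).1 x)) +
        9 * (dInner h u u x * ‖v i x - (b i).1 x‖ ^ 2)) vol[h] :=
      (hd.integrable_sobolev.const_mul 2).add (hdi.const_mul 9)
    refine (integral_mono_of_nonneg (ae_of_all _ fun x => ?_) hR ?_).trans ?_
    · have := hV0 x
      exact add_nonneg (pairing_self_nonneg h x _) (by positivity)
    · filter_upwards [htan, hfull,
        (hb12 i).weak.inner_add_inner_eq_zero h hu.isOpen hu.contMDiffOn htan] with x hx hxO hx'
      obtain ⟨h1, h2⟩ := tangentProj_sub_le (G := weakDifferential (b i).1) h (hu.norm_eq_one x)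
        (mdifferentiableAt_of_contMDiffOn hu.isOpen hu.contMDiffOn hxO)
        (mdifferentiableAt_of_mem_testFields (hv i) x) hx (hx' hxO)
      have h3 := pow_le_pow_left₀ (norm_nonneg _) h1 2
      have h4 := mul_le_mul_of_nonneg_left h3 (hV0 x)
      change pairing h x (cdiff (tangentProj u (v i)) x - weakDifferential (b i).1 x)
        (cdiff (tangentProj u (v i)) x - weakDifferential (b i).1 x) +
          (1 * dInner h u u x + 1) * ‖tangentProj u (v i) x - (b i).1 x‖ ^ 2 ≤ _
      nlinarith [sq_nonneg ‖v i x - (b i).1 x‖]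
    · rw [integral_add (hd.integrable_sobolev.const_mul 2) (hdi.const_mul 9), integral_const_mul,
        integral_const_mul]
      change 2 * sobolevSq h _ _ + 9 * potential h u _ ≤ ε
      have h1 := hvle i
      rw [le_div_iff₀ (by positivity)] at h1
      linarith

/-- The size of such families is bounded by `exists_finrank_le`, so a largest one exists. Every
negative space yields a family of its own dimension, so the largest family bounds the index. -/
theorem IsHarmonicOn.exists_index_family (hu : IsHarmonicOn h u O) (hud : WeaklyDifferentiable u)
    (hc : IsAlmostConstantAtEnd u O) (hfull : ∀ᵐ x ∂vol[h], x ∈ O)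
    (hden : ∀ (w : M → F) (G : (x : M) → T*[x, F]), IsW12 h w G → IsApproximable h O w G) :
    ∃ (m : ℕ) (e : Fin m → M → F), (∀ i, e i ∈ testFields F O) ∧
      (∀ i x, inner ℝ (u x) (e i x) = 0) ∧
      (∀ c : Fin m → ℝ, c ≠ 0 → dirichlet h (∑ i, c i • e i) < potential h u (∑ i, c i • e i)) ∧
      morseIndex h 2 u ≤ m := by
  classical
  let P : ℕ → Prop := fun m => ∃ e : Fin m → M → F, (∀ i, e i ∈ testFields F O) ∧
      (∀ i x, inner ℝ (u x) (e i x) = 0) ∧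
      ∀ c : Fin m → ℝ, c ≠ 0 → dirichlet h (∑ i, c i • e i) < potential h u (∑ i, c i • e i)
  obtain ⟨N, hN⟩ := hu.exists_finrank_le hc
  have hPN : ∀ m, P m → m ≤ N := by
    rintro m ⟨e, he, -, hneg⟩
    have hli : LinearIndependent ℝ e := by
      rw [Fintype.linearIndependent_iff]
      intro g hg
      by_contra! hne
      obtain ⟨i, hi⟩ := hne
      have := hneg g fun h0 => hi (congrFun h0 i)
      rw [hg] at this
      have h1 : potential h u (0 : M → F) = 0 := by simp [potential]
      exact absurd (dirichlet_nonneg h (0 : M → F)) (not_le.2 (h1 ▸ this))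
    have hf := finrank_span_eq_card hli
    rw [Fintype.card_fin] at hf
    rw [← hf]
    refine hN _ (Submodule.span_le.2 (range_subset_iff.2 he)) fun w hw hw0 => ?_
    obtain ⟨c, rfl⟩ := (Submodule.mem_span_range_iff_exists_fun ℝ).1 hw
    refine hneg c fun h0 => hw0 ?_
    simp [h0]
  have hP0 : P 0 := ⟨fun i => i.elim0, fun i => i.elim0, fun i => i.elim0,
    fun c hc => absurd (Subsingleton.elim c 0) hc⟩
  obtain ⟨e, he, het, hneg⟩ := Nat.findGreatest_spec (P := P) (Nat.zero_le N) hP0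
  refine ⟨Nat.findGreatest P N, e, he, het, hneg, iSup_le ?_⟩
  rintro ⟨W, hfin, hW⟩
  have hPW : P (Module.finrank ℝ W) :=
    hu.exists_family_of_isNegativeSpace hud hc hfull hden hW
  exact_mod_cast Nat.le_findGreatest (hPN _ hPW) hPW

end Reduction

/-! ### Perturbation of the second variation -/

section Perturbation

variable {h : SurfaceMetric M} {O : Set M} {u u' w : M → F}

/-- As `w` is tangent along `u`, `⟨u', w⟩ = ⟨u' - u, w⟩` is at most `η |w|`, and `htan'` does the
same for the differentiated relation. Every term by which the projection changes `w` or `dw`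
therefore carries a factor `η`. -/
theorem tangentProj_perturb (h : SurfaceMetric M) {x : M} (hux' : ‖u' x‖ = 1)
    (hu' : DiffAt[F] u' x) (hw : DiffAt[F] w x) (htan : inner ℝ (u x) (w x) = 0)
    (htan' : ∀ ξ, inner ℝ (u x) (cdiff w x ξ) + inner ℝ (cdiff u x ξ) (w x) = 0) {η : ℝ}
    (h1 : ‖u' x - u x‖ ≤ η)
    (h2 : pairing h x (cdiff u' x - cdiff u x) (cdiff u' x - cdiff u x) ≤ η ^ 2) :
    (1 - η ^ 2) * ‖w x‖ ^ 2 ≤ ‖tangentProj u' w x‖ ^ 2 ∧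
      pairing h x (cdiff (tangentProj u' w) x - cdiff w x)
        (cdiff (tangentProj u' w) x - cdiff w x) ≤
      3 * η ^ 2 * (dInner h u' u' x * ‖w x‖ ^ 2 + dInner h w w x + ‖w x‖ ^ 2) := by
  have hη : 0 ≤ η := (norm_nonneg _).trans h1
  have e1 : inner ℝ (u' x) (w x) = inner ℝ (u' x - u x) (w x) := by
    rw [inner_sub_left, htan, sub_zero]
  have b1 : |inner ℝ (u' x) (w x)| ≤ η * ‖w x‖ := by
    rw [e1]
    exact (abs_real_inner_le_norm _ _).trans (by gcongr)
  constructor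
  · have : ‖tangentProj u' w x‖ ^ 2 = ‖w x‖ ^ 2 - inner ℝ (u' x) (w x) ^ 2 := by
      rw [tangentProj, norm_sub_sq_real, norm_smul, hux', real_inner_smul_right,
        real_inner_comm (u' x) (w x), Real.norm_eq_abs, mul_pow, sq_abs]
      ring
    rw [this]
    have := sq_le_sq' (abs_le.1 b1).1 (abs_le.1 b1).2
    linarith [mul_pow η ‖w x‖ 2]
  · have key : ∀ ξ : T[x], ‖(cdiff (tangentProj u' w) x - cdiff w x) ξ‖ ^ 2 ≤
        3 * (η ^ 2 * (‖cdiff u' x ξ‖ ^ 2 * ‖w x‖ ^ 2)) + 3 * (η ^ 2 * ‖cdiff w x ξ‖ ^ 2) +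
          3 * (‖(cdiff u' x - cdiff u x) ξ‖ ^ 2 * ‖w x‖ ^ 2) := by
      intro ξ
      have e2 : (cdiff (tangentProj u' w) x - cdiff w x) ξ = -(inner ℝ (u' x) (w x) • cdiff u' x ξ +
            (inner ℝ (u' x - u x) (cdiff w x ξ) +
              inner ℝ ((cdiff u' x - cdiff u x) ξ) (w x)) • u' x) := by
        change cdiff (tangentProj u' w) x ξ - cdiff w x ξ = _
        have e3 : (cdiff u' x - cdiff u x) ξ = cdiff u' x ξ - cdiff u x ξ := rfl
        have h3 : (inner ℝ (u' x - u x) (cdiff w x ξ) +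
            inner ℝ ((cdiff u' x - cdiff u x) ξ) (w x)) =
            inner ℝ (u' x) (cdiff w x ξ) + inner ℝ (cdiff u' x ξ) (w x) := by
          rw [e3, inner_sub_left, inner_sub_left]
          linarith [htan' ξ]
        rw [cdiff_tangentProj_apply hu' hw, h3]
        abel
      rw [e2, norm_neg]
      have n1 : ‖inner ℝ (u' x) (w x) • cdiff u' x ξ‖ ≤ η * (‖cdiff u' x ξ‖ * ‖w x‖) := by
        rw [norm_smul, Real.norm_eq_abs]
        calc _ ≤ η * ‖w x‖ * ‖cdiff u' x ξ‖ := by gcongr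
          _ = _ := by ring
      have n2 : |inner ℝ (u' x - u x) (cdiff w x ξ)| ≤ η * ‖cdiff w x ξ‖ :=
        (abs_real_inner_le_norm _ _).trans (by gcongr)
      have n3 := abs_real_inner_le_norm ((cdiff u' x - cdiff u x) ξ) (w x)
      have n4 := (norm_add_le (inner ℝ (u' x) (w x) • cdiff u' x ξ)
        ((inner ℝ (u' x - u x) (cdiff w x ξ) + inner ℝ ((cdiff u' x - cdiff u x) ξ) (w x)) • u' x))
      rw [norm_smul _ (u' x), hux', mul_one, Real.norm_eq_abs] at n4
      have n5 := abs_add_le (inner ℝ (u' x - u x) (cdiff w x ξ))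
        (inner ℝ ((cdiff u' x - cdiff u x) ξ) (w x))
      have n6 := n4.trans (add_le_add n1 (n5.trans (add_le_add n2 n3)))
      refine (pow_le_pow_left₀ (norm_nonneg _) n6 2).trans ?_
      nlinarith [sq_nonneg (η * (‖cdiff u' x ξ‖ * ‖w x‖) - η * ‖cdiff w x ξ‖),
        sq_nonneg (η * (‖cdiff u' x ξ‖ * ‖w x‖) - ‖(cdiff u' x - cdiff u x) ξ‖ * ‖w x‖),
        sq_nonneg (η * ‖cdiff w x ξ‖ - ‖(cdiff u' x - cdiff u x) ξ‖ * ‖w x‖)]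
    obtain ⟨f₁, f₂, hf⟩ := exists_orthoFrame h x
    rw [hf.pairing_eq] at h2 ⊢
    rw [dInner, dInner, hf.pairing_eq, hf.pairing_eq]
    simp only [real_inner_self_eq_norm_sq] at h2 ⊢
    have h3 := mul_le_mul_of_nonneg_right h2 (sq_nonneg ‖w x‖)
    linarith [key f₁, key f₂]

/-- The real inequality behind the stability of the second variation. -/
theorem form_perturb_le {X X' Y Y' V V' AB Z η L s b : ℝ} (hη : 0 < η) (hη1 : η ≤ 1)
    (hL : 0 ≤ L) (hX : 0 ≤ X) (hY : 0 ≤ Y) (hX' : X' = X + 2 * AB + Z) (hAB : AB ^ 2 ≤ X * Z)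
    (hX0 : 0 ≤ X')
    (hZ : Z ≤ 3 * η ^ 2 * (V' * Y + X + Y)) (hV : 0 ≤ V) (hV' : 0 ≤ V') (hVL : V ≤ L ^ 2)
    (hV'L : V' ≤ 2 * L ^ 2 + 2) (hVV : V - 2 * L * η ≤ V') (hY' : (1 - η ^ 2) * Y ≤ Y')
    (hs : 0 ≤ s) (hsη : s ≤ η) (hb : 0 ≤ b) (hbη : b ≤ 1 + η) (hbV : V' - η ≤ b * V') :
    b * ((1 + 2 * s) * X' - V' * Y') ≤
      X - V * Y + η * (11 + 12 * (6 * L ^ 2 + 9) + (L + 1) ^ 2) * (X + Y) := by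
  -- In the application `X = |dw|²`, `Y = |w|²`, `V = |du|²`, with primes for the perturbed map and
  -- the projected field. Moreover `AB = dw · (dw' - dw)`, `Z = |dw' - dw|²`, and `b` is the weight.
  set C := 6 * L ^ 2 + 9 with hC
  have hCpos : 0 < C := by positivity
  set n := X + Y with hn
  have hn0 : 0 ≤ n := by positivity
  have hZn : Z ≤ η ^ 2 * (C * n) := by
    have h1 := mul_le_mul_of_nonneg_right hV'L hY
    have h2 : V' * Y + X + Y ≤ (C / 3) * n := by
      rw [hC, hn]
      nlinarith [mul_nonneg (sq_nonneg L) hX]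
    calc Z ≤ 3 * η ^ 2 * (V' * Y + X + Y) := hZ
      _ ≤ 3 * η ^ 2 * (C / 3 * n) := by gcongr
      _ = _ := by ring
  have hABn : 2 * AB ≤ η * (1 + C) * n := by
    have h1 : AB ^ 2 ≤ n * (η ^ 2 * (C * n)) :=
      hAB.trans ((mul_le_mul_of_nonneg_left hZn hX).trans
        (mul_le_mul_of_nonneg_right (by linarith) (by positivity)))
    have h2 : (2 * AB) ^ 2 ≤ (η * (1 + C) * n) ^ 2 := by
      have : n * (η ^ 2 * (C * n)) * 4 ≤ (η * (1 + C) * n) ^ 2 := by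
        have : 0 ≤ (η * n) ^ 2 * (1 - C) ^ 2 := by positivity
        nlinarith
      linarith
    exact (abs_le_of_sq_le_sq' h2 (by positivity)).2
  have hX'n : X' ≤ X + η * (1 + 2 * C) * n := by
    have h1 : η ^ 2 * (C * n) ≤ η * (C * n) := by
      have : η ^ 2 ≤ η := by nlinarith
      gcongr
    rw [hX']
    linarith
  have h1 : b * ((1 + 2 * s) * X') ≤ X + η * (11 + 12 * C) * n := by
    have hbs : b * (1 + 2 * s) ≤ 1 + 5 * η := by
      calc b * (1 + 2 * s) ≤ (1 + η) * (1 + 2 * η) := by gcongr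
        _ ≤ 1 + 5 * η := by nlinarith
    calc b * ((1 + 2 * s) * X') = b * (1 + 2 * s) * X' := by ring
      _ ≤ (1 + 5 * η) * (X + η * (1 + 2 * C) * n) := by gcongr
      _ ≤ _ := by
        have h2 : η * (η * (1 + 2 * C) * n) ≤ 1 * (η * (1 + 2 * C) * n) := by gcongr
        have h3 : η * X ≤ η * n := by gcongr; linarith
        linarith
  have h2 : V * Y - η * (L + 1) ^ 2 * n ≤ b * (V' * Y') := by
    have hη2 : 0 ≤ 1 - η ^ 2 := by nlinarith
    have h3 : b * V' * ((1 - η ^ 2) * Y) ≤ b * V' * Y' := by gcongr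
    have h4 : (V - 2 * L * η - η) * ((1 - η ^ 2) * Y) ≤ b * V' * ((1 - η ^ 2) * Y) := by
      gcongr
      linarith
    have h5 : η ^ 2 * V ≤ η * L ^ 2 := mul_le_mul (by nlinarith) hVL hV hη.le
    have h6 : V - η * (L + 1) ^ 2 ≤ (V - 2 * L * η - η) * (1 - η ^ 2) := by
      have : 0 ≤ η ^ 2 * (2 * L * η + η) := by positivity
      nlinarith
    have h7 := mul_le_mul_of_nonneg_right h6 hY
    have h8 : η * (L + 1) ^ 2 * Y ≤ η * (L + 1) ^ 2 * n := by gcongr; linarith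
    linarith
  linarith

/-- `u'` is smooth near `K` and `η`-close to `u` there, with first derivatives. -/
def IsCloseOn (h : SurfaceMetric M) (u u' : M → F) (K : Set M) (η : ℝ) : Prop :=
  ∃ O', IsOpen O' ∧ K ⊆ O' ∧ SmoothOn[F] u' O' ∧ ∀ x ∈ K, ‖u' x - u x‖ ≤ η ∧
    pairing h x (cdiff u' x - cdiff u x) (cdiff u' x - cdiff u x) ≤ η ^ 2

theorem pairing_perturb (h : SurfaceMetric M) {x : M} {η L : ℝ} (hη : 0 ≤ η) (hL : 0 ≤ L)
    (hu : dInner h u u x ≤ L ^ 2)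
    (h2 : pairing h x (cdiff u' x - cdiff u x) (cdiff u' x - cdiff u x) ≤ η ^ 2) :
    dInner h u' u' x ≤ 2 * L ^ 2 + 2 * η ^ 2 ∧ dInner h u u x - 2 * L * η ≤ dInner h u' u' x := by
  set A := cdiff u' x - cdiff u x with hA
  have e : cdiff u' x = cdiff u x + A := by rw [hA]; abel
  have h1 := pairing_add_self_le h x (cdiff u x) A
  rw [← e] at h1
  change dInner h u' u' x ≤ 2 * dInner h u u x + _ at h1
  refine ⟨by linarith, ?_⟩
  have h3 := (abs_le.1 (abs_pairing_le h x (cdiff u x) A)).1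
  have h4 : pnorm h x (cdiff u x) ≤ L := by
    rw [← abs_of_nonneg hL, ← abs_of_nonneg (pnorm_nonneg h x (cdiff u x))]
    exact sq_le_sq.1 (by rw [pnorm_sq]; exact hu)
  have h5 : pnorm h x A ≤ η := by
    rw [← abs_of_nonneg hη, ← abs_of_nonneg (pnorm_nonneg h x A)]
    exact sq_le_sq.1 (by rw [pnorm_sq]; exact h2)
  have h6 : pnorm h x (cdiff u x) * pnorm h x A ≤ L * η :=
    mul_le_mul h4 h5 (pnorm_nonneg _ _ _) hL
  have h7 : dInner h u' u' x = dInner h u u x + 2 * pairing h x (cdiff u x) A +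
      pairing h x A A := by
    rw [dInner, e, pairing_add_left, pairing_add_right, pairing_add_right,
      pairing_comm h x A (cdiff u x), dInner]
    ring
  linarith [pairing_self_nonneg h x A]

end Perturbation

/-! ### The second variation along nearby maps -/

section PerturbedForm

variable {h : SurfaceMetric M} {O : Set M} {u u' w : M → F}

/-- On a finite family negativity is uniform with respect to the Sobolev norm, by compactness. The
margin `μ` is what perturbations have to respect. -/
theorem IsHarmonicOn.exists_form_le (hu : IsHarmonicOn h u O)
    (hfull : ∀ᵐ x ∂vol[h], x ∈ O) {m : ℕ} {e : Fin m → M → F}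
    (he : ∀ i, e i ∈ testFields F O) (hneg : ∀ c : Fin m → ℝ, c ≠ 0 →
      dirichlet h (∑ i, c i • e i) < potential h u (∑ i, c i • e i)) :
    ∃ μ > 0, ∀ c : Fin m → ℝ, dirichlet h (∑ i, c i • e i) - potential h u (∑ i, c i • e i) ≤
      -μ * sobolevSq h (∑ i, c i • e i) (cdiff (∑ i, c i • e i)) := by
  have hVm := hu.aemeasurable_dInner hfull
  have hV0 : ∀ x, 0 ≤ dInner h u u x := dInner_self_nonneg h u
  let p : Fin m → PairSpace F h hVm hV0 := fun i => ⟨(e i, cdiff (e i)),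
    isW12_of_mem_testFields (he i),
    HarmonicIndex.integrable_potential hu.isOpen hu.contMDiffOn (he i)⟩
  have hmc := sum_mem_testFields he
  have hB : ∀ c : Fin m → ℝ, energyForm hVm hV0 (-1) 0 (∑ i, c i • p i) (∑ i, c i • p i) =
      dirichlet h (∑ i, c i • e i) - potential h u (∑ i, c i • e i) := fun c =>
    hu.energyForm_eq_sub hVm hV0 _ (pairSpace_sum_field hVm hV0 c p) (hmc c)
  obtain ⟨μ, hμ, hle⟩ := exists_form_le_neg_mul (energyForm hVm hV0 (-1) 0)
    (energyForm hVm hV0 0 1) p fun c hc => by rw [hB]; linarith [hneg c hc]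
  refine ⟨μ, hμ, fun c => ?_⟩
  have h1 := hle c
  rw [hB, energyForm_self_eq hVm hV0 0 1 _ (pairSpace_sum_field hVm hV0 c p)
    (isWeakDifferential_cdiff (hmc c).1)] at h1
  refine h1.trans_eq (congrArg (-μ * ·) (integral_congr_fun (fun x => ?_)))
  simp only [zero_mul, zero_add, one_mul]
  exact add_comm _ _

theorem tsupport_tangentProj_subset : tsupport (tangentProj u w) ⊆ tsupport w := by
  refine closure_mono fun x hx => ?_
  contrapose! hx
  rw [Function.notMem_support] at hx ⊢
  simp [tangentProj, hx]

/-- The weight `b` is not required to be close to `1`. The gradient term uses only `b ≤ 1 + η`, and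
the potential term only `b |du'|² ≥ |du'|² - η`, so `b` may be small where `du'` is small. On the
scale of the bubble this freedom is essential. -/
theorem IsHarmonicOn.perturbed_form_neg (hu : IsHarmonicOn h u O)
    (hfull : ∀ᵐ x ∂vol[h], x ∈ O) {m : ℕ} {e : Fin m → M → F}
    (he : ∀ i, e i ∈ testFields F O) (htan : ∀ i x, inner ℝ (u x) (e i x) = 0)
    (hneg : ∀ c : Fin m → ℝ, c ≠ 0 →
      dirichlet h (∑ i, c i • e i) < potential h u (∑ i, c i • e i)) :
    ∃ η > 0, η ≤ 1 ∧ ∀ (u' : M → F) (s : ℝ) (b : M → ℝ) (O' : Set M),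
      IsCloseOn h u u' (⋃ i, tsupport (e i)) η →
      (∀ x, ‖u' x‖ = 1) → 0 ≤ s → s ≤ η → IsOpen O' → (⋃ i, tsupport (e i)) ⊆ O' →
      ContinuousOn b O' → (∀ x ∈ ⋃ i, tsupport (e i), 0 ≤ b x ∧ b x ≤ 1 + η ∧
        dInner h u' u' x - η ≤ b x * dInner h u' u' x) →
      ∀ c : Fin m → ℝ, c ≠ 0 → ∫ x, b x * ((1 + 2 * s) *
          dInner h (tangentProj u' (∑ i, c i • e i)) (tangentProj u' (∑ i, c i • e i)) x -
        dInner h u' u' x * ‖tangentProj u' (∑ i, c i • e i) x‖ ^ 2) ∂vol[h] < 0 := by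
  obtain ⟨μ, hμ, hle⟩ := hu.exists_form_le hfull he hneg
  set K := ⋃ i, tsupport (e i) with hKdef
  have hK : IsCompact K := isCompact_iUnion fun i => (he i).2.1
  have hKO : K ⊆ O := iUnion_subset fun i => (he i).2.2
  obtain ⟨B, hB⟩ := hK.exists_bound_of_continuousOn
    ((continuousOn_dInner h hu.isOpen hu.contMDiffOn hu.contMDiffOn).mono hKO)
  set L := max B 1 with hL
  have hL1 : 1 ≤ L := le_max_right _ _
  have hVL : ∀ x ∈ K, dInner h u u x ≤ L ^ 2 := fun x hx =>
    ((Real.le_norm_self _).trans (hB x hx)).trans ((le_max_left B 1).trans (by nlinarith))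
  set C := 11 + 12 * (6 * L ^ 2 + 9) + (L + 1) ^ 2 with hC
  have hCpos : 0 < C := by positivity
  -- The perturbation costs `η C` times the Sobolev norm; this choice leaves half of the margin `μ`.
  refine ⟨min 1 (μ / (2 * C)), by positivity, min_le_left _ _, ?_⟩
  have hηC : min 1 (μ / (2 * C)) * C ≤ μ / 2 := by
    calc _ ≤ μ / (2 * C) * C := by gcongr; exact min_le_right _ _
      _ = _ := by field_simp
  have hη1 : min 1 (μ / (2 * C)) ≤ 1 := min_le_left _ _
  have hη0 : 0 < min 1 (μ / (2 * C)) := by positivity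
  generalize min 1 (μ / (2 * C)) = η at *
  rintro u' s b O₁ ⟨O₂, hO₂, hKO₂, hs', hclose⟩ hn' hs0 hsη hO₁ hKO₁ hbc hb c hc
  set w := ∑ i, c i • e i with hw
  have hmem := sum_mem_testFields he c
  rw [← hw] at hmem
  have hw0 : ∀ x ∉ K, x ∉ tsupport w := fun x hx hx' =>
    hx (tsupport_sum_subset c (fun i => subset_iUnion (fun i => tsupport (e i)) i) hx')
  have htw : ∀ x, inner ℝ (u x) (w x) = 0 := fun x => by
    simp [hw, Finset.sum_apply, inner_sum, real_inner_smul_right, htan]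
  have hwd := mdifferentiableAt_of_mem_testFields hmem
  have hw'0 : ∀ x ∉ K, x ∉ tsupport (tangentProj u' w) := fun x hx hx' =>
    hw0 x hx (tsupport_tangentProj_subset hx')
  have hw's : SmoothOn[F] (tangentProj u' w) O₂ :=
    contMDiffOn_tangentProj hs' hmem.1.contMDiffOn
  have hD := integrable_dInner_self (h := h) hmem
  have hP := HarmonicIndex.integrable_potential (h := h) hu.isOpen hu.contMDiffOn hmem
  have hS := (isW12_of_mem_testFields (h := h) hmem).integrable_sobolev
  have hint : Integrable (fun x => b x * ((1 + 2 * s) *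
      dInner h (tangentProj u' w) (tangentProj u' w) x -
        dInner h u' u' x * ‖tangentProj u' w x‖ ^ 2)) vol[h] := by
    refine integrable_of_continuousOn_of_eq_zero h (hO₁.inter hO₂) ?_ hK
      (subset_inter hKO₁ hKO₂) fun x hx => ?_
    · refine (hbc.mono inter_subset_left).mul (ContinuousOn.mono ?_ inter_subset_right)
      exact (continuousOn_const.mul (continuousOn_dInner h hO₂ hw's hw's)).sub
        ((continuousOn_dInner h hO₂ hs' hs').mul (hw's.continuousOn.norm.pow 2))
    · rw [dInner_eq_zero_of_notMem_tsupport h _ (hw'0 x hx),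
        image_eq_zero_of_notMem_tsupport (hw'0 x hx)]
      simp
  have hpt : ∀ x, b x * ((1 + 2 * s) * dInner h (tangentProj u' w) (tangentProj u' w) x -
      dInner h u' u' x * ‖tangentProj u' w x‖ ^ 2) ≤ dInner h w w x -
        dInner h u u x * ‖w x‖ ^ 2 + η * C * (‖w x‖ ^ 2 + pairing h x (cdiff w x) (cdiff w x)) := by
    intro x
    by_cases hx : x ∈ K
    · have hux := mdifferentiableAt_of_contMDiffOn hu.isOpen hu.contMDiffOn (hKO hx)
      have htan' : ∀ ξ, inner ℝ (u x) (cdiff w x ξ) + inner ℝ (cdiff u x ξ) (w x) = 0 := by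
        intro ξ
        rw [← cdiff_inner_apply hux (hwd x)]
        simp only [htw]
        rw [cdiff_const]
        rfl
      obtain ⟨hb0, hb1, hb2⟩ := hb x hx
      obtain ⟨c1, c2⟩ := hclose x hx
      obtain ⟨t1, t2⟩ := tangentProj_perturb (u := u) h (hn' x)
        (mdifferentiableAt_of_contMDiffOn hO₂ hs' (hKO₂ hx)) (hwd x) (htw x) htan' c1 c2
      obtain ⟨v1, v2⟩ := pairing_perturb h hη0.le (by positivity) (hVL x hx) c2
      have hv : dInner h u' u' x ≤ 2 * L ^ 2 + 2 := by nlinarith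
      set D := cdiff (tangentProj u' w) x - cdiff w x with hDdef
      have hX' : dInner h (tangentProj u' w) (tangentProj u' w) x =
          dInner h w w x + 2 * pairing h x (cdiff w x) D + pairing h x D D := by
        have e : cdiff (tangentProj u' w) x = cdiff w x + D := by rw [hDdef]; abel
        rw [dInner, e, pairing_add_left, pairing_add_right, pairing_add_right,
          pairing_comm h x D (cdiff w x), dInner]
        ring
      have := form_perturb_le hη0 hη1 (by positivity) (dInner_self_nonneg h w x)
        (sq_nonneg ‖w x‖) hX' (pairing_sq_le h x (cdiff w x) D) (dInner_self_nonneg h _ x) t2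
        (dInner_self_nonneg h u x) (dInner_self_nonneg h u' x) (hVL x hx) hv v2 t1 hs0 hsη hb0 hb1
        hb2
      rw [add_comm (dInner h w w x) (‖w x‖ ^ 2)] at this
      exact this
    · have hz' : dInner h w w x = 0 := dInner_eq_zero_of_notMem_tsupport h w (hw0 x hx)
      have hz : pairing h x (cdiff w x) (cdiff w x) = 0 := hz'
      rw [dInner_eq_zero_of_notMem_tsupport h _ (hw'0 x hx),
        image_eq_zero_of_notMem_tsupport (hw'0 x hx), hz', hz,
        image_eq_zero_of_notMem_tsupport (hw0 x hx)]
      simp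
  have h1 := hle c
  have h2 := hneg c hc
  have h3 : 0 ≤ sobolevSq h w (cdiff w) := integral_nonneg fun x =>
    add_nonneg (sq_nonneg _) (pairing_self_nonneg h x _)
  have hDP : Integrable (fun x => dInner h w w x - dInner h u u x * ‖w x‖ ^ 2) vol[h] := hD.sub hP
  have hSC : Integrable (fun x => η * C * (‖w x‖ ^ 2 + pairing h x (cdiff w x) (cdiff w x)))
    vol[h] := hS.const_mul (η * C)
  refine (integral_mono hint (hDP.add hSC) hpt).trans_lt ?_
  calc ∫ x, (dInner h w w x - dInner h u u x * ‖w x‖ ^ 2 +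
        η * C * (‖w x‖ ^ 2 + pairing h x (cdiff w x) (cdiff w x))) ∂vol[h]
      = dirichlet h w - potential h u w + η * C * sobolevSq h w (cdiff w) := by
        rw [integral_add hDP hSC, integral_sub hD hP, integral_const_mul, dirichlet, potential,
          sobolevSq]
    _ < 0 := by
        linarith [mul_le_mul_of_nonneg_right hηC h3]

theorem continuousOn_weight {O' : Set M} (hO' : IsOpen O') (hs : SmoothOn[F] u O') (t : ℝ) :
    ContinuousOn (fun x => (1 + dInner h u u x) ^ t) O' :=
  (continuousOn_const.add (continuousOn_dInner h hO' hs hs)).rpow_const fun x _ =>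
    Or.inl (add_pos_of_pos_of_nonneg one_pos (dInner_self_nonneg h u x)).ne'

/-- `(∇u · ∇w)² ≤ (1 + |∇u|²) |∇w|²` gives the first integrand the weight of the second. Its
coefficient `p - 2` is `2 s` with `s = p / 2 - 1`. -/
theorem secondVariation_le {O' : Set M} {p : ℝ} (hp : 2 < p) (hud : WeaklyDifferentiable u)
    (hO' : IsOpen O') (hs : SmoothOn[F] u O') (hw : w ∈ testFields F O') :
    secondVariation h p u w ≤ p * ∫ x, (1 + dInner h u u x) ^ (p / 2 - 1) *
      ((1 + 2 * (p / 2 - 1)) * dInner h w w x - dInner h u u x * ‖w x‖ ^ 2) ∂vol[h] := by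
  have hwc : SmoothOn[F] w O' := hw.1.contMDiffOn
  have hVc := continuousOn_dInner h hO' hs hs
  have hw0 : ∀ x ∉ tsupport w, w x = 0 ∧ cdiff w x = 0 := fun x hx =>
    ⟨image_eq_zero_of_notMem_tsupport hx, cdiff_eq_zero_of_notMem_tsupport hx⟩
  have hpos : ∀ x, 0 < 1 + dInner h u u x := fun x => by linarith [dInner_self_nonneg h u x]
  have hi1 : Integrable (fun x => (1 + dInner h u u x) ^ (p / 2 - 2) * dInner h u w x ^ 2)
      vol[h] := by
    refine integrable_of_continuousOn_of_eq_zero h hO' ((continuousOn_weight hO' hs _).mul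
      ((continuousOn_dInner h hO' hs hwc).pow 2)) hw.2.1 hw.2.2 fun x hx => ?_
    simp [dInner_eq_zero_of_notMem_tsupport h u hx]
  have hi2 : ∀ a : ℝ, Integrable (fun x => (1 + dInner h u u x) ^ (p / 2 - 1) *
      (a * dInner h w w x - dInner h u u x * ‖w x‖ ^ 2)) vol[h] := by
    intro a
    refine integrable_of_continuousOn_of_eq_zero h hO' ((continuousOn_weight hO' hs _).mul
      ((continuousOn_const.mul (continuousOn_dInner h hO' hwc hwc)).sub
        (hVc.mul (hwc.continuousOn.norm.pow 2)))) hw.2.1 hw.2.2 fun x hx => ?_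
    simp [dInner_eq_zero_of_notMem_tsupport h w hx, (hw0 x hx).1]
  have hae := hud.ae_eq_cdiff_on h hO' hs
  have haw := weakDifferential_ae_eq_cdiff h hw.1
  have e1 : ∫ x, (1 + gradSq h u x) ^ (p / 2 - 2) * gradInner h u w x ^ 2 ∂vol[h] =
      ∫ x, (1 + dInner h u u x) ^ (p / 2 - 2) * dInner h u w x ^ 2 ∂vol[h] := by
    refine integral_congr_ae ?_
    filter_upwards [hae, haw] with x hx hxw
    by_cases hxs : x ∈ tsupport w
    · rw [gradSq, gradInner, gradInner, hx (hw.2.2 hxs), hxw, dInner, dInner]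
    · rw [gradInner, hxw, (hw0 x hxs).2, dInner_eq_zero_of_notMem_tsupport h u hxs,
        pairing_zero_right]
      simp
  have e2 : ∫ x, (1 + gradSq h u x) ^ (p / 2 - 1) * (gradSq h w x - gradSq h u x * ‖w x‖ ^ 2)
      ∂vol[h] = ∫ x, (1 + dInner h u u x) ^ (p / 2 - 1) *
        (1 * dInner h w w x - dInner h u u x * ‖w x‖ ^ 2) ∂vol[h] := by
    refine integral_congr_ae ?_
    filter_upwards [hae, haw] with x hx hxw
    by_cases hxs : x ∈ tsupport w
    · rw [gradSq, gradSq, gradInner, gradInner, hx (hw.2.2 hxs), hxw, dInner, dInner, one_mul]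
    · rw [gradSq, gradSq, gradInner, gradInner, hxw, (hw0 x hxs).2, (hw0 x hxs).1,
        dInner_eq_zero_of_notMem_tsupport h w hxs, pairing_zero_right]
      simp
  rw [secondVariation, e1, e2, mul_assoc, ← mul_add]
  refine mul_le_mul_of_nonneg_left ?_ (by linarith)
  rw [← integral_const_mul, ← integral_add (hi1.const_mul _) (hi2 1)]
  refine integral_mono ((hi1.const_mul _).add (hi2 1)) (hi2 _) fun x => ?_
  have h1 : dInner h u w x ^ 2 ≤ (1 + dInner h u u x) * dInner h w w x :=
    (pairing_sq_le h x (cdiff u x) (cdiff w x)).trans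
      (mul_le_mul_of_nonneg_right (le_add_of_nonneg_left zero_le_one) (pairing_self_nonneg h x _))
  have h2 : (1 + dInner h u u x) ^ (p / 2 - 1) =
      (1 + dInner h u u x) ^ (p / 2 - 2) * (1 + dInner h u u x) := by
    rw [← Real.rpow_add_one (hpos x).ne']
    congr 1
    ring
  have h3 := mul_le_mul_of_nonneg_left h1 (Real.rpow_nonneg (hpos x).le (p / 2 - 2))
  rw [← mul_assoc, ← h2] at h3
  have h4 := mul_le_mul_of_nonneg_left h3 (by linarith : 0 ≤ p - 2)
  beta_reduce
  linarith

end PerturbedForm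

/-! ### Smooth convergence and rescaled charts -/

section Convergence

theorem norm_fderiv_sub_le {E E' : Type*} [NormedAddCommGroup E] [NormedSpace ℝ E]
    [NormedAddCommGroup E'] [NormedSpace ℝ E'] (f g : E → E') (y : E) :
    ‖fderiv ℝ f y - fderiv ℝ g y‖ ≤ ‖iteratedFDeriv ℝ 1 f y - iteratedFDeriv ℝ 1 g y‖ := by
  refine ContinuousLinearMap.opNorm_le_bound _ (norm_nonneg _) fun v => ?_
  have h1 := (iteratedFDeriv ℝ 1 f y - iteratedFDeriv ℝ 1 g y).le_opNorm fun _ => v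
  simpa [iteratedFDeriv_one_apply] using h1

/-- Convergence of the derivatives of order `0` and `1` suffices; the constants of the chart on the
compact set convert it into the metric norm. -/
theorem TendstoSmoothLoc.eventually_isCloseOn (h : SurfaceMetric M) {φ : Chart[M]}
    (hφ : IsSmoothChart φ) {Ω : Set ℂ} (hΩ : IsOpen Ω) (hΩt : Ω ⊆ φ.target) {u : ℕ → M → F}
    {g : M → F} (hu : TendstoSmoothLoc Ω (fun k y => u k (φ.symm y)) fun y => g (φ.symm y))
    {K : Set M} (hK : IsCompact K) (hKs : K ⊆ φ.source ∩ φ ⁻¹' Ω) {η : ℝ} (hη : 0 < η) :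
    ∀ᶠ k in atTop, IsCloseOn h g (u k) K η := by
  set K' := φ '' K with hK'
  have hK'c : IsCompact K' :=
    hK.image_of_continuousOn (φ.continuousOn.mono fun x hx => (hKs hx).1)
  have hK'Ω : K' ⊆ Ω := by
    rintro _ ⟨x, hx, rfl⟩
    exact (hKs hx).2
  obtain ⟨C, hC, hcomp⟩ := hφ.exists_comparison h hK'c (hK'Ω.trans hΩt) (F := F)
  have hη' : 0 < min η (η / (C + 1)) := by positivity
  filter_upwards [hu.eventually_contDiffOn K' hK'Ω hK'c,
    Metric.tendstoUniformlyOn_iff.1 (hu.tendsto K' hK'Ω hK'c 0) _ hη',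
    Metric.tendstoUniformlyOn_iff.1 (hu.tendsto K' hK'Ω hK'c 1) _ hη'] with k hk h0 h1
  obtain ⟨U, hU, hKU, hUs⟩ := hk
  have hUΩ : IsOpen (U ∩ Ω) := hU.inter hΩ
  have hO : IsOpen (φ.source ∩ φ ⁻¹' (U ∩ Ω)) := φ.isOpen_inter_preimage hUΩ
  have hs := contMDiffOn_of_comp_symm hφ (u := u k) (hUs.mono inter_subset_left : ContDiffOn ℝ ∞
    (fun y => u k (φ.symm y)) (U ∩ Ω))
  have hsg := contMDiffOn_of_comp_symm hφ (u := g) hu.contDiffOn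
  refine ⟨_, hO, fun x hx => ⟨(hKs hx).1, hKU (mem_image_of_mem _ hx), (hKs hx).2⟩, hs,
    fun x hx => ?_⟩
  obtain ⟨hxs, hxΩ⟩ := hKs hx
  have hxt := φ.map_source hxs
  have hy : φ x ∈ K' := mem_image_of_mem _ hx
  have e : φ.symm (φ x) = x := φ.left_inv hxs
  constructor
  · have := h0 (φ x) hy
    rw [dist_comm, dist_eq_norm] at this
    have h2 : ‖u k (φ.symm (φ x)) - g (φ.symm (φ x))‖ ≤ ‖iteratedFDeriv ℝ 0
        (fun y => u k (φ.symm y)) (φ x) - iteratedFDeriv ℝ 0 (fun y => g (φ.symm y)) (φ x)‖ := by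
      have := (iteratedFDeriv ℝ 0 (fun y => u k (φ.symm y)) (φ x) -
        iteratedFDeriv ℝ 0 (fun y => g (φ.symm y)) (φ x)).le_opNorm fun _ => 0
      simpa using this
    rw [e] at h2
    exact h2.trans (this.le.trans (min_le_left _ _))
  · have h3 := h1 (φ x) hy
    rw [dist_comm, dist_eq_norm] at h3
    have h4 := (norm_fderiv_sub_le (fun y => u k (φ.symm y)) (fun y => g (φ.symm y)) (φ x)).trans
      h3.le
    have d1 : DiffAt[F] (u k) (φ.symm (φ x)) := by
      rw [e]
      exact mdifferentiableAt_of_contMDiffOn hO hs ⟨hxs, hKU hy, hxΩ⟩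
    have d2 : DiffAt[F] g (φ.symm (φ x)) := by
      rw [e]
      exact mdifferentiableAt_of_contMDiffOn (φ.isOpen_inter_preimage hΩ) hsg ⟨hxs, hxΩ⟩
    have h5 := ((hcomp _ hy).2.2 (cdiff (u k) (φ.symm (φ x)) - cdiff g (φ.symm (φ x)))).1
    rw [ContinuousLinearMap.sub_comp, ← hφ.fderiv_comp_symm_eq_cdiff hxt d1,
      ← hφ.fderiv_comp_symm_eq_cdiff hxt d2] at h5
    have h6 := pow_le_pow_left₀ (norm_nonneg _) (h4.trans (min_le_right _ _)) 2
    have h7 : C * (η / (C + 1)) ^ 2 ≤ η ^ 2 := by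
      rw [div_pow, mul_div_assoc', div_le_iff₀ (by positivity)]
      nlinarith [sq_nonneg η, mul_nonneg hC.le (sq_nonneg η), mul_nonneg (sq_nonneg C) (sq_nonneg η)]
    have h8 : pairing h (φ.symm (φ x)) (cdiff (u k) (φ.symm (φ x)) - cdiff g (φ.symm (φ x)))
        (cdiff (u k) (φ.symm (φ x)) - cdiff g (φ.symm (φ x))) ≤ η ^ 2 :=
      h5.trans ((mul_le_mul_of_nonneg_left h6 hC.le).trans h7)
    rw [e] at h8
    exact h8

/-- Closeness passes to subsets and finite unions, so by compactness it is enough to have it near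
each point, in one chart. -/
theorem TendstoSmoothLocAway.eventually_isCloseOn (h : SurfaceMetric M) {q : M} {u : ℕ → M → F}
    {g : M → F} (hu : TendstoSmoothLocAway q u g) {K : Set M} (hK : IsCompact K) (hKq : K ⊆ {q}ᶜ)
    {η : ℝ} (hη : 0 < η) : ∀ᶠ k in atTop, IsCloseOn h g (u k) K η := by
  have := ChartedSpace.locallyCompactSpace ℂ M
  refine hK.induction_on (p := fun S => ∀ᶠ k in atTop, IsCloseOn h g (u k) S η) ?_ ?_ ?_ ?_
  · exact Eventually.of_forall fun k => ⟨∅, isOpen_empty, subset_rfl, by simp [ContMDiffOn],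
      fun x hx => hx.elim⟩
  · intro S T hST hT
    filter_upwards [hT] with k ⟨O', h1, h2, h3, h4⟩
    exact ⟨O', h1, hST.trans h2, h3, fun x hx => h4 x (hST hx)⟩
  · intro S T hS hT
    filter_upwards [hS, hT] with k ⟨O₁, h1, h2, h3, h4⟩ ⟨O₂, h1', h2', h3', h4'⟩
    refine ⟨O₁ ∪ O₂, h1.union h1', union_subset_union h2 h2', ?_, ?_⟩
    · rintro x (hx | hx)
      · exact ((h3 x hx).contMDiffAt (h1.mem_nhds hx)).contMDiffWithinAt
      · exact ((h3' x hx).contMDiffAt (h1'.mem_nhds hx)).contMDiffWithinAt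
    · rintro x (hx | hx)
      exacts [h4 x hx, h4' x hx]
  · intro x hx
    set ψ := chartAt ℂ x
    have hO : IsOpen (ψ.source ∩ {q}ᶜ) := ψ.open_source.inter isOpen_compl_singleton
    obtain ⟨C, hC, hxC, hCO⟩ := exists_compact_subset hO ⟨mem_chart_source ℂ x, hKq hx⟩
    refine ⟨C, mem_nhdsWithin_of_mem_nhds (mem_interior_iff_mem_nhds.1 hxC), ?_⟩
    refine (hu ψ (chart_mem_atlas ℂ x)).eventually_isCloseOn h (isSmoothChart_chartAt x)
      (isOpen_target_inter ψ isOpen_compl_singleton) inter_subset_left hC (fun z hz => ?_) hη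
    obtain ⟨hz1, hz2⟩ := hCO hz
    exact ⟨hz1, ψ.map_source hz1, by rw [mem_preimage, ψ.left_inv hz1]; exact hz2⟩

/-- The affine change of coordinates `y ↦ (y - c) / δ`. -/
def rescale (c : ℂ) (δ : ℝ) (hδ : δ ≠ 0) : ℂ ≃ₜ ℂ where
  toFun y := δ⁻¹ • (y - c)
  invFun z := c + δ • z
  left_inv y := by
    beta_reduce
    rw [smul_smul, mul_inv_cancel₀ hδ, one_smul, add_sub_cancel]
  right_inv z := by
    beta_reduce
    rw [add_sub_cancel_left, smul_smul, inv_mul_cancel₀ hδ, one_smul]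
  continuous_toFun := by fun_prop
  continuous_invFun := by fun_prop

theorem IsConformalWith.rescale {h : SurfaceMetric M} {φ : Chart[M]} {r : ℂ → ℝ}
    (hφ : IsConformalWith h φ r) (c : ℂ) {δ : ℝ} (hδ : 0 < δ) :
    IsConformalWith h (φ.transHomeomorph (rescale c δ hδ.ne')) fun z => δ ^ 2 * r (c + δ • z) where
  isSmoothChart :=
    { contMDiffOn := by
        have h1 : ContDiff ℝ ∞ fun y : ℂ => δ⁻¹ • (y - c) := by fun_prop
        exact h1.contMDiff.comp_contMDiffOn hφ.isSmoothChart.contMDiffOn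
      contMDiffOn_symm := by
        have h1 : ContDiff ℝ ∞ fun z : ℂ => c + δ • z := by fun_prop
        exact hφ.isSmoothChart.contMDiffOn_symm.comp h1.contMDiff.contMDiffOn fun z hz => hz }
  pos z hz := mul_pos (by positivity) (hφ.pos _ hz)
  inner_eq z hz v v' := by
    have h1 : HasMFDerivAt 𝓘₂ 𝓘₂ (fun z : ℂ => c + δ • z) z (δ • ContinuousLinearMap.id ℝ ℂ) :=
      (((hasFDerivAt_id z).const_smul δ).const_add c).hasMFDerivAt
    have h2 : ∀ v : ℂ, chartDifferential (φ.transHomeomorph (HarmonicIndex.rescale c δ hδ.ne')) z v =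
        chartDifferential φ (c + δ • z) (δ • v) := by
      intro v
      have h3 := (hφ.isSmoothChart.mdifferentiableAt_symm (y := c + δ • z) hz).hasMFDerivAt.comp z h1
      have h4 : chartDifferential (φ.transHomeomorph (HarmonicIndex.rescale c δ hδ.ne')) z = _ :=
        h3.mfderiv
      rw [h4]
      rfl
    rw [h2, h2]
    have := hφ.inner_eq (c + δ • z) hz (δ • v) (δ • v')
    refine this.trans ?_
    rw [real_inner_smul_left, real_inner_smul_right]
    ring

end Convergence

/-! ### Lower bounds for the index -/

section LowerBound

/-- The integrand of the upper bound `weightedForm` for the second variation. -/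
def weightedDensity (h : SurfaceMetric M) (s : ℝ) (u w : M → F) (x : M) : ℝ :=
  (1 + dInner h u u x) ^ s * ((1 + 2 * s) * dInner h w w x - dInner h u u x * ‖w x‖ ^ 2)

/-- An upper bound for the second variation of `E_p` with `s = p / 2 - 1`, up to a factor `p`. -/
def weightedForm (h : SurfaceMetric M) (s : ℝ) (u w : M → F) : ℝ :=
  ∫ x, weightedDensity h s u w x ∂vol[h]

/-- There are `m` fields along `u`, supported in `N`, that span an `m`-dimensional space on which
`weightedForm` is negative. -/
def HasNegativeFamily (h : SurfaceMetric M) (s : ℝ) (u : M → F) (m : ℕ) (N : Set M) : Prop :=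
  ∃ (t : Fin m → M → F) (O : Set M), IsOpen O ∧ SmoothOn[F] u O ∧
    (∀ i, t i ∈ testFields F O ∧ tsupport (t i) ⊆ N ∧ ∀ x, inner ℝ (u x) (t i x) = 0) ∧
    ∀ c : Fin m → ℝ, c ≠ 0 → weightedForm h s u (∑ i, c i • t i) < 0

theorem tangentProj_sum {ι : Type*} [Fintype ι] (u : M → F) (e : ι → M → F) (c : ι → ℝ) :
    ∑ i, c i • tangentProj u (e i) = tangentProj u (∑ i, c i • e i) := by
  funext x
  simp only [Finset.sum_apply, Pi.smul_apply, tangentProj, inner_sum, real_inner_smul_right,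
    smul_sub, Finset.sum_sub_distrib, Finset.sum_smul, smul_smul]

theorem chartExtend_sum {ι : Type*} [Fintype ι] (φ : Chart[M]) (e : ι → ℂ → F)
    (c : ι → ℝ) : ∑ i, c i • chartExtend φ (e i) = chartExtend φ (∑ i, c i • e i) := by
  funext x
  by_cases hx : x ∈ φ.source
  · simp [Finset.sum_apply, chartExtend_of_mem φ _ hx]
  · simp [Finset.sum_apply, chartExtend_of_notMem φ _ hx]

theorem weightedDensity_eq_zero (h : SurfaceMetric M) (s : ℝ) (u : M → F) {w : M → F} {x : M}
    (hx : x ∉ tsupport w) : weightedDensity h s u w x = 0 := by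
  rw [weightedDensity, dInner_eq_zero_of_notMem_tsupport h w hx,
    image_eq_zero_of_notMem_tsupport hx]
  simp

theorem weightedForm_zero (h : SurfaceMetric M) (s : ℝ) (u : M → F) : weightedForm h s u 0 = 0 := by
  have : ∀ x, weightedDensity h s u 0 x = 0 := fun x =>
    weightedDensity_eq_zero h s u (by simp [tsupport])
  simp [weightedForm, this]

/-- Near every point at least one of the two fields vanishes identically. -/
theorem weightedDensity_add (h : SurfaceMetric M) (s : ℝ) (u : M → F) {v w : M → F}
    (hvw : Disjoint (tsupport v) (tsupport w)) (x : M) :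
    weightedDensity h s u (v + w) x = weightedDensity h s u v x + weightedDensity h s u w x := by
  have key : ∀ {v w : M → F}, x ∉ tsupport w → weightedDensity h s u (v + w) x =
      weightedDensity h s u v x := by
    intro v w hx
    have h1 : v + w =ᶠ[𝓝 x] v := by
      filter_upwards [notMem_tsupport_iff_eventuallyEq.1 hx] with y hy
      simp [hy]
    rw [weightedDensity, weightedDensity, dInner, dInner, cdiff_congr h1, h1.eq_of_nhds]
    rfl
  by_cases hx : x ∈ tsupport w
  · have hx' : x ∉ tsupport v := fun h1 => hvw.le_bot ⟨h1, hx⟩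
    rw [add_comm v, key hx', weightedDensity_eq_zero h s u hx', zero_add]
  · rw [key hx, weightedDensity_eq_zero h s u hx, add_zero]

variable {h : SurfaceMetric M} {O : Set M} {u w : M → F} {s p : ℝ}

theorem integrable_weightedDensity (hO : IsOpen O) (hu : SmoothOn[F] u O)
    (hw : SmoothOn[F] w O) (hc : HasCompactSupport w) (hs : tsupport w ⊆ O) :
    Integrable (weightedDensity h s u w) vol[h] :=
  integrable_of_continuousOn_of_eq_zero h hO ((continuousOn_weight hO hu s).mul
    ((continuousOn_const.mul (continuousOn_dInner h hO hw hw)).sub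
      ((continuousOn_dInner h hO hu hu).mul (hw.continuousOn.norm.pow 2)))) hc hs
    fun _ hx => weightedDensity_eq_zero h s u hx

/-- Negativity forces the fields to be linearly independent, and `secondVariation_le` makes their
span a negative space. -/
theorem card_le_morseIndex (hp : 2 < p) (hud : WeaklyDifferentiable u)
    (hO : IsOpen O) (hu : SmoothOn[F] u O) {ι : Type*} [Fintype ι]
    {t : ι → M → F} (ht : ∀ i, t i ∈ testFields F O) (htan : ∀ i x, inner ℝ (u x) (t i x) = 0)
    (hneg : ∀ c : ι → ℝ, c ≠ 0 → weightedForm h (p / 2 - 1) u (∑ i, c i • t i) < 0) :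
    (Fintype.card ι : ℕ∞) ≤ morseIndex h p u := by
  have hli : LinearIndependent ℝ t := by
    rw [Fintype.linearIndependent_iff]
    intro c hc
    by_contra hne
    have h1 := hneg c fun h0 => hne (by simp [h0])
    rw [hc, weightedForm_zero] at h1
    exact h1.false
  have hW : IsNegativeSpace h p u (Submodule.span ℝ (range t)) := by
    intro w hw
    obtain ⟨c, rfl⟩ := (Submodule.mem_span_range_iff_exists_fun ℝ).1 hw
    have hmem := sum_mem_testFields ht c
    refine ⟨⟨memW12_of_mem_testFields h hmem, Eventually.of_forall fun x => ?_⟩, fun hne => ?_⟩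
    · simp [Finset.sum_apply, inner_sum, real_inner_smul_right, htan]
    · refine (secondVariation_le hp hud hO hu hmem).trans_lt ?_
      exact mul_neg_of_pos_of_neg (by linarith) (hneg c fun h0 => hne (by simp [h0]))
  rw [← finrank_span_eq_card hli]
  exact le_iSup (fun W : {W : Submodule ℝ (M → F) // FiniteDimensional ℝ W ∧
    IsNegativeSpace h p u W} => (Module.finrank ℝ W.1 : ℕ∞))
    ⟨_, FiniteDimensional.span_of_finite ℝ (finite_range t), hW⟩

/-- Disjoint supports exclude cross terms, so the form on a sum is the sum of two nonpositive
numbers, one of which is negative unless all coefficients vanish. -/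
theorem HasNegativeFamily.add_le_morseIndex {m m' : ℕ} {N N' : Set M} (hp : 2 < p)
    (hud : WeaklyDifferentiable u)
    (h1 : HasNegativeFamily h (p / 2 - 1) u m N) (h2 : HasNegativeFamily h (p / 2 - 1) u m' N')
    (hN : Disjoint N N') : ((m + m' : ℕ) : ℕ∞) ≤ morseIndex h p u := by
  obtain ⟨t, O, hO, hu, ht, hneg⟩ := h1
  obtain ⟨t', O', hO', hu', ht', hneg'⟩ := h2
  have hmono : ∀ {A B : Set M} {w : M → F}, w ∈ testFields F A → A ⊆ B → w ∈ testFields F B :=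
    fun h1 h2 => ⟨h1.1, h1.2.1, h1.2.2.trans h2⟩
  have hle : ∀ {k : ℕ} {t : Fin k → M → F}, (∀ c : Fin k → ℝ, c ≠ 0 →
      weightedForm h (p / 2 - 1) u (∑ i, c i • t i) < 0) → ∀ c : Fin k → ℝ,
      weightedForm h (p / 2 - 1) u (∑ i, c i • t i) ≤ 0 := by
    intro k t hneg c
    rcases eq_or_ne c 0 with rfl | hc
    exacts [by simp [weightedForm_zero], (hneg c hc).le]
  have := card_le_morseIndex (h := h) (t := Sum.elim t t') hp hud (hO.union hO')
    (fun x hx => hx.elim (fun hx => ((hu x hx).contMDiffAt (hO.mem_nhds hx)).contMDiffWithinAt)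
      fun hx => ((hu' x hx).contMDiffAt (hO'.mem_nhds hx)).contMDiffWithinAt)
    (fun i => i.rec (fun i => hmono (ht i).1 subset_union_left)
      fun i => hmono (ht' i).1 subset_union_right)
    (fun i => i.rec (fun i => (ht i).2.2) fun i => (ht' i).2.2) fun c hc => ?_
  · simpa using this
  set v := ∑ i, c (Sum.inl i) • t i with hv
  set v' := ∑ i, c (Sum.inr i) • t' i with hv'
  have hsum : ∑ i, c i • Sum.elim t t' i = v + v' := by simp [hv, hv']
  have hvm := sum_mem_testFields (fun i => (ht i).1) fun i => c (Sum.inl i)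
  have hvm' := sum_mem_testFields (fun i => (ht' i).1) fun i => c (Sum.inr i)
  have hdis : Disjoint (tsupport v) (tsupport v') :=
    hN.mono (tsupport_sum_subset _ fun i => (ht i).2.1) (tsupport_sum_subset _ fun i => (ht' i).2.1)
  have hadd : weightedForm h (p / 2 - 1) u (v + v') =
      weightedForm h (p / 2 - 1) u v + weightedForm h (p / 2 - 1) u v' := by
    rw [weightedForm, weightedForm, weightedForm, ← integral_add
      (integrable_weightedDensity hO hu hvm.1.contMDiffOn hvm.2.1 hvm.2.2)
      (integrable_weightedDensity hO' hu' hvm'.1.contMDiffOn hvm'.2.1 hvm'.2.2)]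
    exact integral_congr_ae (Eventually.of_forall (weightedDensity_add h _ u hdis))
  rw [hsum, hadd]
  by_cases hl : (fun i => c (Sum.inl i)) = 0
  · have hr : (fun i => c (Sum.inr i)) ≠ 0 := by
      intro hr
      refine hc (funext fun i => ?_)
      rcases i with i | i
      exacts [congrFun hl i, congrFun hr i]
    exact add_neg_of_nonpos_of_neg (hle hneg _) (hneg' _ hr)
  · exact add_neg_of_neg_of_nonpos (hneg _ hl) (hle hneg' _)

theorem tendsto_rpow_one {a : ℝ} (ha : 0 < a) {s : ℕ → ℝ} (hs : Tendsto s atTop (𝓝 0)) :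
    Tendsto (fun k => a ^ s k) atTop (𝓝 1) := by
  have := ((Real.continuous_const_rpow ha.ne').tendsto 0).comp hs
  rwa [Real.rpow_zero] at this

/-- The weights `β ^ s` with `V / C ≤ β ≤ C (1 + V)` are admissible in `perturbed_form_neg`. -/
theorem rpow_weight_bounds {C A V β s η : ℝ} (hC : 0 < C) (hV0 : 0 ≤ V) (hVA : V ≤ A)
    (hβ : 0 < β) (h1 : V ≤ C * β) (h2 : β ≤ C * (1 + V)) (hs : 0 ≤ s)
    (hup : (C * (1 + A)) ^ s ≤ 1 + η) (hlow : A - (C⁻¹) ^ s * (A - s) ≤ η) (hC1 : (C⁻¹) ^ s ≤ 1) :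
    0 ≤ β ^ s ∧ β ^ s ≤ 1 + η ∧ V - η ≤ β ^ s * V := by
  refine ⟨Real.rpow_nonneg hβ.le s, (Real.rpow_le_rpow hβ.le (h2.trans ?_) hs).trans hup, ?_⟩
  · gcongr
  have h3 : (C⁻¹ * V) ^ s ≤ β ^ s := by
    refine Real.rpow_le_rpow (by positivity) ?_ hs
    rw [inv_mul_le_iff₀ hC]
    exact h1
  rw [Real.mul_rpow (by positivity) hV0] at h3
  -- Bernoulli: `V^{1+s} ≥ 1 + (1 + s) (V - 1) ≥ V - s`. For small `V` the power `V^s` may be far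
  -- below `1`, but the product with `V` is uniformly close to `V` from below.
  have h4 : V - s ≤ V ^ s * V := by
    rcases hV0.eq_or_lt with h0 | h0
    · simp [← h0, hs]
    have := one_add_mul_self_le_rpow_one_add (s := V - 1) (by linarith) (p := 1 + s) (by linarith)
    rw [add_sub_cancel, add_comm 1 s, Real.rpow_add_one h0.ne'] at this
    nlinarith
  have h5 : 0 ≤ (C⁻¹) ^ s := by positivity
  have h6 := mul_le_mul_of_nonneg_right h3 hV0
  have h7 := mul_le_mul_of_nonneg_left h4 h5
  nlinarith [mul_nonneg (sub_nonneg.2 hC1) (sub_nonneg.2 hVA)]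

/-- The base `β` covers both applications: `1 + |dv|²` with `C = 1` on the surface, and `δ² + r⁻¹
|dv|²` on the scale of the bubble, where `C` measures the distortion of the metric in the chart. -/
theorem IsHarmonicOn.eventually_form_neg {g : M → F} (hg : IsHarmonicOn h g O)
    (hfull : ∀ᵐ x ∂vol[h], x ∈ O) {m : ℕ} {e : Fin m → M → F}
    (he : ∀ i, e i ∈ testFields F O) (htan : ∀ i x, inner ℝ (g x) (e i x) = 0)
    (hneg : ∀ c : Fin m → ℝ, c ≠ 0 → dirichlet h (∑ i, c i • e i) < potential h g (∑ i, c i • e i))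
    {v : ℕ → M → F} (hv : ∀ k x, ‖v k x‖ = 1)
    (hclose : ∀ η > 0, ∀ᶠ k in atTop, IsCloseOn h g (v k) (⋃ i, tsupport (e i)) η)
    {s : ℕ → ℝ} (hs0 : ∀ k, 0 ≤ s k) (hs : Tendsto s atTop (𝓝 0)) {C : ℝ} (hC : 1 ≤ C)
    {β : ℕ → M → ℝ} (hβ : ∀ᶠ k in atTop, ∃ O', IsOpen O' ∧ ⋃ i, tsupport (e i) ⊆ O' ∧
      ContinuousOn (β k) O' ∧ ∀ x ∈ O', 0 < β k x ∧ dInner h (v k) (v k) x ≤ C * β k x ∧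
        β k x ≤ C * (1 + dInner h (v k) (v k) x)) :
    ∀ᶠ k in atTop, ∀ c : Fin m → ℝ, c ≠ 0 → ∫ x, β k x ^ s k * ((1 + 2 * s k) *
        dInner h (tangentProj (v k) (∑ i, c i • e i)) (tangentProj (v k) (∑ i, c i • e i)) x -
        dInner h (v k) (v k) x * ‖tangentProj (v k) (∑ i, c i • e i) x‖ ^ 2) ∂vol[h] < 0 := by
  obtain ⟨η, hη, hη1, H⟩ := hg.perturbed_form_neg hfull he htan hneg
  have hK : IsCompact (⋃ i, tsupport (e i)) := isCompact_iUnion fun i => (he i).2.1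
  obtain ⟨B, hB⟩ := hK.exists_bound_of_continuousOn
    ((continuousOn_dInner h hg.isOpen hg.contMDiffOn hg.contMDiffOn).mono
      (iUnion_subset fun i => (he i).2.2))
  set L := max B 1 with hL
  have hL1 : 1 ≤ L := le_max_right _ _
  have hVL : ∀ x ∈ ⋃ i, tsupport (e i), dInner h g g x ≤ L ^ 2 := fun x hx =>
    ((Real.le_norm_self _).trans (hB x hx)).trans ((le_max_left B 1).trans (by nlinarith))
  set A := 2 * L ^ 2 + 2 with hA
  have hC0 : 0 < C := by linarith
  have hlow : Tendsto (fun k => A - (C⁻¹) ^ s k * (A - s k)) atTop (𝓝 (A - 1 * (A - 0))) :=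
    tendsto_const_nhds.sub ((tendsto_rpow_one (inv_pos.2 hC0) hs).mul (tendsto_const_nhds.sub hs))
  rw [sub_zero, one_mul, sub_self] at hlow
  filter_upwards [hclose η hη, hβ, hs.eventually (eventually_le_nhds hη),
    hlow.eventually (eventually_le_nhds hη), (tendsto_rpow_one (by positivity :
      0 < C * (1 + A)) hs).eventually (eventually_le_nhds (by linarith : 1 < 1 + η))]
    with k k1 ⟨O', hO', hKO', hβc, k2⟩ k3 k4 k5
  refine H (v k) (s k) _ O' k1 (hv k) (hs0 k) k3 hO' hKO' (hβc.rpow_const fun x hx =>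
    Or.inl (k2 x hx).1.ne') fun x hx => ?_
  obtain ⟨b1, b2, b3⟩ := k2 x (hKO' hx)
  obtain ⟨_, _, _, _, k1⟩ := k1
  have hVA : dInner h (v k) (v k) x ≤ A :=
    (pairing_perturb h hη.le (by positivity) (hVL x hx) (k1 x hx).2).1.trans (by nlinarith)
  exact rpow_weight_bounds hC0 (dInner_self_nonneg h _ x) hVA b1 b2 b3 (hs0 k) k5 k4
    (Real.rpow_le_one (by positivity) (inv_le_one_of_one_le₀ hC) (hs0 k))

end LowerBound

/-! ### Transplanting negative families -/

section Transplant

variable {h : SurfaceMetric M} {φ : Chart[M]} {r : ℂ → ℝ} {q : M}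
variable {u : ℕ → M → F} {s : ℕ → ℝ} {m : ℕ}

theorem flat_dInner_eq {v w : ℂ → F} {z : ℂ} (hv : DifferentiableAt ℝ v z)
    (hw : DifferentiableAt ℝ w z) :
    dInner flatMetric v w z = flatPairing (fderiv ℝ v z) (fderiv ℝ w z) := by
  have := isConformalWith_refl.dInner_eq (F := F) (y := z) (mem_univ _) (u := v) (w := w)
    hv.mdifferentiableAt hw.mdifferentiableAt
  rw [inv_one, one_mul] at this
  exact this

/-- The volume contributes `r`, and the squared norms of the differentials `r⁻¹`. They cancel in the
quadratic part, and the conformal factor survives in the weight alone. -/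
theorem IsConformalWith.weightedForm_eq (hφ : IsConformalWith h φ r) {u : M → F} {Ω : Set ℂ}
    (hΩ : IsOpen Ω) (hΩt : Ω ⊆ φ.target) (hu : ContDiffOn ℝ ∞ (fun z => u (φ.symm z)) Ω)
    {w : ℂ → F} (hw : w ∈ testFields F Ω) (s : ℝ) :
    weightedForm h s u (tangentProj u (chartExtend φ w)) =
      ∫ z, (1 + (r z)⁻¹ * dInner flatMetric (fun z => u (φ.symm z)) (fun z => u (φ.symm z)) z) ^ s *
        ((1 + 2 * s) * dInner flatMetric (tangentProj (fun z => u (φ.symm z)) w)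
          (tangentProj (fun z => u (φ.symm z)) w) z -
        dInner flatMetric (fun z => u (φ.symm z)) (fun z => u (φ.symm z)) z *
          ‖tangentProj (fun z => u (φ.symm z)) w z‖ ^ 2) ∂vol[flatMetric] := by
  set v := fun z => u (φ.symm z) with hv
  set W := tangentProj u (chartExtend φ w) with hW
  set w' := tangentProj v w with hw'
  set k : ℂ → ℝ := fun z => (1 + (r z)⁻¹ * dInner flatMetric v v z) ^ s *
    ((1 + 2 * s) * dInner flatMetric w' w' z - dInner flatMetric v v z * ‖w' z‖ ^ 2) with hk
  have hws : ContDiff ℝ ∞ w := contMDiff_iff_contDiff.1 hw.1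
  have hO : IsOpen (φ.source ∩ φ ⁻¹' Ω) := φ.isOpen_inter_preimage hΩ
  have huO := contMDiffOn_of_comp_symm hφ.isSmoothChart hu
  have hext := chartExtend_mem_testFields hφ.isSmoothChart hws hw.2.1 hw.2.2 hΩt
  have hWm : W ∈ testFields F (φ.source ∩ φ ⁻¹' Ω) := tangentProj_mem_testFields hO huO hext
  have hvO : SmoothOn[F] v Ω := contMDiffOn_iff_contDiffOn.2 hu
  have hw'm : w' ∈ testFields F Ω := tangentProj_mem_testFields hΩ hvO hw
  have hW' : ∀ z ∈ φ.target, W (φ.symm z) = w' z := fun z hz => by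
    rw [hW, hw', tangentProj, tangentProj, chartExtend_symm φ w hz]
  have hk0 : ∀ z ∉ tsupport w, k z = 0 := by
    intro z hz
    have hz' : z ∉ tsupport w' := fun h1 => hz (tsupport_tangentProj_subset h1)
    rw [hk]
    beta_reduce
    rw [dInner_eq_zero_of_notMem_tsupport _ _ hz', image_eq_zero_of_notMem_tsupport hz']
    simp
  have e1 : ∫ x, weightedDensity h s u W x ∂vol[h] = ∫ z, k z := by
    refine hφ.integral_eq (integrable_weightedDensity hO huO hWm.1.contMDiffOn hWm.2.1
      hWm.2.2).aestronglyMeasurable (fun x hx => weightedDensity_eq_zero h s u fun h1 =>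
        hx (hWm.2.2 h1).1) (fun z hz => hk0 z fun h1 => hz (hΩt (hw.2.2 h1))) fun z hz => ?_
    by_cases hzs : z ∈ tsupport w
    · have hzΩ := hw.2.2 hzs
      have hzO : φ.symm z ∈ φ.source ∩ φ ⁻¹' Ω :=
        ⟨φ.map_target hz, by rwa [mem_preimage, φ.right_inv hz]⟩
      have d1 := mdifferentiableAt_of_contMDiffOn hO huO hzO
      have d2 := mdifferentiableAt_of_mem_testFields hWm (φ.symm z)
      have d3 : DifferentiableAt ℝ v z :=
        (hu.contDiffAt (hΩ.mem_nhds hzΩ)).differentiableAt (by simp)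
      have d4 : DifferentiableAt ℝ w' z := (mdifferentiableAt_of_mem_testFields hw'm z).differentiableAt
      have e3 : (fun z => W (φ.symm z)) =ᶠ[𝓝 z] w' :=
        Filter.eventually_of_mem (φ.open_target.mem_nhds hz) hW'
      have hr := (hφ.pos z hz).ne'
      rw [weightedDensity, hφ.dInner_eq hz d1 d1, hφ.dInner_eq hz d2 d2, hW' z hz, e3.fderiv_eq,
        ← flat_dInner_eq d3 d3, ← flat_dInner_eq d4 d4, hk]
      field_simp
    · rw [hk0 z hzs, weightedDensity_eq_zero, mul_zero]
      intro h1
      obtain ⟨z', hz', h2⟩ := tsupport_chartExtend_subset hw.2.1 (hw.2.2.trans hΩt)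
        (tsupport_tangentProj_subset h1)
      exact hzs (φ.symm.injOn (hΩt (hw.2.2 hz')) hz h2 ▸ hz')
  refine e1.trans (Eq.symm ?_)
  have hkc : Integrable k vol[flatMetric] → ∫ z, k z ∂vol[flatMetric] = ∫ z, k z := fun hi =>
    isConformalWith_refl.integral_eq hi.aestronglyMeasurable (fun x hx => (hx (mem_univ x)).elim)
      (fun x hx => (hx (mem_univ x)).elim) fun z _ => one_mul _
  refine hkc (integrable_of_continuousOn_of_eq_zero flatMetric hΩ ?_ hw.2.1 hw.2.2 hk0)
  have hr : ContinuousOn r Ω := ((hφ.isSmoothChart.continuousOn_chartDensity h).congr fun y hy =>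
    (hφ.chartDensity_eq hy).symm).mono hΩt
  have hvc := continuousOn_dInner flatMetric hΩ hvO hvO
  refine ContinuousOn.mul (ContinuousOn.rpow_const (continuousOn_const.add
    ((hr.inv₀ fun y hy => (hφ.pos y (hΩt hy)).ne').mul hvc)) fun y hy => Or.inl ?_)
    ((continuousOn_const.mul (continuousOn_dInner flatMetric hΩ hw'm.1.contMDiffOn
      hw'm.1.contMDiffOn)).sub (hvc.mul (hw'm.1.continuous.continuousOn.norm.pow 2)))
  have := mul_nonneg (inv_nonneg.2 (hφ.pos y (hΩt hy)).le) (dInner_self_nonneg flatMetric v y)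
  positivity

theorem IsHarmonicOn.eventually_hasNegativeFamily {g : M → F} {O : Set M} (hg : IsHarmonicOn h g O)
    (hfull : ∀ᵐ x ∂vol[h], x ∈ O) {e : Fin m → M → F}
    (he : ∀ i, e i ∈ testFields F O) (htan : ∀ i x, inner ℝ (g x) (e i x) = 0)
    (hneg : ∀ c : Fin m → ℝ, c ≠ 0 → dirichlet h (∑ i, c i • e i) < potential h g (∑ i, c i • e i))
    (hu1 : ∀ k x, ‖u k x‖ = 1)
    (hclose : ∀ η > 0, ∀ᶠ k in atTop, IsCloseOn h g (u k) (⋃ i, tsupport (e i)) η)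
    (hs0 : ∀ k, 0 ≤ s k) (hs : Tendsto s atTop (𝓝 0)) :
    ∀ᶠ k in atTop, HasNegativeFamily h (s k) (u k) m (⋃ i, tsupport (e i)) := by
  have hβ : ∀ᶠ k in atTop, ∃ O', IsOpen O' ∧ ⋃ i, tsupport (e i) ⊆ O' ∧
      ContinuousOn (fun x => 1 + dInner h (u k) (u k) x) O' ∧ ∀ x ∈ O',
        0 < 1 + dInner h (u k) (u k) x ∧ dInner h (u k) (u k) x ≤ 1 * (1 + dInner h (u k) (u k) x) ∧
        1 + dInner h (u k) (u k) x ≤ 1 * (1 + dInner h (u k) (u k) x) := by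
    filter_upwards [hclose 1 one_pos] with k ⟨O', hO', hKO', hs', _⟩
    refine ⟨O', hO', hKO', continuousOn_const.add (continuousOn_dInner h hO' hs' hs'),
      fun x _ => ?_⟩
    have := dInner_self_nonneg h (u k) x
    exact ⟨by positivity, by linarith, by linarith⟩
  filter_upwards [hg.eventually_form_neg hfull he htan hneg hu1 hclose hs0 hs le_rfl hβ,
    hclose 1 one_pos] with k k1 ⟨O', hO', hKO', hs', _⟩
  refine ⟨fun i => tangentProj (u k) (e i), O', hO', hs', fun i => ⟨?_, ?_, fun x =>
    inner_tangentProj (hu1 k x)⟩, fun c hc => ?_⟩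
  · exact tangentProj_mem_testFields hO' hs' ⟨(he i).1, (he i).2.1,
      (subset_iUnion (fun i => tsupport (e i)) i).trans hKO'⟩
  · exact tsupport_tangentProj_subset.trans (subset_iUnion (fun i => tsupport (e i)) i)
  · rw [tangentProj_sum]
    exact k1 c hc

/-- The fields are placed in the conformal chart rescaled by `δ k` about `c k`. Their supports
shrink to `q`, hence enter `N`, and in the rescaled chart the maps converge to `g`, so
`eventually_form_neg` applies to the flat integral. -/
theorem IsHarmonicOn.eventually_hasNegativeFamily_bubble {g : ℂ → F}
    (hg : IsHarmonicOn flatMetric g univ) {e : Fin m → ℂ → F}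
    (he : ∀ i, e i ∈ testFields F univ) (htan : ∀ i x, inner ℝ (g x) (e i x) = 0)
    (hneg : ∀ c : Fin m → ℝ, c ≠ 0 →
      dirichlet flatMetric (∑ i, c i • e i) < potential flatMetric g (∑ i, c i • e i))
    (hu1 : ∀ k x, ‖u k x‖ = 1) (hφ : IsConformalWith h φ r) (hq : q ∈ φ.source) {N : Set M}
    (hN : IsOpen N) (hqN : q ∈ N) {c : ℕ → ℂ} (hc : Tendsto c atTop (𝓝 (φ q))) {δ : ℕ → ℝ}
    (hδ : ∀ k, 0 < δ k) (hδ0 : Tendsto δ atTop (𝓝 0))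
    (hconv : TendstoSmoothLoc univ (fun k z => u k (φ.symm (c k + δ k • z))) g)
    (hs0 : ∀ k, 0 ≤ s k) (hs : Tendsto s atTop (𝓝 0)) :
    ∀ᶠ k in atTop, HasNegativeFamily h (s k) (u k) m N := by
  set K := ⋃ i, tsupport (e i) with hKdef
  have hK : IsCompact K := isCompact_iUnion fun i => (he i).2.1
  have hfull : ∀ᵐ x ∂vol[flatMetric], x ∈ (univ : Set ℂ) :=
    Eventually.of_forall mem_univ
  have hNt : IsOpen (φ.target ∩ φ.symm ⁻¹' N) := isOpen_target_inter φ hN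
  obtain ⟨ρ, hρ, hball⟩ := Metric.nhds_basis_closedBall.mem_iff.1 (hNt.mem_nhds
    (x := φ q) ⟨φ.map_source hq, by rwa [mem_preimage, φ.left_inv hq]⟩)
  obtain ⟨C₀, hC₀, hcomp⟩ := hφ.isSmoothChart.exists_comparison h (F := F)
    (isCompact_closedBall (φ q) ρ) fun y hy => (hball hy).1
  set C := max C₀ 1 with hCdef
  have hC1 : 1 ≤ C := le_max_right _ _
  have hrC : ∀ y ∈ Metric.closedBall (φ q) ρ, r y ≤ C ∧ 1 ≤ C * r y := by
    intro y hy
    obtain ⟨h1, h2, -⟩ := hcomp y hy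
    rw [hφ.chartDensity_eq (hball hy).1] at h1 h2
    exact ⟨h1.trans (le_max_left _ _), h2.trans (mul_le_mul_of_nonneg_right (le_max_left _ _)
      (hφ.pos y (hball hy).1).le)⟩
  obtain ⟨R, hR, hKR⟩ := hK.isBounded.exists_pos_norm_le
  have hin : ∀ᶠ k in atTop, ∀ z ∈ K, c k + δ k • z ∈ Metric.ball (φ q) ρ := by
    have h1 : Tendsto (fun k => ‖c k - φ q‖ + δ k * R) atTop (𝓝 (‖φ q - φ q‖ + 0 * R)) :=
      (hc.sub_const _).norm.add (hδ0.mul_const R)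
    rw [sub_self, norm_zero, zero_mul, add_zero] at h1
    filter_upwards [h1.eventually (eventually_lt_nhds hρ)] with k hk z hz
    rw [Metric.mem_ball, dist_eq_norm]
    calc ‖c k + δ k • z - φ q‖ = ‖(c k - φ q) + δ k • z‖ := by congr 1; ring
      _ ≤ ‖c k - φ q‖ + δ k * R := by
          refine (norm_add_le _ _).trans ?_
          rw [norm_smul, Real.norm_of_nonneg (hδ k).le]
          exact add_le_add_right (mul_le_mul_of_nonneg_left (hKR z hz) (hδ k).le) _
      _ < ρ := hk
  set v : ℕ → ℂ → F := fun k z => u k (φ.symm (c k + δ k • z)) with hv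
  have hclose : ∀ η > 0, ∀ᶠ k in atTop, IsCloseOn flatMetric g (v k) K η := fun η hη =>
    TendstoSmoothLoc.eventually_isCloseOn flatMetric isConformalWith_refl.isSmoothChart isOpen_univ
      (subset_univ _) hconv hK (fun x _ => ⟨mem_univ x, mem_univ _⟩) hη
  have hdata : ∀ᶠ k in atTop, ∃ Ω, IsOpen Ω ∧ K ⊆ Ω ∧ ContDiffOn ℝ ∞ (v k) Ω ∧
      ∀ z ∈ Ω, c k + δ k • z ∈ Metric.ball (φ q) ρ := by
    filter_upwards [hin, hconv.eventually_contDiffOn K (subset_univ _) hK] with k k1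
      ⟨U, hU, hKU, hUs⟩
    exact ⟨U ∩ (fun z => c k + δ k • z) ⁻¹' Metric.ball (φ q) ρ,
      hU.inter (Metric.isOpen_ball.preimage (by fun_prop)), fun z hz => ⟨hKU hz, k1 z hz⟩,
      hUs.mono inter_subset_left, fun z hz => hz.2⟩
  -- The weight in the rescaled chart is `(1 + (δ² r)⁻¹ |dv|²)^s`. Multiplication by the positive
  -- constant `δ^{2s}` preserves signs and turns its base into `β`, which stays bounded on the
  -- supports as `δ → 0`.
  set β : ℕ → ℂ → ℝ := fun k z =>
    δ k ^ 2 + (r (c k + δ k • z))⁻¹ * dInner flatMetric (v k) (v k) z with hβdef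
  have hβ : ∀ᶠ k in atTop, ∃ O', IsOpen O' ∧ K ⊆ O' ∧ ContinuousOn (β k) O' ∧ ∀ z ∈ O',
      0 < β k z ∧ dInner flatMetric (v k) (v k) z ≤ C * β k z ∧
        β k z ≤ C * (1 + dInner flatMetric (v k) (v k) z) := by
    filter_upwards [hdata, hδ0.eventually (eventually_le_nhds one_pos)]
      with k ⟨Ω, hΩ, hKΩ, hvs, hΩb⟩ hδ1
    have hvm := contMDiffOn_iff_contDiffOn.2 hvs
    have hΩt : ∀ z ∈ Ω, c k + δ k • z ∈ φ.target := fun z hz =>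
      (hball (Metric.ball_subset_closedBall (hΩb z hz))).1
    have hrc : ContinuousOn (fun z => r (c k + δ k • z)) Ω :=
      ContinuousOn.comp (g := r) (t := φ.target)
        ((hφ.isSmoothChart.continuousOn_chartDensity h).congr fun y hy =>
          (hφ.chartDensity_eq hy).symm) (by fun_prop) hΩt
    refine ⟨Ω, hΩ, hKΩ, continuousOn_const.add ((hrc.inv₀ fun z hz =>
      (hφ.pos _ (hΩt z hz)).ne').mul (continuousOn_dInner flatMetric hΩ hvm hvm)), fun z hz => ?_⟩
    obtain ⟨r1, r2⟩ := hrC _ (Metric.ball_subset_closedBall (hΩb z hz))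
    have hr0 := hφ.pos _ (hΩt z hz)
    have hE := dInner_self_nonneg flatMetric (v k) z
    have hδk := hδ k
    rw [hβdef]
    beta_reduce
    generalize r (c k + δ k • z) = r' at *
    generalize dInner flatMetric (v k) (v k) z = E at *
    have q1 : E ≤ C * (r'⁻¹ * E) := by
      rw [← mul_assoc]
      refine le_mul_of_one_le_left hE ?_
      rwa [← div_eq_mul_inv, one_le_div hr0]
    have q2 : r'⁻¹ * E ≤ C * E := by
      refine mul_le_mul_of_nonneg_right ?_ hE
      rwa [inv_le_iff_one_le_mul₀ hr0]
    refine ⟨by positivity, ?_, ?_⟩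
    · nlinarith [mul_nonneg (zero_le_one.trans hC1) (sq_nonneg (δ k))]
    · nlinarith
  filter_upwards [hg.eventually_form_neg hfull he htan hneg (fun k z => hu1 k _) hclose hs0 hs hC1 hβ,
    hdata] with k k1 ⟨Ω, hΩ, hKΩ, hvs, hΩb⟩
  set ψ := φ.transHomeomorph (rescale (c k) (δ k) (hδ k).ne') with hψdef
  have hψ : IsConformalWith h ψ fun z => δ k ^ 2 * r (c k + δ k • z) := hφ.rescale (c k) (hδ k)
  have hΩt : Ω ⊆ ψ.target := fun z hz => (hball (Metric.ball_subset_closedBall (hΩb z hz))).1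
  have hvs' : ContDiffOn ℝ ∞ (fun z => u k (ψ.symm z)) Ω := hvs
  have hO : IsOpen (ψ.source ∩ ψ ⁻¹' Ω) := ψ.isOpen_inter_preimage hΩ
  have huO := contMDiffOn_of_comp_symm hψ.isSmoothChart hvs'
  have heΩ : ∀ i, e i ∈ testFields F Ω := fun i => ⟨(he i).1, (he i).2.1,
    (subset_iUnion (fun i => tsupport (e i)) i).trans hKΩ⟩
  refine ⟨fun i => tangentProj (u k) (chartExtend ψ (e i)), _, hO, huO, fun i => ⟨?_, ?_, fun x =>
    inner_tangentProj (hu1 k x)⟩, fun b hb => ?_⟩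
  · exact tangentProj_mem_testFields hO huO (chartExtend_mem_testFields hψ.isSmoothChart
      (contMDiff_iff_contDiff.1 (he i).1) (he i).2.1 (heΩ i).2.2 hΩt)
  · refine tsupport_tangentProj_subset.trans ((tsupport_chartExtend_subset (he i).2.1
      ((heΩ i).2.2.trans hΩt)).trans ?_)
    rintro _ ⟨z, hz, rfl⟩
    exact (hball (Metric.ball_subset_closedBall (hΩb z ((heΩ i).2.2 hz)))).2
  · have hmem : ∑ i, b i • e i ∈ testFields F Ω :=
      Submodule.sum_mem _ fun i _ => Submodule.smul_mem _ _ (heΩ i)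
    rw [tangentProj_sum, chartExtend_sum, hψ.weightedForm_eq hΩ hΩt hvs' hmem]
    have hpos : 0 < (δ k ^ 2) ^ s k := Real.rpow_pos_of_pos (by have := hδ k; positivity) _
    refine neg_of_mul_neg_right (a := (δ k ^ 2) ^ s k) ?_ hpos.le
    rw [← integral_const_mul]
    refine Eq.trans_lt (integral_congr_fun (fun z => ?_)) (k1 b hb)
    change (δ k ^ 2) ^ s k * ((1 + (δ k ^ 2 * r (c k + δ k • z))⁻¹ *
      dInner flatMetric (v k) (v k) z) ^ s k * ((1 + 2 * s k) * dInner flatMetric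
        (tangentProj (v k) (∑ i, b i • e i)) (tangentProj (v k) (∑ i, b i • e i)) z -
        dInner flatMetric (v k) (v k) z * ‖tangentProj (v k) (∑ i, b i • e i) z‖ ^ 2)) = _
    by_cases hz : z ∈ tsupport (∑ i, b i • e i)
    · have hr0 := hφ.pos _ (hΩt (hmem.2.2 hz))
      have hδk := hδ k
      have hE := dInner_self_nonneg flatMetric (v k) z
      rw [← mul_assoc, ← Real.mul_rpow (by positivity) (by positivity)]
      congr 2
      rw [hβdef]
      field_simp
    · have hz' : z ∉ tsupport (tangentProj (v k) (∑ i, b i • e i)) := fun h1 =>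
        hz (tsupport_tangentProj_subset h1)
      rw [dInner_eq_zero_of_notMem_tsupport _ _ hz', image_eq_zero_of_notMem_tsupport hz']
      simp

theorem TendstoSmoothLocAway.contMDiffOn {u : ℕ → M → F} {g : M → F}
    (hu : TendstoSmoothLocAway q u g) : SmoothOn[F] g {q}ᶜ := by
  intro x hx
  set ψ := chartAt ℂ x
  have hxs : x ∈ ψ.source := mem_chart_source ℂ x
  have h1 := contMDiffOn_of_comp_symm (isSmoothChart_chartAt x)
    (hu ψ (chart_mem_atlas ℂ x)).contDiffOn
  have h2 := ψ.isOpen_inter_preimage (isOpen_target_inter ψ (isOpen_compl_singleton (x := q)))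
  exact (h1.contMDiffAt (h2.mem_nhds ⟨hxs, ψ.map_source hxs, by
    rwa [mem_preimage, ψ.left_inv hxs]⟩)).contMDiffWithinAt

theorem ae_ne (h : SurfaceMetric M) (q : M) : ∀ᵐ x ∂vol[h], x ∈ ({q}ᶜ : Set M) := by
  refine ae_riemannianVolume_of_charts h fun ψ _ => ?_
  filter_upwards [compl_mem_ae_iff.2 (measure_singleton (μ := volume) (ψ q))] with y hy hyt hq
  exact hy (by rw [mem_singleton_iff, ← mem_singleton_iff.1 hq, ψ.right_inv hyt])

end Transplant

end HarmonicIndex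

end

theorem mainTheorem7 {M : Type*} [TopologicalSpace M] [T2Space M] [CompactSpace M]
    [ChartedSpace ℂ M] [IsManifold 𝓘(ℝ, ℂ) ∞ M] [MeasurableSpace M] [BorelSpace M]
    (h : SurfaceMetric M) (n : ℕ) (p : ℕ → ℝ) (hp : ∀ k, 2 < p k) (hp_lim : Tendsto p atTop (𝓝 2))
    (u : ℕ → M → EuclideanSpace ℝ (Fin (n + 1))) (hu : ∀ k, IsPHarmonic h (p k) (u k))
    (hu_bdd : BddAbove (range fun k => energy h (p k) (u k)))
    (uinf : M → EuclideanSpace ℝ (Fin (n + 1))) (vinf : ℂ → EuclideanSpace ℝ (Fin (n + 1)))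
    (q : M) (φ : OpenPartialHomeomorph M ℂ) (a : ℕ → M) (δ : ℕ → ℝ)
    (hbubble : BubbleConvergence h u uinf vinf q φ a δ) : ∀ᶠ k in atTop,
      morseIndex h 2 uinf + morseIndex flatMetric 2 vinf ≤ morseIndex h (p k) (u k) := by
  have : SecondCountableTopology M := ChartedSpace.secondCountable_of_sigmaCompact ℂ M
  have hu1 : ∀ k x, ‖u k x‖ = 1 := fun k => (hu k).memSphereW1.norm_eq_one
  have hs0 : ∀ k, 0 ≤ p k / 2 - 1 := fun k => by linarith [hp k]
  have hs : Tendsto (fun k => p k / 2 - 1) atTop (𝓝 0) := by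
    have := (hp_lim.div_const 2).sub_const 1
    rwa [div_self two_ne_zero, sub_self] at this
  obtain ⟨r, hφ⟩ := hbubble.isConformalChart.exists_factor
  have hq := hbubble.mem_source
  have hg := hbubble.harmonic.isHarmonicOn isOpen_compl_singleton hbubble.tendsto_away.contMDiffOn
  have hv := hbubble.harmonic_bubble.isHarmonicOn isOpen_univ
    (contMDiffOn_iff_contDiffOn.2 hbubble.tendsto_bubble.contDiffOn)
  have hfull := ae_ne h q
  obtain ⟨m, e, he, htan, hneg, hm⟩ := hg.exists_index_family
    hbubble.harmonic.memSphereW1.weaklyDifferentiable (hg.isAlmostConstantAtEnd_puncture hφ hq)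
    hfull fun w G hw => hw.isApproximable_puncture hφ hq
  obtain ⟨m', e', he', htan', hneg', hm'⟩ := hv.exists_index_family
    hbubble.harmonic_bubble.memSphereW1.weaklyDifferentiable hv.isAlmostConstantAtEnd_plane
    (Eventually.of_forall mem_univ) fun w G hw => hw.isApproximable_plane
  -- The supports of the first family form a compact set that misses `q`. Its complement is a
  -- neighbourhood of `q`, so the bubble fields eventually lie in it and are disjoint from the first
  -- family.
  have hK : IsCompact (⋃ i, tsupport (e i)) := isCompact_iUnion fun i => (he i).2.1
  have hKq : ⋃ i, tsupport (e i) ⊆ {q}ᶜ := iUnion_subset fun i => (he i).2.2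
  have hc : Tendsto (fun k => φ (a k)) atTop (𝓝 (φ q)) :=
    (φ.continuousAt hq).tendsto.comp hbubble.tendsto_center
  filter_upwards [hg.eventually_hasNegativeFamily hfull he htan hneg hu1
      (fun η hη => hbubble.tendsto_away.eventually_isCloseOn h hK hKq hη) hs0 hs,
    hv.eventually_hasNegativeFamily_bubble he' htan' hneg' hu1 hφ hq hK.isClosed.isOpen_compl
      (fun h1 => hKq h1 rfl) hc hbubble.radius_pos hbubble.tendsto_radius hbubble.tendsto_bubble
      hs0 hs] with k k1 k2
  calc morseIndex h 2 uinf + morseIndex flatMetric 2 vinf ≤ m + m' := add_le_add hm hm'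
    _ = ((m + m' : ℕ) : ℕ∞) := by push_cast; rfl
    _ ≤ morseIndex h (p k) (u k) :=
        k1.add_le_morseIndex (hp k) (hu k).memSphereW1.weaklyDifferentiable k2 disjoint_compl_right
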